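/- Let $k$ be a finite field with $q$ elements, $v=\sqrt q>0$, let $A$ be a finite dimensional hereditary $k$-algebra (all left ideals are projective), and let $m=0$ or $m>2$ be an integer; put $\mathbb Z_m=\mathbb Z/m\mathbb Z$, $\mathbb Z_0=\mathbb Z$. Modules are finite dimensional left $A$-modules, $\mathrm{Iso}(A)$ is the set of their isomorphism classes, $K(A)$ their Grothendieck group, $\hat M\in K(A)$ the class of $M$, and $a_M=|\mathrm{Aut}\,M|$. Let $\langle\cdot,\cdot\rangle$ be the Euler form on $K(A)$, $\langle \hat M,\hat N\rangle=\dim_k\mathrm{Hom}_A(M,N)-\dim_k\mathrm{Ext}^1_A(M,N)$, and $(\alpha,\beta)=\langle\alpha,\beta\rangle+\langle\beta,\alpha\rangle$. For objects $M,N,L$ let $\mathrm{Ext}^1(M,N)_L$ be the set of equivalence classes of extensions $0\to N\to L\to M\to 0$ with middle term $L$. Put $$F_{MN}^L=\frac{|\mathrm{Ext}^1_A(M,N)_L|}{|\mathrm{Hom}_A(M,N)|}\cdot\frac{a_L}{a_Ma_N},\qquad \gamma_{MN}^{XY}=\frac{|\{(f,g,h): 0\to X\xrightarrow{g}M\xrightarrow{f}N\xrightarrow{h}Y\to0\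 \text{exact}\}|}{a_Ma_N}.$$ *The lattice algebra.* $L_m(A)$ is the unital associative $\mathbb C$-algebra generated by $Z^{(i)}_{[M]}$ ($[M]\in\mathrm{Iso}(A)$, $i\in\mathbb Z_m$) and $K^{(i)}_\alpha$ ($\alpha\in K(A)$, $i\in\mathbb Z_m$) with $Z^{(i)}_{[0]}=K^{(i)}_0=1$ and the relations $$K_\alpha^{(i)}K_\beta^{(i)}=K_{\alpha+\beta}^{(i)},\qquad K_\alpha^{(i)}K_\beta^{(j)}=v^{c}K_\beta^{(j)}K_\alpha^{(i)},\quad c=(\alpha,\beta)\text{ if }i=j+1,\ -(\alpha,\beta)\text{ if }i=j-1,\ 0\text{ otherwise};\tag{3.1}$$ $$K_\alpha^{(i)}Z_{[M]}^{(j)}=v^{c}Z_{[M]}^{(j)}K_\alpha^{(i)},\quad c=(\alpha,\hat M)\text{ if }i=j,\ -(\alpha,\hat M)\text{ if }i=j-1,\ 0\text{ otherwise};\tag{3.2}$$ $$Z_{[M]}^{(i)}Z_{[N]}^{(i)}=v^{\langle\hat M,\hat N\rangle}\sum_{[L]}F_{MN}^LZ_{[L]}^{(i)};\tag{3.3}$$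 $$Z_{[M]}^{(i+1)}Z_{[N]}^{(i)}=\sum_{[X],[Y]}v^{\langle\hat M-\hat X,\hat X-\hat Y\rangle}\gamma_{MN}^{XY}K^{(i)}_{\hat M-\hat X}Z_{[Y]}^{(i)}Z_{[X]}^{(i+1)};\tag{3.4}$$ $$Z_{[M]}^{(i)}Z_{[N]}^{(j)}=Z_{[N]}^{(j)}Z_{[M]}^{(i)}\quad\text{if } i-j\neq0,1,m-1\text{ in }\mathbb Z_m.\tag{3.5}$$ *Bridgeland's Hall algebra.* Let $\mathcal C_m(\mathcal P)$ be the category of $m$-cyclic complexes $(M_i,d_i)_{i\in\mathbb Z_m}$, $d_i:M_i\to M_{i+1}$, $d_{i+1}d_i=0$, of finite dimensional projective $A$-modules (bounded complexes if $m=0$), with the exact structure of chain-wise exact sequences and the shifts $M_\bullet[t]=(M_{i+t},(-1)^td_{i+t})$. Its twisted Hall algebra is the $\mathbb C$-vector space with basis the isomorphism classes $[M_\bullet]$, with unit $[0]$ and $$[M_\bullet]*[N_\bullet]=v^{\sum_i\langle\hat M_i,\hat N_i\rangle}\sum_{[L_\bullet]}\frac{|\mathrm{Ext}^1(M_\bullet,N_\bullet)_{L_\bullet}|}{|\mathrm{Hom}(M_\bullet,N_\bullet)|}[L_\bullet],$$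 and $\mathcal{DH}_m(A)$ is its localization at all $v^n[M_\bullet]$ with $n\in\mathbb Z$ and $M_\bullet$ acyclic. For a map $f:Q\to P$ of projective modules let $C_f$ be the complex with $Q$ in degree $m-1$, $P$ in degree $0$, zero elsewhere, and $f$ as only nonzero differential; put $K_P=C_{\mathrm{id}_P}$. For $r\in\mathbb Z_m$ (represented in $\{0,\dots,m-1\}$ if $m>0$) and $\alpha=\hat P-\hat Q$ with $P,Q$ projective put $K_{\alpha,r}=[K_P[r]]*[K_Q[r]]^{-1}$. For a module $M$ with minimal projective resolution $0\to\Omega_M\xrightarrow{\delta}P_M\to M\to0$ put $C_M=C_\delta$ and $e_{M,r}=a_M^{-1}v^{\langle\hat\Omega_M,\hat M\rangle}K_{-\hat\Omega_M,r}*[C_M[r]]$. **Theorem.** There is an isomorphism of $\mathbb C$-algebras $L_m(A)\to\mathcal{DH}_m(A)$ with $Z^{(i)}_{[M]}\mapsto e_{M,i}$ and $K^{(i)}_\alpha\mapsto K_{\alpha,i}$ for all modules $M$, all $\alpha\in K(A)$ and all $i\in\mathbb Z_m$ (whatever the choice of $P,Q$ and of the minimal resolutions). -/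

import Mathlib

open CategoryTheory CategoryTheory.Limits

universe v u

namespace BridgelandHall

/-- A ring is (left) hereditary if all its left ideals are projective modules. -/
class IsHereditaryRing (A : Type u) [Ring A] : Prop where
  projective_ideal : ∀ I : Ideal A, Module.Projective A I

section Hereditary

variable {A : Type u} [Ring A] [IsHereditaryRing A]

/-- Over a hereditary ring, a submodule `N` is projective as soon as it has a linear form whose
kernel is projective. -/
theorem projective_of_ker {N : Type u} [AddCommGroup N] [Module A N] (f : N →ₗ[A] A)
    (hf : Module.Projective A (LinearMap.ker f)) : Module.Projective A N := by
  have hI : Module.Projective A (LinearMap.range f) :=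
    IsHereditaryRing.projective_ideal (LinearMap.range f)
  obtain ⟨s, hs⟩ := Module.projective_lifting_property f.rangeRestrict
    (LinearMap.id : LinearMap.range f →ₗ[A] LinearMap.range f) f.surjective_rangeRestrict
  have hs' : ∀ y, f (s y) = y := fun y => by
    have := LinearMap.congr_fun hs y
    exact congrArg Subtype.val this
  let i : N →ₗ[A] LinearMap.ker f × LinearMap.range f :=
    LinearMap.prod
      (LinearMap.codRestrict (LinearMap.ker f) (LinearMap.id - s ∘ₗ f.rangeRestrict) (by
        intro x
        simp [hs'])) f.rangeRestrict
  let p : LinearMap.ker f × LinearMap.range f →ₗ[A] N :=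
    LinearMap.coprod (LinearMap.ker f).subtype s
  refine Module.Projective.of_split i p ?_
  ext x
  simp [i, p]

/-- Over a hereditary ring, submodules of finite free modules are projective. -/
theorem projective_of_embeds : ∀ (n : ℕ) {N : Type u} [AddCommGroup N] [Module A N]
    (f : N →ₗ[A] (Fin n → A)), Function.Injective f → Module.Projective A N
  | 0, N, _, _, f, hf => by
    have : Subsingleton N := hf.subsingleton
    infer_instance
  | n + 1, N, _, _, f, hf => by
    refine projective_of_ker ((LinearMap.proj 0) ∘ₗ f) ?_
    refine projective_of_embeds n
      (LinearMap.funLeft A A Fin.succ ∘ₗ f ∘ₗ (LinearMap.ker ((LinearMap.proj 0) ∘ₗ f)).subtype) ?_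
    rw [← LinearMap.ker_eq_bot, LinearMap.ker_eq_bot']
    rintro ⟨x, hx⟩ h
    have : f x = 0 := by
      funext j
      refine Fin.cases ?_ (fun j => ?_) j
      · simpa using hx
      · exact congrFun h j
    exact Subtype.ext (hf (by simpa using this))

/-- Every finitely generated module over a hereditary left noetherian ring is the cokernel of an
injective map between finitely generated projective modules. -/
theorem exists_resolution [IsNoetherianRing A] (M : ModuleCat.{u} A) [Module.Finite A M] :
    ∃ (Q P : ModuleCat.{u} A) (f : Q ⟶ P) (g : P ⟶ M) (w : f ≫ g = 0),
      (ShortComplex.mk f g w).ShortExact ∧ (Module.Finite A Q ∧ Module.Projective A Q) ∧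
      (Module.Finite A P ∧ Module.Projective A P) := by
  obtain ⟨n, f, hf⟩ := Module.Finite.exists_fin' A M
  refine ⟨.of A (LinearMap.ker f), .of A (Fin n → A), ModuleCat.ofHom (LinearMap.ker f).subtype,
    ModuleCat.ofHom f, by ext x; exact x.2, ?_, ⟨?_, ?_⟩, ?_, ?_⟩
  · have := (ModuleCat.mono_iff_injective (ModuleCat.ofHom (LinearMap.ker f).subtype)).2
      Subtype.val_injective
    have := (ModuleCat.epi_iff_surjective (ModuleCat.ofHom f)).2 hf
    refine ShortComplex.ShortExact.mk' ?_ ‹_› ‹_›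
    rw [ShortComplex.moduleCat_exact_iff]
    intro x hx
    exact ⟨⟨x, hx⟩, rfl⟩
  · exact inferInstanceAs (Module.Finite A (LinearMap.ker f))
  · exact projective_of_embeds n (LinearMap.ker f).subtype Subtype.val_injective
  · exact inferInstanceAs (Module.Finite A (Fin n → A))
  · exact inferInstanceAs (Module.Projective A (Fin n → A))

/-- Over a hereditary left noetherian ring finitely generated modules have projective dimension
at most one. -/
theorem hasProjectiveDimensionLT_two [IsNoetherianRing A] (M : ModuleCat.{u} A)
    [Module.Finite A M] : HasProjectiveDimensionLT M 2 := by
  obtain ⟨Q, P, f, g, w, hS, ⟨_, h1⟩, _, h2⟩ := exists_resolution M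
  have : Projective Q := ModuleCat.projective_of_categoryTheory_projective _
  have : Projective P := ModuleCat.projective_of_categoryTheory_projective _
  exact hS.hasProjectiveDimensionLT_X₃ 1 inferInstance inferInstance

end Hereditary

section Euler

open Abelian

variable (k : Type v) [Field k] {A : Type u} [Ring A] [Algebra k A]

/-- The Euler form on modules, `⟨M, N⟩ = dim_k Hom_A(M, N) - dim_k Ext¹_A(M, N)`. -/
noncomputable def eulerObj (M N : ModuleCat.{u} A) : ℤ :=
  (Module.finrank k (M ⟶ N) : ℤ) - (Module.finrank k (Ext M N 1) : ℤ)

theorem finite_hom [Module.Finite k A] (M N : ModuleCat.{u} A)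
    [Module.Finite A M] [Module.Finite A N] : Module.Finite k (M ⟶ N) := by
  let := ModuleCat.moduleOfAlgebraModule (k := k) M
  let := ModuleCat.moduleOfAlgebraModule (k := k) N
  have := ModuleCat.isScalarTower_of_algebra_moduleCat (k := k) M
  have := ModuleCat.isScalarTower_of_algebra_moduleCat (k := k) N
  have : Module.Finite k M := Module.Finite.trans A M
  have : Module.Finite k N := Module.Finite.trans A N
  let φ : (M ⟶ N) →ₗ[k] (M →ₗ[k] N) :=
    { toFun f := f.hom.restrictScalars k
      map_add' _ _ := rfl
      map_smul' _ _ := by ext; rfl }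
  refine Module.Finite.of_injective φ fun f g h => ?_
  ext x
  exact LinearMap.congr_fun h x

theorem finite_ext_zero [Module.Finite k A] (M N : ModuleCat.{u} A)
    [Module.Finite A M] [Module.Finite A N] : Module.Finite k (Ext M N 0) :=
  have := finite_hom k M N
  Module.Finite.equiv (Ext.linearEquiv₀ (R := k)).symm

theorem isNoetherianRing_of_finite [Module.Finite k A] : IsNoetherianRing A :=
  isNoetherian_of_tower k inferInstance

theorem finite_ext_one [Module.Finite k A] [IsHereditaryRing A] (M N : ModuleCat.{u} A)
    [Module.Finite A M] [Module.Finite A N] : Module.Finite k (Ext M N 1) := by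
  have := isNoetherianRing_of_finite k (A := A)
  obtain ⟨Q, P, f, g, w, hS, ⟨_, h1⟩, _, h2⟩ := exists_resolution M
  have : Projective P := ModuleCat.projective_of_categoryTheory_projective _
  have := finite_ext_zero k Q N
  refine Module.Finite.of_surjective (hS.extClass.precompOfLinear k N (add_zero 1)) fun x => ?_
  exact Ext.contravariant_sequence_exact₃ hS N x
    (Ext.eq_zero_of_projective _) (add_zero 1)

/-- Dimension count in a six-term exact sequence. -/
theorem finrank_six {V₁ V₂ V₃ V₄ V₅ V₆ : Type*} [AddCommGroup V₁] [AddCommGroup V₂]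
    [AddCommGroup V₃] [AddCommGroup V₄] [AddCommGroup V₅] [AddCommGroup V₆]
    [Module k V₁] [Module k V₂] [Module k V₃] [Module k V₄] [Module k V₅] [Module k V₆]
    [Module.Finite k V₁] [Module.Finite k V₂] [Module.Finite k V₃]
    [Module.Finite k V₄] [Module.Finite k V₅] [Module.Finite k V₆]
    (f₁ : V₁ →ₗ[k] V₂) (f₂ : V₂ →ₗ[k] V₃) (f₃ : V₃ →ₗ[k] V₄) (f₄ : V₄ →ₗ[k] V₅)
    (f₅ : V₅ →ₗ[k] V₆) (h₁ : Function.Injective f₁) (h₂ : Function.Exact f₁ f₂)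
    (h₃ : Function.Exact f₂ f₃) (h₄ : Function.Exact f₃ f₄) (h₅ : Function.Exact f₄ f₅)
    (h₆ : Function.Surjective f₅) :
    (Module.finrank k V₂ : ℤ) - Module.finrank k V₅ =
      ((Module.finrank k V₁ : ℤ) - Module.finrank k V₄) +
        ((Module.finrank k V₃ : ℤ) - Module.finrank k V₆) := by
  have e₁ := f₁.finrank_range_add_finrank_ker
  have e₂ := f₂.finrank_range_add_finrank_ker
  have e₃ := f₃.finrank_range_add_finrank_ker
  have e₄ := f₄.finrank_range_add_finrank_ker
  have e₅ := f₅.finrank_range_add_finrank_ker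
  rw [LinearMap.ker_eq_bot.2 h₁, finrank_bot] at e₁
  rw [h₂.linearMap_ker_eq] at e₂
  rw [h₃.linearMap_ker_eq] at e₃
  rw [h₄.linearMap_ker_eq] at e₄
  rw [h₅.linearMap_ker_eq, LinearMap.range_eq_top.2 h₆, finrank_top] at e₅
  omega

variable [Module.Finite k A] [IsHereditaryRing A]

theorem eulerObj_add_right {S : ShortComplex (ModuleCat.{u} A)} (hS : S.ShortExact)
    (M : ModuleCat.{u} A) [Module.Finite A M] [Module.Finite A S.X₁] [Module.Finite A S.X₂]
    [Module.Finite A S.X₃] :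
    eulerObj k M S.X₂ = eulerObj k M S.X₁ + eulerObj k M S.X₃ := by
  have := isNoetherianRing_of_finite k (A := A)
  have := hasProjectiveDimensionLT_two M
  have := hS.mono_f
  have a₁ := finite_ext_zero k M S.X₁
  have a₂ := finite_ext_zero k M S.X₂
  have a₃ := finite_ext_zero k M S.X₃
  have b₁ := finite_ext_one k M S.X₁
  have b₂ := finite_ext_one k M S.X₂
  have b₃ := finite_ext_one k M S.X₃
  simp only [eulerObj]
  rw [← (Ext.linearEquiv₀ (R := k) (X := M) (Y := S.X₁)).finrank_eq,
    ← (Ext.linearEquiv₀ (R := k) (X := M) (Y := S.X₂)).finrank_eq,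
    ← (Ext.linearEquiv₀ (R := k) (X := M) (Y := S.X₃)).finrank_eq]
  refine finrank_six k ((Ext.mk₀ S.f).postcompOfLinear k M (add_zero 0))
    ((Ext.mk₀ S.g).postcompOfLinear k M (add_zero 0))
    (hS.extClass.postcompOfLinear k M (zero_add 1))
    ((Ext.mk₀ S.f).postcompOfLinear k M (add_zero 1))
    ((Ext.mk₀ S.g).postcompOfLinear k M (add_zero 1)) ?_ ?_ ?_ ?_ ?_ ?_
  · exact Ext.postcomp_mk₀_injective_of_mono M S.f
  · exact (ShortComplex.ab_exact_iff_function_exact _).1 (Ext.covariant_sequence_exact₂' M hS 0)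
  · exact (ShortComplex.ab_exact_iff_function_exact _).1
      (Ext.covariant_sequence_exact₃' M hS 0 1 (zero_add 1))
  · exact (ShortComplex.ab_exact_iff_function_exact _).1
      (Ext.covariant_sequence_exact₁' M hS 0 1 (zero_add 1))
  · exact (ShortComplex.ab_exact_iff_function_exact _).1 (Ext.covariant_sequence_exact₂' M hS 1)
  · intro x
    exact Ext.covariant_sequence_exact₃ M hS x rfl (Ext.eq_zero_of_hasProjectiveDimensionLT _ 2 le_rfl)

theorem eulerObj_add_left {S : ShortComplex (ModuleCat.{u} A)} (hS : S.ShortExact)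
    (N : ModuleCat.{u} A) [Module.Finite A N] [Module.Finite A S.X₁] [Module.Finite A S.X₂]
    [Module.Finite A S.X₃] :
    eulerObj k S.X₂ N = eulerObj k S.X₁ N + eulerObj k S.X₃ N := by
  have := isNoetherianRing_of_finite k (A := A)
  have := hasProjectiveDimensionLT_two S.X₃
  have := hS.epi_g
  have a₁ := finite_ext_zero k S.X₁ N
  have a₂ := finite_ext_zero k S.X₂ N
  have a₃ := finite_ext_zero k S.X₃ N
  have b₁ := finite_ext_one k S.X₁ N
  have b₂ := finite_ext_one k S.X₂ N
  have b₃ := finite_ext_one k S.X₃ N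
  simp only [eulerObj]
  rw [← (Ext.linearEquiv₀ (R := k) (Y := N) (X := S.X₁)).finrank_eq,
    ← (Ext.linearEquiv₀ (R := k) (Y := N) (X := S.X₂)).finrank_eq,
    ← (Ext.linearEquiv₀ (R := k) (Y := N) (X := S.X₃)).finrank_eq, add_comm]
  refine finrank_six k ((Ext.mk₀ S.g).precompOfLinear k N (zero_add 0))
    ((Ext.mk₀ S.f).precompOfLinear k N (zero_add 0))
    (hS.extClass.precompOfLinear k N (add_zero 1))
    ((Ext.mk₀ S.g).precompOfLinear k N (zero_add 1))
    ((Ext.mk₀ S.f).precompOfLinear k N (zero_add 1)) ?_ ?_ ?_ ?_ ?_ ?_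
  · exact Ext.precomp_mk₀_injective_of_epi N S.g
  · exact (ShortComplex.ab_exact_iff_function_exact _).1 (Ext.contravariant_sequence_exact₂' hS N 0)
  · exact (ShortComplex.ab_exact_iff_function_exact _).1
      (Ext.contravariant_sequence_exact₁' hS N 0 1 (add_zero 1))
  · exact (ShortComplex.ab_exact_iff_function_exact _).1
      (Ext.contravariant_sequence_exact₃' hS N 0 1 (add_zero 1))
  · exact (ShortComplex.ab_exact_iff_function_exact _).1 (Ext.contravariant_sequence_exact₂' hS N 1)
  · intro x
    exact Ext.contravariant_sequence_exact₁ hS N x rfl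
      (Ext.eq_zero_of_hasProjectiveDimensionLT _ 2 le_rfl)

end Euler

section Grothendieck

variable (A : Type u) [Ring A]

/-- The elements `[L] - [M] - [N]`, one for each short exact sequence `0 → M → L → N → 0`. -/
def grothendieckRelations : Set (FreeAbelianGroup (FGModuleCat.{u} A)) :=
  {x | ∃ (M L N : FGModuleCat.{u} A) (f : M.obj ⟶ L.obj) (g : L.obj ⟶ N.obj) (w : f ≫ g = 0),
    (ShortComplex.mk f g w).ShortExact ∧
      x = FreeAbelianGroup.of L - FreeAbelianGroup.of M - FreeAbelianGroup.of N}

/-- The Grothendieck group of the category of finitely generated `A`-modules. -/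
abbrev K0 : Type (u + 1) :=
  FreeAbelianGroup (FGModuleCat.{u} A) ⧸ AddSubgroup.closure (grothendieckRelations A)

variable {A}

/-- The class of a module in the Grothendieck group. -/
def K0.mk (M : FGModuleCat.{u} A) : K0 A := QuotientAddGroup.mk (FreeAbelianGroup.of M)

variable (k : Type v) [Field k] [Algebra k A] [Module.Finite k A] [IsHereditaryRing A]

/-- The Euler form with one argument a module and the other one in the Grothendieck group. -/
noncomputable def eulerRight (M : FGModuleCat.{u} A) : K0 A →+ ℤ :=
  QuotientAddGroup.lift _ (FreeAbelianGroup.lift fun N => eulerObj k M.obj N.obj) (by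
    refine (AddSubgroup.closure_le _).2 ?_
    rintro _ ⟨X, Y, Z, f, g, w, h, rfl⟩
    have := eulerObj_add_right k h M.obj
    simp only [SetLike.mem_coe, AddMonoidHom.mem_ker, map_sub, FreeAbelianGroup.lift_apply_of]
    simp only at this
    omega)

/-- The Euler form `⟨·,·⟩ : K(A) × K(A) → ℤ`. -/
noncomputable def eulerForm : K0 A →+ K0 A →+ ℤ :=
  QuotientAddGroup.lift _ (FreeAbelianGroup.lift fun M => eulerRight k M) (by
    refine (AddSubgroup.closure_le _).2 ?_
    rintro _ ⟨X, Y, Z, f, g, w, h, rfl⟩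
    simp only [SetLike.mem_coe, AddMonoidHom.mem_ker, map_sub, FreeAbelianGroup.lift_apply_of]
    ext N
    have := eulerObj_add_left k h N.obj
    simp only at this
    simp [eulerRight]
    omega)

theorem eulerForm_mk (M N : FGModuleCat.{u} A) :
    eulerForm k (K0.mk M) (K0.mk N) = eulerObj k M.obj N.obj := by
  simp [eulerForm, eulerRight, K0.mk]

/-- The symmetric Euler form `(α, β) = ⟨α, β⟩ + ⟨β, α⟩`. -/
noncomputable def symEuler (α β : K0 A) : ℤ := eulerForm k α β + eulerForm k β α

end Grothendieck

section Extensions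

variable {C : Type*} [Category C] [HasZeroMorphisms C]

/-- The short exact sequences `0 → N → L → M → 0` with given terms. -/
def ShortExactSeq (M N L : C) : Type _ :=
  {p : (N ⟶ L) × (L ⟶ M) // ∃ w : p.1 ≫ p.2 = 0, (ShortComplex.mk p.1 p.2 w).ShortExact}

/-- Equivalence of extensions of `M` by `N` with middle term `L`. -/
def ExtEquiv (M N L : C) (p p' : ShortExactSeq M N L) : Prop :=
  ∃ e : L ≅ L, p.1.1 ≫ e.hom = p'.1.1 ∧ e.hom ≫ p'.1.2 = p.1.2

/-- `|Ext¹(M, N)_L|`: the number of equivalence classes of extensions of `M` by `N` whose middle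
term is (isomorphic to) `L`. -/
noncomputable def extCard (M N L : C) : ℕ := Nat.card (Quot (ExtEquiv M N L))

end Extensions

section Modules

variable {A : Type u} [Ring A]

variable (A) in
/-- The set `Iso(A)` of isomorphism classes of finitely generated `A`-modules. -/
abbrev IsoMod : Type (u + 1) := Quotient (isIsomorphicSetoid (FGModuleCat.{u} A))

/-- The isomorphism class of a module. -/
def IsoMod.mk (M : FGModuleCat.{u} A) : IsoMod A := Quotient.mk _ M

/-- `a_M = |Aut M|`. -/
noncomputable def autCard (M : FGModuleCat.{u} A) : ℕ := Nat.card (M ≅ M)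

/-- The Ringel-Hall number
`F_{MN}^L = (|Ext¹(M, N)_L| / |Hom(M, N)|) * (|Aut L| / (|Aut M| |Aut N|))`. -/
noncomputable def ringelHallNumber (M N L : FGModuleCat.{u} A) : ℂ :=
  (extCard M.obj N.obj L.obj : ℂ) / (Nat.card (M.obj ⟶ N.obj) : ℂ) *
    ((autCard L : ℂ) / ((autCard M : ℂ) * (autCard N : ℂ)))

/-- The set of all `(f, g, h)` such that `0 → X --g--> M --f--> N --h--> Y → 0` is exact. -/
def FourTermExact (M N X Y : FGModuleCat.{u} A) :
    Set ((M.obj →ₗ[A] N.obj) × (X.obj →ₗ[A] M.obj) × (N.obj →ₗ[A] Y.obj)) :=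
  {p | Function.Injective p.2.1 ∧ Function.Exact p.2.1 p.1 ∧ Function.Exact p.1 p.2.2 ∧
    Function.Surjective p.2.2}

/-- `γ_{MN}^{XY}`: the number of exact sequences `0 → X → M → N → Y → 0` divided by
`a_M a_N`. -/
noncomputable def gammaNumber (M N X Y : FGModuleCat.{u} A) : ℂ :=
  (Nat.card (FourTermExact M N X Y) : ℂ) / ((autCard M : ℂ) * (autCard N : ℂ))

end Modules

/-- `v = √q`, where `q` is the number of elements of the finite field `k`. -/
noncomputable def vParam (k : Type v) : ℂ := ((Real.sqrt (Nat.card k : ℝ) : ℝ) : ℂ)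

section Lattice

variable (k : Type v) [Field k] (A : Type u) [Ring A] [Algebra k A] [Module.Finite k A]
  [IsHereditaryRing A] (m : ℕ)

/-- The symbols `Z_{[M]}^{(i)}` and `K_α^{(i)}`, where `i ∈ ℤ/m` (and `ℤ/0 = ℤ`). -/
inductive LatticeGen : Type (u + 1)
  | Z (M : IsoMod A) (i : ZMod m) : LatticeGen
  | K (α : K0 A) (i : ZMod m) : LatticeGen

variable {A m} in
/-- The symbol `Z_{[M]}^{(i)}` in the free algebra. -/
noncomputable def freeZ (M : IsoMod A) (i : ZMod m) : FreeAlgebra ℂ (LatticeGen A m) :=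
  FreeAlgebra.ι ℂ (LatticeGen.Z M i)

variable {A m} in
/-- The symbol `K_α^{(i)}` in the free algebra. -/
noncomputable def freeK (α : K0 A) (i : ZMod m) : FreeAlgebra ℂ (LatticeGen A m) :=
  FreeAlgebra.ι ℂ (LatticeGen.K α i)

/-- The defining relations of the `m`-periodic lattice algebra. The sums over isomorphism classes
are finite: `F_{MN}^L ≠ 0` forces `|L| = |M| |N|`, and `γ_{MN}^{XY} ≠ 0` forces `X` to be
isomorphic to a submodule of `M` and `Y` to a quotient of `N`. -/
inductive LatticeRel :
    FreeAlgebra ℂ (LatticeGen A m) → FreeAlgebra ℂ (LatticeGen A m) → Prop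
  /-- The class of zero is the unit in each copy of the group algebra of `K(A)`. -/
  | K_zero (i : ZMod m) : LatticeRel (freeK 0 i) 1
  /-- The class of the zero module is the unit in each copy of the Ringel-Hall algebra. -/
  | Z_zero (M : FGModuleCat.{u} A) (hM : Subsingleton M.obj) (i : ZMod m) :
      LatticeRel (freeZ (IsoMod.mk M) i) 1
  | K_add (α β : K0 A) (i : ZMod m) : LatticeRel (freeK α i * freeK β i) (freeK (α + β) i)
  | K_K (α β : K0 A) (i j : ZMod m) :
      LatticeRel (freeK α i * freeK β j)
        ((if i = j + 1 then vParam k ^ symEuler k α β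
          else if i = (m : ZMod m) - 1 + j then vParam k ^ (-symEuler k α β)
          else 1) • (freeK β j * freeK α i))
  | K_Z (α : K0 A) (M : FGModuleCat.{u} A) (i j : ZMod m) :
      LatticeRel (freeK α i * freeZ (IsoMod.mk M) j)
        ((if i = j then vParam k ^ symEuler k α (K0.mk M)
          else if i = (m : ZMod m) - 1 + j then vParam k ^ (-symEuler k α (K0.mk M))
          else 1) • (freeZ (IsoMod.mk M) j * freeK α i))
  | Z_Z_same (M N : FGModuleCat.{u} A) (i : ZMod m) :
      LatticeRel (freeZ (IsoMod.mk M) i * freeZ (IsoMod.mk N) i)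
        (vParam k ^ eulerForm k (K0.mk M) (K0.mk N) •
          ∑ᶠ L : IsoMod A, ringelHallNumber M N L.out • freeZ L i)
  | Z_Z_adjacent (M N : FGModuleCat.{u} A) (i : ZMod m) :
      LatticeRel (freeZ (IsoMod.mk M) (i + 1) * freeZ (IsoMod.mk N) i)
        (∑ᶠ p : IsoMod A × IsoMod A,
          (vParam k ^ eulerForm k (K0.mk M - K0.mk p.1.out) (K0.mk p.1.out - K0.mk p.2.out) *
            gammaNumber M N p.1.out p.2.out) •
          (freeK (K0.mk M - K0.mk p.1.out) i * freeZ p.2 i * freeZ p.1 (i + 1)))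
  | Z_Z_far (M N : FGModuleCat.{u} A) (i j : ZMod m) (h₀ : i - j ≠ 0) (h₁ : i - j ≠ 1)
      (h₂ : i - j ≠ (m : ZMod m) - 1) :
      LatticeRel (freeZ (IsoMod.mk M) i * freeZ (IsoMod.mk N) j)
        (freeZ (IsoMod.mk N) j * freeZ (IsoMod.mk M) i)

/-- The `m`-periodic lattice algebra `L_m(A)`. -/
abbrev LatticeAlgebra : Type (u + 1) := RingQuot (LatticeRel k A m)

variable {A m} in
/-- The generator `Z_{[M]}^{(i)}` of `L_m(A)`. -/
noncomputable def latticeZ (M : FGModuleCat.{u} A) (i : ZMod m) : LatticeAlgebra k A m :=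
  RingQuot.mkAlgHom ℂ (LatticeRel k A m) (freeZ (IsoMod.mk M) i)

variable {A m} in
/-- The generator `K_α^{(i)}` of `L_m(A)`. -/
noncomputable def latticeK (α : K0 A) (i : ZMod m) : LatticeAlgebra k A m :=
  RingQuot.mkAlgHom ℂ (LatticeRel k A m) (freeK α i)

end Lattice

section Complexes

variable (A : Type u) [Ring A] (m : ℕ)

/-- `m`-cyclic complexes of `A`-modules: modules `M_i` and maps `d_i : M_i → M_{i+1}` with
`d_{i+1} d_i = 0`, for `i ∈ ℤ/m`. For `m = 0` these are the complexes indexed by `ℤ`. -/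
abbrev CyclicComplex : Type (u + 1) :=
  HomologicalComplex (ModuleCat.{u} A) (ComplexShape.up (ZMod m))

/-- The complexes whose terms are finitely generated projective and almost all zero. The
finiteness of the support is automatic for `m > 0`; for `m = 0` it says that the complex is
bounded. -/
def projComplexes : ObjectProperty (CyclicComplex A m) := fun M =>
  (∀ i, Module.Finite A (M.X i) ∧ Module.Projective A (M.X i)) ∧
    {i | ¬ Subsingleton (M.X i)}.Finite

/-- The category `C_m(P)` of `m`-cyclic complexes of finitely generated projective `A`-modules
(bounded complexes if `m = 0`). -/
abbrev ProjComplex : Type (u + 1) := (projComplexes A m).FullSubcategory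

/-- The isomorphism classes of objects of `C_m(P)`. -/
abbrev IsoComplex : Type (u + 1) := Quotient (isIsomorphicSetoid (ProjComplex A m))

variable {A m}

/-- The shift `M[t]`, with `M[t]_i = M_{i+t}` and differential `(-1)^t d_{i+t}`. -/
def shiftComplex (M : CyclicComplex A m) (t : ℤ) : CyclicComplex A m where
  X i := M.X (i + (t : ZMod m))
  d i j := t.negOnePow • M.d (i + (t : ZMod m)) (j + (t : ZMod m))
  shape i j hij := by
    rw [M.shape, smul_zero]
    intro h
    apply hij
    simp only [ComplexShape.up_Rel] at h ⊢
    rw [add_right_comm] at h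
    exact add_right_cancel h
  d_comp_d' i j l _ _ := by
    simp only [Linear.comp_units_smul, Linear.units_smul_comp, M.d_comp_d, smul_zero]

theorem shiftComplex_mem {M : CyclicComplex A m} (hM : projComplexes A m M) (t : ℤ) :
    projComplexes A m (shiftComplex M t) := by
  refine ⟨fun i => hM.1 _, ?_⟩
  exact hM.2.preimage (f := fun i : ZMod m => i + (t : ZMod m)) (add_left_injective _).injOn

/-- The shift on `C_m(P)`. -/
def ProjComplex.shift (M : ProjComplex A m) (t : ℤ) : ProjComplex A m :=
  ⟨shiftComplex M.obj t, shiftComplex_mem M.property t⟩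

/-- The complex `C_f` of a map `f : Q → P`: it has `Q` in degree `m - 1`, `P` in degree `0`, zero
in the other degrees, and `f` as its only nonzero differential. -/
noncomputable def twoTermComplex {Q P : ModuleCat.{u} A} (f : Q ⟶ P) : CyclicComplex A m :=
  HomologicalComplex.double f (c := ComplexShape.up (ZMod m)) (i₀ := (m : ZMod m) - 1) (i₁ := 0)
    (by simp)

theorem twoTermComplex_mem {Q P : ModuleCat.{u} A} (f : Q ⟶ P)
    (hQ : Module.Finite A Q ∧ Module.Projective A Q)
    (hP : Module.Finite A P ∧ Module.Projective A P) :
    projComplexes A m (twoTermComplex f) := by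
  classical
  have h0 : ∀ X : ModuleCat.{u} A, IsZero X → Subsingleton X :=
    fun X hX => ModuleCat.subsingleton_of_isZero hX
  constructor
  · intro i
    by_cases h₁ : i = (m : ZMod m) - 1
    · have : (twoTermComplex f : CyclicComplex A m).X i = Q := by
        simp [twoTermComplex, HomologicalComplex.double, h₁]
      rw [this]; exact hQ
    by_cases h₂ : i = 0
    · have : (twoTermComplex f : CyclicComplex A m).X i = P := by
        rw [h₂] at h₁ ⊢
        exact (if_neg h₁).trans (if_pos rfl)
      rw [this]; exact hP
    · have := h0 _ (HomologicalComplex.isZero_double_X f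
        (c := ComplexShape.up (ZMod m)) (by simp) i h₁ h₂)
      change Subsingleton ((twoTermComplex f : CyclicComplex A m).X i) at this
      exact ⟨inferInstance, inferInstance⟩
  · refine (Set.toFinite {(m : ZMod m) - 1, 0}).subset fun i hi => ?_
    by_contra h
    simp only [Set.mem_insert_iff, Set.mem_singleton_iff, not_or] at h
    exact hi (h0 _ (HomologicalComplex.isZero_double_X f
        (c := ComplexShape.up (ZMod m)) (by simp) i h.1 h.2))

variable (A) in
/-- The property of being a finitely generated projective module. -/
def fgProj : ObjectProperty (ModuleCat.{u} A) := fun P =>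
  Module.Finite A P ∧ Module.Projective A P

variable (A) in
/-- The category of finitely generated projective `A`-modules. -/
abbrev ProjMod : Type (u + 1) := (fgProj A).FullSubcategory

/-- A projective module as an object of the category of finitely generated modules. -/
def ProjMod.toFG (P : ProjMod A) : FGModuleCat.{u} A := ⟨P.obj, P.property.1⟩

/-- The object `C_f` of `C_m(P)`. -/
noncomputable def twoTerm {Q P : ProjMod A} (f : Q.obj ⟶ P.obj) : ProjComplex A m :=
  ⟨twoTermComplex f, twoTermComplex_mem f Q.property P.property⟩

variable (m) in
/-- The object `K_P = C_{id_P}` of `C_m(P)`. -/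
noncomputable def contractible (P : ProjMod A) : ProjComplex A m := twoTerm (𝟙 P.obj)

/-- A minimal projective resolution `0 → Ω → P → M → 0`: the map `P → M` is a projective cover,
that is, its kernel is a superfluous submodule. -/
structure MinProjRes (M : FGModuleCat.{u} A) where
  P : ProjMod A
  Ω : ProjMod A
  δ : Ω.obj ⟶ P.obj
  ε : P.obj ⟶ M.obj
  w : δ ≫ ε = 0
  shortExact : (ShortComplex.mk δ ε w).ShortExact
  minimal : ∀ N : Submodule A P.obj, N ⊔ LinearMap.ker ε.hom = ⊤ → N = ⊤

end Complexes

section Localization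

/-- The relations of the localization of `H` at `S`: the symbols of elements of `H` are linear and
multiplicative, the symbol of the unit is the unit, and the symbols of elements of `S` have
two-sided inverses. -/
inductive LocRel {H : Type*} [AddCommGroup H] [Module ℂ H] (mul : H →ₗ[ℂ] H →ₗ[ℂ] H) (e : H)
    (S : Set H) : FreeAlgebra ℂ (H ⊕ S) → FreeAlgebra ℂ (H ⊕ S) → Prop
  | add (x y : H) : LocRel mul e S (FreeAlgebra.ι ℂ (Sum.inl (x + y)))
      (FreeAlgebra.ι ℂ (Sum.inl x) + FreeAlgebra.ι ℂ (Sum.inl y))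
  | smul (c : ℂ) (x : H) : LocRel mul e S (FreeAlgebra.ι ℂ (Sum.inl (c • x)))
      (c • FreeAlgebra.ι ℂ (Sum.inl x))
  | mul (x y : H) : LocRel mul e S (FreeAlgebra.ι ℂ (Sum.inl (mul x y)))
      (FreeAlgebra.ι ℂ (Sum.inl x) * FreeAlgebra.ι ℂ (Sum.inl y))
  | one : LocRel mul e S (FreeAlgebra.ι ℂ (Sum.inl e)) 1
  | mul_inv (s : S) : LocRel mul e S
      (FreeAlgebra.ι ℂ (Sum.inl s.1) * FreeAlgebra.ι ℂ (Sum.inr s)) 1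
  | inv_mul (s : S) : LocRel mul e S
      (FreeAlgebra.ι ℂ (Sum.inr s) * FreeAlgebra.ι ℂ (Sum.inl s.1)) 1

/-- The localization `H[S⁻¹]` of a complex algebra, given by its underlying vector space, its
multiplication and its unit: the universal unital associative algebra under `H` in which the
elements of `S` are invertible. If `S` satisfies the Ore conditions this is the Ore
localization. -/
abbrev AlgLocalization {H : Type*} [AddCommGroup H] [Module ℂ H] (mul : H →ₗ[ℂ] H →ₗ[ℂ] H)
    (e : H) (S : Set H) : Type _ :=
  RingQuot (LocRel mul e S)

end Localization

section Hall

variable (k : Type v) [Field k] (A : Type u) [Ring A] [Algebra k A] (m : ℕ)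

variable {A m} in
/-- `⟨M, N⟩ = ∑_i ⟨M_i, N_i⟩` for complexes `M` and `N`. -/
noncomputable def eulerComplex (M N : ProjComplex A m) : ℤ :=
  ∑ᶠ i : ZMod m, eulerObj k (M.obj.X i) (N.obj.X i)

/-- The vector space with basis the isomorphism classes of objects of `C_m(P)`. -/
abbrev TwistedHall : Type (u + 1) := IsoComplex A m →₀ ℂ

variable {A m} in
/-- The basis element `[M]`. -/
noncomputable def hallBasis (M : ProjComplex A m) : TwistedHall A m :=
  Finsupp.single (Quotient.mk _ M) 1

variable {A m} in
/-- The product `[M] * [N] = v^⟨M, N⟩ ∑_{[L]} (|Ext¹(M, N)_L| / |Hom(M, N)|) [L]`. The exact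
structure of `C_m(P)` is that of chain-wise exact sequences, which are the short exact sequences
of complexes. The sum is finite since a nonzero coefficient forces `|L_i| = |M_i| |N_i|`. -/
noncomputable def hallProduct (M N : ProjComplex A m) : TwistedHall A m :=
  vParam k ^ eulerComplex k M N •
    ∑ᶠ L : IsoComplex A m,
      ((extCard M.obj N.obj L.out.obj : ℂ) / (Nat.card (M.obj ⟶ N.obj) : ℂ)) •
        (Finsupp.single L 1 : TwistedHall A m)

/-- The multiplication of the twisted Hall algebra. -/
noncomputable def hallMul : TwistedHall A m →ₗ[ℂ] TwistedHall A m →ₗ[ℂ] TwistedHall A m :=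
  Finsupp.linearCombination ℂ fun M =>
    Finsupp.linearCombination ℂ fun N => hallProduct k M.out N.out

/-- The zero complex. -/
noncomputable def zeroComplex : ProjComplex A m :=
  contractible m ⟨ModuleCat.of A PUnit, inferInstance, inferInstance⟩

/-- The set `S = {v^n [M] | H_*(M) = 0, n ∈ ℤ}`. -/
def acyclicSet : Set (TwistedHall A m) :=
  {x | ∃ (M : ProjComplex A m) (n : ℤ), M.obj.Acyclic ∧ x = vParam k ^ n • hallBasis M}

/-- Bridgeland's Hall algebra `DH_m(A)`: the localization of the twisted Hall algebra of `C_m(P)`,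
whose unit is the class of the zero complex, at the set `S`. -/
abbrev BridgelandHallAlgebra : Type (u + 1) :=
  AlgLocalization (hallMul k A m) (hallBasis (zeroComplex A m)) (acyclicSet k A m)

variable {A m}

/-- The image in `DH_m(A)` of the basis element `[M]`. -/
noncomputable def hallClass (M : ProjComplex A m) : BridgelandHallAlgebra k A m :=
  RingQuot.mkAlgHom ℂ _ (FreeAlgebra.ι ℂ (Sum.inl (hallBasis M)))

/-- The element `K_{α,r} = [K_P[r]] * [K_Q[r]]⁻¹` of `DH_m(A)`, for `α = P̂ - Q̂`. The complex
`K_Q[r]` is acyclic for `m ≠ 1` and its class is then invertible. The index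
`r ∈ ℤ/m` is represented by an integer in `{0, …, m - 1}` (by itself if `m = 0`). -/
noncomputable def bridgelandK (P Q : ProjMod A) (r : ZMod m) : BridgelandHallAlgebra k A m :=
  hallClass k ((contractible m P).shift r.cast) *
    Ring.inverse (hallClass k ((contractible m Q).shift r.cast))

/-- The zero module, as a projective module. -/
def zeroProj : ProjMod A := ⟨ModuleCat.of A PUnit, inferInstance, inferInstance⟩

/-- The element `e_{M,r} = a_M⁻¹ v^⟨Ω, M⟩ K_{-Ω,r} * [C_M[r]]` of `DH_m(A)`, where
`0 → Ω → P → M → 0` is a minimal projective resolution of `M` and `C_M` is the two-term complex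
of `Ω → P`. -/
noncomputable def bridgelandE [Module.Finite k A] [IsHereditaryRing A] {M : FGModuleCat.{u} A}
    (R : MinProjRes M) (r : ZMod m) : BridgelandHallAlgebra k A m :=
  ((autCard M : ℂ)⁻¹ * vParam k ^ eulerForm k (K0.mk R.Ω.toFG) (K0.mk M)) •
    (bridgelandK k zeroProj R.Ω r * hallClass k ((twoTerm R.δ).shift r.cast))

end Hall

section WellDefined

variable {A : Type u} [Ring A] {m : ℕ}

theorem exact_contractible (hm : m ≠ 1) (P : ProjMod A) {a j b : ZMod m} (ha : a + 1 = j)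
    (hb : j + 1 = b) (x : (contractible m P).obj.X j)
    (hx : (contractible m P).obj.d j b x = 0) :
    ∃ y : (contractible m P).obj.X a, (contractible m P).obj.d a j y = x := by
  have h01 : (m : ZMod m) - 1 ≠ 0 := by
    have : Nontrivial (ZMod m) := ZMod.nontrivial_iff.2 hm
    simp
  have hrel : (ComplexShape.up (ZMod m)).Rel ((m : ZMod m) - 1) 0 := by simp
  have hiso : IsIso ((contractible m P).obj.d ((m : ZMod m) - 1) 0) := by
    have := HomologicalComplex.double_d (𝟙 P.obj) hrel h01
    change IsIso ((HomologicalComplex.double (𝟙 P.obj) hrel).d _ _)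
    rw [this]
    infer_instance
  by_cases h₁ : j = (m : ZMod m) - 1
  · have hb' : b = 0 := by rw [← hb, h₁]; simp
    subst hb' h₁
    have hinj := (ModuleCat.mono_iff_injective
      ((contractible m P).obj.d ((m : ZMod m) - 1) 0)).1 inferInstance
    refine ⟨0, ?_⟩
    rw [map_zero]
    exact (hinj (by rw [hx, map_zero])).symm
  by_cases h₂ : j = 0
  · have ha' : a = (m : ZMod m) - 1 := by
      rw [h₂] at ha
      simpa [eq_neg_iff_add_eq_zero] using ha
    subst ha' h₂
    exact (ModuleCat.epi_iff_surjective
      ((contractible m P).obj.d ((m : ZMod m) - 1) 0)).1 inferInstance x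
  · have : Subsingleton ((contractible m P).obj.X j) :=
      ModuleCat.subsingleton_of_isZero
        (HomologicalComplex.isZero_double_X (𝟙 P.obj) hrel j h₁ h₂)
    exact ⟨0, Subsingleton.elim _ _⟩

/-- The complexes `K_P[t]` are acyclic. -/
theorem acyclic_contractible_shift (hm : m ≠ 1) (P : ProjMod A) (t : ℤ) :
    ((contractible m P).shift t).obj.Acyclic := by
  intro i
  rw [HomologicalComplex.exactAt_iff' _ (i - 1) i (i + 1)
    ((ComplexShape.up (ZMod m)).prev_eq' (by simp))
    ((ComplexShape.up (ZMod m)).next_eq' (by simp)), ShortComplex.moduleCat_exact_iff]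
  intro x hx
  change t.negOnePow • ((contractible m P).obj.d _ _) x = 0 at hx
  obtain h | h := Int.even_or_odd t
  · obtain ⟨y, hy⟩ := exact_contractible hm P (a := i - 1 + t) (j := i + t) (b := i + 1 + t)
      (by ring) (by ring) x (by
      simpa [Int.negOnePow_even _ h] using hx)
    refine ⟨y, ?_⟩
    change (t.negOnePow • (contractible m P).obj.d _ _) y = x
    simpa [Int.negOnePow_even _ h] using hy
  · obtain ⟨y, hy⟩ := exact_contractible hm P (a := i - 1 + t) (j := i + t) (b := i + 1 + t)
      (by ring) (by ring) x (by
      simpa [Int.negOnePow_odd _ h] using hx)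
    refine ⟨-y, ?_⟩
    change (t.negOnePow • (contractible m P).obj.d _ _) (-y) = x
    simpa [Int.negOnePow_odd _ h] using hy

/-- The classes of acyclic complexes are invertible in `DH_m(A)`. -/
theorem isUnit_hallClass (k : Type v) [Field k] [Algebra k A] (M : ProjComplex A m)
    (hM : M.obj.Acyclic) : IsUnit (hallClass k M) := by
  have hS : hallBasis M ∈ acyclicSet k A m := ⟨M, 0, hM, by simp⟩
  refine ⟨⟨hallClass k M, RingQuot.mkAlgHom ℂ _ (FreeAlgebra.ι ℂ (Sum.inr ⟨_, hS⟩)), ?_, ?_⟩, rfl⟩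
  · rw [hallClass, ← map_mul, RingQuot.mkAlgHom_rel ℂ (LocRel.mul_inv ⟨_, hS⟩), map_one]
  · rw [hallClass, ← map_mul, RingQuot.mkAlgHom_rel ℂ (LocRel.inv_mul ⟨_, hS⟩), map_one]

/-- Every element of the Grothendieck group is a difference of classes of projective modules. -/
theorem exists_eq_sub [IsNoetherianRing A] [IsHereditaryRing A] (α : K0 A) :
    ∃ P Q : ProjMod A, α = K0.mk P.toFG - K0.mk Q.toFG := by
  have add : ∀ P Q : ProjMod A, ∃ R : ProjMod A, K0.mk R.toFG = K0.mk P.toFG + K0.mk Q.toFG := by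
    intro P Q
    have := P.property.1; have := P.property.2; have := Q.property.1; have := Q.property.2
    let R : ProjMod A := ⟨ModuleCat.of A (P.obj × Q.obj), inferInstance, inferInstance⟩
    refine ⟨R, ?_⟩
    have : FreeAbelianGroup.of R.toFG - FreeAbelianGroup.of P.toFG - FreeAbelianGroup.of Q.toFG ∈
        AddSubgroup.closure (grothendieckRelations A) := by
      refine AddSubgroup.subset_closure ⟨P.toFG, R.toFG, Q.toFG,
        ModuleCat.ofHom (LinearMap.inl A P.obj Q.obj),
        ModuleCat.ofHom (LinearMap.snd A P.obj Q.obj), by ext x; rfl, ?_, rfl⟩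
      refine ShortComplex.ShortExact.mk' ?_ ((ModuleCat.mono_iff_injective (ModuleCat.ofHom (LinearMap.inl A P.obj Q.obj))).2 ?_)
        ((ModuleCat.epi_iff_surjective (ModuleCat.ofHom (LinearMap.snd A P.obj Q.obj))).2 ?_)
      · rw [ShortComplex.moduleCat_exact_iff]
        rintro ⟨x, y⟩ hxy
        exact ⟨x, Prod.ext rfl (show (0 : Q.obj) = y from Eq.symm hxy)⟩
      · exact LinearMap.inl_injective (R := A) (M := P.obj) (M₂ := Q.obj)
      · exact LinearMap.snd_surjective (R := A) (M := P.obj) (M₂ := Q.obj)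
    have := (QuotientAddGroup.eq_zero_iff _).2 this
    rw [QuotientAddGroup.mk_sub, QuotientAddGroup.mk_sub, sub_sub, sub_eq_zero] at this
    exact this
  obtain ⟨x, rfl⟩ := QuotientAddGroup.mk_surjective α
  induction x using FreeAbelianGroup.induction_on with
  | zero =>
    exact ⟨zeroProj, zeroProj, by simp⟩
  | of M =>
    have : Module.Finite A M.obj := M.property
    obtain ⟨X₁, X₂, f, g, w, hS, h1, h2⟩ := exists_resolution M.obj
    refine ⟨⟨X₂, h2⟩, ⟨X₁, h1⟩, ?_⟩
    have : FreeAbelianGroup.of (ProjMod.toFG ⟨X₂, h2⟩) - FreeAbelianGroup.of (ProjMod.toFG ⟨X₁, h1⟩)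
        - FreeAbelianGroup.of M ∈ AddSubgroup.closure (grothendieckRelations A) :=
      AddSubgroup.subset_closure ⟨ProjMod.toFG ⟨X₁, h1⟩, ProjMod.toFG ⟨X₂, h2⟩, M, f, g, w, hS, rfl⟩
    have := (QuotientAddGroup.eq_zero_iff _).2 this
    rw [QuotientAddGroup.mk_sub, QuotientAddGroup.mk_sub, sub_eq_zero] at this
    exact this.symm
  | neg M ih =>
    obtain ⟨P, Q, h⟩ := ih
    exact ⟨Q, P, by rw [QuotientAddGroup.mk_neg, h, neg_sub]⟩
  | add x y hx hy =>
    obtain ⟨P, Q, h⟩ := hx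
    obtain ⟨P', Q', h'⟩ := hy
    obtain ⟨R, hR⟩ := add P P'
    obtain ⟨R', hR'⟩ := add Q Q'
    refine ⟨R, R', ?_⟩
    rw [QuotientAddGroup.mk_add, h, h', hR, hR']
    abel

/-- Over a finite hereditary ring every finitely generated module has a minimal projective
resolution. -/
theorem nonempty_minProjRes [Finite A] [IsHereditaryRing A] (M : FGModuleCat.{u} A) :
    Nonempty (MinProjRes M) := by
  classical
  have hfin : ∀ X : ModuleCat.{u} A, Module.Finite A X → Finite X :=
    fun X _ => Module.finite_of_finite A
  have hM := M.property
  -- choose a surjection from a projective module with as few elements as possible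
  let p : ℕ → Prop := fun n => ∃ (P : ProjMod A) (f : P.obj →ₗ[A] M.obj),
    Function.Surjective f ∧ Nat.card P.obj = n
  have hp : ∃ n, p n := by
    have : Module.Finite A M.obj := M.property
    obtain ⟨X₁, X₂, f, g, w, hS, h1, h2⟩ := exists_resolution M.obj
    exact ⟨_, ⟨X₂, h2⟩, g.hom, (ModuleCat.epi_iff_surjective g).1 hS.epi_g, rfl⟩
  obtain ⟨P, f, hf, hcard⟩ := Nat.find_spec hp
  have := P.property.1
  have := P.property.2
  have := hfin P.obj P.property.1
  have hmin : ∀ (P' : ProjMod A) (f' : P'.obj →ₗ[A] M.obj), Function.Surjective f' →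
      Nat.card P.obj ≤ Nat.card P'.obj := fun P' f' h => by
    rw [hcard]
    exact Nat.find_min' hp ⟨P', f', h, rfl⟩
  have key : ∀ N : Submodule A P.obj, N ⊔ LinearMap.ker f = ⊤ → N = ⊤ := by
    intro N hN
    -- a minimal submodule among those that surject onto `M`
    obtain ⟨N', hN'N, hN'⟩ := exists_minimal_le_of_wellFoundedLT
      (fun X : Submodule A P.obj => X ⊔ LinearMap.ker f = ⊤) N hN
    have hsurj : ∀ X : Submodule A P.obj, X ⊔ LinearMap.ker f = ⊤ ↔
        Function.Surjective (f ∘ₗ X.subtype) := by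
      intro X
      rw [← LinearMap.range_eq_top, LinearMap.range_comp, Submodule.range_subtype]
      constructor
      · intro h
        have := congrArg (Submodule.map f) h
        rw [Submodule.map_sup, Submodule.map_top, LinearMap.range_eq_top.2 hf] at this
        rw [← this, eq_comm, sup_eq_left]
        rintro _ ⟨x, hx, rfl⟩
        rw [LinearMap.mem_ker.1 hx]
        exact zero_mem _
      · intro h
        rw [← Submodule.comap_map_eq, h, Submodule.comap_top]
    obtain ⟨g, hg⟩ := Module.projective_lifting_property (f ∘ₗ N'.subtype) f ((hsurj N').1 hN'.1)
    -- the restriction of the lift to `N'` is bijective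
    have hh : Function.Surjective (g ∘ₗ N'.subtype) := by
      let X : Submodule A P.obj := LinearMap.range (N'.subtype ∘ₗ g ∘ₗ N'.subtype)
      have hX : X ≤ N' := by
        rintro _ ⟨x, rfl⟩
        exact (g x).2
      have hX2 : X ⊔ LinearMap.ker f = ⊤ := by
        rw [hsurj]
        intro y
        obtain ⟨x, hx⟩ := (hsurj N').1 hN'.1 y
        refine ⟨⟨g x, ⟨x, rfl⟩⟩, ?_⟩
        have := LinearMap.congr_fun hg x
        exact this.trans hx
      intro z
      obtain ⟨x, hx⟩ := hN'.2 hX2 hX z.2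
      exact ⟨x, Subtype.ext hx⟩
    have hbij : Function.Bijective (g ∘ₗ N'.subtype) :=
      ⟨Finite.injective_iff_surjective.2 hh, hh⟩
    let e := LinearEquiv.ofBijective (g ∘ₗ N'.subtype) hbij
    have hproj : Module.Projective A N' := by
      refine Module.Projective.of_split (N'.subtype ∘ₗ e.symm.toLinearMap) g ?_
      ext x
      have := e.apply_symm_apply x
      exact congrArg Subtype.val this
    have hle := hmin ⟨ModuleCat.of A N', inferInstanceAs (Module.Finite A N'), hproj⟩
      (f ∘ₗ N'.subtype) ((hsurj N').1 hN'.1)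
    have : (N' : Set P.obj) = Set.univ := by
      refine Set.eq_of_subset_of_ncard_le (Set.subset_univ _) ?_ (Set.toFinite _)
      rw [Set.ncard_univ]
      exact hle
    refine top_le_iff.1 (le_trans ?_ hN'N)
    intro x _
    have hx : x ∈ (N' : Set P.obj) := by rw [this]; exact Set.mem_univ x
    exact hx
  obtain ⟨n, i, hi⟩ := Module.Finite.exists_fin' A P.obj
  obtain ⟨s, hs⟩ := Module.projective_lifting_property i LinearMap.id hi
  refine ⟨⟨P, ⟨ModuleCat.of A (LinearMap.ker f), inferInstanceAs (Module.Finite A (LinearMap.ker f)),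
    projective_of_embeds n (s ∘ₗ (LinearMap.ker f).subtype) ?_⟩,
    ModuleCat.ofHom (LinearMap.ker f).subtype, ModuleCat.ofHom f, by ext x; exact x.2, ?_, key⟩⟩
  · have : Function.Injective s := fun x y h => by
      have hx := LinearMap.congr_fun hs x
      have hy := LinearMap.congr_fun hs y
      simp only [LinearMap.comp_apply, LinearMap.id_apply] at hx hy
      rw [← hx, ← hy, h]
    exact this.comp Subtype.val_injective
  · have := (ModuleCat.mono_iff_injective (ModuleCat.ofHom (LinearMap.ker f).subtype)).2
      Subtype.val_injective
    have := (ModuleCat.epi_iff_surjective (ModuleCat.ofHom f)).2 hf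
    refine ShortComplex.ShortExact.mk' ?_ ‹_› ‹_›
    rw [ShortComplex.moduleCat_exact_iff]
    intro x hx
    exact ⟨⟨x, hx⟩, rfl⟩

end WellDefined

end BridgelandHall

/-!
The proof works with a cocycle form of the product of the Hall algebra of complexes of projectives.
An extension `0 → N → L → M → 0` of such complexes splits in each degree, so `L` is the complex
`N ⊕ M` with its differential twisted by a cocycle `φ : M i → N (i + 1)`. Comparing extensions with
splittings (Riedtmann's formula) gives

  `[M] * [N] = v ^ (-∑ i, ⟨M i, N i⟩) • ∑ φ, [twist φ]`

(`hallClass_mul`), a finite sum without automorphism groups. Contractible complexes commute with all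
others up to a power of `v`, because all their cocycles are coboundaries; they are determined by the
classes of the images of their differentials, which gives the elements `K_α` (`kap`) for all
`α ∈ K(A)`. The elements `e_M` may be computed from any projective resolution of length one, since
two resolutions differ by a contractible complex (`modElt`, `bridgelandE_eq_modElt`).

*The relations.* For modules in the same degree both sides of the relation are sums over
`Hom(Ω_M, P_N) → Hom(Ω_M, N)`. For modules in consecutive degrees the cocycles are, up to sign, the
homomorphisms of the resolutions, and the complex twisted by a lift of `f : M → N` is the direct sum
of resolutions of `ker f` and `coker f`. For modules in distant degrees there are no cocycles. This
yields the homomorphism `latticeHom`.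

*Surjectivity.* Over a hereditary ring the kernels and the images of the differentials are
projective, so a complex is a direct sum of a two-term complex, which resolves one homology module,
and a smaller complex. The product of the two classes is a multiple of the class of the
direct sum plus classes of complexes whose homology has smaller dimension; by induction all classes
lie in the range (`latticeHom_surjective`).

*Injectivity.* The lattice algebra is filtered by the total dimension of the modules in a product of
generators. Modulo lower terms the generators `Z` with different indices commute, so the subquotient
of weight `n` is spanned by standard products, indexed by a finitely supported family `h` of modules
and a degree in `K(A)^m` (`filtration_succ_le`). The image of such a product is a multiple of the
class of a complex with homology `h`, times elements `K`, plus classes with less homology. These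
images are separated by functionals on the localized Hall algebra, which come from a right action
(`rightAction`) of this algebra on functions of virtual complexes: pairs of a complex `N` and a
family `κ` of classes of contractible complexes which are formally removed from `N`. The indicator
function of given homology modules, together with given classes of the images of the differentials,
isolates one standard product (`exists_test`, `latticeHom_injective`).
-/

namespace BridgelandHall

/-! ### Classes of modules and the Euler form -/

section Classes

variable {A : Type u} [Ring A]

variable (A) in
/-- The class of an unbundled finitely generated module in the Grothendieck group. -/
def cl (X : Type u) [AddCommGroup X] [Module A X] [Module.Finite A X] : K0 A :=
  K0.mk (FGModuleCat.of A X)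

theorem cl_of_exact {X Y Z : Type u} [AddCommGroup X] [Module A X] [Module.Finite A X]
    [AddCommGroup Y] [Module A Y] [Module.Finite A Y] [AddCommGroup Z] [Module A Z]
    [Module.Finite A Z] (f : X →ₗ[A] Y) (g : Y →ₗ[A] Z) (hf : Function.Injective f)
    (hg : Function.Surjective g) (h : Function.Exact f g) : cl A Y = cl A X + cl A Z := by
  have hw : ModuleCat.ofHom f ≫ ModuleCat.ofHom g = 0 := by
    ext x; exact (h (f x)).2 ⟨x, rfl⟩
  have hS : (ShortComplex.mk (ModuleCat.ofHom f) (ModuleCat.ofHom g) hw).ShortExact := by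
    refine ShortComplex.ShortExact.mk' ?_ ((ModuleCat.mono_iff_injective _).2 hf)
      ((ModuleCat.epi_iff_surjective _).2 hg)
    rw [ShortComplex.ShortExact.moduleCat_exact_iff_function_exact]
    exact h
  have : FreeAbelianGroup.of (FGModuleCat.of A Y) - FreeAbelianGroup.of (FGModuleCat.of A X) -
      FreeAbelianGroup.of (FGModuleCat.of A Z) ∈
        AddSubgroup.closure (grothendieckRelations A) :=
    AddSubgroup.subset_closure ⟨FGModuleCat.of A X, FGModuleCat.of A Y, FGModuleCat.of A Z,
      _, _, hw, hS, rfl⟩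
  have := (QuotientAddGroup.eq_zero_iff _).2 this
  rw [QuotientAddGroup.mk_sub, QuotientAddGroup.mk_sub, sub_sub, sub_eq_zero] at this
  exact this

variable (A) in
theorem cl_of_subsingleton (X : Type u) [AddCommGroup X] [Module A X] [Module.Finite A X]
    [Subsingleton X] : cl A X = 0 := by
  have := cl_of_exact (A := A) (LinearMap.id : X →ₗ[A] X) (LinearMap.id : X →ₗ[A] X)
    Function.injective_id Function.surjective_id
    (fun x => ⟨fun _ => ⟨x, rfl⟩, fun _ => Subsingleton.elim _ _⟩)
  simpa using this

theorem cl_congr {X Y : Type u} [AddCommGroup X] [Module A X] [Module.Finite A X]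
    [AddCommGroup Y] [Module A Y] [Module.Finite A Y] (e : X ≃ₗ[A] Y) : cl A X = cl A Y := by
  have := cl_of_exact (e.toLinearMap) (0 : Y →ₗ[A] PUnit.{u + 1}) e.injective
    (fun x => ⟨0, Subsingleton.elim _ _⟩)
    (fun x => ⟨fun _ => e.surjective x, fun _ => rfl⟩)
  rw [this, cl_of_subsingleton A PUnit, add_zero]

variable (A) in
theorem cl_prod (X Y : Type u) [AddCommGroup X] [Module A X] [Module.Finite A X]
    [AddCommGroup Y] [Module A Y] [Module.Finite A Y] :
    cl A (X × Y) = cl A X + cl A Y :=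
  cl_of_exact (LinearMap.inl A X Y) (LinearMap.snd A X Y) LinearMap.inl_injective
    LinearMap.snd_surjective (LinearMap.exact_iff.2 (by simp [LinearMap.range_inl]))

variable (k : Type v) [Field k] [Algebra k A] [Module.Finite k A] [IsHereditaryRing A]

theorem eulerForm_projective (P X : Type u) [AddCommGroup P] [Module A P] [Module.Finite A P]
    [Module.Projective A P] [AddCommGroup X] [Module A X] [Module.Finite A X] :
    eulerForm k (cl A P) (cl A X) = Module.finrank k (ModuleCat.of A P ⟶ ModuleCat.of A X) := by
  rw [cl, cl, eulerForm_mk, eulerObj]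
  have : Projective (ModuleCat.of A P) := ModuleCat.projective_of_categoryTheory_projective _
  have h : Subsingleton (Abelian.Ext (ModuleCat.of A P) (ModuleCat.of A X) 1) :=
    ⟨fun x y => by rw [Abelian.Ext.eq_zero_of_projective x, Abelian.Ext.eq_zero_of_projective y]⟩
  have h' : Module.finrank k (Abelian.Ext (ModuleCat.of A P) (ModuleCat.of A X) 1) = 0 :=
    Module.finrank_zero_of_subsingleton
  change _ - ((Module.finrank k (Abelian.Ext (ModuleCat.of A P) (ModuleCat.of A X) 1) : ℕ) : ℤ) = _
  rw [h']
  simp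

theorem vParam_pow_two (k : Type v) : vParam k ^ (2 : ℤ) = (Nat.card k : ℂ) := by
  rw [vParam, zpow_ofNat, ← Complex.ofReal_pow, Real.sq_sqrt (Nat.cast_nonneg _)]
  simp

theorem vParam_ne_zero (k : Type v) [Field k] [Finite k] : vParam k ≠ 0 := by
  rw [vParam, Complex.ofReal_ne_zero, Real.sqrt_ne_zero (Nat.cast_nonneg _), Nat.cast_ne_zero]
  exact Nat.card_pos.ne'

/-- Over a finite field, `|Hom(P, X)| = v^{2⟨P, X⟩}` for `P` projective. -/
theorem card_hom_projective (P X : Type u) [AddCommGroup P] [Module A P] [Module.Finite A P]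
    [Module.Projective A P] [AddCommGroup X] [Module A X] [Module.Finite A X] :
    (Nat.card (P →ₗ[A] X) : ℂ) = vParam k ^ (2 * eulerForm k (cl A P) (cl A X)) := by
  rw [eulerForm_projective, zpow_mul, vParam_pow_two]
  have := finite_hom k (ModuleCat.of A P) (ModuleCat.of A X)
  have h := Module.natCard_eq_pow_finrank (K := k) (V := ModuleCat.of A P ⟶ ModuleCat.of A X)
  rw [Nat.card_congr (ModuleCat.homEquiv (M := ModuleCat.of A P) (N := ModuleCat.of A X))] at h
  rw [zpow_natCast, ← Nat.cast_pow, ← h]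

variable (A) in
/-- The dimension as a function on the Grothendieck group. -/
noncomputable def dimK : K0 A →+ ℤ := eulerForm k (cl A A)

theorem dimK_nonneg (X : Type u) [AddCommGroup X] [Module A X] [Module.Finite A X] :
    0 ≤ dimK A k (cl A X) := by
  rw [dimK, eulerForm_projective]
  exact Int.natCast_nonneg _

theorem dimK_pos (X : Type u) [AddCommGroup X] [Module A X] [Module.Finite A X]
    [Nontrivial X] : 0 < dimK A k (cl A X) := by
  rw [dimK, eulerForm_projective]
  have := finite_hom k (ModuleCat.of A A) (ModuleCat.of A X)
  obtain ⟨x, hx⟩ := exists_ne (0 : X)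
  have : Nontrivial (ModuleCat.of A A ⟶ ModuleCat.of A X) := by
    refine ⟨ModuleCat.ofHom (LinearMap.toSpanSingleton A X x), 0, fun h => hx ?_⟩
    have := LinearMap.congr_fun (congrArg ModuleCat.Hom.hom h) (1 : A)
    simpa using this
  exact_mod_cast Module.finrank_pos

end Classes

/-! ### Finite products -/

section Pi

theorem finite_pi_of_subsingleton {ι : Type*} {V : ι → Type*} [∀ i, Finite (V i)] (s : Finset ι)
    (h : ∀ i ∉ s, Subsingleton (V i)) : Finite (∀ i, V i) := by
  refine Finite.of_injective (fun (f : ∀ i, V i) (i : s) => f i) fun f g hfg => ?_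
  funext i
  by_cases hi : i ∈ s
  · exact congrFun hfg ⟨i, hi⟩
  · exact (h i hi).elim _ _

theorem natCard_pi_of_subsingleton {ι : Type*} {V : ι → Type*} [∀ i, Inhabited (V i)]
    (s : Finset ι) (h : ∀ i ∉ s, Subsingleton (V i)) :
    Nat.card (∀ i, V i) = ∏ i ∈ s, Nat.card (V i) := by
  classical
  rw [← Finset.prod_coe_sort, ← Nat.card_pi]
  refine Nat.card_congr (Equiv.ofBijective (fun f (i : s) => f i) ⟨fun f g hfg => ?_, fun g => ?_⟩)
  · funext i
    by_cases hi : i ∈ s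
    · exact congrFun hfg ⟨i, hi⟩
    · exact (h i hi).elim _ _
  · refine ⟨fun i => if hi : i ∈ s then g ⟨i, hi⟩ else default, ?_⟩
    funext i
    simp

end Pi

/-! ### Complexes, cocycles and twisted direct sums -/

section Complexes

variable {A : Type u} [Ring A] {m : ℕ}

/-- The module in degree `i`. -/
abbrev ProjComplex.X (M : ProjComplex A m) (i : ZMod m) : Type u := M.obj.X i

/-- The differential as a linear map. -/
abbrev ProjComplex.d (M : ProjComplex A m) (i j : ZMod m) : M.X i →ₗ[A] M.X j :=
  (M.obj.d i j).hom

namespace ProjComplex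

instance (M : ProjComplex A m) (i : ZMod m) : Module.Finite A (M.X i) := (M.property.1 i).1

instance (M : ProjComplex A m) (i : ZMod m) : Module.Projective A (M.X i) := (M.property.1 i).2

instance [Finite A] (M : ProjComplex A m) (i : ZMod m) : Finite (M.X i) :=
  Module.finite_of_finite A

theorem d_d (M : ProjComplex A m) (i j l : ZMod m) (x : M.X i) : M.d j l (M.d i j x) = 0 :=
  LinearMap.congr_fun (congrArg ModuleCat.Hom.hom (M.obj.d_comp_d i j l)) x

theorem d_eq_zero (M : ProjComplex A m) {i j : ZMod m} (h : i + 1 ≠ j) : M.d i j = 0 :=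
  congrArg ModuleCat.Hom.hom (M.obj.shape i j h)

/-- The finite set of degrees in which a complex is nonzero. -/
noncomputable def supp (M : ProjComplex A m) : Finset (ZMod m) := M.property.2.toFinset

theorem subsingleton_of_notMem_supp (M : ProjComplex A m) {i : ZMod m} (h : i ∉ M.supp) :
    Subsingleton (M.X i) := by
  by_contra h'
  exact h ((Set.Finite.mem_toFinset _).2 h')

/-- Constructor for complexes of projective modules. -/
abbrev ofLinear (X : ZMod m → Type u) [∀ i, AddCommGroup (X i)] [∀ i, Module A (X i)]
    [∀ i, Module.Finite A (X i)] [∀ i, Module.Projective A (X i)] (d : ∀ i j, X i →ₗ[A] X j)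
    (hd : ∀ i j, i + 1 ≠ j → d i j = 0) (dd : ∀ i j l x, d j l (d i j x) = 0)
    (s : Finset (ZMod m)) (hs : ∀ i ∉ s, Subsingleton (X i)) : ProjComplex A m where
  obj :=
    { X := fun i => ModuleCat.of A (X i)
      d := fun i j => ModuleCat.ofHom (d i j)
      shape := fun i j h => by
        rw [hd i j h]; rfl
      d_comp_d' := fun i j l _ _ => by
        ext x; exact dd i j l x }
  property := by
    refine ⟨fun _ => ⟨inferInstanceAs (Module.Finite A (X _)),
      inferInstanceAs (Module.Projective A (X _))⟩, s.finite_toSet.subset fun i hi => ?_⟩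
    by_contra h
    exact hi (hs i h)

/-- The class of the module in degree `i`. -/
def cls (M : ProjComplex A m) (i : ZMod m) : K0 A := cl A (M.X i)

theorem cls_eq_zero (M : ProjComplex A m) {i : ZMod m} (h : i ∉ M.supp) : M.cls i = 0 :=
  have := M.subsingleton_of_notMem_supp h
  cl_of_subsingleton A (M.X i)

end ProjComplex

/-- The automorphism `(x, y) ↦ (x + s y, y)` of a direct sum. -/
def shear {X Y : Type*} [AddCommGroup X] [AddCommGroup Y] [Module A X] [Module A Y]
    (s : Y →ₗ[A] X) : (X × Y) ≃ₗ[A] (X × Y) where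
  toFun p := (p.1 + s p.2, p.2)
  invFun p := (p.1 - s p.2, p.2)
  map_add' p q := by ext <;> simp [add_add_add_comm]
  map_smul' c p := by ext <;> simp
  left_inv p := by simp
  right_inv p := by simp

/-- Isomorphisms of complexes, as families of linear equivalences commuting with the
differentials. -/
@[ext]
structure ComplexEquiv (M N : ProjComplex A m) where
  e : ∀ i, M.X i ≃ₗ[A] N.X i
  comm : ∀ i j x, e j (M.d i j x) = N.d i j (e i x)

namespace ComplexEquiv

variable {M N L : ProjComplex A m}

/-- The identity. -/
def refl (M : ProjComplex A m) : ComplexEquiv M M := ⟨fun _ => LinearEquiv.refl A _, fun _ _ _ => rfl⟩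

/-- The inverse isomorphism. -/
def symm (e : ComplexEquiv M N) : ComplexEquiv N M :=
  ⟨fun i => (e.e i).symm, fun i j x => by
    rw [LinearEquiv.symm_apply_eq, e.comm, LinearEquiv.apply_symm_apply]⟩

/-- The composition of isomorphisms. -/
def trans (e : ComplexEquiv M N) (f : ComplexEquiv N L) : ComplexEquiv M L :=
  ⟨fun i => (e.e i).trans (f.e i), fun i j x => by
    simp only [LinearEquiv.trans_apply, e.comm, f.comm]⟩

/-- The categorical isomorphism given by a `ComplexEquiv`. -/
def toIso (e : ComplexEquiv M N) : M.obj ≅ N.obj :=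
  HomologicalComplex.Hom.isoOfComponents (fun i => (e.e i).toModuleIso) (fun i j _ => by
    ext x; exact (e.comm i j x).symm)

/-- The `ComplexEquiv` given by a categorical isomorphism. -/
def ofIso (e : M.obj ≅ N.obj) : ComplexEquiv M N :=
  ⟨fun i => ((HomologicalComplex.eval _ _ i).mapIso e).toLinearEquiv, fun i j x => by
    exact LinearMap.congr_fun (congrArg ModuleCat.Hom.hom (e.hom.comm i j).symm) x⟩

/-- Categorical isomorphisms of complexes are the same as `ComplexEquiv`s. -/
def equivIso (M N : ProjComplex A m) : (M.obj ≅ N.obj) ≃ ComplexEquiv M N where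
  toFun := ofIso
  invFun := toIso
  left_inv e := by ext i x; rfl
  right_inv e := by
    ext i x; rfl

instance [Finite A] (M N : ProjComplex A m) : Finite (ComplexEquiv M N) := by
  have h1 : Finite (∀ i, M.X i → N.X i) := by
    refine finite_pi_of_subsingleton (M.supp ∪ N.supp) fun i hi => ?_
    have := N.subsingleton_of_notMem_supp (fun h => hi (Finset.mem_union_right _ h))
    infer_instance
  refine Finite.of_injective (fun (e : ComplexEquiv M N) i => (e.e i : M.X i → N.X i))
    fun e f h => ?_
  ext i x
  exact congrFun (congrFun h i) x

end ComplexEquiv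

theorem isoComplex_eq_iff {M N : ProjComplex A m} :
    (Quotient.mk (isIsomorphicSetoid (ProjComplex A m)) M = Quotient.mk _ N) ↔
      Nonempty (ComplexEquiv M N) := by
  rw [Quotient.eq]
  constructor
  · rintro ⟨e⟩
    exact ⟨.ofIso ((projComplexes A m).ι.mapIso e)⟩
  · rintro ⟨e⟩
    exact ⟨(projComplexes A m).isoMk e.toIso⟩

theorem hallBasis_congr {M N : ProjComplex A m} (e : ComplexEquiv M N) :
    hallBasis M = hallBasis N := by
  rw [hallBasis, hallBasis, isoComplex_eq_iff.2 ⟨e⟩]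

theorem hallClass_congr (k : Type v) [Field k] [Algebra k A] {M N : ProjComplex A m}
    (e : ComplexEquiv M N) : hallClass k M = hallClass k N := by
  rw [hallClass, hallClass, hallBasis_congr e]

/-- Degree one cocycles of the complex `Hom(M, N)`, with the sign convention `dφ + φd = 0`. -/
@[ext]
structure Cocycle (M N : ProjComplex A m) where
  f : ∀ i j, M.X i →ₗ[A] N.X j
  shape : ∀ i j, i + 1 ≠ j → f i j = 0
  cond : ∀ i j l x, N.d j l (f i j x) + f j l (M.d i j x) = 0

namespace Cocycle

variable {M N L : ProjComplex A m}

instance [Finite A] (M N : ProjComplex A m) : Finite (Cocycle M N) := by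
  have h1 : Finite (∀ i : ZMod m, M.X i → N.X (i + 1)) := by
    refine finite_pi_of_subsingleton (N.supp.preimage (· + 1) (add_left_injective 1).injOn)
      fun i hi => ?_
    have := N.subsingleton_of_notMem_supp (i := i + 1) (by simpa using hi)
    infer_instance
  refine Finite.of_injective (fun (φ : Cocycle M N) i => (φ.f i (i + 1) : M.X i → N.X (i + 1)))
    fun φ ψ h => ?_
  ext i j x
  by_cases hij : i + 1 = j
  · subst hij
    exact congrFun (congrFun h i) x
  · rw [φ.shape i j hij, ψ.shape i j hij]

noncomputable instance [Finite A] (M N : ProjComplex A m) : Fintype (Cocycle M N) :=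
  Fintype.ofFinite _

instance : Zero (Cocycle M N) := ⟨⟨0, fun _ _ _ => rfl, fun i j l x => by simp⟩⟩

@[simp] theorem zero_f (i j : ZMod m) : (0 : Cocycle M N).f i j = 0 := rfl

/-- The twisted direct sum: the extension of `M` by `N` with modules `N_i × M_i` and differential
`(n, m) ↦ (dn + φm, dm)`. -/
noncomputable abbrev twist (φ : Cocycle M N) : ProjComplex A m :=
  ProjComplex.ofLinear (fun i => N.X i × M.X i)
    (fun i j => ((N.d i j).coprod (φ.f i j)).prod (M.d i j ∘ₗ LinearMap.snd A _ _))
    (fun i j h => by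
      rw [N.d_eq_zero h, M.d_eq_zero h, φ.shape i j h]; ext <;> simp)
    (fun i j l x => by
      have := φ.cond i j l x.2
      refine Prod.ext ?_ ?_
      · simpa [N.d_d, add_assoc] using this
      · simp [M.d_d])
    (M.supp ∪ N.supp) (fun i hi => by
      have h1 := M.subsingleton_of_notMem_supp (fun h => hi (Finset.mem_union_left _ h))
      have h2 := N.subsingleton_of_notMem_supp (fun h => hi (Finset.mem_union_right _ h))
      exact inferInstanceAs (Subsingleton (N.X i × M.X i)))

theorem twist_d (φ : Cocycle M N) (i j : ZMod m) (x : N.X i × M.X i) :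
    φ.twist.d i j x = ((N.d i j x.1 + φ.f i j x.2, M.d i j x.2) : N.X j × M.X j) := rfl

theorem twist_cls (φ : Cocycle M N) (i : ZMod m) : φ.twist.cls i = N.cls i + M.cls i :=
  cl_prod A (N.X i) (M.X i)

/-- Transport of cocycles along isomorphisms. -/
def congr {M' N' : ProjComplex A m} (e : ComplexEquiv M M') (f : ComplexEquiv N N') :
    Cocycle M N ≃ Cocycle M' N' where
  toFun φ := ⟨fun i j => (f.e j).toLinearMap ∘ₗ φ.f i j ∘ₗ (e.e i).symm.toLinearMap,
    fun i j h => by rw [φ.shape i j h]; ext; simp, fun i j l x => by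
      have := congrArg (f.e l) (φ.cond i j l ((e.e i).symm x))
      have h2 := e.symm.comm i j x
      simp only [ComplexEquiv.symm] at h2
      simpa [f.comm, h2] using this⟩
  invFun φ := ⟨fun i j => (f.e j).symm.toLinearMap ∘ₗ φ.f i j ∘ₗ (e.e i).toLinearMap,
    fun i j h => by rw [φ.shape i j h]; ext; simp, fun i j l x => by
      have := congrArg (f.e l).symm (φ.cond i j l (e.e i x))
      have h2 := fun i j x => f.symm.comm i j x
      simp only [ComplexEquiv.symm] at h2
      simpa [h2, e.comm] using this⟩
  left_inv φ := by ext i j x; simp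
  right_inv φ := by ext i j x; simp

/-- Transport of twisted direct sums along isomorphisms. -/
noncomputable def congrTwist {M' N' : ProjComplex A m} (e : ComplexEquiv M M') (f : ComplexEquiv N N')
    (φ : Cocycle M N) : ComplexEquiv φ.twist (congr e f φ).twist where
  e i := LinearEquiv.prodCongr (f.e i) (e.e i)
  comm i j x := by
    change ((f.e j (N.d i j x.1 + φ.f i j x.2), e.e j (M.d i j x.2)) : N'.X j × M'.X j) =
      (N'.d i j (f.e i x.1) + f.e j (φ.f i j ((e.e i).symm (e.e i x.2))), M'.d i j (e.e i x.2))
    rw [map_add, f.comm, e.comm, LinearEquiv.symm_apply_apply]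

/-- If `φ = ds - sd` is the coboundary of `s`, the twisted direct sum is the direct sum. -/
noncomputable def twistEquivZero (φ : Cocycle M N) (s : ∀ i, M.X i →ₗ[A] N.X i)
    (hs : ∀ i j, i + 1 = j → ∀ x, φ.f i j x = N.d i j (s i x) - s j (M.d i j x)) :
    ComplexEquiv φ.twist (0 : Cocycle M N).twist where
  e i := shear (s i)
  comm i j x := by
    change ((N.d i j x.1 + φ.f i j x.2 + s j (M.d i j x.2), M.d i j x.2) : N.X j × M.X j) =
      (N.d i j (x.1 + s i x.2) + (0 : M.X i →ₗ[A] N.X j) x.2, M.d i j x.2)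
    by_cases h : i + 1 = j
    · rw [hs i j h]; simp [add_assoc]
    · rw [φ.shape i j h, M.d_eq_zero h, N.d_eq_zero h]; simp

end Cocycle

/-- The direct sum of complexes, in the order `N ⊕ M`. -/
noncomputable abbrev directSum (N M : ProjComplex A m) : ProjComplex A m := (0 : Cocycle M N).twist

/-- Commutativity of direct sums. -/
noncomputable def directSumComm (N M : ProjComplex A m) : ComplexEquiv (directSum N M) (directSum M N) where
  e i := LinearEquiv.prodComm A (N.X i) (M.X i)
  comm i j x := by
    change ((M.d i j x.2, N.d i j x.1 + (0 : M.X i →ₗ[A] N.X j) x.2) : M.X j × N.X j) =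
      (M.d i j x.2 + (0 : N.X i →ₗ[A] M.X j) x.1, N.d i j x.1)
    simp

end Complexes

/-! ### Counting extensions -/

section Riedtmann

variable {C : Type*} [Category C] [Abelian C] {M N L : C}

/-- The type of short exact sequences `0 → N → L → M → 0`, in reducible form. -/
abbrev ExactPair (M N L : C) : Type _ :=
  {p : (N ⟶ L) × (L ⟶ M) // ∃ w : p.1 ≫ p.2 = 0, (ShortComplex.mk p.1 p.2 w).ShortExact}

/-- Automorphisms of the middle term act on short exact sequences. -/
instance shortExactSeqAction : MulAction (Aut L) (ExactPair M N L) where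
  smul e p := ⟨(p.1.1 ≫ e.hom, e.inv ≫ p.1.2), by
    obtain ⟨⟨f, g⟩, w, hS⟩ := p
    have h0 : (f ≫ e.hom) ≫ e.inv ≫ g = 0 := by
      rw [Category.assoc]
      exact (congrArg (f ≫ ·) (e.hom_inv_id_assoc g)).trans w
    refine ⟨h0, ?_⟩
    refine ShortComplex.shortExact_of_iso ?_ hS
    exact ShortComplex.isoMk (Iso.refl _) e (Iso.refl _) (by simp)
      ((e.hom_inv_id_assoc g).trans (Category.comp_id g).symm)⟩
  one_smul p := Subtype.ext (Prod.ext (Category.comp_id _) (Category.id_comp _))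
  mul_smul e f p := Subtype.ext (Prod.ext
    (show p.1.1 ≫ f.hom ≫ e.hom = (p.1.1 ≫ f.hom) ≫ e.hom by simp)
    (show (e.inv ≫ f.inv) ≫ p.1.2 = e.inv ≫ f.inv ≫ p.1.2 by simp))

theorem shortExactSeq_smul_eq_iff (e : Aut L) (p p' : ExactPair M N L) :
    e • p = p' ↔ p.1.1 ≫ e.hom = p'.1.1 ∧ e.hom ≫ p'.1.2 = p.1.2 := by
  rw [Subtype.ext_iff, Prod.ext_iff]
  refine and_congr Iff.rfl ?_
  change e.inv ≫ p.1.2 = p'.1.2 ↔ _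
  exact (Iso.inv_comp_eq (show L ≅ L from e)).trans eq_comm

/-- The stabilizer of a short exact sequence under the automorphisms of its middle term consists of
the `1 + ghf` with `h : M ⟶ N`. -/
noncomputable def stabilizerEquiv (p : ExactPair M N L) :
    MulAction.stabilizer (Aut L) p ≃ (M ⟶ N) := by
  have hmono : Mono p.1.1 := p.2.2.mono_f
  have hepi : Epi p.1.2 := p.2.2.epi_g
  have w := p.2.1
  refine (Equiv.ofBijective (fun h : M ⟶ N => (⟨(show Aut L from
    ⟨𝟙 L + p.1.2 ≫ h ≫ p.1.1, 𝟙 L - p.1.2 ≫ h ≫ p.1.1, ?_, ?_⟩), ?_⟩ :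
      MulAction.stabilizer (Aut L) p)) ⟨?_, ?_⟩).symm
  · simp [reassoc_of% w, Preadditive.add_comp, Preadditive.comp_sub]
  · simp [reassoc_of% w, Preadditive.sub_comp, Preadditive.comp_add]
  · refine MulAction.mem_stabilizer_iff.2 ((shortExactSeq_smul_eq_iff _ _ _).2 ?_)
    constructor <;> simp [reassoc_of% w, Preadditive.comp_add, Preadditive.add_comp, w]
  · intro h h' hh
    have : 𝟙 L + p.1.2 ≫ h ≫ p.1.1 = 𝟙 L + p.1.2 ≫ h' ≫ p.1.1 :=
      congrArg (fun e : MulAction.stabilizer (Aut L) p => e.1.hom) hh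
    rw [add_right_inj] at this
    exact (cancel_mono p.1.1).1 ((cancel_epi p.1.2).1 this)
  · rintro ⟨e, he⟩
    rw [MulAction.mem_stabilizer_iff, shortExactSeq_smul_eq_iff] at he
    obtain ⟨l, hl⟩ := p.2.2.exact.desc' (e.hom - 𝟙 L) (by
      simp only [Preadditive.comp_sub, he.1, Category.comp_id, sub_self])
    have hl0 : l ≫ p.1.2 = 0 := by
      rw [← cancel_epi p.1.2, ← Category.assoc]
      change ((_ ≫ l) ≫ _) = _
      erw [hl]
      simp [Preadditive.sub_comp, he.2]
    have hl' := p.2.2.exact.lift_f l hl0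
    refine ⟨p.2.2.exact.lift l hl0, Subtype.ext (Iso.ext ?_)⟩
    change 𝟙 L + p.1.2 ≫ _ ≫ p.1.1 = e.hom
    erw [hl', hl]
    simp

/-- Riedtmann's formula: the number of extension classes with middle term `L` times `|Aut L|` is
the number of short exact sequences times `|Hom(M, N)|`. -/
theorem extCard_mul_card_aut (M N L : C) :
    extCard M N L * Nat.card (L ≅ L) = Nat.card (ExactPair M N L) * Nat.card (M ⟶ N) := by
  have h1 : Quot (α := ExactPair M N L) (ExtEquiv M N L) ≃ MulAction.orbitRel.Quotient (Aut L) (ExactPair M N L) :=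
    Quot.congrRight fun p p' => by
      change _ ↔ p ∈ MulAction.orbit (Aut L) p'
      rw [MulAction.mem_orbit_symm, MulAction.mem_orbit_iff]
      simp only [shortExactSeq_smul_eq_iff]
      rfl
  change Nat.card (Quot (α := ExactPair M N L) (ExtEquiv M N L)) * Nat.card (Aut L) = _
  rw [Nat.card_congr h1, ← Nat.card_prod, ← Nat.card_prod]
  refine Nat.card_congr ?_
  refine (MulAction.sigmaFixedByEquivOrbitsProdGroup (Aut L) (ExactPair M N L)).symm.trans ?_
  calc (Σ e : Aut L, MulAction.fixedBy (ExactPair M N L) e)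
      ≃ {q : Aut L × ExactPair M N L // q.1 • q.2 = q.2} :=
        (Equiv.subtypeProdEquivSigmaSubtype fun e p => e • p = p).symm
    _ ≃ {q : ExactPair M N L × Aut L // q.2 • q.1 = q.1} :=
        (Equiv.prodComm _ _).subtypeEquiv fun _ => Iff.rfl
    _ ≃ Σ p : ExactPair M N L, MulAction.stabilizer (Aut L) p :=
        Equiv.subtypeProdEquivSigmaSubtype fun p (e : Aut L) => e • p = p
    _ ≃ Σ _ : ExactPair M N L, (M ⟶ N) := Equiv.sigmaCongrRight stabilizerEquiv
    _ ≃ _ := Equiv.sigmaEquivProd _ _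

end Riedtmann

section Counting

theorem sum_eq_finsum_card {T Q V : Type*} [Fintype T] [AddCommGroup V] [Module ℂ V] (c : T → Q)
    (u : Q → V) : ∑ t, u (c t) = ∑ᶠ q, (Nat.card {t // c t = q} : ℂ) • u q := by
  classical
  rw [finsum_eq_sum_of_support_subset (s := Finset.univ.image c)]
  · rw [← Finset.sum_fiberwise_of_maps_to (g := c) (t := Finset.univ.image c)
      (fun t _ => Finset.mem_image_of_mem c (Finset.mem_univ t))]
    refine Finset.sum_congr rfl fun q _ => ?_
    rw [Finset.sum_congr rfl (g := fun _ => u q) (fun t ht => by rw [(Finset.mem_filter.1 ht).2]),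
      Finset.sum_const, Nat.card_eq_fintype_card, Fintype.card_subtype, Nat.cast_smul_eq_nsmul]
  · intro q hq
    by_contra h
    refine hq ?_
    have : IsEmpty {t // c t = q} :=
      ⟨fun t => h (by simpa using ⟨t.1, t.2⟩)⟩
    simp

theorem card_sigma_of_torsor {T : Type*} (E : T → Type*) [Finite T] [∀ t, Finite (E t)]
    (p : T → Prop) (a : ℕ) (h1 : ∀ t, p t → Nat.card (E t) = a) (h2 : ∀ t, E t → p t) :
    Nat.card (Σ t, E t) = Nat.card {t // p t} * a := by
  classical
  have := Fintype.ofFinite T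
  rw [Nat.card_sigma, Nat.card_eq_fintype_card, Fintype.card_subtype]
  rw [← Finset.sum_filter_add_sum_filter_not Finset.univ p, Finset.sum_eq_zero (s := {x | ¬ p x}),
    add_zero, Finset.sum_congr rfl (g := fun _ => a) (fun t ht => h1 t (Finset.mem_filter.1 ht).2)]
  · simp
  · intro t ht
    have : IsEmpty (E t) := ⟨fun x => (Finset.mem_filter.1 ht).2 (h2 t x)⟩
    exact Nat.card_of_isEmpty

end Counting

/-! ### The product of the Hall algebra as a sum over cocycles -/

section Product

variable {A : Type u} [Ring A] {m : ℕ}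

theorem shortExact_complex_iff {M N L : CyclicComplex A m} (f : N ⟶ L) (g : L ⟶ M) :
    (∃ w : f ≫ g = 0, (ShortComplex.mk f g w).ShortExact) ↔
      ∀ i, Function.Injective (f.f i).hom ∧ Function.Surjective (g.f i).hom ∧
        Function.Exact (f.f i).hom (g.f i).hom := by
  constructor
  · rintro ⟨w, h⟩ i
    have := (HomologicalComplex.shortExact_iff_degreewise_shortExact _).1 h i
    exact ⟨(ModuleCat.mono_iff_injective _).1 this.mono_f,
      (ModuleCat.epi_iff_surjective _).1 this.epi_g,
      (ShortComplex.ShortExact.moduleCat_exact_iff_function_exact _).1 this.exact⟩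
  · intro h
    have w : f ≫ g = 0 := by
      ext i x
      exact ((h i).2.2 _).2 ⟨x, rfl⟩
    refine ⟨w, (HomologicalComplex.shortExact_iff_degreewise_shortExact _).2 fun i => ?_⟩
    exact ShortComplex.ShortExact.mk'
      ((ShortComplex.ShortExact.moduleCat_exact_iff_function_exact _).2 (h i).2.2)
      ((ModuleCat.mono_iff_injective _).2 (h i).1) ((ModuleCat.epi_iff_surjective _).2 (h i).2.1)

/-- Short exact sequences of complexes of projectives with a chosen degreewise splitting. -/
abbrev SplitSeq (M N L : ProjComplex A m) : Type _ :=
  Σ p : ExactPair M.obj N.obj L.obj,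
    {s : ∀ i, M.X i →ₗ[A] L.X i // ∀ i x, (p.1.2.f i).hom (s i x) = x}

/-- The splittings of a short exact sequence form a torsor under `∏ Hom(M_i, N_i)`. -/
noncomputable def splitSeqEquiv (M N L : ProjComplex A m) :
    SplitSeq M N L ≃ ExactPair M.obj N.obj L.obj × (∀ i, M.X i →ₗ[A] N.X i) := by
  refine (Equiv.sigmaCongrRight fun p => ?_).trans (Equiv.sigmaEquivProd _ _)
  have hp := (shortExact_complex_iff p.1.1 p.1.2).1 p.2
  choose s hs using fun i => Module.projective_lifting_property (p.1.2.f i).hom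
    (LinearMap.id : M.X i →ₗ[A] M.X i) (hp i).2.1
  have hs' : ∀ i x, (p.1.2.f i).hom (s i x) = x := fun i x => LinearMap.congr_fun (hs i) x
  refine (Equiv.ofBijective (fun h : (∀ i, M.X i →ₗ[A] N.X i) =>
    (⟨fun i => s i + (p.1.1.f i).hom ∘ₗ h i, fun i x => ?_⟩ :
      {s : ∀ i, M.X i →ₗ[A] L.X i // ∀ i x, (p.1.2.f i).hom (s i x) = x})) ⟨?_, ?_⟩).symm
  · have := (hp i).2.2.apply_apply_eq_zero (h i x)
    simp only [LinearMap.add_apply, map_add, hs', LinearMap.comp_apply]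
    rw [this, add_zero]
  · intro h h' hh
    funext i
    ext x
    have := LinearMap.congr_fun (congrFun (congrArg Subtype.val hh) i) x
    simp only [LinearMap.add_apply, LinearMap.comp_apply, add_right_inj] at this
    exact (hp i).1 this
  · rintro ⟨t, ht⟩
    have key : ∀ i (x : M.X i), t i x - s i x ∈ LinearMap.range (p.1.1.f i).hom := by
      intro i x
      refine ((hp i).2.2 _).1 ?_
      rw [map_sub, ht, hs', sub_self]
    refine ⟨fun i => (LinearEquiv.ofInjective (p.1.1.f i).hom (hp i).1).symm.toLinearMap ∘ₗ
      LinearMap.codRestrict _ (t i - s i) (key i), Subtype.ext ?_⟩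
    funext i
    ext x
    have := congrArg Subtype.val ((LinearEquiv.ofInjective (p.1.1.f i).hom (hp i).1).apply_symm_apply
      (LinearMap.codRestrict _ (t i - s i) (key i) x))
    exact (congrArg (s i x + ·) this).trans (by simp)

/-- The split short exact sequence defined by an isomorphism from a twisted direct sum. -/
noncomputable def splitSeqOfTwist {M N L : ProjComplex A m}
    (q : Σ φ : Cocycle M N, ComplexEquiv φ.twist L) : SplitSeq M N L := by
  refine ⟨⟨(⟨fun i => ModuleCat.ofHom ((q.2.e i).toLinearMap ∘ₗ LinearMap.inl A (N.X i) (M.X i)),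
    fun i j _ => ?_⟩, ⟨fun i => ModuleCat.ofHom (LinearMap.snd A (N.X i) (M.X i) ∘ₗ
      (q.2.e i).symm.toLinearMap), fun i j _ => ?_⟩), ?_⟩,
    fun i => (q.2.e i).toLinearMap ∘ₗ LinearMap.inr A (N.X i) (M.X i), fun i x => ?_⟩
  · ext x
    have h := q.2.comm i j ((x, 0) : N.X i × M.X i)
    rw [Cocycle.twist_d] at h
    change L.d i j (q.2.e i ((x, 0) : N.X i × M.X i)) =
      q.2.e j ((N.d i j x, 0) : N.X j × M.X j)
    simpa using h.symm
  · ext x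
    have h := q.2.symm.comm i j x
    change M.d i j (((q.2.e i).symm x : N.X i × M.X i).2) =
      (((q.2.e j).symm (L.d i j x)) : N.X j × M.X j).2
    refine (congrArg Prod.snd (h.trans (Cocycle.twist_d _ _ _ _))).symm
  · refine (shortExact_complex_iff _ _).2 fun i => ⟨?_, ?_, ?_⟩
    · exact (q.2.e i).injective.comp (LinearMap.inl_injective (R := A) (M := N.X i) (M₂ := M.X i))
    · exact (LinearMap.snd_surjective (R := A) (M := N.X i) (M₂ := M.X i)).comp (q.2.e i).symm.surjective
    · intro x
      constructor
      · intro hx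
        refine ⟨((q.2.e i).symm x : N.X i × M.X i).1, ?_⟩
        have h0 : ((q.2.e i).symm x : N.X i × M.X i).2 = 0 := hx
        have : ((((q.2.e i).symm x : N.X i × M.X i).1, 0) : N.X i × M.X i) = (q.2.e i).symm x :=
          Prod.ext rfl h0.symm
        change q.2.e i (((((q.2.e i).symm x : N.X i × M.X i).1, 0) : N.X i × M.X i)) = x
        rw [this, LinearEquiv.apply_symm_apply]
      · rintro ⟨n, rfl⟩
        change ((q.2.e i).symm (q.2.e i ((n, 0) : N.X i × M.X i)) : N.X i × M.X i).2 = 0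
        rw [LinearEquiv.symm_apply_apply]
  · change ((q.2.e i).symm (q.2.e i ((0, x) : N.X i × M.X i)) : N.X i × M.X i).2 = x
    rw [LinearEquiv.symm_apply_apply]

theorem splitSeqOfTwist_injective {M N L : ProjComplex A m} :
    Function.Injective (splitSeqOfTwist (M := M) (N := N) (L := L)) := by
  rintro ⟨φ, e⟩ ⟨φ', e'⟩ h
  have h1 : ∀ i (n : N.X i), e.e i ((n, 0) : N.X i × M.X i) = e'.e i ((n, 0) : N.X i × M.X i) :=
    fun i n => congrArg (fun q : SplitSeq M N L => (q.1.1.1.f i).hom n) h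
  have h2 : ∀ i (x : M.X i), e.e i ((0, x) : N.X i × M.X i) = e'.e i ((0, x) : N.X i × M.X i) :=
    fun i x => congrArg (fun q : SplitSeq M N L => q.2.1 i x) h
  have h3 : ∀ i (x : N.X i × M.X i), e.e i x = e'.e i x := by
    intro i x
    have : x = ((x.1, 0) : N.X i × M.X i) + ((0, x.2) : N.X i × M.X i) := by ext <;> simp
    rw [this]
    erw [map_add, map_add]
    rw [h1, h2]
  have : φ = φ' := by
    ext i j x
    have a := e.comm i j ((0, x) : N.X i × M.X i)
    have b := e'.comm i j ((0, x) : N.X i × M.X i)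
    rw [h3 i, ← b, h3 j] at a
    have := congrArg Prod.fst ((e'.e j).injective a)
    rw [Cocycle.twist_d, Cocycle.twist_d] at this
    simpa using this
  subst this
  have : e = e' := by
    ext i x
    exact h3 i x
  rw [this]

/-- The middle term of a degreewise split short exact sequence is a twisted direct sum: the cocycle
measures the failure of the splitting `s` to commute with the differentials. -/
theorem splitSeqOfTwist_surjective {M N L : ProjComplex A m} :
    Function.Surjective (splitSeqOfTwist (M := M) (N := N) (L := L)) := by
  rintro ⟨⟨⟨f, g⟩, w⟩, s, hs⟩
  have hp := (shortExact_complex_iff f g).1 w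
  simp only at hs
  have hfg : ∀ i n, (g.f i).hom ((f.f i).hom n) = 0 := fun i n => (hp i).2.2.apply_apply_eq_zero n
  let e : ∀ i, (N.X i × M.X i) ≃ₗ[A] L.X i := fun i =>
    LinearEquiv.ofBijective (((f.f i).hom).coprod (s i)) ⟨by
      rw [← LinearMap.ker_eq_bot, LinearMap.ker_eq_bot']
      rintro ⟨n, x⟩ h
      simp only [LinearMap.coprod_apply] at h
      have hx : x = 0 := by
        have := congrArg (g.f i).hom h
        rwa [map_add, hfg, zero_add, hs, map_zero] at this
      subst hx
      rw [map_zero, add_zero] at h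
      rw [(hp i).1 (h.trans (map_zero _).symm)]
      rfl, fun y => by
      obtain ⟨n, hn⟩ := ((hp i).2.2 (y - s i ((g.f i).hom y))).1 (by
        rw [map_sub, hs, sub_self])
      exact ⟨(n, (g.f i).hom y), by
        change (f.f i).hom n + _ = _
        rw [hn]; simp⟩⟩
  have he : ∀ i n x, e i (n, x) = (f.f i).hom n + s i x := fun i n x => rfl
  have hg : ∀ i y, ((e i).symm y).2 = (g.f i).hom y := by
    intro i y
    obtain ⟨⟨n, x⟩, rfl⟩ := (e i).surjective y
    rw [LinearEquiv.symm_apply_apply, he, map_add, hfg, zero_add, hs]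
  have fcomm : ∀ i j n, L.d i j ((f.f i).hom n) = (f.f j).hom (N.d i j n) := fun i j n =>
    LinearMap.congr_fun (congrArg ModuleCat.Hom.hom (f.comm i j)) n
  have gcomm : ∀ i j y, M.d i j ((g.f i).hom y) = (g.f j).hom (L.d i j y) := fun i j y =>
    LinearMap.congr_fun (congrArg ModuleCat.Hom.hom (g.comm i j)) y
  -- The cocycle is `d s - s d`, which takes values in the image of `f`.
  let φ : ∀ i j, M.X i →ₗ[A] N.X j := fun i j => LinearMap.fst A _ _ ∘ₗ (e j).symm.toLinearMap ∘ₗ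
    (L.d i j ∘ₗ s i - s j ∘ₗ M.d i j)
  have hφ : ∀ i j x, (f.f j).hom (φ i j x) = L.d i j (s i x) - s j (M.d i j x) := by
    intro i j x
    have h0 : ((e j).symm (L.d i j (s i x) - s j (M.d i j x))).2 = 0 := by
      rw [hg, map_sub, ← gcomm, hs, hs, sub_self]
    have h1 := (e j).apply_symm_apply (L.d i j (s i x) - s j (M.d i j x))
    rw [← Prod.mk.eta (p := (e j).symm _), he, h0, map_zero, add_zero] at h1
    exact h1
  let c : Cocycle M N := ⟨φ, fun i j h => by
      ext x
      refine (hp j).1 ?_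
      rw [hφ, L.d_eq_zero h, M.d_eq_zero h]
      simp, fun i j l x => by
      refine (hp l).1 ?_
      rw [map_add, ← fcomm, hφ, hφ, map_sub, L.d_d, M.d_d, map_zero, map_zero]
      simp⟩
  refine ⟨⟨c, ⟨e, fun i j x => ?_⟩⟩, ?_⟩
  · obtain ⟨n, x⟩ := x
    rw [Cocycle.twist_d]
    change (f.f j).hom (N.d i j n + φ i j x) + s j (M.d i j x) =
      L.d i j ((f.f i).hom n + s i x)
    rw [map_add, hφ, map_add, fcomm]
    abel
  · refine Sigma.subtype_ext (Subtype.ext (Prod.ext ?_ ?_)) ?_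
    · ext i n
      change e i (n, 0) = (f.f i).hom n
      rw [he, map_zero, add_zero]
    · ext i y
      exact hg i y
    · funext i
      ext x
      change e i (0, x) = s i x
      rw [he, map_zero, zero_add]

theorem card_shortExactSeq_mul (M N L : ProjComplex A m) :
    Nat.card (ExactPair M.obj N.obj L.obj) * Nat.card (∀ i, M.X i →ₗ[A] N.X i) =
      Nat.card (Σ φ : Cocycle M N, ComplexEquiv φ.twist L) := by
  rw [← Nat.card_prod, ← Nat.card_congr (splitSeqEquiv M N L)]
  exact (Nat.card_congr (Equiv.ofBijective _ ⟨splitSeqOfTwist_injective,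
    splitSeqOfTwist_surjective⟩)).symm

theorem finite_hom_complex [Finite A] (M N : ProjComplex A m) : Finite (M.obj ⟶ N.obj) := by
  have h1 : Finite (∀ i : ZMod m, M.X i → N.X i) := by
    refine finite_pi_of_subsingleton N.supp fun i hi => ?_
    have := N.subsingleton_of_notMem_supp hi
    infer_instance
  refine Finite.of_injective (fun (f : M.obj ⟶ N.obj) i => ((f.f i).hom : M.X i → N.X i))
    fun f g h => ?_
  ext i x
  exact congrFun (congrFun h i) x

theorem finite_pi_hom [Finite A] (M N : ProjComplex A m) : Finite (∀ i, M.X i →ₗ[A] N.X i) := by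
  have (i : ZMod m) : Finite (M.X i →ₗ[A] N.X i) := Finite.of_injective _ DFunLike.coe_injective
  refine finite_pi_of_subsingleton N.supp fun i hi => ?_
  have := N.subsingleton_of_notMem_supp hi
  exact ⟨fun f g => by ext; exact Subsingleton.elim _ _⟩

/-- The structure constants of the Hall algebra count cocycles: the automorphisms of `L` act freely on
the short exact sequences, and also on the isomorphisms of the twisted direct sums with `L`. -/
theorem extCard_div_card_hom [Finite A] (M N L : ProjComplex A m) :
    (extCard M.obj N.obj L.obj : ℂ) / (Nat.card (M.obj ⟶ N.obj) : ℂ) =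
      (Nat.card (∀ i, M.X i →ₗ[A] N.X i) : ℂ)⁻¹ *
        (Nat.card {φ : Cocycle M N // Nonempty (ComplexEquiv φ.twist L)} : ℂ) := by
  have := finite_hom_complex M N
  have := finite_pi_hom M N
  have h0 : Nat.card (L.obj ≅ L.obj) = Nat.card (ComplexEquiv L L) :=
    Nat.card_congr (ComplexEquiv.equivIso L L)
  have : Nonempty (ComplexEquiv L L) := ⟨.refl L⟩
  have n1 : (Nat.card (ComplexEquiv L L) : ℂ) ≠ 0 := Nat.cast_ne_zero.2 Nat.card_pos.ne'
  have n2 : (Nat.card (M.obj ⟶ N.obj) : ℂ) ≠ 0 := Nat.cast_ne_zero.2 Nat.card_pos.ne'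
  have n3 : (Nat.card (∀ i, M.X i →ₗ[A] N.X i) : ℂ) ≠ 0 := Nat.cast_ne_zero.2 Nat.card_pos.ne'
  have h1 := extCard_mul_card_aut M.obj N.obj L.obj
  have h2 := card_shortExactSeq_mul M N L
  rw [card_sigma_of_torsor (fun φ : Cocycle M N => ComplexEquiv φ.twist L)
    (fun φ => Nonempty (ComplexEquiv φ.twist L)) (Nat.card (ComplexEquiv L L)) (fun φ ⟨e⟩ =>
      Nat.card_congr ⟨fun f => e.symm.trans f, fun f => e.trans f, fun f => by
        ext i x
        simp [ComplexEquiv.trans, ComplexEquiv.symm], fun f => by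
        ext i x
        simp [ComplexEquiv.trans, ComplexEquiv.symm]⟩) (fun φ e => ⟨e⟩)] at h2
  rw [h0] at h1
  have h1' : (extCard M.obj N.obj L.obj : ℂ) * (Nat.card (ComplexEquiv L L) : ℂ) =
    (Nat.card (ExactPair M.obj N.obj L.obj) : ℂ) * Nat.card (M.obj ⟶ N.obj) := by
      exact_mod_cast h1
  have h2' : (Nat.card (ExactPair M.obj N.obj L.obj) : ℂ) *
      Nat.card (∀ i, M.X i →ₗ[A] N.X i) =
      (Nat.card {φ : Cocycle M N // Nonempty (ComplexEquiv φ.twist L)} : ℂ) *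
        Nat.card (ComplexEquiv L L) := by exact_mod_cast h2
  rw [div_eq_iff n2]
  refine mul_right_cancel₀ n1 ?_
  rw [h1', eq_comm, mul_right_comm, mul_assoc _ _ (Nat.card (ComplexEquiv L L) : ℂ), ← h2',
    mul_comm (Nat.card (ExactPair M.obj N.obj L.obj) : ℂ), inv_mul_cancel_left₀ n3]

variable (k : Type v) [Field k] [Algebra k A]

theorem hallProduct_eq_sum [Finite A] (M N : ProjComplex A m) :
    hallProduct k M N = (vParam k ^ eulerComplex k M N *
      (Nat.card (∀ i, M.X i →ₗ[A] N.X i) : ℂ)⁻¹) •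
        ∑ φ : Cocycle M N, hallBasis φ.twist := by
  rw [hallProduct, mul_smul]
  congr 1
  have h := sum_eq_finsum_card (fun φ : Cocycle M N =>
    (Quotient.mk _ φ.twist : IsoComplex A m)) (fun q => (Finsupp.single q 1 : TwistedHall A m))
  rw [show (∑ φ : Cocycle M N, hallBasis φ.twist) = _ from h, smul_finsum]
  refine finsum_congr fun q => ?_
  rw [extCard_div_card_hom, mul_smul]
  congr 2
  refine congrArg Nat.cast (Nat.card_congr (Equiv.subtypeEquivRight fun φ => ?_))
  rw [← isoComplex_eq_iff, Quotient.out_eq]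

/-- The image of a vector of the twisted Hall algebra in its localization. -/
noncomputable def hallMap : TwistedHall A m →ₗ[ℂ] BridgelandHallAlgebra k A m where
  toFun x := RingQuot.mkAlgHom ℂ _ (FreeAlgebra.ι ℂ (Sum.inl x))
  map_add' x y := by
    rw [RingQuot.mkAlgHom_rel ℂ (LocRel.add x y), map_add]
  map_smul' c x := by
    rw [RingQuot.mkAlgHom_rel ℂ (LocRel.smul c x), map_smul]; rfl

theorem hallMap_mul (x y : TwistedHall A m) :
    hallMap k (hallMul k A m x y) = hallMap k x * hallMap k y :=
  (RingQuot.mkAlgHom_rel ℂ (LocRel.mul x y)).trans (map_mul _ _ _)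

theorem hallClass_zeroComplex : hallClass k (zeroComplex A m) = 1 :=
  (RingQuot.mkAlgHom_rel ℂ LocRel.one).trans (map_one _)

section Euler

variable [Module.Finite k A] [IsHereditaryRing A]

theorem eulerComplex_eq (M N : ProjComplex A m) :
    eulerComplex k M N = ∑ᶠ i, eulerForm k (M.cls i) (N.cls i) :=
  finsum_congr fun i => (eulerForm_mk k ⟨M.obj.X i, (M.property.1 i).1⟩ ⟨N.obj.X i, (N.property.1 i).1⟩).symm

theorem eulerComplex_eq_sum (M N : ProjComplex A m) {s : Finset (ZMod m)} (hs : M.supp ⊆ s) :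
    eulerComplex k M N = ∑ i ∈ s, eulerForm k (M.cls i) (N.cls i) := by
  rw [eulerComplex_eq]
  refine finsum_eq_sum_of_support_subset _ fun i hi => hs ?_
  by_contra h
  exact hi (by simp [M.cls_eq_zero h])

theorem card_pi_hom [Finite k] (M N : ProjComplex A m) :
    (Nat.card (∀ i, M.X i →ₗ[A] N.X i) : ℂ) = vParam k ^ (2 * eulerComplex k M N) := by
  rw [natCard_pi_of_subsingleton M.supp (fun i hi => by
    have := M.subsingleton_of_notMem_supp hi
    exact ⟨fun f g => by ext x; rw [Subsingleton.elim x 0, map_zero, map_zero]⟩),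
    eulerComplex_eq_sum k M N subset_rfl, Nat.cast_prod, Finset.mul_sum]
  rw [Finset.prod_congr rfl fun i _ => card_hom_projective k (M.X i) (N.X i)]
  induction M.supp using Finset.cons_induction with
  | empty => simp
  | cons a s h ih => 
    rw [Finset.prod_cons, Finset.sum_cons, zpow_add₀ (vParam_ne_zero k), ih]
    rfl

variable [Finite k] [Finite A]

/-- The product in the twisted Hall algebra is a sum over cocycles. -/
theorem hallMul_hallBasis (M N : ProjComplex A m) :
    hallMul k A m (hallBasis M) (hallBasis N) = vParam k ^ (-eulerComplex k M N) •
      ∑ φ : Cocycle M N, hallBasis φ.twist := by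
  have h1 : hallMul k A m (hallBasis M) (hallBasis N) =
      hallProduct k (Quotient.out (Quotient.mk (isIsomorphicSetoid (ProjComplex A m)) M))
        (Quotient.out (Quotient.mk (isIsomorphicSetoid (ProjComplex A m)) N)) := by
    simp [hallMul, hallBasis]
  obtain ⟨e⟩ := isoComplex_eq_iff.1
    (Quotient.out_eq (Quotient.mk (isIsomorphicSetoid (ProjComplex A m)) M))
  obtain ⟨f⟩ := isoComplex_eq_iff.1
    (Quotient.out_eq (Quotient.mk (isIsomorphicSetoid (ProjComplex A m)) N))
  rw [h1]
  generalize Quotient.out (Quotient.mk (isIsomorphicSetoid (ProjComplex A m)) M) = M' at *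
  generalize Quotient.out (Quotient.mk (isIsomorphicSetoid (ProjComplex A m)) N) = N' at *
  have h2 : eulerComplex k M' N' = eulerComplex k M N := by
    rw [eulerComplex_eq, eulerComplex_eq]
    refine finsum_congr fun i => ?_
    rw [ProjComplex.cls, ProjComplex.cls, cl_congr (e.e i), cl_congr (f.e i)]
    rfl
  rw [hallProduct_eq_sum, card_pi_hom k, h2, ← zpow_neg, ← zpow_add₀ (vParam_ne_zero k)]
  congr 1
  · congr 1; ring
  · exact Fintype.sum_equiv (Cocycle.congr e f) _ _ fun φ =>
      hallBasis_congr (Cocycle.congrTwist e f φ)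

theorem hallClass_mul (M N : ProjComplex A m) :
    hallClass k M * hallClass k N = vParam k ^ (-eulerComplex k M N) •
      ∑ φ : Cocycle M N, hallClass k φ.twist := by
  have := hallMap_mul k (hallBasis M) (hallBasis N)
  rw [hallMul_hallBasis, map_smul, map_sum] at this
  exact this.symm

end Euler

end Product

/-! ### Coboundaries -/

section Coboundary

variable {A : Type u} [Ring A] {m : ℕ} {M N : ProjComplex A m}

/-- The coboundary `ds - sd` of a family of linear maps. -/
def Cocycle.cob (s : ∀ i, M.X i →ₗ[A] N.X i) : Cocycle M N where
  f i j := N.d i j ∘ₗ s i - s j ∘ₗ M.d i j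
  shape i j h := by rw [N.d_eq_zero h, M.d_eq_zero h]; simp
  cond i j l x := by simp [N.d_d, M.d_d]

theorem Cocycle.cob_f (s : ∀ i, M.X i →ₗ[A] N.X i) (i j : ZMod m) (x : M.X i) :
    (Cocycle.cob s).f i j x = N.d i j (s i x) - s j (M.d i j x) := rfl

/-- The extension defined by a coboundary splits. -/
noncomputable def Cocycle.cobTwist (s : ∀ i, M.X i →ₗ[A] N.X i) :
    ComplexEquiv (Cocycle.cob s).twist (directSum N M) :=
  Cocycle.twistEquivZero _ s fun _ _ _ _ => rfl

theorem Cocycle.ext_succ {φ ψ : Cocycle M N}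
    (h : ∀ i j, i + 1 = j → ∀ x, φ.f i j x = ψ.f i j x) : φ = ψ := by
  ext i j x
  by_cases hij : i + 1 = j
  · exact h i j hij x
  · rw [φ.shape i j hij, ψ.shape i j hij]

end Coboundary

/-! ### Two-term complexes -/

section TwoTerm

variable {A : Type u} [Ring A] {m : ℕ}

/-- Complexes concentrated in the degrees `a - 1` and `a`. -/
def IsTwoTerm (a : ZMod m) (T : ProjComplex A m) : Prop :=
  ∀ i, i ≠ a → i + 1 ≠ a → Subsingleton (T.X i)

/-- Two complexes concentrated in degrees `b` and `a = b + 1` are isomorphic if their differentials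
from degree `b` to degree `a` are. -/
theorem IsTwoTerm.nonempty_equiv {a b : ZMod m} (hb : b + 1 = a) (h1 : (1 : ZMod m) ≠ 0)
    (h2 : (2 : ZMod m) ≠ 0)
    {T T' : ProjComplex A m} (hT : IsTwoTerm a T) (hT' : IsTwoTerm a T')
    (eb : T.X b ≃ₗ[A] T'.X b) (ea : T.X a ≃ₗ[A] T'.X a)
    (h : ∀ x, ea (T.d b a x) = T'.d b a (eb x)) : Nonempty (ComplexEquiv T T') := by
  classical
  have hab : b ≠ a := by
    rintro rfl
    exact h1 (by simpa using hb)
  have key : ∀ i, ∃ e : T.X i ≃ₗ[A] T'.X i, (∀ hi : i = a, hi ▸ e = ea) ∧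
      (∀ hi : i = b, hi ▸ e = eb) := by
    intro i
    by_cases hia : i = a
    · subst hia
      exact ⟨ea, fun _ => rfl, fun hi => absurd hi.symm hab⟩
    by_cases hib : i = b
    · subst hib
      exact ⟨eb, fun hi => absurd hi hab, fun _ => rfl⟩
    · have hi : i + 1 ≠ a := fun h => hib (add_right_cancel (h.trans hb.symm))
      have := hT i hia hi
      have := hT' i hia hi
      exact ⟨LinearEquiv.ofSubsingleton _ _, fun hi => absurd hi hia, fun hi => absurd hi hib⟩
  choose e he he' using key
  refine ⟨⟨e, fun i j x => ?_⟩⟩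
  by_cases hij : i + 1 = j
  · by_cases hia : i = a
    · subst hia
      have h3 : j ≠ i := fun h => h1 (by rw [← hij] at h; simpa using h)
      have h4 : j + 1 ≠ i := by
        rintro h
        rw [← hij, add_assoc, one_add_one_eq_two, add_eq_left] at h
        exact h2 h
      have := hT' j h3 h4
      exact Subsingleton.elim _ _
    by_cases hib : i = b
    · subst hib
      obtain rfl : j = a := hij.symm.trans hb
      have e1 : e j = ea := he j rfl
      have e2 : e i = eb := he' i rfl
      rw [e1, e2, h]
    · have := hT i hia (fun h => hib (add_right_cancel (h.trans hb.symm)))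
      rw [Subsingleton.elim x 0]
      simp only [map_zero]
  · rw [T.d_eq_zero hij, T'.d_eq_zero hij]
    simp

/-- A complex concentrated in degrees `a - 1` and `a`, with injective differential, resolves its
homology in degree `a`. -/
structure Resolves (a : ZMod m) (T : ProjComplex A m) {X : Type u} [AddCommGroup X] [Module A X]
    (p : T.X a →ₗ[A] X) : Prop where
  twoTerm : IsTwoTerm a T
  injective : Function.Injective (T.d (a - 1) a)
  exact : ∀ x, p x = 0 ↔ ∃ y, T.d (a - 1) a y = x
  surjective : Function.Surjective p

/-- The description of the shifts of the complexes `C_f`. -/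
theorem twoTerm_shift {Q P : ProjMod A} (f : Q.obj ⟶ P.obj) (t : ℤ) (h1 : (1 : ZMod m) ≠ 0) {a b : ZMod m}
    (ha : a + (t : ZMod m) = 0) (hb : b + 1 = a) :
    IsTwoTerm a ((twoTerm f : ProjComplex A m).shift t) ∧
    ∃ (eQ : Q.obj ≃ₗ[A] ((twoTerm f : ProjComplex A m).shift t).X b)
      (eP : P.obj ≃ₗ[A] ((twoTerm f : ProjComplex A m).shift t).X a),
      ∀ x, ((twoTerm f : ProjComplex A m).shift t).d b a (eQ x) = eP (f.hom x) := by
  have hrel : (ComplexShape.up (ZMod m)).Rel ((m : ZMod m) - 1) 0 := by simp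
  have h01 : (m : ZMod m) - 1 ≠ 0 := by simpa using h1
  constructor
  · intro i hia hib
    refine ModuleCat.subsingleton_of_isZero (HomologicalComplex.isZero_double_X f hrel
      (i + (t : ZMod m)) ?_ ?_)
    · rintro h
      apply hib
      refine add_right_cancel (b := (t : ZMod m)) ?_
      rw [add_right_comm, h, ha]
      simp
    · rintro h
      exact hia (add_right_cancel (h.trans ha.symm))
  · have key : ∀ i j : ZMod m, i = (m : ZMod m) - 1 → j = 0 →
        ∃ (eQ : Q.obj ≃ₗ[A] (twoTerm f : ProjComplex A m).X i)
          (eP : P.obj ≃ₗ[A] (twoTerm f : ProjComplex A m).X j),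
          ∀ x, (twoTerm f : ProjComplex A m).d i j (eQ x) = eP (f.hom x) := by
      rintro i j rfl rfl
      refine ⟨(HomologicalComplex.doubleXIso₀ f hrel).symm.toLinearEquiv,
        (HomologicalComplex.doubleXIso₁ f hrel h01).symm.toLinearEquiv, fun x => ?_⟩
      have h := HomologicalComplex.double_d f hrel h01
      have h' : (HomologicalComplex.doubleXIso₀ f hrel).inv ≫
          (HomologicalComplex.double f hrel).d _ _ =
          f ≫ (HomologicalComplex.doubleXIso₁ f hrel h01).inv := by
        rw [h, Iso.inv_hom_id_assoc]
      exact LinearMap.congr_fun (congrArg ModuleCat.Hom.hom h') x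
    obtain ⟨eQ, eP, h⟩ := key (b + (t : ZMod m)) (a + (t : ZMod m)) (by
      rw [eq_sub_iff_add_eq, add_right_comm, hb, ha]; simp) ha
    -- The shift multiplies the differential by `(-1) ^ t`; the sign is absorbed into `eP`.
    rcases Int.even_or_odd t with ht | ht
    · refine ⟨eQ, eP, fun x => ?_⟩
      change (t.negOnePow • (twoTerm f : ProjComplex A m).obj.d _ _).hom (eQ x) = _
      rw [Int.negOnePow_even _ ht, one_smul]
      exact h x
    · have h' : ∀ x, - (twoTerm f : ProjComplex A m).d (b + (t : ZMod m)) (a + (t : ZMod m))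
          (eQ x) = eP (- f.hom x) := fun x => by rw [h, map_neg]
      refine ⟨eQ, (LinearEquiv.neg A).trans eP, fun x => Eq.trans ?_ (h' x)⟩
      change (t.negOnePow • (twoTerm f : ProjComplex A m).obj.d _ _).hom (eQ x) = _
      rw [Int.negOnePow_odd _ ht, Units.neg_smul, one_smul]
      rfl

end TwoTerm

/-! ### Homology and boundaries -/

section Homology

variable {A : Type u} [Ring A] {m : ℕ}

/-- The relation "the homology of `M` in degree `i` is `X`". -/
def HasHomology (M : ProjComplex A m) (i : ZMod m) (X : Type u) [AddCommGroup X] [Module A X] :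
    Prop :=
  ∃ p : LinearMap.ker (M.d i (i + 1)) →ₗ[A] X, Function.Surjective p ∧
    ∀ z, p z = 0 ↔ z.1 ∈ LinearMap.range (M.d (i - 1) i)

theorem exists_hasHomology [IsNoetherianRing A] (M : ProjComplex A m) (i : ZMod m) :
    ∃ X : FGModuleCat.{u} A, HasHomology M i X := by
  refine ⟨FGModuleCat.of A (LinearMap.ker (M.d i (i + 1)) ⧸
    (LinearMap.range (M.d (i - 1) i)).comap (LinearMap.ker (M.d i (i + 1))).subtype),
    Submodule.mkQ _, Submodule.mkQ_surjective _, fun z => ?_⟩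
  exact Submodule.Quotient.mk_eq_zero _

theorem HasHomology.congr_left {M N : ProjComplex A m} (e : ComplexEquiv M N) {i : ZMod m}
    {X : Type u} [AddCommGroup X] [Module A X] (h : HasHomology M i X) : HasHomology N i X := by
  obtain ⟨p, hp, hp'⟩ := h
  have hk : ∀ z : N.X i, N.d i (i + 1) z = 0 ↔ M.d i (i + 1) ((e.e i).symm z) = 0 := by
    intro z
    have := e.symm.comm i (i + 1) z
    simp only [ComplexEquiv.symm] at this
    rw [← this, LinearEquiv.map_eq_zero_iff]
  let e' : LinearMap.ker (N.d i (i + 1)) →ₗ[A] LinearMap.ker (M.d i (i + 1)) :=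
    (e.e i).symm.toLinearMap.restrict fun z hz => (hk z).1 hz
  refine ⟨p ∘ₗ e', fun x => ?_, fun z => ?_⟩
  · obtain ⟨z, rfl⟩ := hp x
    refine ⟨⟨e.e i z, (hk _).2 (by simp)⟩, ?_⟩
    rw [LinearMap.comp_apply]
    congr 1
    exact Subtype.ext ((e.e i).symm_apply_apply z.1)
  · rw [LinearMap.comp_apply, hp']
    have h1 := fun x => e.comm (i - 1) i x
    have h2 := fun x => e.symm.comm (i - 1) i x
    simp only [ComplexEquiv.symm] at h2
    constructor
    · rintro ⟨y, hy⟩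
      refine ⟨e.e (i - 1) y, ?_⟩
      rw [← h1, hy]
      exact (e.e i).apply_symm_apply z.1
    · rintro ⟨y, hy⟩
      refine ⟨(e.e (i - 1)).symm y, ?_⟩
      rw [← h2, hy]
      rfl

theorem HasHomology.congr_right {M : ProjComplex A m} {i : ZMod m} {X Y : Type u}
    [AddCommGroup X] [Module A X] [AddCommGroup Y] [Module A Y] (h : HasHomology M i X)
    (e : X ≃ₗ[A] Y) : HasHomology M i Y := by
  obtain ⟨p, hp, hp'⟩ := h
  exact ⟨e.toLinearMap ∘ₗ p, e.surjective.comp hp, fun z => by simp [hp']⟩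

theorem HasHomology.nonempty_equiv {M : ProjComplex A m} {i : ZMod m} {X Y : Type u}
    [AddCommGroup X] [Module A X] [AddCommGroup Y] [Module A Y] (h : HasHomology M i X)
    (h' : HasHomology M i Y) : Nonempty (X ≃ₗ[A] Y) := by
  obtain ⟨p, hp, hp'⟩ := h
  obtain ⟨q, hq, hq'⟩ := h'
  have hk : LinearMap.ker p = LinearMap.ker q := by
    ext z
    rw [LinearMap.mem_ker, LinearMap.mem_ker, hp', hq']
  exact ⟨(p.quotKerEquivOfSurjective hp).symm.trans ((Submodule.quotEquivOfEq _ _ hk).trans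
    (q.quotKerEquivOfSurjective hq))⟩

theorem HasHomology.directSum {N M : ProjComplex A m} {i : ZMod m} {X Y : Type u}
    [AddCommGroup X] [Module A X] [AddCommGroup Y] [Module A Y] (h : HasHomology N i X)
    (h' : HasHomology M i Y) : HasHomology (directSum N M) i (X × Y) := by
  obtain ⟨p, hp, hp'⟩ := h
  obtain ⟨q, hq, hq'⟩ := h'
  have hd : ∀ j l (z : N.X j × M.X j), (BridgelandHall.directSum N M).d j l z =
      ((N.d j l z.1, M.d j l z.2) : N.X l × M.X l) := by
    intro j l z
    rw [Cocycle.twist_d, Cocycle.zero_f, LinearMap.zero_apply, add_zero]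
  let r1 : LinearMap.ker ((BridgelandHall.directSum N M).d i (i + 1)) →ₗ[A]
      LinearMap.ker (N.d i (i + 1)) :=
    (LinearMap.fst A (N.X i) (M.X i)).restrict fun z hz => by
      have h0 := hz
      rw [LinearMap.mem_ker, hd] at h0
      exact congrArg Prod.fst h0
  let r2 : LinearMap.ker ((BridgelandHall.directSum N M).d i (i + 1)) →ₗ[A]
      LinearMap.ker (M.d i (i + 1)) :=
    (LinearMap.snd A (N.X i) (M.X i)).restrict fun z hz => by
      have h0 := hz
      rw [LinearMap.mem_ker, hd] at h0
      exact congrArg Prod.snd h0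
  refine ⟨(p ∘ₗ r1).prod (q ∘ₗ r2), ?_, ?_⟩
  · rintro ⟨x, y⟩
    obtain ⟨z, rfl⟩ := hp x
    obtain ⟨w, rfl⟩ := hq y
    refine ⟨⟨((z.1, w.1) : N.X i × M.X i), ?_⟩, rfl⟩
    rw [LinearMap.mem_ker, hd]
    exact Prod.ext z.2 w.2
  · intro z
    change ((p (r1 z), q (r2 z)) : X × Y) = 0 ↔ _
    rw [Prod.mk_eq_zero, hp', hq']
    constructor
    · rintro ⟨⟨y, hy⟩, ⟨y', hy'⟩⟩
      refine ⟨((y, y') : N.X (i - 1) × M.X (i - 1)), ?_⟩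
      rw [hd]
      exact Prod.ext hy hy'
    · rintro ⟨y, hy⟩
      rw [hd] at hy
      exact ⟨⟨y.1, congrArg Prod.fst hy⟩, ⟨y.2, congrArg Prod.snd hy⟩⟩

/-- Vanishing of the homology in degree `i`. -/
def ExactAt (M : ProjComplex A m) (i : ZMod m) : Prop :=
  ∀ x, M.d i (i + 1) x = 0 → ∃ y, M.d (i - 1) i y = x

theorem ExactAt.hasHomology {M : ProjComplex A m} {i : ZMod m} (h : ExactAt M i) :
    HasHomology M i PUnit.{u + 1} :=
  ⟨0, fun _ => ⟨0, rfl⟩, fun z => ⟨fun _ => h z.1 z.2, fun _ => rfl⟩⟩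

theorem HasHomology.exactAt {M : ProjComplex A m} {i : ZMod m} {X : Type u} [AddCommGroup X]
    [Module A X] [Subsingleton X] (h : HasHomology M i X) : ExactAt M i := by
  obtain ⟨p, -, hp⟩ := h
  exact fun x hx => (hp ⟨x, hx⟩).1 (Subsingleton.elim _ _)

theorem acyclic_iff_exactAt (M : ProjComplex A m) : M.obj.Acyclic ↔ ∀ i, ExactAt M i := by
  refine forall_congr' fun i => ?_
  rw [HomologicalComplex.exactAt_iff' _ (i - 1) i (i + 1)
    ((ComplexShape.up (ZMod m)).prev_eq' (by simp))
    ((ComplexShape.up (ZMod m)).next_eq' (by simp)), ShortComplex.moduleCat_exact_iff]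
  rfl

theorem exactAt_of_subsingleton {M : ProjComplex A m} {i : ZMod m} (h : Subsingleton (M.X i)) :
    ExactAt M i := fun _ _ => ⟨0, Subsingleton.elim _ _⟩

/-- A direct summand with vanishing homology can be ignored. -/
theorem hasHomology_directSum_iff {N K : ProjComplex A m} [IsNoetherianRing A] {i : ZMod m}
    (hK : ExactAt K i) {X : Type u} [AddCommGroup X] [Module A X] :
    HasHomology (directSum N K) i X ↔ HasHomology N i X := by
  have h0 : ∀ (Y : Type u) [AddCommGroup Y] [Module A Y], HasHomology N i Y →
      HasHomology (directSum N K) i Y := fun Y _ _ h =>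
    (h.directSum hK.hasHomology).congr_right LinearEquiv.prodUnique
  refine ⟨fun h => ?_, h0 X⟩
  obtain ⟨H, hH⟩ := exists_hasHomology N i
  obtain ⟨e⟩ := (h0 _ hH).nonempty_equiv h
  exact hH.congr_right e

section Beta

/-- The class in the Grothendieck group of the boundaries in degree `i`. -/
noncomputable def beta (M : ProjComplex A m) (i : ZMod m) : K0 A :=
  cl A (LinearMap.range (M.d (i - 1) i))

theorem cl_congr_of_eq {X : Type u} [AddCommGroup X] [Module A X] {S S' : Submodule A X}
    [Module.Finite A S] [Module.Finite A S'] (h : S = S') : cl A S = cl A S' :=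
  cl_congr (LinearEquiv.ofEq _ _ h)

theorem beta_eq (M : ProjComplex A m) {i j : ZMod m} (h : j + 1 = i) :
    beta M i = cl A (LinearMap.range (M.d j i)) := by
  obtain rfl : j = i - 1 := eq_sub_of_add_eq h
  rfl

theorem cl_range_congr {X Y X' Y' : Type u} [AddCommGroup X] [Module A X] [Module.Finite A X]
    [AddCommGroup Y] [Module A Y] [Module.Finite A Y] [AddCommGroup X'] [Module A X']
    [Module.Finite A X'] [AddCommGroup Y'] [Module A Y'] [Module.Finite A Y'] (f : X →ₗ[A] Y)
    (f' : X' →ₗ[A] Y') (e : X ≃ₗ[A] X') (e' : Y ≃ₗ[A] Y') (h : ∀ x, e' (f x) = f' (e x)) :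
    cl A (LinearMap.range f) = cl A (LinearMap.range f') := by
  have : LinearMap.range f' = (LinearMap.range f).map e'.toLinearMap := by
    ext y
    constructor
    · rintro ⟨x, rfl⟩
      exact ⟨f (e.symm x), ⟨_, rfl⟩, by simp [h]⟩
    · rintro ⟨_, ⟨x, rfl⟩, rfl⟩
      exact ⟨e x, (h x).symm⟩
  exact cl_congr ((e'.submoduleMap _).trans (LinearEquiv.ofEq _ _ this.symm))

theorem beta_congr {M N : ProjComplex A m} (e : ComplexEquiv M N) (i : ZMod m) :
    beta M i = beta N i :=
  cl_range_congr _ _ (e.e (i - 1)) (e.e i) (e.comm (i - 1) i)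

theorem cl_ker_add_range [IsNoetherianRing A] {X Y : Type u} [AddCommGroup X] [Module A X] [Module.Finite A X]
    [AddCommGroup Y] [Module A Y] [Module.Finite A Y] (f : X →ₗ[A] Y) :
    cl A X = cl A (LinearMap.ker f) + cl A (LinearMap.range f) :=
  cl_of_exact (LinearMap.ker f).subtype f.rangeRestrict Subtype.val_injective
    f.surjective_rangeRestrict (LinearMap.exact_iff.2 (by simp))

theorem beta_directSum (N M : ProjComplex A m) (i : ZMod m) :
    beta (directSum N M) i = beta N i + beta M i := by
  have hd : ∀ z : N.X (i - 1) × M.X (i - 1), (directSum N M).d (i - 1) i z =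
      ((N.d (i - 1) i z.1, M.d (i - 1) i z.2) : N.X i × M.X i) := by
    intro z
    rw [Cocycle.twist_d, Cocycle.zero_f, LinearMap.zero_apply, add_zero]
  refine cl_of_exact ((LinearMap.inl A (N.X i) (M.X i)).restrict ?_)
    ((LinearMap.snd A (N.X i) (M.X i)).restrict ?_) ?_ ?_ ?_
  · rintro _ ⟨y, rfl⟩
    exact ⟨((y, 0) : N.X (i - 1) × M.X (i - 1)), by rw [hd, map_zero]; rfl⟩
  · rintro _ ⟨y, rfl⟩
    rw [hd]
    exact ⟨y.2, rfl⟩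
  · intro x y h
    exact Subtype.ext (congrArg Prod.fst (congrArg Subtype.val h))
  · rintro ⟨_, ⟨y, rfl⟩⟩
    exact ⟨⟨_, ⟨((0, y) : N.X (i - 1) × M.X (i - 1)), rfl⟩⟩, Subtype.ext (by
      change ((directSum N M).d (i - 1) i ((0, y) : N.X (i - 1) × M.X (i - 1))).2 = _
      rw [hd])⟩
  · rintro ⟨_, ⟨y, rfl⟩⟩
    rw [Subtype.ext_iff]
    change ((directSum N M).d (i - 1) i y).2 = 0 ↔ _
    constructor
    · intro h
      refine ⟨⟨N.d (i - 1) i y.1, ⟨y.1, rfl⟩⟩, Subtype.ext (Prod.ext ?_ h.symm)⟩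
      change N.d (i - 1) i y.1 = ((directSum N M).d (i - 1) i y).1
      rw [hd]
    · rintro ⟨w, hw⟩
      exact (congrArg (fun z => (Subtype.val z).2) hw).symm

/-- The class of the homology of `M` in degree `i`. -/
noncomputable def hcl (M : ProjComplex A m) (i : ZMod m) : K0 A :=
  M.cls i - beta M i - beta M (i + 1)

theorem HasHomology.hcl_eq [IsNoetherianRing A] {M : ProjComplex A m} {i : ZMod m} {X : Type u}
    [AddCommGroup X] [Module A X] [Module.Finite A X] (h : HasHomology M i X) :
    hcl M i = cl A X := by
  obtain ⟨p, hp, hp'⟩ := h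
  have h1 : LinearMap.range (M.d (i - 1) i) ≤ LinearMap.ker (M.d i (i + 1)) := by
    rintro _ ⟨y, rfl⟩
    exact M.d_d _ _ _ y
  have h2 := cl_ker_add_range (M.d i (i + 1))
  have h3 : cl A (LinearMap.ker (M.d i (i + 1))) =
      cl A (LinearMap.range (M.d (i - 1) i)) + cl A X :=
    cl_of_exact (Submodule.inclusion h1) p (Submodule.inclusion_injective h1) hp fun z => by
      rw [hp']
      constructor
      · intro hz
        exact ⟨⟨z.1, hz⟩, rfl⟩
      · rintro ⟨y, rfl⟩
        exact y.2
  rw [hcl, beta_eq M (i := i + 1) rfl, ProjComplex.cls, h2, h3, beta]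
  abel

end Beta

end Homology

/-! ### Splitting off two-term complexes -/

set_option linter.unusedSectionVars false

section Peel

variable {A : Type u} [Ring A] {m : ℕ}

instance projective_submodule [IsHereditaryRing A] {P : Type u} [AddCommGroup P] [Module A P]
    [Module.Finite A P] [Module.Projective A P] (S : Submodule A P) : Module.Projective A S := by
  obtain ⟨n, i, hi⟩ := Module.Finite.exists_fin' A P
  obtain ⟨s, hs⟩ := Module.projective_lifting_property i LinearMap.id hi
  have hs' : Function.LeftInverse i s := fun x => LinearMap.congr_fun hs x
  exact projective_of_embeds n (s ∘ₗ S.subtype) (hs'.injective.comp Subtype.val_injective)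

theorem exists_isCompl_ker [IsHereditaryRing A] {P P' : Type u} [AddCommGroup P] [Module A P]
    [AddCommGroup P'] [Module A P'] [Module.Finite A P'] [Module.Projective A P']
    (f : P →ₗ[A] P') : ∃ C : Submodule A P, IsCompl (LinearMap.ker f) C := by
  obtain ⟨s, hs⟩ := Module.projective_lifting_property f.rangeRestrict LinearMap.id
    f.surjective_rangeRestrict
  have hs' : ∀ y, f (s y) = y := fun y => congrArg Subtype.val (LinearMap.congr_fun hs y)
  refine ⟨LinearMap.range s, ?_, ?_⟩
  · rw [Submodule.disjoint_def]
    rintro _ hx ⟨y, rfl⟩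
    rw [LinearMap.mem_ker, hs', ZeroMemClass.coe_eq_zero] at hx
    rw [hx, map_zero]
  · rw [codisjoint_iff, eq_top_iff]
    rintro x -
    refine Submodule.mem_sup.2 ⟨x - s (f.rangeRestrict x), ?_, s (f.rangeRestrict x), ⟨_, rfl⟩,
      sub_add_cancel _ _⟩
    rw [LinearMap.mem_ker, map_sub, hs', sub_eq_zero]
    rfl

/-- The cycles in degree `i`. -/
abbrev ProjComplex.cyc (M : ProjComplex A m) (i : ZMod m) : Submodule A (M.X i) :=
  LinearMap.ker (M.d i (i + 1))

theorem ProjComplex.mem_cyc (M : ProjComplex A m) {i j : ZMod m} (h : i + 1 = j) {x : M.X i} :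
    x ∈ M.cyc i ↔ M.d i j x = 0 := by
  subst h; rfl

theorem ProjComplex.d_of_mem_cyc (M : ProjComplex A m) {i : ZMod m} {x : M.X i} (hx : x ∈ M.cyc i)
    (j : ZMod m) : M.d i j x = 0 := by
  by_cases h : i + 1 = j
  · exact (M.mem_cyc h).1 hx
  · rw [M.d_eq_zero h]; rfl

theorem ProjComplex.d_mem_cyc (M : ProjComplex A m) {i j : ZMod m} (x : M.X i) :
    M.d i j x ∈ M.cyc j := M.d_d i j (j + 1) x

variable [IsNoetherianRing A] [IsHereditaryRing A]

/-- The subcomplex given by submodules that are stable under the differential. -/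
noncomputable abbrev ProjComplex.sub (M : ProjComplex A m) (S : ∀ i, Submodule A (M.X i))
    (hS : ∀ i j, ∀ x ∈ S i, M.d i j x ∈ S j) : ProjComplex A m :=
  ProjComplex.ofLinear (fun i => S i) (fun i j => (M.d i j).restrict (hS i j))
    (fun i j h => by
      ext x
      change M.d i j x = 0
      rw [M.d_eq_zero h]; rfl)
    (fun i j l x => Subtype.ext (M.d_d i j l x))
    M.supp (fun i hi => by
      have := M.subsingleton_of_notMem_supp hi
      infer_instance)

/-- A complex is the direct sum of degreewise complementary subcomplexes. -/
noncomputable def subSumEquiv (M : ProjComplex A m) {S T : ∀ i, Submodule A (M.X i)}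
    (hS : ∀ i j, ∀ x ∈ S i, M.d i j x ∈ S j) (hT : ∀ i j, ∀ x ∈ T i, M.d i j x ∈ T j)
    (h : ∀ i, IsCompl (S i) (T i)) : ComplexEquiv (directSum (M.sub S hS) (M.sub T hT)) M where
  e i := Submodule.prodEquivOfIsCompl _ _ (h i)
  comm i j x := by
    change (M.d i j x.1.1 + ((0 : Cocycle (M.sub T hT) (M.sub S hS)).f i j x.2).1) +
      M.d i j x.2.1 = M.d i j (x.1.1 + x.2.1)
    simp

/-- Every complex is the direct sum of a subcomplex `S` which is exact in degree `a` and a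
subcomplex `T` concentrated in the degrees `a - 1` and `a`, with injective differential. -/
theorem exists_peel (M : ProjComplex A m) (a : ZMod m) (h1 : (1 : ZMod m) ≠ 0) :
    ∃ S T : ∀ i, Submodule A (M.X i), (∀ i j, ∀ x ∈ S i, M.d i j x ∈ S j) ∧
      (∀ i j, ∀ x ∈ T i, M.d i j x ∈ T j) ∧ (∀ i, IsCompl (S i) (T i)) ∧
      T a = M.cyc a ∧ S (a - 1) = M.cyc (a - 1) ∧ Disjoint (S a) (M.cyc a) ∧
      Disjoint (T (a - 1)) (M.cyc (a - 1)) ∧ (∀ i, i ≠ a → i + 1 ≠ a → T i = ⊥) := by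
  classical
  choose C hC using fun i => exists_isCompl_ker (M.d i (i + 1))
  have hne : ∀ i : ZMod m, i + 1 = a → i ≠ a := by
    rintro i hi rfl
    exact h1 (by simpa using hi)
  have ha : a - 1 + 1 = a := sub_add_cancel a 1
  have ha' : a - 1 ≠ a := hne _ ha
  -- Complements `C i` of the cycles exist, since the boundaries are projective.
  refine ⟨fun i => if i = a then C i else if i + 1 = a then M.cyc i else ⊤,
    fun i => if i = a then M.cyc i else if i + 1 = a then C i else ⊥, ?_, ?_, ?_, ?_, ?_, ?_, ?_, ?_⟩
  · intro i j x hx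
    beta_reduce at hx ⊢
    by_cases hij : i + 1 = j
    · by_cases hj : j = a
      · have hia : i + 1 = a := hij.trans hj
        rw [if_neg (hne i hia), if_pos hia] at hx
        rw [M.d_of_mem_cyc hx]
        exact zero_mem _
      · rw [if_neg hj]
        split_ifs
        · exact M.d_mem_cyc x
        · trivial
    · rw [M.d_eq_zero hij]
      exact zero_mem _
  · intro i j x hx
    beta_reduce at hx ⊢
    by_cases hia : i = a
    · rw [if_pos hia] at hx
      rw [M.d_of_mem_cyc hx]
      exact zero_mem _
    by_cases hib : i + 1 = a
    · by_cases hj : j = a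
      · rw [if_pos hj]
        exact M.d_mem_cyc x
      · rw [M.d_eq_zero (fun h => hj (h.symm.trans hib))]
        exact zero_mem _
    · rw [if_neg hia, if_neg hib, Submodule.mem_bot] at hx
      rw [hx, map_zero]
      exact zero_mem _
  · intro i
    by_cases hia : i = a
    · simp only [if_pos hia]
      exact (hC i).symm
    by_cases hib : i + 1 = a
    · simp only [if_neg hia, if_pos hib]
      exact hC i
    · simp only [if_neg hia, if_neg hib]
      exact isCompl_top_bot
  · simp
  · simp [ha']
  · simp only [if_true]
    exact (hC a).disjoint.symm
  · simp only [if_neg ha', if_pos ha]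
    exact (hC (a - 1)).disjoint.symm
  · intro i hia hib
    simp only [if_neg hia, if_neg hib]

end Peel

/-! ### Dimensions -/

section Dimension

variable {A : Type u} [Ring A] (k : Type v) [Field k] [Algebra k A] [Module.Finite k A]
  [IsHereditaryRing A]

theorem dimK_le_of_injective [IsNoetherianRing A] {X Y : Type u} [AddCommGroup X] [Module A X]
    [Module.Finite A X] [AddCommGroup Y] [Module A Y] [Module.Finite A Y] (f : X →ₗ[A] Y)
    (hf : Function.Injective f) : dimK A k (cl A X) ≤ dimK A k (cl A Y) := by
  rw [cl_of_exact f (LinearMap.range f).mkQ hf (Submodule.mkQ_surjective _)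
    (LinearMap.exact_iff.2 (by simp)), map_add]
  exact le_add_of_nonneg_right (dimK_nonneg k _)

theorem dimK_lt_of_injective [IsNoetherianRing A] {X Y : Type u} [AddCommGroup X] [Module A X]
    [Module.Finite A X] [AddCommGroup Y] [Module A Y] [Module.Finite A Y] (f : X →ₗ[A] Y)
    (hf : Function.Injective f) (hf' : ¬ Function.Surjective f) :
    dimK A k (cl A X) < dimK A k (cl A Y) := by
  rw [cl_of_exact f (LinearMap.range f).mkQ hf (Submodule.mkQ_surjective _)
    (LinearMap.exact_iff.2 (by simp)), map_add]
  have : Nontrivial (Y ⧸ LinearMap.range f) :=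
    Submodule.Quotient.nontrivial_iff.2 (fun h => hf' (LinearMap.range_eq_top.1 h))
  exact lt_add_of_pos_right _ (dimK_pos k _)

variable {m : ℕ}

/-- The total dimension of a complex. -/
noncomputable def tdim (M : ProjComplex A m) : ℤ := ∑ᶠ i, dimK A k (M.cls i)

/-- The total dimension of the homology of a complex. -/
noncomputable def hdim (M : ProjComplex A m) : ℤ := ∑ᶠ i, dimK A k (hcl M i)

theorem ProjComplex.cls_congr {M N : ProjComplex A m} (e : ComplexEquiv M N) (i : ZMod m) :
    M.cls i = N.cls i := cl_congr (e.e i)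

theorem hcl_congr {M N : ProjComplex A m} (e : ComplexEquiv M N) (i : ZMod m) :
    hcl M i = hcl N i := by
  rw [hcl, hcl, ProjComplex.cls_congr e, beta_congr e, beta_congr e]

theorem tdim_congr {M N : ProjComplex A m} (e : ComplexEquiv M N) : tdim k M = tdim k N :=
  finsum_congr fun i => by rw [ProjComplex.cls_congr e]

theorem hdim_congr {M N : ProjComplex A m} (e : ComplexEquiv M N) : hdim k M = hdim k N :=
  finsum_congr fun i => by rw [hcl_congr e]

theorem beta_eq_zero_left (M : ProjComplex A m) {i : ZMod m} (h : Subsingleton (M.X i)) :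
    beta M i = 0 := cl_of_subsingleton A _

theorem beta_eq_zero_right (M : ProjComplex A m) {i : ZMod m} (h : Subsingleton (M.X i)) :
    beta M (i + 1) = 0 := by
  rw [beta_eq M (i := i + 1) rfl]
  have : Subsingleton (LinearMap.range (M.d i (i + 1))) := by
    refine ⟨?_⟩
    rintro ⟨_, x, rfl⟩ ⟨_, y, rfl⟩
    rw [Subsingleton.elim x y]
  exact cl_of_subsingleton A _

theorem hcl_eq_zero (M : ProjComplex A m) {i : ZMod m} (h : i ∉ M.supp) : hcl M i = 0 := by
  have h' := M.subsingleton_of_notMem_supp h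
  rw [hcl, M.cls_eq_zero h, beta_eq_zero_left M h', beta_eq_zero_right M h']
  simp

theorem tdim_eq_sum (M : ProjComplex A m) {s : Finset (ZMod m)} (hs : M.supp ⊆ s) :
    tdim k M = ∑ i ∈ s, dimK A k (M.cls i) := by
  refine finsum_eq_sum_of_support_subset _ fun i hi => hs ?_
  by_contra h
  exact hi (by simp [M.cls_eq_zero h])

theorem hdim_eq_sum (M : ProjComplex A m) {s : Finset (ZMod m)} (hs : M.supp ⊆ s) :
    hdim k M = ∑ i ∈ s, dimK A k (hcl M i) := by
  refine finsum_eq_sum_of_support_subset _ fun i hi => hs ?_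
  by_contra h
  exact hi (by simp [hcl_eq_zero M h])

theorem dimK_hcl_nonneg [IsNoetherianRing A] (M : ProjComplex A m) (i : ZMod m) :
    0 ≤ dimK A k (hcl M i) := by
  obtain ⟨X, hX⟩ := exists_hasHomology M i
  rw [hX.hcl_eq]
  exact dimK_nonneg k _

theorem hdim_nonneg [IsNoetherianRing A] (M : ProjComplex A m) : 0 ≤ hdim k M := by
  rw [hdim_eq_sum k M subset_rfl]
  exact Finset.sum_nonneg fun i _ => dimK_hcl_nonneg k M i

theorem tdim_nonneg (M : ProjComplex A m) : 0 ≤ tdim k M := by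
  rw [tdim_eq_sum k M subset_rfl]
  exact Finset.sum_nonneg fun i _ => dimK_nonneg k _

theorem supp_twist_subset {M N : ProjComplex A m} (φ : Cocycle M N) :
    φ.twist.supp ⊆ M.supp ∪ N.supp := by
  intro i hi
  by_contra h
  have h1 := M.subsingleton_of_notMem_supp (fun h' => h (Finset.mem_union_left _ h'))
  have h2 := N.subsingleton_of_notMem_supp (fun h' => h (Finset.mem_union_right _ h'))
  exact ((Set.Finite.mem_toFinset _).1 hi) (inferInstanceAs (Subsingleton (N.X i × M.X i)))

theorem tdim_twist {M N : ProjComplex A m} (φ : Cocycle M N) :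
    tdim k φ.twist = tdim k M + tdim k N := by
  rw [tdim_eq_sum k _ (supp_twist_subset φ), tdim_eq_sum k M Finset.subset_union_left,
    tdim_eq_sum k N Finset.subset_union_right, ← Finset.sum_add_distrib]
  exact Finset.sum_congr rfl fun i _ => by rw [Cocycle.twist_cls, map_add, add_comm]

theorem hdim_directSum (N M : ProjComplex A m) :
    hdim k (directSum N M) = hdim k N + hdim k M := by
  rw [hdim_eq_sum k _ (supp_twist_subset _), hdim_eq_sum k M Finset.subset_union_left,
    hdim_eq_sum k N Finset.subset_union_right, ← Finset.sum_add_distrib]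
  refine Finset.sum_congr rfl fun i _ => ?_
  rw [← map_add, hcl, hcl, hcl, Cocycle.twist_cls, beta_directSum, beta_directSum]
  congr 1
  abel

section

variable [IsNoetherianRing A]

/-- The boundaries of a twisted direct sum: kernel and image of the projection to the boundaries of
the quotient complex. -/
theorem beta_twist {M N : ProjComplex A m} (φ : Cocycle M N) {i j : ZMod m} (h : i + 1 = j) :
    ∃ (K : Submodule A (LinearMap.range (φ.twist.d i j)))
      (f : LinearMap.range (N.d i j) →ₗ[A] K),
      Function.Injective f ∧ beta φ.twist j = cl A K + beta M j ∧
      ∀ z, M.d i j z = 0 → φ.f i j z ∉ LinearMap.range (N.d i j) → ¬ Function.Surjective f := by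
  let π : LinearMap.range (φ.twist.d i j) →ₗ[A] M.X j :=
    LinearMap.snd A (N.X j) (M.X j) ∘ₗ (LinearMap.range (φ.twist.d i j)).subtype
  have hrange : LinearMap.range π = LinearMap.range (M.d i j) := by
    ext y
    constructor
    · rintro ⟨⟨_, x, rfl⟩, rfl⟩
      exact ⟨x.2, rfl⟩
    · rintro ⟨x, rfl⟩
      exact ⟨⟨_, ((0, x) : N.X i × M.X i), rfl⟩, rfl⟩
  let f : LinearMap.range (N.d i j) →ₗ[A] LinearMap.ker π :=
    LinearMap.codRestrict _ (LinearMap.codRestrict _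
      (LinearMap.inl A (N.X j) (M.X j) ∘ₗ (LinearMap.range (N.d i j)).subtype) (by
        rintro ⟨_, x, rfl⟩
        refine ⟨((x, 0) : N.X i × M.X i), ?_⟩
        rw [Cocycle.twist_d]
        simp
        rfl)) (fun x => rfl)
  refine ⟨LinearMap.ker π, f, ?_, ?_, ?_⟩
  · intro x y hxy
    have := congrArg (fun w : LinearMap.ker π => (w.1.1 : N.X j × M.X j).1) hxy
    exact Subtype.ext this
  · rw [beta_eq _ h, beta_eq _ h, cl_ker_add_range π, cl_congr_of_eq hrange]
  · intro z hz hz' hf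
    have hmem : ((φ.f i j z, 0) : N.X j × M.X j) ∈ LinearMap.range (φ.twist.d i j) := by
      refine ⟨((0, z) : N.X i × M.X i), ?_⟩
      rw [Cocycle.twist_d]
      simp [hz]
    obtain ⟨y, hy⟩ := hf ⟨⟨_, hmem⟩, rfl⟩
    have := congrArg (fun w : LinearMap.ker π => (w.1.1 : N.X j × M.X j).1) hy
    change y.1 = φ.f i j z at this
    exact hz' (this ▸ y.2)

theorem dimK_beta_twist_le {M N : ProjComplex A m} (φ : Cocycle M N) (j : ZMod m) :
    dimK A k (beta M j) + dimK A k (beta N j) ≤ dimK A k (beta φ.twist j) := by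
  obtain ⟨K, f, hf, h, -⟩ := beta_twist φ (i := j - 1) (j := j) (by simp)
  rw [h, map_add, add_comm]
  gcongr
  exact dimK_le_of_injective k f hf

theorem dimK_beta_twist_lt {M N : ProjComplex A m} (φ : Cocycle M N) {i j : ZMod m} (h : i + 1 = j)
    (z : M.X i) (hz : M.d i j z = 0) (hz' : φ.f i j z ∉ LinearMap.range (N.d i j)) :
    dimK A k (beta M j) + dimK A k (beta N j) < dimK A k (beta φ.twist j) := by
  obtain ⟨K, f, hf, h', hs⟩ := beta_twist φ h
  rw [h', map_add, add_comm, add_lt_add_iff_right, beta_eq N h]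
  exact dimK_lt_of_injective k f hf (hs z hz hz')

theorem dimK_hcl_twist_le {M N : ProjComplex A m} (φ : Cocycle M N) (i : ZMod m) :
    dimK A k (hcl φ.twist i) ≤ dimK A k (hcl M i) + dimK A k (hcl N i) := by
  have h1 := dimK_beta_twist_le k φ i
  have h2 := dimK_beta_twist_le k φ (i + 1)
  simp only [hcl, map_sub, Cocycle.twist_cls, map_add]
  linarith

theorem hdim_twist_le {M N : ProjComplex A m} (φ : Cocycle M N) :
    hdim k φ.twist ≤ hdim k M + hdim k N := by
  rw [hdim_eq_sum k _ (supp_twist_subset φ), hdim_eq_sum k M Finset.subset_union_left,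
    hdim_eq_sum k N Finset.subset_union_right, ← Finset.sum_add_distrib]
  exact Finset.sum_le_sum fun i _ => dimK_hcl_twist_le k φ i

/-- If a connecting homomorphism of an extension of complexes is nonzero, the homology of the
middle term is smaller than the homology of the outer terms. -/
theorem hdim_twist_lt {M N : ProjComplex A m} (φ : Cocycle M N) {i j : ZMod m} (h : i + 1 = j)
    (z : M.X i) (hz : M.d i j z = 0) (hz' : φ.f i j z ∉ LinearMap.range (N.d i j)) :
    hdim k φ.twist < hdim k M + hdim k N := by
  rw [hdim_eq_sum k _ (supp_twist_subset φ), hdim_eq_sum k M Finset.subset_union_left,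
    hdim_eq_sum k N Finset.subset_union_right, ← Finset.sum_add_distrib]
  refine Finset.sum_lt_sum (fun i _ => dimK_hcl_twist_le k φ i) ⟨j, ?_, ?_⟩
  · refine Finset.mem_union_right _ ?_
    by_contra hj
    have := N.subsingleton_of_notMem_supp hj
    exact hz' (by rw [Subsingleton.elim (φ.f i j z) 0]; exact zero_mem _)
  · have h1 := dimK_beta_twist_lt k φ h z hz hz'
    have h2 := dimK_beta_twist_le k φ (j + 1)
    simp only [hcl, map_sub, Cocycle.twist_cls, map_add]
    linarith

end

omit [IsHereditaryRing A] in
theorem exists_comp_eq_of_range_le {P X Y : Type*} [AddCommGroup P] [Module A P]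
    [Module.Projective A P] [AddCommGroup X] [Module A X] [AddCommGroup Y] [Module A Y]
    (f : X →ₗ[A] Y) (g : P →ₗ[A] Y) (h : ∀ x, ∃ y, f y = g x) : ∃ s : P →ₗ[A] X, ∀ x, f (s x) = g x := by
  obtain ⟨s, hs⟩ := Module.projective_lifting_property f.rangeRestrict
    (LinearMap.codRestrict (LinearMap.range f) g h) f.surjective_rangeRestrict
  exact ⟨s, fun x => congrArg Subtype.val (LinearMap.congr_fun hs x)⟩

/-- An extension of a two-term complex in degrees `a - 1`, `a` by a complex which is exact in
degree `a` either splits or has smaller homology than its ends. -/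
theorem cob_or_hdim_lt [IsNoetherianRing A] {a : ZMod m} (h1 : (1 : ZMod m) ≠ 0)
    (h2 : (2 : ZMod m) ≠ 0) {T N : ProjComplex A m} (hT : IsTwoTerm a T) (hN : ExactAt N a)
    (φ : Cocycle T N) :
    (∃ s, φ = Cocycle.cob s) ∨ hdim k φ.twist < hdim k T + hdim k N := by
  classical
  have hT1 : Subsingleton (T.X (a + 1)) := hT _ (by simpa using h1) (by
    rw [add_assoc, one_add_one_eq_two]
    simpa using h2)
  by_cases hz : ∀ z : T.X a, ∃ y, N.d a (a + 1) y = φ.f a (a + 1) z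
  · left
    have hb : a - 1 + 1 = a := sub_add_cancel a 1
    have hba : a - 1 ≠ a := by simpa using h1
    -- The homotopy is built from the top degree downwards, using that the modules are projective.
    obtain ⟨sa, hsa⟩ := exists_comp_eq_of_range_le (N.d a (a + 1)) (φ.f a (a + 1)) hz
    obtain ⟨sb, hsb⟩ := exists_comp_eq_of_range_le (N.d (a - 1) a)
      (φ.f (a - 1) a + sa ∘ₗ T.d (a - 1) a) (fun x => hN _ (by
        rw [LinearMap.add_apply, map_add, LinearMap.comp_apply, hsa]
        exact φ.cond (a - 1) a (a + 1) x))
    refine ⟨Function.update (Function.update 0 (a - 1) sb) a sa, Cocycle.ext_succ fun i j h x => ?_⟩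
    rw [Cocycle.cob_f]
    by_cases hia : i = a
    · subst hia
      obtain rfl : i + 1 = j := h
      rw [Function.update_self, hsa, Subsingleton.elim (T.d i (i + 1) x) 0, map_zero, sub_zero]
    by_cases hib : i = a - 1
    · subst hib
      obtain rfl : j = a := h.symm.trans hb
      rw [Function.update_self, Function.update_of_ne hba, Function.update_self, hsb]
      simp
    · have := hT i hia (fun h => hib (eq_sub_of_add_eq h))
      rw [Subsingleton.elim x 0]
      simp
  · right
    push Not at hz
    obtain ⟨z, hz⟩ := hz
    -- A cycle `z` whose image is not a boundary is lost in the homology of the extension.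
    refine hdim_twist_lt k φ rfl z (Subsingleton.elim _ _) ?_
    rintro ⟨y, hy⟩
    exact hz y hy

end Dimension

/-! ### Projective modules are determined by their classes -/

section ProjectiveClasses

variable {A : Type u} [Ring A]

set_option linter.unusedSectionVars false

/-- A linear map is the same as a surjection onto a submodule of the target. -/
noncomputable def homEquivSigmaSurjective (P X : Type u) [AddCommGroup P] [Module A P]
    [AddCommGroup X] [Module A X] : (P →ₗ[A] X) ≃
      Σ S : Submodule A X, {g : P →ₗ[A] S // Function.Surjective g} where
  toFun f := ⟨LinearMap.range f, f.rangeRestrict, f.surjective_rangeRestrict⟩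
  invFun q := q.1.subtype ∘ₗ q.2.1
  left_inv f := rfl
  right_inv q := by
    obtain ⟨S, g, hg⟩ := q
    have hS : LinearMap.range (S.subtype ∘ₗ g) = S := by
      rw [LinearMap.range_comp, LinearMap.range_eq_top.2 hg, Submodule.map_top,
        Submodule.range_subtype]
    have : ∀ (S' : Submodule A X) (_ : S' = S) (g' : P →ₗ[A] S')
        (hg' : Function.Surjective g'), (∀ x, (g' x : X) = g x) →
        (⟨S', g', hg'⟩ : Σ S : Submodule A X, {g : P →ₗ[A] S // Function.Surjective g}) =
          ⟨S, g, hg⟩ := by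
      rintro S' rfl g' hg' h
      obtain rfl : g' = g := LinearMap.ext fun x => Subtype.ext (h x)
      rfl
    exact this _ hS _ (LinearMap.surjective_rangeRestrict _) fun x => rfl

/-- Modules with the same numbers of homomorphisms to every module have the same numbers of
surjections: a homomorphism is a surjection onto its image, so that one can argue by induction on
the cardinality of the target. -/
theorem card_surjective_eq [Finite A] {P P' : Type u} [AddCommGroup P] [Module A P]
    [Module.Finite A P] [AddCommGroup P'] [Module A P'] [Module.Finite A P']
    (h : ∀ (X : Type u) [AddCommGroup X] [Module A X] [Module.Finite A X],
      Nat.card (P →ₗ[A] X) = Nat.card (P' →ₗ[A] X)) (n : ℕ) :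
    ∀ (X : Type u) [AddCommGroup X] [Module A X] [Module.Finite A X], Nat.card X = n →
      Nat.card {g : P →ₗ[A] X // Function.Surjective g} =
        Nat.card {g : P' →ₗ[A] X // Function.Surjective g} := by
  classical
  induction n using Nat.strong_induction_on with
  | _ n ih =>
    intro X _ _ _ hX
    have hXf : Finite X := Module.finite_of_finite A
    have hPf : Finite P := Module.finite_of_finite A
    have hPf' : Finite P' := Module.finite_of_finite A
    have (Y : Type u) [AddCommGroup Y] [Module A Y] [Finite Y] : Finite (P →ₗ[A] Y) :=
      Finite.of_injective _ DFunLike.coe_injective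
    have (Y : Type u) [AddCommGroup Y] [Module A Y] [Finite Y] : Finite (P' →ₗ[A] Y) :=
      Finite.of_injective _ DFunLike.coe_injective
    have : Finite (Submodule A X) := Finite.of_injective _ SetLike.coe_injective
    have := Fintype.ofFinite (Submodule A X)
    have h0 := h X
    rw [Nat.card_congr (homEquivSigmaSurjective P X), Nat.card_congr (homEquivSigmaSurjective P' X),
      Nat.card_sigma, Nat.card_sigma, ← Finset.add_sum_erase _ _ (Finset.mem_univ ⊤),
      ← Finset.add_sum_erase _ _ (Finset.mem_univ ⊤)] at h0
    have h1 : ∀ S ∈ Finset.univ.erase (⊤ : Submodule A X),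
        Nat.card {g : P →ₗ[A] S // Function.Surjective g} =
        Nat.card {g : P' →ₗ[A] S // Function.Surjective g} := by
      intro S hS
      refine ih (Nat.card S) ?_ S rfl
      rw [← hX]
      refine lt_of_le_of_ne (Nat.card_le_card_of_injective _ Subtype.val_injective) fun h => ?_
      refine (Finset.mem_erase.1 hS).1 ?_
      have hb := (Nat.bijective_iff_injective_and_card (Subtype.val : S → X)).2
        ⟨Subtype.val_injective, h⟩
      exact eq_top_iff.2 fun x _ => by
        obtain ⟨y, rfl⟩ := hb.2 x
        exact y.2
    rw [Finset.sum_congr rfl h1, Nat.add_right_cancel_iff] at h0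
    have h2 : ∀ (R : Type u) [AddCommGroup R] [Module A R],
        Nat.card {g : R →ₗ[A] (⊤ : Submodule A X) // Function.Surjective g} =
        Nat.card {g : R →ₗ[A] X // Function.Surjective g} := fun R _ _ =>
      Nat.card_congr
        { toFun := fun g => ⟨Submodule.topEquiv.toLinearMap ∘ₗ g.1,
            (Submodule.topEquiv (R := A) (M := X)).surjective.comp g.2⟩
          invFun := fun g => ⟨Submodule.topEquiv.symm.toLinearMap ∘ₗ g.1,
            (Submodule.topEquiv (R := A) (M := X)).symm.surjective.comp g.2⟩
          left_inv := fun g => rfl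
          right_inv := fun g => rfl }
    rwa [h2, h2] at h0

/-- Finitely generated projective modules over a finite hereditary algebra with the same class in
the Grothendieck group are isomorphic: both receive the same number of surjections from either,
since the number of homomorphisms to a module is read off from the Euler form. -/
theorem nonempty_equiv_of_cl_eq (k : Type v) [Field k] [Algebra k A] [Module.Finite k A]
    [IsHereditaryRing A] [Finite k] [Finite A] {P P' : Type u} [AddCommGroup P] [Module A P]
    [Module.Finite A P] [Module.Projective A P] [AddCommGroup P'] [Module A P']
    [Module.Finite A P'] [Module.Projective A P'] (h : cl A P = cl A P') :
    Nonempty (P ≃ₗ[A] P') := by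
  have hPf : Finite P := Module.finite_of_finite A
  have hPf' : Finite P' := Module.finite_of_finite A
  have (X Y : Type u) [AddCommGroup X] [Module A X] [Finite X] [AddCommGroup Y] [Module A Y]
      [Finite Y] : Finite (X →ₗ[A] Y) := Finite.of_injective _ DFunLike.coe_injective
  have h1 : ∀ (X : Type u) [AddCommGroup X] [Module A X] [Module.Finite A X],
      Nat.card (P →ₗ[A] X) = Nat.card (P' →ₗ[A] X) := by
    intro X _ _ _
    have := card_hom_projective (A := A) k P X
    rw [h, ← card_hom_projective (A := A) k P' X] at this
    exact_mod_cast this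
  have e1 : ∃ f : P →ₗ[A] P', Function.Surjective f := by
    have h2 := card_surjective_eq h1 _ P' rfl
    have : Nonempty {g : P' →ₗ[A] P' // Function.Surjective g} :=
      ⟨⟨LinearMap.id, Function.surjective_id⟩⟩
    have h3 : 0 < Nat.card {g : P →ₗ[A] P' // Function.Surjective g} := h2 ▸ Nat.card_pos
    obtain ⟨f, hf⟩ := (Nat.card_pos_iff.1 h3).1
    exact ⟨f, hf⟩
  have e2 : ∃ f : P' →ₗ[A] P, Function.Surjective f := by
    have h2 := card_surjective_eq h1 _ P rfl
    have : Nonempty {g : P →ₗ[A] P // Function.Surjective g} :=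
      ⟨⟨LinearMap.id, Function.surjective_id⟩⟩
    have h3 : 0 < Nat.card {g : P' →ₗ[A] P // Function.Surjective g} := h2 ▸ Nat.card_pos
    obtain ⟨f, hf⟩ := (Nat.card_pos_iff.1 h3).1
    exact ⟨f, hf⟩
  obtain ⟨f, hf⟩ := e1
  obtain ⟨g, hg⟩ := e2
  have hc : Nat.card P = Nat.card P' :=
    le_antisymm (Nat.card_le_card_of_surjective g hg) (Nat.card_le_card_of_surjective f hf)
  exact ⟨LinearEquiv.ofBijective f ((Nat.bijective_iff_surjective_and_card f).2 ⟨hf, hc⟩)⟩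

end ProjectiveClasses

/-! ### Contractible two-term complexes -/

section Contractible

set_option linter.unusedSectionVars false

variable {A : Type u} [Ring A] {m : ℕ}

/-- Complexes concentrated in degrees `a - 1` and `a` with bijective differential. -/
structure IsContractible (a : ZMod m) (K : ProjComplex A m) : Prop where
  twoTerm : IsTwoTerm a K
  bijective : Function.Bijective (K.d (a - 1) a)

namespace IsContractible

variable {a : ZMod m} {K : ProjComplex A m}

/-- The inverse of the differential. -/
noncomputable def equiv (h : IsContractible a K) : K.X (a - 1) ≃ₗ[A] K.X a :=
  LinearEquiv.ofBijective _ h.bijective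

theorem d_symm (h : IsContractible a K) (x : K.X a) : K.d (a - 1) a (h.equiv.symm x) = x :=
  h.equiv.apply_symm_apply x

theorem symm_d (h : IsContractible a K) (x : K.X (a - 1)) : h.equiv.symm (K.d (a - 1) a x) = x :=
  h.equiv.symm_apply_apply x

theorem cls_pred (h : IsContractible a K) : K.cls (a - 1) = K.cls a := cl_congr h.equiv

theorem exactAt (h : IsContractible a K) (i : ZMod m) : ExactAt K i := by
  by_cases hia : i = a
  · subst hia
    exact fun x _ => h.bijective.2 x
  by_cases hib : i = a - 1
  · intro x hx
    refine ⟨0, ?_⟩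
    rw [map_zero]
    have h2 : i + 1 = a := by rw [hib, sub_add_cancel]
    rw [h2] at hx
    subst hib
    exact (h.bijective.1 (by rw [hx, map_zero])).symm
  · exact exactAt_of_subsingleton (h.twoTerm i hia fun h => hib (eq_sub_of_add_eq h))

theorem acyclic (h : IsContractible a K) : K.obj.Acyclic :=
  (acyclic_iff_exactAt K).2 h.exactAt

theorem directSum {K' : ProjComplex A m} (h : IsContractible a K) (h' : IsContractible a K') :
    IsContractible a (directSum K K') where
  twoTerm i hia hib := by
    have h1 := h.twoTerm i hia hib
    have h2 := h'.twoTerm i hia hib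
    exact inferInstanceAs (Subsingleton (K.X i × K'.X i))
  bijective := by
    have : ⇑((BridgelandHall.directSum K K').d (a - 1) a) =
        Prod.map (K.d (a - 1) a) (K'.d (a - 1) a) := by
      funext x
      rw [Cocycle.twist_d, Cocycle.zero_f, LinearMap.zero_apply, add_zero]
      rfl
    rw [this]
    exact h.bijective.prodMap h'.bijective

/-- Cocycles on a contractible complex are coboundaries. -/
noncomputable def cocycleEquivLeft (h : IsContractible a K) (h1 : (1 : ZMod m) ≠ 0)
    (N : ProjComplex A m) : Cocycle K N ≃ (K.X a →ₗ[A] N.X a) where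
  toFun φ := -(φ.f (a - 1) a ∘ₗ h.equiv.symm.toLinearMap)
  invFun t := Cocycle.cob (by classical exact Function.update 0 a t)
  left_inv φ := by
    classical
    have hba : a - 1 ≠ a := by simpa using h1
    refine Cocycle.ext_succ fun i j hij x => ?_
    rw [Cocycle.cob_f]
    by_cases hia : i = a
    · subst hia
      have hj : j ≠ i := fun h => h1 (by rw [← hij] at h; simpa using h)
      have := φ.cond (i - 1) i j (h.equiv.symm x)
      rw [h.d_symm] at this
      rw [Function.update_self, Function.update_of_ne hj]
      simp only [LinearMap.neg_apply, LinearMap.comp_apply, map_neg]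
      simpa using (eq_neg_of_add_eq_zero_right this).symm
    by_cases hib : i = a - 1
    · subst hib
      obtain rfl : j = a := by rw [← hij, sub_add_cancel]
      rw [Function.update_self, Function.update_of_ne hba]
      simp [h.symm_d]
    · have := h.twoTerm i hia fun h => hib (eq_sub_of_add_eq h)
      rw [Subsingleton.elim x 0]
      simp
  right_inv t := by
    classical
    have hba : a - 1 ≠ a := by simpa using h1
    ext x
    rw [LinearMap.neg_apply, LinearMap.comp_apply, Cocycle.cob_f, Function.update_self,
      Function.update_of_ne hba]
    simp [h.d_symm]

theorem eq_cob_left (h : IsContractible a K) (h1 : (1 : ZMod m) ≠ 0)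
    {N : ProjComplex A m} (φ : Cocycle K N) : ∃ s, φ = Cocycle.cob s :=
  ⟨_, ((h.cocycleEquivLeft h1 N).symm_apply_apply φ).symm⟩

/-- Cocycles with values in a contractible complex are coboundaries. -/
noncomputable def cocycleEquivRight (h : IsContractible a K) (h1 : (1 : ZMod m) ≠ 0)
    (N : ProjComplex A m) : Cocycle N K ≃ (N.X (a - 1) →ₗ[A] K.X (a - 1)) where
  toFun φ := h.equiv.symm.toLinearMap ∘ₗ φ.f (a - 1) a
  invFun t := Cocycle.cob (by classical exact Function.update 0 (a - 1) t)
  left_inv φ := by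
    classical
    have hba : a - 1 ≠ a := by simpa using h1
    refine Cocycle.ext_succ fun i j hij x => ?_
    rw [Cocycle.cob_f]
    by_cases hja : j = a
    · obtain rfl : i = a - 1 := eq_sub_of_add_eq (hij.trans hja)
      subst hja
      rw [Function.update_self, Function.update_of_ne hba.symm]
      simp [h.d_symm]
    by_cases hjb : j = a - 1
    · subst hjb
      have hi : i ≠ a - 1 := fun h => h1 (by rw [h] at hij; exact add_eq_left.1 hij)
      rw [Function.update_self, Function.update_of_ne hi]
      have := φ.cond i (a - 1) a x
      simp only [Pi.zero_apply, LinearMap.zero_apply, map_zero, LinearMap.comp_apply, zero_sub,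
        LinearEquiv.coe_coe]
      rw [eq_neg_of_add_eq_zero_right this, map_neg, neg_neg, h.symm_d]
    · have := h.twoTerm j hja fun h => hjb (eq_sub_of_add_eq h)
      exact Subsingleton.elim _ _
  right_inv t := by
    classical
    have hba : a - 1 ≠ a := by simpa using h1
    ext x
    rw [LinearMap.comp_apply, Cocycle.cob_f, Function.update_self,
      Function.update_of_ne hba.symm]
    simp [h.symm_d]

theorem eq_cob_right (h : IsContractible a K) (h1 : (1 : ZMod m) ≠ 0)
    {N : ProjComplex A m} (φ : Cocycle N K) : ∃ s, φ = Cocycle.cob s :=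
  ⟨_, ((h.cocycleEquivRight h1 N).symm_apply_apply φ).symm⟩

end IsContractible

variable (k : Type v) [Field k] [Algebra k A] [Module.Finite k A] [IsHereditaryRing A]

theorem eulerComplex_twoTerm_left {a : ZMod m} (h1 : (1 : ZMod m) ≠ 0) {T : ProjComplex A m} (hT : IsTwoTerm a T)
    (N : ProjComplex A m) : eulerComplex k T N =
      eulerForm k (T.cls a) (N.cls a) + eulerForm k (T.cls (a - 1)) (N.cls (a - 1)) := by
  classical
  rw [eulerComplex_eq, finsum_eq_sum_of_support_subset (s := {a, a - 1}), Finset.sum_pair]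
  · exact (by simpa using h1 : a - 1 ≠ a).symm
  · intro i hi
    by_contra h
    simp only [Finset.coe_insert, Finset.coe_singleton, Set.mem_insert_iff,
      Set.mem_singleton_iff, not_or] at h
    have := hT i h.1 fun h' => h.2 (eq_sub_of_add_eq h')
    have h0 : T.cls i = 0 := cl_of_subsingleton A (T.X i)
    exact hi (by simp [h0])

theorem eulerComplex_twoTerm_right {a : ZMod m} (h1 : (1 : ZMod m) ≠ 0) {T : ProjComplex A m} (hT : IsTwoTerm a T)
    (N : ProjComplex A m) : eulerComplex k N T =
      eulerForm k (N.cls a) (T.cls a) + eulerForm k (N.cls (a - 1)) (T.cls (a - 1)) := by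
  classical
  rw [eulerComplex_eq, finsum_eq_sum_of_support_subset (s := {a, a - 1}), Finset.sum_pair]
  · exact (by simpa using h1 : a - 1 ≠ a).symm
  · intro i hi
    by_contra h
    simp only [Finset.coe_insert, Finset.coe_singleton, Set.mem_insert_iff,
      Set.mem_singleton_iff, not_or] at h
    have := hT i h.1 fun h' => h.2 (eq_sub_of_add_eq h')
    have h0 : T.cls i = 0 := cl_of_subsingleton A (T.X i)
    exact hi (by simp [h0])

variable [Finite k] [Finite A]

/-- The product of two classes when all extensions split. -/
theorem hallClass_mul_of_split {M N : ProjComplex A m} (h : ∀ φ : Cocycle M N, ∃ s, φ = Cocycle.cob s) :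
    hallClass k M * hallClass k N =
      (vParam k ^ (-eulerComplex k M N) * (Nat.card (Cocycle M N) : ℂ)) •
        hallClass k (directSum N M) := by
  rw [hallClass_mul, mul_smul, Finset.sum_congr rfl (g := fun _ => hallClass k (directSum N M))]
  · rw [Finset.sum_const, Finset.card_univ, Nat.card_eq_fintype_card, Nat.cast_smul_eq_nsmul]
  · intro φ _
    obtain ⟨s, rfl⟩ := h φ
    exact hallClass_congr k (Cocycle.cobTwist s)

theorem IsContractible.mul_left {a : ZMod m} {K : ProjComplex A m} (h : IsContractible a K)
    (h1 : (1 : ZMod m) ≠ 0) (N : ProjComplex A m) :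
    hallClass k K * hallClass k N = vParam k ^ (eulerForm k (K.cls a) (N.cls a - N.cls (a - 1))) •
      hallClass k (BridgelandHall.directSum N K) := by
  rw [hallClass_mul_of_split k (h.eq_cob_left h1), Nat.card_congr (h.cocycleEquivLeft h1 N),
    card_hom_projective k, ← zpow_add₀ (vParam_ne_zero k), eulerComplex_twoTerm_left k h1 h.twoTerm,
    h.cls_pred, map_sub]
  congr 2
  simp only [ProjComplex.cls]
  ring

theorem IsContractible.mul_right {a : ZMod m} {K : ProjComplex A m} (h : IsContractible a K)
    (h1 : (1 : ZMod m) ≠ 0) (N : ProjComplex A m) :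
    hallClass k N * hallClass k K =
      vParam k ^ (eulerForm k (N.cls (a - 1) - N.cls a) (K.cls a)) •
      hallClass k (BridgelandHall.directSum N K) := by
  rw [hallClass_mul_of_split k (h.eq_cob_right h1), Nat.card_congr (h.cocycleEquivRight h1 N),
    card_hom_projective k, ← zpow_add₀ (vParam_ne_zero k), eulerComplex_twoTerm_right k h1 h.twoTerm,
    hallClass_congr k (directSumComm K N)]
  change vParam k ^ (_ + 2 * eulerForm k (N.cls (a - 1)) (K.cls (a - 1))) • _ = _
  rw [h.cls_pred, map_sub, AddMonoidHom.sub_apply]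
  congr 2
  ring

end Contractible

/-! ### Decomposition of acyclic complexes -/

section AcyclicInduction

set_option linter.unusedSectionVars false

variable {A : Type u} [Ring A] {m : ℕ}

theorem directSum_d (N M : ProjComplex A m) (i j : ZMod m) (x : N.X i × M.X i) :
    (directSum N M).d i j x = ((N.d i j x.1, M.d i j x.2) : N.X j × M.X j) := by
  rw [Cocycle.twist_d, Cocycle.zero_f, LinearMap.zero_apply, add_zero]

theorem ExactAt.congr {M N : ProjComplex A m} (e : ComplexEquiv M N) {i : ZMod m}
    (h : ExactAt M i) : ExactAt N i :=
  (h.hasHomology.congr_left e).exactAt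

theorem ExactAt.of_directSum {N M : ProjComplex A m} {i : ZMod m} (h : ExactAt (directSum N M) i) :
    ExactAt N i := by
  intro x hx
  obtain ⟨y, hy⟩ := h ((x, 0) : N.X i × M.X i) (by
    rw [directSum_d, hx, map_zero]; rfl)
  rw [directSum_d] at hy
  exact ⟨y.1, congrArg Prod.fst hy⟩

/-- A complex without nonzero cycles vanishes. -/
theorem subsingleton_of_cyc_eq_bot {M : ProjComplex A m} (h : ∀ i, M.cyc i = ⊥) (i : ZMod m) :
    Subsingleton (M.X i) := by
  refine subsingleton_of_forall_eq 0 fun x => ?_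
  have h1 : M.d i (i + 1) x = 0 := by
    have : M.d i (i + 1) x ∈ M.cyc (i + 1) := M.d_mem_cyc x
    rwa [h, Submodule.mem_bot] at this
  have : x ∈ M.cyc i := h1
  rwa [h, Submodule.mem_bot] at this

variable [IsHereditaryRing A]

/-- Every complex `M` is the direct sum of a complex `N` which has no cycles in degree `a`, and a
complex `T` concentrated in the degrees `a - 1` and `a`, with injective differential, whose module
in degree `a` is the module of cycles of `M`. -/
theorem exists_directSum [IsNoetherianRing A] (M : ProjComplex A m) (a : ZMod m) (h1 : (1 : ZMod m) ≠ 0) :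
    ∃ N T : ProjComplex A m, Nonempty (ComplexEquiv (directSum N T) M) ∧ ExactAt N a ∧
      IsTwoTerm a T ∧ Function.Injective (T.d (a - 1) a) ∧ Nonempty (T.X a ≃ₗ[A] M.cyc a) ∧
      (∀ x, N.d a (a + 1) x = 0 → x = 0) ∧ (ExactAt M a → IsContractible a T) := by
  obtain ⟨S, T, hS, hT, hST, hTa, hSb, hSa, hTb, hT0⟩ := exists_peel M a h1
  have hinj : Function.Injective ((M.sub T hT).d (a - 1) a) := by
    rw [injective_iff_map_eq_zero]
    intro x hx
    have h0 : M.d (a - 1) a x.1 = 0 := congrArg Subtype.val hx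
    exact Subtype.ext (Submodule.disjoint_def.1 hTb x.1 x.2
      ((M.mem_cyc (sub_add_cancel a 1)).2 h0))
  have htwo : IsTwoTerm a (M.sub T hT) := fun i hia hib => by
    have h := hT0 i hia hib
    have : Subsingleton (T i) := by rw [h]; infer_instance
    exact this
  have hSa' : ∀ x, (M.sub S hS).d a (a + 1) x = 0 → x = 0 := fun x hx =>
    Subtype.ext (Submodule.disjoint_def.1 hSa x.1 x.2 (congrArg Subtype.val hx))
  refine ⟨M.sub S hS, M.sub T hT, ⟨subSumEquiv M hS hT hST⟩, ?_, htwo, hinj,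
    ⟨LinearEquiv.ofEq _ _ hTa⟩, hSa', fun hM => ⟨htwo, hinj, ?_⟩⟩
  · intro x hx
    exact ⟨0, by rw [hSa' x hx, map_zero]⟩
  · intro x
    have hx : x.1 ∈ M.cyc a := hTa ▸ x.2
    obtain ⟨y, hy⟩ := hM x.1 hx
    have hmem : y ∈ S (a - 1) ⊔ T (a - 1) := by
      rw [(hST (a - 1)).sup_eq_top]; trivial
    obtain ⟨s, hs, t, ht, rfl⟩ := Submodule.mem_sup.1 hmem
    rw [hSb] at hs
    rw [map_add, (M.mem_cyc (sub_add_cancel a 1)).1 hs, zero_add] at hy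
    exact ⟨⟨t, ht⟩, Subtype.ext hy⟩

variable (k : Type v) [Field k] [Algebra k A] [Module.Finite k A] [IsNoetherianRing A]

theorem tdim_pos {M : ProjComplex A m} {i : ZMod m} (h : Nontrivial (M.X i)) : 0 < tdim k M := by
  rw [tdim_eq_sum k M subset_rfl]
  refine Finset.sum_pos' (fun i _ => dimK_nonneg k _) ⟨i, ?_, dimK_pos k _⟩
  by_contra hi
  have := M.subsingleton_of_notMem_supp hi
  exact not_subsingleton (M.X i) this

/-- Every nonzero complex has a nonzero direct summand `T` that is concentrated in two adjacent
degrees and has injective differential; the complement has smaller total dimension. -/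
theorem exists_directSum_tdim_lt (h1 : (1 : ZMod m) ≠ 0) (M : ProjComplex A m)
    (hM : ¬ ∀ i, Subsingleton (M.X i)) :
    ∃ (a : ZMod m) (N T : ProjComplex A m), Nonempty (ComplexEquiv (directSum N T) M) ∧
      ExactAt N a ∧ IsTwoTerm a T ∧ Function.Injective (T.d (a - 1) a) ∧
      tdim k N < tdim k M ∧ (ExactAt M a → IsContractible a T) := by
  have : ∃ a, M.cyc a ≠ ⊥ := by
    by_contra h
    push Not at h
    exact hM (subsingleton_of_cyc_eq_bot h)
  obtain ⟨a, ha⟩ := this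
  obtain ⟨N, T, ⟨e⟩, hN, hT, hinj, ⟨f⟩, -, hc⟩ := exists_directSum M a h1
  refine ⟨a, N, T, ⟨e⟩, hN, hT, hinj, ?_, hc⟩
  have : Nontrivial (M.cyc a) := (Submodule.nontrivial_iff_ne_bot).2 ha
  have h2 := tdim_pos k (M := T) f.toEquiv.nontrivial
  rw [← tdim_congr k e, tdim_twist]
  linarith

include k in
/-- Acyclic complexes are built from the zero complex by adding contractible two-term complexes. -/
theorem acyclic_induction (h1 : (1 : ZMod m) ≠ 0) {motive : ProjComplex A m → Prop}
    (congr : ∀ M N, ComplexEquiv M N → motive M → motive N)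
    (zero : ∀ M : ProjComplex A m, (∀ i, Subsingleton (M.X i)) → motive M)
    (add : ∀ a N K, IsContractible a K → motive N → motive (directSum N K)) (M : ProjComplex A m)
    (hM : ∀ i, ExactAt M i) : motive M := by
  obtain ⟨n, hn⟩ : ∃ n : ℕ, tdim k M ≤ n := ⟨_, Int.self_le_toNat _⟩
  induction n generalizing M with
  | zero =>
    refine zero M fun i => ?_
    by_contra h
    rw [not_subsingleton_iff_nontrivial] at h
    exact absurd (tdim_pos k h) (not_lt.2 (by simpa using hn))
  | succ n ih =>
    by_cases h0 : ∀ i, Subsingleton (M.X i)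
    · exact zero M h0
    obtain ⟨a, N, T, ⟨e⟩, hN, hT, hinj, hlt, hc⟩ := exists_directSum_tdim_lt k h1 M h0
    refine congr _ _ e (add a N T (hc (hM a)) (ih N (fun i => ?_) ?_))
    · exact ((hM i).congr e.symm).of_directSum
    · push_cast at hn
      linarith

end AcyclicInduction

/-! ### The elements `K_α` of Bridgeland's Hall algebra -/

section Kappa

set_option linter.unusedSectionVars false

variable {A : Type u} [Ring A] {m : ℕ} (k : Type v) [Field k] [Algebra k A] [Module.Finite k A]
  [IsHereditaryRing A] [Finite k] [Finite A]

omit [IsHereditaryRing A] [Finite A] in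
theorem subsingleton_zeroComplex (i : ZMod m) : Subsingleton ((zeroComplex A m).X i) := by
  classical
  have hz : ∀ X : ModuleCat.{u} A, X = ModuleCat.of A PUnit.{u + 1} → Subsingleton X := by
    rintro _ rfl
    exact inferInstanceAs (Subsingleton PUnit)
  by_cases h1 : i = (m : ZMod m) - 1
  · exact hz _ (if_pos h1)
  by_cases h2 : i = 0
  · exact hz _ ((if_neg h1).trans (if_pos h2))
  · exact ModuleCat.subsingleton_of_isZero
      (HomologicalComplex.isZero_double_X _ (by simp) i h1 h2)

theorem hallClass_zero {M : ProjComplex A m} (h : ∀ i, Subsingleton (M.X i)) :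
    hallClass k M = 1 := by
  have h0 : ∀ i, Subsingleton ((zeroComplex A m).X i) := subsingleton_zeroComplex
  rw [← hallClass_zeroComplex k]
  exact hallClass_congr k ⟨fun i => by
    have := h i; have := h0 i; exact LinearEquiv.ofSubsingleton _ _, fun i j x => by
    have := h0 j; exact Subsingleton.elim _ _⟩

/-- The contractible complex `P = P` in the degrees `a - 1` and `a`. -/
noncomputable def contractibleAt (a : ZMod m) (P : ProjMod A) : ProjComplex A m :=
  (contractible m P).shift (-a).cast

theorem exists_isTwoTerm_contractibleAt (h1 : (1 : ZMod m) ≠ 0) (a : ZMod m) (P : ProjMod A) :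
    IsContractible a (contractibleAt a P) ∧ (contractibleAt a P).cls a = K0.mk P.toFG := by
  have ha : a + (((-a).cast : ℤ) : ZMod m) = 0 := by rw [ZMod.intCast_zmod_cast]; simp
  obtain ⟨h2, eQ, eP, h⟩ := twoTerm_shift (m := m) (Q := P) (P := P) (𝟙 P.obj) (-a).cast h1 ha
    (sub_add_cancel a 1)
  refine ⟨⟨h2, ?_⟩, ?_⟩
  · have : ⇑((contractibleAt a P).d (a - 1) a) = eP ∘ eQ.symm := by
      funext x
      exact (congrArg _ (eQ.apply_symm_apply x)).symm.trans (h (eQ.symm x))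
    rw [this]
    exact eP.bijective.comp eQ.symm.bijective
  · have := P.property.1
    exact (cl_congr eP).symm

theorem isContractible_contractibleAt (h1 : (1 : ZMod m) ≠ 0) (a : ZMod m) (P : ProjMod A) :
    IsContractible a (contractibleAt a P) := (exists_isTwoTerm_contractibleAt h1 a P).1

theorem cls_contractibleAt (h1 : (1 : ZMod m) ≠ 0) (a : ZMod m) (P : ProjMod A) :
    (contractibleAt a P).cls a = K0.mk P.toFG := (exists_isTwoTerm_contractibleAt h1 a P).2

namespace IsContractible

variable {a : ZMod m} {K K' K'' : ProjComplex A m}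

theorem isUnit (h : IsContractible a K) : IsUnit (hallClass k K) := isUnit_hallClass k K h.acyclic

/-- Contractible complexes in degrees `a - 1` and `a` are determined by their class. -/
theorem hallClass_eq (h : IsContractible a K) (h' : IsContractible a K') (h1 : (1 : ZMod m) ≠ 0)
    (h2 : (2 : ZMod m) ≠ 0) (hc : K.cls a = K'.cls a) : hallClass k K = hallClass k K' := by
  obtain ⟨e⟩ := nonempty_equiv_of_cl_eq k hc
  obtain ⟨f⟩ := IsTwoTerm.nonempty_equiv (sub_add_cancel a 1) h1 h2 h.twoTerm h'.twoTerm
    ((h.equiv.trans e).trans h'.equiv.symm) e (fun x => (h'.d_symm _).symm)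
  exact hallClass_congr k f

theorem hallClass_mul (h : IsContractible a K) (h1 : (1 : ZMod m) ≠ 0)
    (h' : IsContractible a K') :
    hallClass k K * hallClass k K' = hallClass k (BridgelandHall.directSum K' K) := by
  rw [h.mul_left k h1, h'.cls_pred, sub_self, map_zero, zpow_zero, one_smul]

theorem hallClass_commute (h1 : (1 : ZMod m) ≠ 0) (h : IsContractible a K)
    (h' : IsContractible a K') : hallClass k K * hallClass k K' = hallClass k K' * hallClass k K := by
  rw [h.hallClass_mul k h1 h', h'.hallClass_mul k h1 h]
  exact hallClass_congr k (directSumComm _ _)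

theorem mul_comm_smul (h : IsContractible a K) (h1 : (1 : ZMod m) ≠ 0) (N : ProjComplex A m) :
    hallClass k K * hallClass k N = vParam k ^ symEuler k (K.cls a) (N.cls a - N.cls (a - 1)) •
      (hallClass k N * hallClass k K) := by
  rw [h.mul_left k h1, h.mul_right k h1, smul_smul, ← zpow_add₀ (vParam_ne_zero k)]
  congr 2
  simp only [symEuler, map_sub, AddMonoidHom.sub_apply]
  ring

end IsContractible

/-- The element `K_α` of Bridgeland's Hall algebra supported in the degrees `a - 1` and `a`. Since the
shift by `r` moves the degree `0` to the degree `-r`, this is `K_{α, r}` for `r = -a`. -/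
noncomputable def kap (a : ZMod m) (α : K0 A) : BridgelandHallAlgebra k A m :=
  hallClass k (contractibleAt a (exists_eq_sub α).choose) *
    Ring.inverse (hallClass k (contractibleAt a (exists_eq_sub α).choose_spec.choose))

section

variable (h1 : (1 : ZMod m) ≠ 0) (h2 : (2 : ZMod m) ≠ 0)
include h1

theorem exists_kap_mul (a : ZMod m) (α : K0 A) : ∃ K K' : ProjComplex A m, IsContractible a K ∧
    IsContractible a K' ∧ α = K.cls a - K'.cls a ∧ kap k a α * hallClass k K' = hallClass k K := by
  have hα := (exists_eq_sub α).choose_spec.choose_spec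
  have h := isContractible_contractibleAt h1 a (exists_eq_sub α).choose
  have h' := isContractible_contractibleAt h1 a (exists_eq_sub α).choose_spec.choose
  refine ⟨_, _, h, h', ?_, ?_⟩
  · rw [cls_contractibleAt h1, cls_contractibleAt h1]
    exact hα
  · rw [kap, mul_assoc, Ring.inverse_mul_cancel _ (h'.isUnit k), mul_one]

include h2

theorem kap_mul_hallClass {a : ZMod m} {α : K0 A} {K K' : ProjComplex A m} (h : IsContractible a K)
    (h' : IsContractible a K') (hα : α = K.cls a - K'.cls a) :
    kap k a α * hallClass k K' = hallClass k K := by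
  obtain ⟨L, L', hL, hL', hα', e⟩ := exists_kap_mul k h1 a α
  refine (hL'.isUnit k).mul_left_injective ?_
  beta_reduce
  rw [mul_assoc, h'.hallClass_commute k h1 hL', ← mul_assoc, e, hL.hallClass_mul k h1 h',
    h.hallClass_mul k h1 hL']
  refine (h'.directSum hL).hallClass_eq k (hL'.directSum h) h1 h2 ?_
  rw [Cocycle.twist_cls, Cocycle.twist_cls, ← sub_eq_zero]
  rw [← sub_eq_zero] at hα hα'
  calc _ = (α - (K.cls a - K'.cls a)) - (α - (L.cls a - L'.cls a)) := by abel
    _ = 0 := by rw [hα, hα', sub_zero]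

theorem eq_kap {a : ZMod m} {α : K0 A} {K K' : ProjComplex A m} (h : IsContractible a K)
    (h' : IsContractible a K') (hα : α = K.cls a - K'.cls a) {x : BridgelandHallAlgebra k A m}
    (hx : x * hallClass k K' = hallClass k K) : x = kap k a α := by
  refine (h'.isUnit k).mul_left_injective ?_
  beta_reduce
  rw [hx, kap_mul_hallClass k h1 h2 h h' hα]

theorem bridgelandK_eq (P Q : ProjMod A) (r : ZMod m) :
    bridgelandK k P Q r = kap k (-r) (K0.mk P.toFG - K0.mk Q.toFG) := by
  refine eq_kap k h1 h2 (isContractible_contractibleAt h1 (-r) P)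
    (isContractible_contractibleAt h1 (-r) Q) ?_ ?_
  · rw [cls_contractibleAt h1, cls_contractibleAt h1]
  · have h := (isContractible_contractibleAt h1 (-r) Q).isUnit k
    rw [contractibleAt, neg_neg] at h
    rw [bridgelandK, contractibleAt, contractibleAt, neg_neg, mul_assoc,
      Ring.inverse_mul_cancel _ h, mul_one]

theorem kap_zero (a : ZMod m) : kap k a (0 : K0 A) = 1 := by
  obtain ⟨K, K', hK, hK', hα, -⟩ := exists_kap_mul k h1 a (0 : K0 A)
  exact (eq_kap k h1 h2 hK hK (sub_self _).symm (one_mul _)).symm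

theorem hallClass_eq_kap {a : ZMod m} {K : ProjComplex A m} (h : IsContractible a K) :
    hallClass k K = kap k a (K.cls a) :=
  eq_kap k h1 h2 (h.directSum h) h (by rw [Cocycle.twist_cls]; abel)
    (h.hallClass_mul k h1 h)

theorem kap_add (a : ZMod m) (α β : K0 A) : kap k a (α + β) = kap k a α * kap k a β := by
  obtain ⟨K, K', hK, hK', hα, e⟩ := exists_kap_mul k h1 a α
  obtain ⟨L, L', hL, hL', hβ, f⟩ := exists_kap_mul k h1 a β
  refine (eq_kap k h1 h2 (hL.directSum hK) (hK'.directSum hL') ?_ ?_).symm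
  · rw [Cocycle.twist_cls, Cocycle.twist_cls, hα, hβ]
    abel
  · rw [← hL'.hallClass_mul k h1 hK', ← hK.hallClass_mul k h1 hL, mul_assoc,
      ← mul_assoc (kap k a β), f, hL.hallClass_commute k h1 hK', ← mul_assoc, e]

theorem kap_mul_kap_neg (a : ZMod m) (α : K0 A) : kap k a α * kap k a (-α) = 1 := by
  rw [← kap_add k h1 h2, add_neg_cancel, kap_zero k h1 h2]

/-- The elements `K_α` commute with the classes of complexes up to powers of `v`. -/
theorem kap_mul_comm (a : ZMod m) (α : K0 A) (N : ProjComplex A m) :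
    kap k a α * hallClass k N = vParam k ^ symEuler k α (N.cls a - N.cls (a - 1)) •
      (hallClass k N * kap k a α) := by
  obtain ⟨K, K', hK, hK', hα, e⟩ := exists_kap_mul k h1 a α
  refine (hK'.isUnit k).mul_left_injective ?_
  beta_reduce
  have h3 := congrArg (kap k a α * ·) (hK'.mul_comm_smul k h1 N)
  have h4 := hK.mul_comm_smul k h1 N
  beta_reduce at h3
  rw [← mul_assoc, e, h4, mul_smul_comm, ← mul_assoc] at h3
  rw [smul_mul_assoc, mul_assoc (hallClass k N), e]
  have h5 := congrArg (vParam k ^ (-symEuler k (K'.cls a) (N.cls a - N.cls (a - 1))) • ·) h3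
  beta_reduce at h5
  rw [smul_smul, smul_smul, ← zpow_add₀ (vParam_ne_zero k), ← zpow_add₀ (vParam_ne_zero k),
    neg_add_cancel, zpow_zero, one_smul] at h5
  rw [← h5, hα]
  congr 2
  simp only [symEuler, map_sub, AddMonoidHom.sub_apply]
  ring

end

end Kappa

/-! ### Isomorphism classes of modules -/

section IsoClasses

variable {A : Type u} [Ring A]

/-- Isomorphisms of finitely generated modules, as linear equivalences. -/
def fgIsoEquiv (M N : FGModuleCat.{u} A) : (M ≅ N) ≃ (M.obj ≃ₗ[A] N.obj) where
  toFun e := ((ModuleCat.isFG A).ι.mapIso e).toLinearEquiv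
  invFun e := (ModuleCat.isFG A).isoMk e.toModuleIso
  left_inv e := by ext x; rfl
  right_inv e := by ext x; rfl

theorem isoMod_eq_iff {M N : FGModuleCat.{u} A} :
    IsoMod.mk M = IsoMod.mk N ↔ Nonempty (M.obj ≃ₗ[A] N.obj) := by
  rw [IsoMod.mk, IsoMod.mk, Quotient.eq]
  exact (fgIsoEquiv M N).nonempty_congr

theorem isoMod_mk_eq_iff {M : FGModuleCat.{u} A} {q : IsoMod A} :
    IsoMod.mk M = q ↔ Nonempty (M.obj ≃ₗ[A] q.out.obj) := by
  rw [← isoMod_eq_iff, IsoMod.mk, IsoMod.mk, Quotient.out_eq]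

theorem autCard_eq (M : FGModuleCat.{u} A) : autCard M = Nat.card (M.obj ≃ₗ[A] M.obj) :=
  Nat.card_congr (fgIsoEquiv M M)

instance finite_linearEquiv {X Y : Type*} [AddCommGroup X] [Module A X] [AddCommGroup Y]
    [Module A Y] [Finite X] [Finite Y] : Finite (X ≃ₗ[A] Y) :=
  Finite.of_injective (fun e => (e : X → Y)) DFunLike.coe_injective

instance finite_linearMap {X Y : Type*} [AddCommGroup X] [Module A X] [AddCommGroup Y]
    [Module A Y] [Finite X] [Finite Y] : Finite (X →ₗ[A] Y) :=
  Finite.of_injective (fun e => (e : X → Y)) DFunLike.coe_injective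

instance finite_fgModule [Finite A] (M : FGModuleCat.{u} A) : Finite M.obj :=
  have : Module.Finite A M.obj := M.property
  Module.finite_of_finite A

instance moduleFinite_fgModule (M : FGModuleCat.{u} A) : Module.Finite A M.obj := M.property

theorem card_iso_obj (M : FGModuleCat.{u} A) : Nat.card (M.obj ≅ M.obj) = autCard M := by
  rw [autCard_eq]
  exact Nat.card_congr
    { toFun := fun e => e.toLinearEquiv
      invFun := fun e => e.toModuleIso
      left_inv := fun e => by ext x; rfl
      right_inv := fun e => by ext x; rfl }

theorem autCard_ne_zero [Finite A] (M : FGModuleCat.{u} A) : (autCard M : ℂ) ≠ 0 := by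
  rw [autCard_eq, Nat.cast_ne_zero]
  exact (Nat.card_pos (α := M.obj ≃ₗ[A] M.obj)).ne'

theorem nonempty_equiv_out (M : FGModuleCat.{u} A) :
    Nonempty (M.obj ≃ₗ[A] (IsoMod.mk M).out.obj) :=
  isoMod_eq_iff.1 (Quotient.out_eq (IsoMod.mk M)).symm

theorem autCard_congr {M N : FGModuleCat.{u} A} (e : M.obj ≃ₗ[A] N.obj) :
    autCard M = autCard N := by
  rw [autCard_eq, autCard_eq]
  exact Nat.card_congr
    { toFun := fun f => e.symm.trans (f.trans e)
      invFun := fun f => e.trans (f.trans e.symm)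
      left_inv := fun f => by ext; simp
      right_inv := fun f => by ext; simp }

end IsoClasses

/-! ### Comparison of resolutions -/

section Resolutions

set_option linter.unusedSectionVars false

variable {A : Type u} [Ring A] {m : ℕ} {a : ZMod m}

theorem Resolves.congr_right {T : ProjComplex A m} {X Y : Type u} [AddCommGroup X] [Module A X]
    [AddCommGroup Y] [Module A Y] {p : T.X a →ₗ[A] X} (h : Resolves a T p) (e : X ≃ₗ[A] Y) :
    Resolves a T (e.toLinearMap ∘ₗ p) where
  twoTerm := h.twoTerm
  injective := h.injective
  exact x := by
    rw [← h.exact]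
    simp
  surjective := e.surjective.comp h.surjective

theorem Resolves.nonempty_equiv (h1 : (1 : ZMod m) ≠ 0) (h2 : (2 : ZMod m) ≠ 0)
    {T T' : ProjComplex A m} {X : Type u} [AddCommGroup X]
    [Module A X] {p : T.X a →ₗ[A] X} {p' : T'.X a →ₗ[A] X} (h : Resolves a T p)
    (h' : Resolves a T' p') (e : T.X a ≃ₗ[A] T'.X a) (he : ∀ x, p' (e x) = p x) :
    Nonempty (ComplexEquiv T T') := by
  have hr : (LinearMap.range (T.d (a - 1) a)).map e.toLinearMap =
      LinearMap.range (T'.d (a - 1) a) := by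
    ext y
    rw [LinearMap.mem_range, ← h'.exact]
    constructor
    · rintro ⟨x, hx, rfl⟩
      exact (he x).trans ((h.exact x).2 hx)
    · intro hy
      refine ⟨e.symm y, (h.exact _).1 ?_, e.apply_symm_apply y⟩
      rw [← he, e.apply_symm_apply, hy]
  let f := (LinearEquiv.ofInjective _ h.injective).trans
    ((LinearEquiv.ofSubmodules e _ _ hr).trans (LinearEquiv.ofInjective _ h'.injective).symm)
  refine IsTwoTerm.nonempty_equiv (sub_add_cancel a 1) h1 h2 h.twoTerm h'.twoTerm f e fun x => ?_
  have : LinearEquiv.ofInjective _ h'.injective (f x) =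
      LinearEquiv.ofSubmodules e _ _ hr (LinearEquiv.ofInjective _ h.injective x) := by
    simp [f]
  exact (congrArg Subtype.val this).symm

theorem Resolves.directSum_contractible {T K : ProjComplex A m} {X : Type u} [AddCommGroup X]
    [Module A X] {p : T.X a →ₗ[A] X} (h : Resolves a T p) (hK : IsContractible a K) :
    Resolves a (directSum T K) (p ∘ₗ LinearMap.fst A (T.X a) (K.X a)) where
  twoTerm i hia hib := by
    have := h.twoTerm i hia hib
    have := hK.twoTerm i hia hib
    exact inferInstanceAs (Subsingleton (T.X i × K.X i))
  injective := by
    have : ⇑((directSum T K).d (a - 1) a) = Prod.map (T.d (a - 1) a) (K.d (a - 1) a) := by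
      funext x
      exact directSum_d T K _ _ x
    rw [this]
    exact h.injective.prodMap hK.bijective.1
  exact x := by
    refine (h.exact x.1).trans ⟨?_, ?_⟩
    · rintro ⟨y, hy⟩
      refine ⟨((y, hK.equiv.symm x.2) : T.X (a - 1) × K.X (a - 1)), ?_⟩
      rw [directSum_d, hy, hK.d_symm]
    · rintro ⟨y, hy⟩
      rw [directSum_d] at hy
      exact ⟨y.1, congrArg Prod.fst hy⟩
  surjective := h.surjective.comp Prod.fst_surjective

/-- Schanuel's lemma: two resolutions of a module become isomorphic after the contractible complex of
the projective module in degree `a` of each one is added to the other one. -/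
theorem Resolves.schanuel (h1 : (1 : ZMod m) ≠ 0) (h2 : (2 : ZMod m) ≠ 0)
    {T T' K K' : ProjComplex A m} {X : Type u} [AddCommGroup X] [Module A X]
    {p : T.X a →ₗ[A] X} {p' : T'.X a →ₗ[A] X} (h : Resolves a T p) (h' : Resolves a T' p')
    (hK : IsContractible a K) (hK' : IsContractible a K') (e : T.X a ≃ₗ[A] K.X a)
    (e' : T'.X a ≃ₗ[A] K'.X a) :
    Nonempty (ComplexEquiv (directSum T K') (directSum T' K)) := by
  obtain ⟨s, hs⟩ := Module.projective_lifting_property p' p h'.surjective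
  obtain ⟨s', hs'⟩ := Module.projective_lifting_property p p' h.surjective
  have hs := LinearMap.congr_fun hs
  have hs' := LinearMap.congr_fun hs'
  simp only [LinearMap.comp_apply] at hs hs'
  let E : (T.X a × K'.X a) ≃ₗ[A] (T'.X a × K.X a) :=
    (((LinearEquiv.refl A (T.X a)).prodCongr e'.symm).trans
      ((shear s').symm.trans (LinearEquiv.prodComm A _ _))).trans
      ((shear s).trans ((LinearEquiv.refl A (T'.X a)).prodCongr e))
  refine (h.directSum_contractible hK').nonempty_equiv h1 h2 (h'.directSum_contractible hK) E ?_
  rintro ⟨x, y⟩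
  change p' (e'.symm y + s (x - s' (e'.symm y))) = p x
  rw [map_add, hs, map_sub, hs']
  abel

theorem Resolves.cl_eq [IsNoetherianRing A] {T : ProjComplex A m} {X : Type u} [AddCommGroup X] [Module A X]
    [Module.Finite A X] {p : T.X a →ₗ[A] X} (h : Resolves a T p) :
    T.cls a = T.cls (a - 1) + cl A X :=
  cl_of_exact _ p h.injective h.surjective fun x => (h.exact x)

/-- A two-term complex with injective differential resolves its cokernel. -/
theorem resolves_of_hasHomology (h1 : (1 : ZMod m) ≠ 0) (h2 : (2 : ZMod m) ≠ 0)
    {T : ProjComplex A m} (hT : IsTwoTerm a T) (hinj : Function.Injective (T.d (a - 1) a))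
    {X : Type u} [AddCommGroup X] [Module A X] (hX : HasHomology T a X) :
    ∃ p : T.X a →ₗ[A] X, Resolves a T p := by
  obtain ⟨p, hp, hp'⟩ := hX
  have hT1 : Subsingleton (T.X (a + 1)) := hT _ (by simpa using h1) (by
    rw [add_assoc, one_add_one_eq_two]
    simpa using h2)
  refine ⟨p ∘ₗ LinearMap.codRestrict _ LinearMap.id fun x => Subsingleton.elim _ _, hT, hinj,
    fun x => hp' _, fun y => ?_⟩
  obtain ⟨z, rfl⟩ := hp y
  exact ⟨z.1, rfl⟩

theorem exactAt_sub_one {T : ProjComplex A m} (hinj : Function.Injective (T.d (a - 1) a)) :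
    ExactAt T (a - 1) := by
  intro x hx
  refine ⟨0, ?_⟩
  have hx' : T.d (a - 1) a x = 0 := (T.mem_cyc (sub_add_cancel a 1)).1 hx
  rw [map_zero]
  exact (hinj (by rw [hx', map_zero])).symm

end Resolutions

/-! ### The elements of Bridgeland's Hall algebra given by modules -/

section ResElt

set_option linter.unusedSectionVars false

variable {A : Type u} [Ring A] {m : ℕ} (k : Type v) [Field k] [Algebra k A] [Module.Finite k A]
  [IsHereditaryRing A] [Finite k] [Finite A]

/-- For a complex `Ω → P` in degrees `a - 1` and `a` resolving a module `X`, the element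
`v^⟨Ω, X⟩ K_{-Ω} [Ω → P]`. -/
noncomputable def resElt (a : ZMod m) (T : ProjComplex A m) : BridgelandHallAlgebra k A m :=
  vParam k ^ eulerForm k (T.cls (a - 1)) (T.cls a - T.cls (a - 1)) •
    (kap k a (-T.cls (a - 1)) * hallClass k T)

theorem resElt_congr {a : ZMod m} {T T' : ProjComplex A m} (e : ComplexEquiv T T') :
    resElt k a T = resElt k a T' := by
  rw [resElt, resElt, ProjComplex.cls_congr e, ProjComplex.cls_congr e, hallClass_congr k e]

variable (h1 : (1 : ZMod m) ≠ 0) (h2 : (2 : ZMod m) ≠ 0)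
include h1 h2

theorem resElt_directSum {a : ZMod m} (T : ProjComplex A m) {K : ProjComplex A m}
    (hK : IsContractible a K) : resElt k a (directSum T K) = resElt k a T := by
  have h := hK.mul_left k h1 T
  rw [resElt, resElt, Cocycle.twist_cls, Cocycle.twist_cls, hK.cls_pred,
    ← one_smul ℂ (hallClass k (directSum T K)), ← zpow_zero (vParam k),
    ← neg_add_cancel (eulerForm k (K.cls a) (T.cls a - T.cls (a - 1))),
    zpow_add₀ (vParam_ne_zero k), mul_smul, ← h, mul_smul_comm, smul_smul,
    ← zpow_add₀ (vParam_ne_zero k), neg_add, kap_add k h1 h2, hallClass_eq_kap k h1 h2 hK,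
    mul_assoc, ← mul_assoc (kap k a (-K.cls a)), ← kap_add k h1 h2, neg_add_cancel,
    kap_zero k h1 h2, one_mul]
  congr 2
  simp only [map_add, map_sub, AddMonoidHom.add_apply]
  ring

/-- The element attached to a resolution depends only on the module. -/
theorem resElt_eq {a : ZMod m} {T T' : ProjComplex A m} {X : Type u} [AddCommGroup X] [Module A X]
    {p : T.X a →ₗ[A] X} {p' : T'.X a →ₗ[A] X} (h : Resolves a T p) (h' : Resolves a T' p') :
    resElt k a T = resElt k a T' := by
  have key : ∀ U : ProjComplex A m, ∃ K : ProjComplex A m, IsContractible a K ∧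
      Nonempty (U.X a ≃ₗ[A] K.X a) := by
    intro U
    let P : ProjMod A := ⟨ModuleCat.of A (U.X a), inferInstance, inferInstance⟩
    refine ⟨contractibleAt a P, isContractible_contractibleAt h1 a P,
      nonempty_equiv_of_cl_eq k (cls_contractibleAt h1 a P).symm⟩
  obtain ⟨K, hK, ⟨e⟩⟩ := key T
  obtain ⟨K', hK', ⟨e'⟩⟩ := key T'
  obtain ⟨f⟩ := Resolves.schanuel h1 h2 h h' hK hK' e e'
  rw [← resElt_directSum k h1 h2 T hK', ← resElt_directSum k h1 h2 T' hK, resElt_congr k f]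

omit h1 h2 in
/-- The normalized element of Bridgeland's Hall algebra given by a module and a degree `a`, which is
`e_{X, r}` for `r = -a`. -/
noncomputable def modElt (X : FGModuleCat.{u} A) (a : ZMod m) : BridgelandHallAlgebra k A m :=
  bridgelandE k (nonempty_minProjRes X).some (-a)

theorem exists_resolves {X : FGModuleCat.{u} A} (R : MinProjRes X) (r : ZMod m) :
    ∃ (T : ProjComplex A m) (p : T.X (-r) →ₗ[A] X.obj), Resolves (-r) T p ∧
      bridgelandE k R r = (autCard X : ℂ)⁻¹ • resElt k (-r) T := by
  have ha : -r + ((r.cast : ℤ) : ZMod m) = 0 := by rw [ZMod.intCast_zmod_cast]; simp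
  obtain ⟨h3, eQ, eP, h⟩ := twoTerm_shift (m := m) R.δ r.cast h1 ha (sub_add_cancel (-r) 1)
  have hinj : Function.Injective R.δ.hom :=
    (ModuleCat.mono_iff_injective R.δ).1 R.shortExact.mono_f
  have hsurj : Function.Surjective R.ε.hom :=
    (ModuleCat.epi_iff_surjective R.ε).1 R.shortExact.epi_g
  have hexact := (ShortComplex.moduleCat_exact_iff _).1 R.shortExact.exact
  have hw : ∀ x, R.ε.hom (R.δ.hom x) = 0 := fun x =>
    LinearMap.congr_fun (congrArg ModuleCat.Hom.hom R.w) x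
  have := R.Ω.property.1
  have hcl : ((twoTerm R.δ : ProjComplex A m).shift r.cast).cls (-r - 1) = K0.mk R.Ω.toFG :=
    (cl_congr eQ).symm
  have hR : Resolves (-r) ((twoTerm R.δ : ProjComplex A m).shift r.cast)
      (R.ε.hom ∘ₗ eP.symm.toLinearMap) := by
    refine ⟨h3, fun x y hxy => ?_, fun x => ⟨fun hx => ?_, ?_⟩, hsurj.comp eP.symm.surjective⟩
    · rw [← eQ.apply_symm_apply x, ← eQ.apply_symm_apply y, h, h] at hxy
      exact eQ.symm.injective (hinj (eP.injective hxy))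
    · obtain ⟨y, hy⟩ := hexact _ hx
      refine ⟨eQ y, ?_⟩
      rw [h]
      exact (eP.symm_apply_eq.1 hy.symm).symm
    · rintro ⟨y, rfl⟩
      rw [← eQ.apply_symm_apply y, h]
      refine (congrArg R.ε.hom (eP.symm_apply_apply _)).trans (hw _)
  refine ⟨_, _, hR, ?_⟩
  rw [bridgelandE, resElt, bridgelandK_eq k h1 h2, hR.cl_eq, hcl, add_sub_cancel_left, mul_smul]
  have hz : (K0.mk (zeroProj : ProjMod A).toFG) = 0 := by
    have : Subsingleton ((zeroProj : ProjMod A).toFG).obj := inferInstanceAs (Subsingleton PUnit)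
    exact cl_of_subsingleton A _
  rw [hz, zero_sub]
  rfl

/-- The element `e_M` of Bridgeland's Hall algebra can be computed from any resolution. -/
theorem resElt_eq_smul_bridgelandE {X : FGModuleCat.{u} A} {r : ZMod m} {T : ProjComplex A m}
    {p : T.X (-r) →ₗ[A] X.obj} (h : Resolves (-r) T p) (R : MinProjRes X) :
    resElt k (-r) T = (autCard X : ℂ) • bridgelandE k R r := by
  obtain ⟨T', p', h', e⟩ := exists_resolves k h1 h2 R r
  rw [e, smul_smul, mul_inv_cancel₀ (autCard_ne_zero X), one_smul]
  exact resElt_eq k h1 h2 h h'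

theorem resElt_eq_smul_modElt {X : FGModuleCat.{u} A} {a : ZMod m} {T : ProjComplex A m}
    {p : T.X a →ₗ[A] X.obj} (h : Resolves a T p) : resElt k a T = (autCard X : ℂ) • modElt k X a := by
  obtain ⟨r, rfl⟩ : ∃ r, a = -r := ⟨-a, (neg_neg a).symm⟩
  rw [modElt, neg_neg, resElt_eq_smul_bridgelandE k h1 h2 h]

theorem exists_resolves_modElt (X : FGModuleCat.{u} A) (a : ZMod m) :
    ∃ (T : ProjComplex A m) (p : T.X a →ₗ[A] X.obj), Resolves a T p ∧
      modElt k X a = (autCard X : ℂ)⁻¹ • resElt k a T := by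
  obtain ⟨r, rfl⟩ : ∃ r, a = -r := ⟨-a, (neg_neg a).symm⟩
  obtain ⟨T, p, h, e⟩ := exists_resolves k h1 h2 (nonempty_minProjRes X).some r
  exact ⟨T, p, h, by rw [modElt, neg_neg, e]⟩

theorem bridgelandE_eq_modElt {X : FGModuleCat.{u} A} (R : MinProjRes X) (r : ZMod m) :
    bridgelandE k R r = modElt k X (-r) := by
  obtain ⟨T, p, h, e⟩ := exists_resolves k h1 h2 (nonempty_minProjRes X).some r
  rw [modElt, neg_neg, e, resElt_eq_smul_bridgelandE k h1 h2 h R, smul_smul,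
    inv_mul_cancel₀ (autCard_ne_zero X), one_smul]

theorem modElt_congr {X Y : FGModuleCat.{u} A} (e : X.obj ≃ₗ[A] Y.obj) (a : ZMod m) :
    modElt k X a = modElt k Y a := by
  obtain ⟨T, p, h, e'⟩ := exists_resolves_modElt k h1 h2 X a
  rw [e', autCard_congr e, resElt_eq_smul_modElt k h1 h2 (h.congr_right e), smul_smul,
    inv_mul_cancel₀ (autCard_ne_zero Y), one_smul]

theorem modElt_of_subsingleton (X : FGModuleCat.{u} A) (hX : Subsingleton X.obj) (a : ZMod m) :
    modElt k X a = 1 := by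
  obtain ⟨T, p, h, e⟩ := exists_resolves_modElt k h1 h2 X a
  have hT : IsContractible a T :=
    ⟨h.twoTerm, h.injective, fun x => (h.exact x).1 (Subsingleton.elim _ _)⟩
  have hc : autCard X = 1 := by
    rw [autCard_eq]
    have : Subsingleton (X.obj ≃ₗ[A] X.obj) := ⟨fun f g => by ext; exact Subsingleton.elim _ _⟩
    exact Nat.card_unique
  rw [e, hc, Nat.cast_one, inv_one, one_smul, resElt, hT.cls_pred, sub_self, map_zero, zpow_zero,
    one_smul, hallClass_eq_kap k h1 h2 hT, ← kap_add k h1 h2, neg_add_cancel, kap_zero k h1 h2]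

end ResElt

/-! ### Commutation with the elements `K_α` -/

section Weight

set_option linter.unusedSectionVars false

variable {A : Type u} [Ring A] {m : ℕ} (k : Type v) [Field k] [Algebra k A] [Module.Finite k A]
  [IsHereditaryRing A] [Finite k] [Finite A]

@[simp] theorem symEuler_add (α β γ : K0 A) :
    symEuler k α (β + γ) = symEuler k α β + symEuler k α γ := by
  simp only [symEuler, map_add, AddMonoidHom.add_apply]; ring

@[simp] theorem symEuler_sub (α β γ : K0 A) :
    symEuler k α (β - γ) = symEuler k α β - symEuler k α γ := by
  simp only [symEuler, map_sub, AddMonoidHom.sub_apply]; ring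

@[simp] theorem symEuler_neg (α β : K0 A) : symEuler k α (-β) = -symEuler k α β := by
  simp only [symEuler, map_neg, AddMonoidHom.neg_apply]; ring

@[simp] theorem symEuler_zero (α : K0 A) : symEuler k α (0 : K0 A) = 0 := by
  simp [symEuler]

/-- The element `x` commutes with all `K_α` in the degrees `a - 1`, `a` up to the powers of `v`
given by `(α, δ)`. -/
def HasWeight (a : ZMod m) (x : BridgelandHallAlgebra k A m) (δ : K0 A) : Prop :=
  ∀ α, kap k a α * x = vParam k ^ symEuler k α δ • (x * kap k a α)

variable {k} {a : ZMod m} {x y : BridgelandHallAlgebra k A m} {δ δ' : K0 A}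

theorem HasWeight.mul (h : HasWeight k a x δ) (h' : HasWeight k a y δ') :
    HasWeight k a (x * y) (δ + δ') := by
  intro α
  rw [← mul_assoc, h, smul_mul_assoc, mul_assoc, h', mul_smul_comm, smul_smul,
    ← zpow_add₀ (vParam_ne_zero k), symEuler_add, mul_assoc]

theorem HasWeight.smul (h : HasWeight k a x δ) (c : ℂ) : HasWeight k a (c • x) δ := by
  intro α
  rw [mul_smul_comm, h, smul_mul_assoc, smul_comm]

theorem HasWeight.of_mul (h : HasWeight k a (x * y) δ) (h' : HasWeight k a y δ') (hy : IsUnit y) :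
    HasWeight k a x (δ - δ') := by
  intro α
  refine hy.mul_left_injective ?_
  beta_reduce
  have h3 := h α
  have h4 := h' α
  rw [mul_assoc, h3, symEuler_sub, zpow_sub₀ (vParam_ne_zero k), smul_mul_assoc, mul_assoc x,
    mul_assoc x, h4, mul_smul_comm, smul_smul, div_mul_cancel₀ _ (zpow_ne_zero _ (vParam_ne_zero k))]

variable (k)
variable (h1 : (1 : ZMod m) ≠ 0) (h2 : (2 : ZMod m) ≠ 0)
include h1 h2

theorem hasWeight_hallClass (a : ZMod m) (N : ProjComplex A m) :
    HasWeight k a (hallClass k N) (N.cls a - N.cls (a - 1)) :=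
  fun α => kap_mul_comm k h1 h2 a α N

omit h1 h2 in
theorem IsTwoTerm.cls_eq [IsNoetherianRing A] {b : ZMod m} {T : ProjComplex A m} (hT : IsTwoTerm b T)
    (h1 : (1 : ZMod m) ≠ 0) {α : K0 A} (hb : T.cls b = T.cls (b - 1) + α) (i : ZMod m) :
    T.cls i = (if i = b ∨ i + 1 = b then T.cls (b - 1) else 0) + (if i = b then α else 0) := by
  have hbb : b - 1 ≠ b := by simpa using h1
  by_cases hi : i = b
  · subst hi
    rw [if_pos (Or.inl rfl), if_pos rfl, hb]
  by_cases hi' : i + 1 = b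
  · obtain rfl : i = b - 1 := eq_sub_of_add_eq hi'
    rw [if_pos (Or.inr hi'), if_neg hi, add_zero]
  · have := hT i hi hi'
    rw [if_neg (by tauto), if_neg hi, add_zero]
    exact cl_of_subsingleton A (T.X i)

theorem hasWeight_kap (a b : ZMod m) (β : K0 A) :
    HasWeight k a (kap k b β) ((if a = b ∨ a + 1 = b then β else 0) -
      (if a - 1 = b ∨ a - 1 + 1 = b then β else 0)) := by
  obtain ⟨K, K', hK, hK', rfl, e⟩ := exists_kap_mul k h1 b β
  have h3 := hasWeight_hallClass k h1 h2 a K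
  have h4 := hasWeight_hallClass k h1 h2 a K'
  rw [← e] at h3
  have h5 := h3.of_mul h4 (hK'.isUnit k)
  have hc : ∀ {K : ProjComplex A m}, IsContractible b K → ∀ i,
      K.cls i = if i = b ∨ i + 1 = b then K.cls b else 0 := by
    intro K hK i
    rw [hK.twoTerm.cls_eq h1 (α := 0) (by rw [hK.cls_pred, add_zero]), hK.cls_pred]
    simp
  rw [hc hK a, hc hK (a - 1), hc hK' a, hc hK' (a - 1)] at h5
  convert h5 using 1
  split_ifs <;> abel

theorem hasWeight_resElt {b : ZMod m} {T : ProjComplex A m} {X : Type u} [AddCommGroup X]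
    [Module A X] [Module.Finite A X] {p : T.X b →ₗ[A] X} (h : Resolves b T p) (a : ZMod m) :
    HasWeight k a (resElt k b T) ((if a = b then cl A X else 0) - if a = b + 1 then cl A X else 0) := by
  have h3 := ((hasWeight_kap k h1 h2 a b (-T.cls (b - 1))).mul
    (hasWeight_hallClass k h1 h2 a T)).smul
    (vParam k ^ eulerForm k (T.cls (b - 1)) (T.cls b - T.cls (b - 1)))
  rw [h.twoTerm.cls_eq h1 h.cl_eq a, h.twoTerm.cls_eq h1 h.cl_eq (a - 1)] at h3
  rw [resElt]
  convert h3 using 1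
  simp only [sub_eq_iff_eq_add (a := a) (b := 1) (c := b)]
  split_ifs <;> abel

theorem hasWeight_modElt (X : FGModuleCat.{u} A) (a b : ZMod m) :
    HasWeight k a (modElt k X b) ((if a = b then K0.mk X else 0) - if a = b + 1 then K0.mk X else 0) := by
  obtain ⟨T, p, h, e⟩ := exists_resolves_modElt k h1 h2 X b
  rw [e]
  exact (hasWeight_resElt k h1 h2 h a).smul _

end Weight

/-! ### Counting the extensions of two modules with given resolutions -/

section CountExtensions

set_option linter.unusedSectionVars false

variable {A : Type u} [Ring A] {ΩM PM M ΩN PN N L : Type u}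
  [AddCommGroup ΩM] [Module A ΩM] [AddCommGroup PM] [Module A PM] [AddCommGroup M] [Module A M]
  [AddCommGroup ΩN] [Module A ΩN] [AddCommGroup PN] [Module A PN] [AddCommGroup N] [Module A N]
  [AddCommGroup L] [Module A L]

/-- The pairs of maps in short exact sequences `0 → N → L → M → 0`. -/
abbrev LinearExactPair (A : Type u) [Ring A] (M N L : Type u) [AddCommGroup M] [Module A M]
    [AddCommGroup N] [Module A N] [AddCommGroup L] [Module A L] : Type _ :=
  {p : (N →ₗ[A] L) × (L →ₗ[A] M) // Function.Injective p.1 ∧ Function.Exact p.1 p.2 ∧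
    Function.Surjective p.2}

theorem card_exactPair (M N L : ModuleCat.{u} A) :
    Nat.card (ExactPair M N L) = Nat.card (LinearExactPair A M N L) := by
  refine Nat.card_congr ((ModuleCat.homEquiv.prodCongr ModuleCat.homEquiv).subtypeEquiv fun p => ?_)
  constructor
  · rintro ⟨w, h⟩
    refine ⟨(ModuleCat.mono_iff_injective _).1 h.mono_f, fun x => ⟨fun hx => ?_, ?_⟩,
      (ModuleCat.epi_iff_surjective _).1 h.epi_g⟩
    · exact (ShortComplex.moduleCat_exact_iff _).1 h.exact x hx
    · rintro ⟨y, rfl⟩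
      exact LinearMap.congr_fun (congrArg ModuleCat.Hom.hom w) y
  · rintro ⟨hi, he, hs⟩
    have w : p.1 ≫ p.2 = 0 := by
      ext y
      exact (he _).2 ⟨y, rfl⟩
    refine ⟨w, ShortComplex.ShortExact.mk' ?_ ((ModuleCat.mono_iff_injective _).2 hi)
      ((ModuleCat.epi_iff_surjective _).2 hs)⟩
    rw [ShortComplex.moduleCat_exact_iff]
    exact fun x hx => (he x).1 hx

/-- The map `h` is the cokernel of the map `ΩN × ΩM → PN × PM` with components `δN`, `δM` and `φ`. -/
def IsPushoutMap (δM : ΩM →ₗ[A] PM) (δN : ΩN →ₗ[A] PN) (φ : ΩM →ₗ[A] PN)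
    (h : PN × PM →ₗ[A] L) : Prop :=
  Function.Surjective h ∧ ∀ z, h z = 0 ↔ ∃ y : ΩN × ΩM, (δN y.1 + φ y.2, δM y.2) = z

variable {δM : ΩM →ₗ[A] PM} {εM : PM →ₗ[A] M} {δN : ΩN →ₗ[A] PN} {εN : PN →ₗ[A] N}

/-- The maps with the same cokernel form a torsor under the automorphisms of the cokernel. -/
theorem card_isPushoutMap (φ : ΩM →ₗ[A] PN) (h0 : PN × PM →ₗ[A] L)
    (hh0 : IsPushoutMap δM δN φ h0) :
    Nat.card {h : PN × PM →ₗ[A] L // IsPushoutMap δM δN φ h} = Nat.card (L ≃ₗ[A] L) := by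
  refine (Nat.card_congr (Equiv.ofBijective (fun e : L ≃ₗ[A] L =>
    (⟨e.toLinearMap ∘ₗ h0, e.surjective.comp hh0.1, fun z => by
      rw [← hh0.2]; simp⟩ : {h : PN × PM →ₗ[A] L // IsPushoutMap δM δN φ h})) ⟨?_, ?_⟩)).symm
  · intro e e' hee
    ext x
    obtain ⟨z, rfl⟩ := hh0.1 x
    exact LinearMap.congr_fun (congrArg Subtype.val hee) z
  · rintro ⟨h, hh⟩
    have hk : LinearMap.ker h0 = LinearMap.ker h := by
      ext z
      rw [LinearMap.mem_ker, LinearMap.mem_ker, hh0.2, hh.2]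
    refine ⟨(h0.quotKerEquivOfSurjective hh0.1).symm.trans ((Submodule.quotEquivOfEq _ _ hk).trans
      (h.quotKerEquivOfSurjective hh.1)), Subtype.ext (LinearMap.ext fun z => ?_)⟩
    have : (h0.quotKerEquivOfSurjective hh0.1).symm (h0 z) = Submodule.Quotient.mk z := by
      rw [LinearEquiv.symm_apply_eq]
      rfl
    change h.quotKerEquivOfSurjective hh.1 (Submodule.quotEquivOfEq _ _ hk
      ((h0.quotKerEquivOfSurjective hh0.1).symm (h0 z))) = h z
    rw [this]
    rfl

/-- A lift of the resolutions of the ends of a short exact sequence to its middle term. -/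
def IsLift (δM : ΩM →ₗ[A] PM) (εM : PM →ₗ[A] M) (εN : PN →ₗ[A] N) (p : (N →ₗ[A] L) × (L →ₗ[A] M))
    (q : (ΩM →ₗ[A] PN) × (PM →ₗ[A] L)) : Prop :=
  (∀ x, p.2 (q.2 x) = εM x) ∧ ∀ x, p.1 (εN (q.1 x)) + q.2 (δM x) = 0

variable (hδM : Function.Injective δM) (hδN : Function.Injective δN) (hM : Function.Exact δM εM) (hN : Function.Exact δN εN)
  (hεM : Function.Surjective εM) (hεN : Function.Surjective εN)
include hM hN hεM hεN

/-- The middle term of an extension is the cokernel of the differential of the extension of the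
resolutions. -/
theorem IsLift.isPushoutMap {p : (N →ₗ[A] L) × (L →ₗ[A] M)} (hp : Function.Injective p.1 ∧
    Function.Exact p.1 p.2 ∧ Function.Surjective p.2) {q : (ΩM →ₗ[A] PN) × (PM →ₗ[A] L)}
    (hq : IsLift δM εM εN p q) : IsPushoutMap δM δN q.1 ((p.1 ∘ₗ εN).coprod q.2) := by
  obtain ⟨hi, he, hs⟩ := hp
  constructor
  · intro x
    obtain ⟨z, hz⟩ := hεM (p.2 x)
    obtain ⟨y, hy⟩ := (he (x - q.2 z)).1 (by rw [map_sub, hq.1, hz, sub_self])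
    obtain ⟨w, rfl⟩ := hεN y
    exact ⟨(w, z), by simp [hy]⟩
  · rintro ⟨n, z⟩
    simp only [LinearMap.coprod_apply, LinearMap.comp_apply]
    constructor
    · intro h
      have h3 := congrArg p.2 h
      rw [map_add, (he _).2 ⟨_, rfl⟩, zero_add, hq.1, map_zero] at h3
      obtain ⟨x, rfl⟩ := (hM z).1 h3
      rw [eq_neg_of_add_eq_zero_right (hq.2 x), add_neg_eq_zero] at h
      obtain ⟨y, hy⟩ := (hN (n - q.1 x)).1 (by rw [map_sub, hi h, sub_self])
      exact ⟨(y, x), by simp [hy]⟩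
    · rintro ⟨⟨y, x⟩, h⟩
      rw [Prod.mk.injEq] at h
      rw [← h.1, ← h.2, map_add, (hN _).2 ⟨y, rfl⟩, zero_add]
      exact hq.2 x

include hδM in
/-- The short exact sequences with middle term `L`, together with lifts of the resolutions of their
ends, are the same as the presentations of `L` of the form `ΩN × ΩM → PN × PM`. -/
theorem card_isLift :
    Nat.card (Σ p : LinearExactPair A M N L, {q // IsLift δM εM εN p.1 q}) =
    Nat.card (Σ φ : ΩM →ₗ[A] PN, {h : PN × PM →ₗ[A] L // IsPushoutMap δM δN φ h}) := by
  refine Nat.card_congr (Equiv.ofBijective (fun r =>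
    ⟨r.2.1.1, (r.1.1.1 ∘ₗ εN).coprod r.2.1.2, r.2.2.isPushoutMap hM hN hεM hεN r.1.2⟩) ⟨?_, ?_⟩)
  · rintro ⟨⟨⟨f, g⟩, hp⟩, ⟨φ, t⟩, hq⟩ ⟨⟨⟨f', g'⟩, hp'⟩, ⟨φ', t'⟩, hq'⟩ h
    have e1 : φ = φ' := congrArg Sigma.fst h
    have e2 : (f ∘ₗ εN).coprod t = (f' ∘ₗ εN).coprod t' := by
      subst e1
      exact congrArg Subtype.val (eq_of_heq (Sigma.mk.inj h).2)
    obtain rfl : f = f' := by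
      ext x
      obtain ⟨y, rfl⟩ := hεN x
      simpa using LinearMap.congr_fun e2 (y, 0)
    obtain rfl : t = t' := by
      ext x
      simpa using LinearMap.congr_fun e2 (0, x)
    obtain rfl : g = g' := by
      ext x
      obtain ⟨⟨y, z⟩, rfl⟩ := (IsLift.isPushoutMap hM hN hεM hεN hp hq).1 x
      have h3 := fun y => (hp.2.1 (f y)).2 ⟨y, rfl⟩
      have h4 := fun y => (hp'.2.1 (f y)).2 ⟨y, rfl⟩
      have h5 := hq.1 z
      have h6 := hq'.1 z
      simp only at h3 h4 h5 h6
      simp [h3, h4, h5, h6]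
    subst e1
    rfl
  · rintro ⟨φ, h, hs, he⟩
    have hf : ∃ f : N →ₗ[A] L, ∀ x, f (εN x) = h (x, 0) := by
      have hk : LinearMap.ker εN ≤ LinearMap.ker (h ∘ₗ LinearMap.inl A PN PM) := by
        intro x hx
        obtain ⟨y, rfl⟩ := (hN x).1 hx
        exact (he _).2 ⟨(y, 0), by simp⟩
      refine ⟨(Submodule.liftQ _ _ hk) ∘ₗ (εN.quotKerEquivOfSurjective hεN).symm.toLinearMap,
        fun x => ?_⟩
      have : (εN.quotKerEquivOfSurjective hεN).symm (εN x) = Submodule.Quotient.mk x := by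
        rw [LinearEquiv.symm_apply_eq]; rfl
      change Submodule.liftQ _ _ hk ((εN.quotKerEquivOfSurjective hεN).symm (εN x)) = _
      rw [this]
      rfl
    have hg : ∃ g : L →ₗ[A] M, ∀ z, g (h z) = εM z.2 := by
      have hk : LinearMap.ker h ≤ LinearMap.ker (εM ∘ₗ LinearMap.snd A PN PM) := by
        intro x hx
        obtain ⟨y, rfl⟩ := (he x).1 hx
        exact (hM _).2 ⟨y.2, rfl⟩
      refine ⟨(Submodule.liftQ _ _ hk) ∘ₗ (h.quotKerEquivOfSurjective hs).symm.toLinearMap,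
        fun x => ?_⟩
      have : (h.quotKerEquivOfSurjective hs).symm (h x) = Submodule.Quotient.mk x := by
        rw [LinearEquiv.symm_apply_eq]; rfl
      change Submodule.liftQ _ _ hk ((h.quotKerEquivOfSurjective hs).symm (h x)) = _
      rw [this]
      rfl
    obtain ⟨f, hf⟩ := hf
    obtain ⟨g, hg⟩ := hg
    refine ⟨⟨⟨(f, g), ?_, ?_, ?_⟩, (φ, h ∘ₗ LinearMap.inr A PN PM), ?_, ?_⟩, ?_⟩
    · rw [injective_iff_map_eq_zero]
      intro x hx
      obtain ⟨y, rfl⟩ := hεN x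
      rw [hf, he] at hx
      obtain ⟨⟨w, z⟩, hz⟩ := hx
      rw [Prod.mk.injEq] at hz
      obtain rfl : z = 0 := hδM (by rw [hz.2, map_zero])
      rw [map_zero, add_zero] at hz
      rw [← hz.1]
      exact (hN _).2 ⟨w, rfl⟩
    · intro x
      obtain ⟨⟨n, z⟩, rfl⟩ := hs x
      change g _ = 0 ↔ _
      rw [hg, hM]
      constructor
      · rintro ⟨y, rfl⟩
        refine ⟨εN (n - φ y), ?_⟩
        change f _ = _
        rw [hf, ← sub_eq_zero, ← map_sub, he]
        exact ⟨(0, -y), by simp⟩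
      · rintro ⟨y, hy⟩
        obtain ⟨y, rfl⟩ := hεN y
        change f _ = _ at hy
        rw [hf, ← sub_eq_zero, ← map_sub, he] at hy
        obtain ⟨⟨w, x⟩, hx⟩ := hy
        exact ⟨-x, by simpa using congrArg (fun z => -z.2) hx⟩
    · intro x
      obtain ⟨y, rfl⟩ := hεM x
      exact ⟨h (0, y), hg _⟩
    · exact fun x => hg (0, x)
    · intro x
      change f _ + h (0, δM x) = 0
      rw [hf, ← map_add, he]
      exact ⟨(0, x), by simp⟩
    · have : (f ∘ₗ εN).coprod (h ∘ₗ LinearMap.inr A PN PM) = h := by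
        ext x
        · simp [hf]
        · simp
      refine Sigma.ext rfl (heq_of_eq (Subtype.ext this))

omit hεM in
include hδN in
/-- The lifts form a torsor under the homomorphisms `PM → N` and `ΩM → ΩN`. -/
theorem card_isLift_fiber [Module.Projective A ΩM] [Module.Projective A PM]
    (p : LinearExactPair A M N L) :
    Nat.card {q // IsLift δM εM εN p.1 q} =
      Nat.card (PM →ₗ[A] N) * Nat.card (ΩM →ₗ[A] ΩN) := by
  obtain ⟨⟨f, g⟩, hi, he, hs⟩ := p
  obtain ⟨t, ht⟩ := exists_comp_eq_of_range_le g εM fun x => hs (εM x)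
  have hφ : ∀ x, ∃ y, (f ∘ₗ εN) y = (-(t ∘ₗ δM)) x := by
    intro x
    obtain ⟨y, hy⟩ := (he ((-(t ∘ₗ δM)) x)).1 (by
      simp [ht, (hM _).2 ⟨x, rfl⟩])
    obtain ⟨z, rfl⟩ := hεN y
    exact ⟨z, hy⟩
  obtain ⟨φ, hφ⟩ := exists_comp_eq_of_range_le _ _ hφ
  -- Changing the lift of `εM` by `s : PM → N` changes the cocycle by a lift `σ s : PM → PN` of `s`.
  choose σ hσ using fun s : PM →ₗ[A] N => exists_comp_eq_of_range_le εN s fun x => hεN (s x)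
  rw [← Nat.card_prod]
  refine (Nat.card_congr (Equiv.ofBijective (fun r : (PM →ₗ[A] N) × (ΩM →ₗ[A] ΩN) =>
    (⟨(φ - σ r.1 ∘ₗ δM + δN ∘ₗ r.2, t + f ∘ₗ r.1), fun x => ?_, fun x => ?_⟩ :
      {q // IsLift δM εM εN (f, g) q})) ⟨?_, ?_⟩)).symm
  · simp [ht, (he _).2 ⟨r.1 x, rfl⟩]
  · have h3 := hφ x
    simp only [LinearMap.comp_apply, LinearMap.neg_apply] at h3
    simp [h3, hσ, (hN _).2 ⟨r.2 x, rfl⟩]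
  · rintro ⟨s, ψ⟩ ⟨s', ψ'⟩ h
    have h3 := congrArg Subtype.val h
    simp only [Prod.mk.injEq] at h3
    obtain rfl : s = s' := by
      ext x
      have := LinearMap.congr_fun h3.2 x
      simp only [LinearMap.add_apply, LinearMap.comp_apply, add_right_inj] at this
      exact hi this
    have h4 := h3.1
    obtain rfl : ψ = ψ' := by
      ext x
      have := LinearMap.congr_fun h4 x
      simp only [LinearMap.add_apply, LinearMap.comp_apply, add_right_inj] at this
      exact hδN this
    rfl
  · rintro ⟨⟨φ', t'⟩, h3, h4⟩
    simp only at h3 h4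
    obtain ⟨s, hs'⟩ := exists_comp_eq_of_range_le f (t' - t) fun x => (he _).1 (by
      rw [LinearMap.sub_apply, map_sub, h3, ht, sub_self])
    obtain ⟨ψ, hψ⟩ := exists_comp_eq_of_range_le δN (φ' - φ + σ s ∘ₗ δM) fun x => (hN _).1 (by
      refine hi ?_
      have h5 := hφ x
      have h6 := h4 x
      have h7 := hs' (δM x)
      simp only [LinearMap.comp_apply, LinearMap.neg_apply, LinearMap.sub_apply] at h5 h7
      simp only [LinearMap.add_apply, LinearMap.sub_apply, map_add, map_sub, LinearMap.comp_apply,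
        hσ, h5, h7, map_zero]
      rw [← h6]
      abel)
    refine ⟨(s, ψ), Subtype.ext (Prod.ext (LinearMap.ext fun x => ?_) (LinearMap.ext fun x => ?_))⟩
    · have h5 := hψ x
      simp only [LinearMap.add_apply, LinearMap.sub_apply, LinearMap.comp_apply] at h5
      simp only [LinearMap.add_apply, LinearMap.sub_apply, LinearMap.comp_apply, h5]
      abel
    · have h5 := hs' x
      simp only [LinearMap.sub_apply] at h5
      simp [h5]

end CountExtensions

/-! ### Products of elements given by modules in the same degree -/

section SameDegree

set_option linter.unusedSectionVars false

variable {A : Type u} [Ring A] {m : ℕ} {a : ZMod m}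

theorem IsTwoTerm.subsingleton_succ (h1 : (1 : ZMod m) ≠ 0) (h2 : (2 : ZMod m) ≠ 0)
    {T : ProjComplex A m} (hT : IsTwoTerm a T) : Subsingleton (T.X (a + 1)) :=
  hT _ (by simpa using h1) (by
    rw [add_assoc, one_add_one_eq_two]
    simpa using h2)

/-- Cocycles between complexes concentrated in the degrees `a - 1` and `a`. -/
noncomputable def cocycleEquivHom (h1 : (1 : ZMod m) ≠ 0) (h2 : (2 : ZMod m) ≠ 0)
    {T T' : ProjComplex A m} (hT : IsTwoTerm a T) (hT' : IsTwoTerm a T') :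
    Cocycle T T' ≃ (T.X (a - 1) →ₗ[A] T'.X a) where
  toFun φ := φ.f (a - 1) a
  invFun f := by
    classical
    exact
    { f := fun i j => if h : i = a - 1 ∧ j = a then h.1 ▸ h.2 ▸ f else 0
      shape := fun i j hij => by
        rw [dif_neg]
        rintro ⟨rfl, rfl⟩
        exact hij (sub_add_cancel _ _)
      cond := fun i j l x => by
        have hs := hT.subsingleton_succ h1 h2
        have hs' := hT'.subsingleton_succ h1 h2
        have e1 : T'.d j l ((if h : i = a - 1 ∧ j = a then h.1 ▸ h.2 ▸ f else 0 :
            T.X i →ₗ[A] T'.X j) x) = 0 := by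
          by_cases h : i = a - 1 ∧ j = a
          · obtain ⟨rfl, rfl⟩ := h
            by_cases hl : j + 1 = l
            · subst hl
              exact Subsingleton.elim _ _
            · rw [T'.d_eq_zero hl]; rfl
          · rw [dif_neg h, LinearMap.zero_apply, map_zero]
        have e2 : (if h : j = a - 1 ∧ l = a then h.1 ▸ h.2 ▸ f else 0 :
            T.X j →ₗ[A] T'.X l) (T.d i j x) = 0 := by
          by_cases h : j = a - 1 ∧ l = a
          · obtain ⟨rfl, rfl⟩ := h
            by_cases hi : i + 1 = l - 1
            · have : Subsingleton (T.X i) := by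
                refine hT i ?_ ?_
                · rintro rfl
                  apply h2
                  have : i + 1 + 1 = i := by rw [hi, sub_add_cancel]
                  rwa [add_assoc, one_add_one_eq_two, add_eq_left] at this
                · rw [hi]; simpa using h1
              rw [Subsingleton.elim x 0, map_zero, map_zero]
            · rw [T.d_eq_zero hi, LinearMap.zero_apply, map_zero]
          · rw [dif_neg h, LinearMap.zero_apply]
        rw [e1, e2, add_zero] }
  left_inv φ := by
    refine Cocycle.ext_succ fun i j hij x => ?_
    by_cases h : i = a - 1 ∧ j = a
    · obtain ⟨rfl, rfl⟩ := h
      simp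
    · simp only [dif_neg h]
      have hj : Subsingleton (T.X i) ∨ Subsingleton (T'.X j) := by
        by_cases hi : i = a
        · subst hi hij
          exact Or.inr (hT'.subsingleton_succ h1 h2)
        · refine Or.inl (hT i hi fun h' => h ⟨eq_sub_of_add_eq h', hij.symm.trans h'⟩)
      rcases hj with h | h
      · rw [Subsingleton.elim x 0]; simp
      · exact Subsingleton.elim _ _
  right_inv f := by simp

theorem resolves_twist {T T' : ProjComplex A m}
    (hT : IsTwoTerm a T) (hT' : IsTwoTerm a T') (hi : Function.Injective (T.d (a - 1) a))
    (hi' : Function.Injective (T'.d (a - 1) a)) (φ : Cocycle T T') {X : Type u} [AddCommGroup X]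
    [Module A X] (p : φ.twist.X a →ₗ[A] X) (hp : IsPushoutMap (T.d (a - 1) a) (T'.d (a - 1) a)
      (φ.f (a - 1) a) (show T'.X a × T.X a →ₗ[A] X from p)) : Resolves a φ.twist p where
  twoTerm i hia hib := by
    have := hT i hia hib
    have := hT' i hia hib
    exact inferInstanceAs (Subsingleton (T'.X i × T.X i))
  injective := by
    rw [injective_iff_map_eq_zero]
    rintro ⟨x, y⟩ h
    have h3 : ((T'.d (a - 1) a x + φ.f (a - 1) a y, T.d (a - 1) a y) : T'.X a × T.X a) = 0 := h
    rw [Prod.mk_eq_zero] at h3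
    obtain rfl : y = 0 := hi (by rw [h3.2, map_zero])
    obtain rfl : x = 0 := hi' (by simpa using h3.1)
    rfl
  exact z := hp.2 z
  surjective := hp.1

variable (k : Type v) [Field k] [Algebra k A] [Module.Finite k A]
  [IsHereditaryRing A] [Finite k] [Finite A]
variable (h1 : (1 : ZMod m) ≠ 0) (h2 : (2 : ZMod m) ≠ 0)
include h1 h2

omit [Finite k] h1 h2 in
theorem mul_mul_mul_comm_of_smul {B : Type*} [Ring B] [Algebra ℂ B] {x y z w : B} {c : ℂ}
    (h : y * z = c • (z * y)) : x * y * (z * w) = c • (x * z * (y * w)) := by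
  rw [mul_assoc, ← mul_assoc y, h, smul_mul_assoc, mul_smul_comm, mul_assoc, mul_assoc]

/-- The product formula for the elements of resolutions, before the cocycles are sorted by the
cokernel of the extension. -/
theorem resElt_mul_resElt {T T' : ProjComplex A m} {M N : Type u} [AddCommGroup M] [Module A M]
    [Module.Finite A M] [AddCommGroup N] [Module A N] [Module.Finite A N] {p : T.X a →ₗ[A] M}
    {p' : T'.X a →ₗ[A] N} (h : Resolves a T p) (h' : Resolves a T' p') :
    resElt k a T * resElt k a T' = vParam k ^ (-eulerForm k (cl A M) (cl A N) -
        2 * eulerForm k (T.cls (a - 1)) (T'.cls a)) •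
      ∑ φ : Cocycle T T', resElt k a φ.twist := by
  have e1 : ∀ φ : Cocycle T T', resElt k a φ.twist =
      vParam k ^ (eulerForm k (T'.cls (a - 1) + T.cls (a - 1)) (cl A N + cl A M)) •
      (kap k a (-T.cls (a - 1)) * kap k a (-T'.cls (a - 1)) * hallClass k φ.twist) := by
    intro φ
    rw [resElt, Cocycle.twist_cls, Cocycle.twist_cls, ← kap_add k h1 h2, h.cl_eq, h'.cl_eq]
    congr 3
    abel
  rw [Finset.sum_congr rfl fun φ _ => e1 φ, ← Finset.smul_sum, ← Finset.mul_sum, smul_smul,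
    resElt, resElt, smul_mul_smul_comm, h.cl_eq, h'.cl_eq, add_sub_cancel_left, add_sub_cancel_left]
  have e2 := kap_mul_comm k h1 h2 a (-T'.cls (a - 1)) T
  have e3 := hallClass_mul k T T'
  have e4 := congrArg (vParam k ^ (eulerComplex k T T') • ·) e3
  beta_reduce at e4
  rw [smul_smul, ← zpow_add₀ (vParam_ne_zero k), add_neg_cancel, zpow_zero, one_smul] at e4
  rw [← e4, mul_smul_comm, mul_mul_mul_comm_of_smul e2, smul_smul, smul_smul]
  congr 1
  rw [eulerComplex_twoTerm_left k h1 h.twoTerm, ← zpow_add₀ (vParam_ne_zero k),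
    ← zpow_add₀ (vParam_ne_zero k), ← zpow_add₀ (vParam_ne_zero k), ← zpow_add₀ (vParam_ne_zero k)]
  congr 1
  rw [h.cl_eq, h'.cl_eq]
  simp only [symEuler, map_add, map_sub, map_neg, AddMonoidHom.add_apply, AddMonoidHom.sub_apply,
    AddMonoidHom.neg_apply]
  ring

/-- The relation between the elements given by modules in a fixed degree. -/
theorem modElt_mul_modElt (M N : FGModuleCat.{u} A) :
    modElt k M a * modElt k N a = vParam k ^ eulerForm k (K0.mk M) (K0.mk N) •
      ∑ᶠ L : IsoMod A, ringelHallNumber M N L.out • modElt k L.out a := by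
  obtain ⟨T, p, h, e⟩ := exists_resolves_modElt k h1 h2 M a
  obtain ⟨T', p', h', e'⟩ := exists_resolves_modElt k h1 h2 N a
  let X : Cocycle T T' → FGModuleCat.{u} A := fun φ =>
    FGModuleCat.of A ((T'.X a × T.X a) ⧸ LinearMap.range (φ.twist.d (a - 1) a))
  have hX : ∀ φ : Cocycle T T', IsPushoutMap (T.d (a - 1) a) (T'.d (a - 1) a) (φ.f (a - 1) a)
      (show T'.X a × T.X a →ₗ[A] (X φ).obj from
        (LinearMap.range (φ.twist.d (a - 1) a)).mkQ) := fun φ =>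
    ⟨Submodule.mkQ_surjective _, fun z => Submodule.Quotient.mk_eq_zero _⟩
  have hres : ∀ φ, resElt k a φ.twist = (autCard (IsoMod.mk (X φ)).out : ℂ) •
      modElt k (IsoMod.mk (X φ)).out a := by
    intro φ
    obtain ⟨f⟩ := nonempty_equiv_out (X φ)
    rw [resElt_eq_smul_modElt k h1 h2
      (resolves_twist h.twoTerm h'.twoTerm h.injective h'.injective φ _ (hX φ)),
      autCard_congr f, modElt_congr k h1 h2 f]
  rw [e, e', smul_mul_smul_comm, resElt_mul_resElt k h1 h2 h h',
    Finset.sum_congr rfl fun φ _ => hres φ,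
    sum_eq_finsum_card (fun φ => IsoMod.mk (X φ)) fun q => (autCard q.out : ℂ) • modElt k q.out a,
    smul_smul, smul_finsum, smul_finsum]
  refine finsum_congr fun q => ?_
  rw [smul_smul, smul_smul, smul_smul]
  congr 1
  -- the number of cocycles with a given cokernel
  have c1 : Nat.card {φ : Cocycle T T' // IsoMod.mk (X φ) = q} * autCard q.out =
      Nat.card (LinearExactPair A M.obj N.obj q.out.obj) *
        (Nat.card (T.X a →ₗ[A] N.obj) * Nat.card (T.X (a - 1) →ₗ[A] T'.X (a - 1))) := by
    have hM : Function.Exact (T.d (a - 1) a) p := h.exact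
    have hN : Function.Exact (T'.d (a - 1) a) p' := h'.exact
    have d1 := card_isLift (L := q.out.obj) h.injective hM hN h.surjective h'.surjective
    have : Finite (LinearExactPair A M.obj N.obj q.out.obj) := Subtype.finite
    have := Fintype.ofFinite (LinearExactPair A M.obj N.obj q.out.obj)
    rw [Nat.card_sigma, Finset.sum_congr rfl fun r _ =>
      card_isLift_fiber h'.injective hM hN h'.surjective r, Finset.sum_const, Finset.card_univ,
      ← Nat.card_eq_fintype_card, smul_eq_mul,
      card_sigma_of_torsor _ (fun φ => Nonempty {h // IsPushoutMap (L := q.out.obj)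
        (T.d (a - 1) a) (T'.d (a - 1) a) φ h}) (autCard q.out)
        (fun φ ⟨h⟩ => by rw [autCard_eq]; exact card_isPushoutMap φ h.1 h.2) (fun φ h => ⟨h⟩)] at d1
    rw [d1]
    congr 1
    refine Nat.card_congr ((cocycleEquivHom h1 h2 h.twoTerm h'.twoTerm).subtypeEquiv fun φ => ?_)
    rw [isoMod_mk_eq_iff]
    constructor
    · rintro ⟨f⟩
      refine ⟨⟨f.toLinearMap ∘ₗ (LinearMap.range (φ.twist.d (a - 1) a)).mkQ, ?_, fun z => ?_⟩⟩
      · exact f.surjective.comp (hX φ).1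
      · exact f.map_eq_zero_iff.trans ((hX φ).2 z)
    · rintro ⟨f, hf⟩
      have hk : LinearMap.range (φ.twist.d (a - 1) a) = LinearMap.ker f := by
        ext z
        exact (hf.2 z).symm
      exact ⟨(Submodule.quotEquivOfEq _ _ hk).trans (f.quotKerEquivOfSurjective hf.1)⟩
  have c2 := extCard_mul_card_aut M.obj N.obj q.out.obj
  rw [card_iso_obj, card_exactPair] at c2
  have c1' := congrArg (Nat.cast : ℕ → ℂ) c1
  have c2' := congrArg (Nat.cast : ℕ → ℂ) c2
  simp only [Nat.cast_mul] at c1' c2'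
  rw [card_hom_projective k, card_hom_projective k, ← zpow_add₀ (vParam_ne_zero k)] at c1'
  have hH : (Nat.card (M.obj ⟶ N.obj) : ℂ) ≠ 0 := by
    have : Finite (M.obj ⟶ N.obj) := Finite.of_equiv _ ModuleCat.homEquiv.symm
    exact Nat.cast_ne_zero.2 Nat.card_pos.ne'
  have hq := autCard_ne_zero q.out
  have hMa := autCard_ne_zero M
  have hNa := autCard_ne_zero N
  rw [mul_assoc, mul_assoc, c1', ringelHallNumber]
  have c3 : (extCard M.obj N.obj q.out.obj : ℂ) / (Nat.card (M.obj ⟶ N.obj) : ℂ) *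
      ((autCard q.out : ℂ) / ((autCard M : ℂ) * (autCard N : ℂ))) =
      (Nat.card (LinearExactPair A M.obj N.obj q.out.obj) : ℂ) *
        ((autCard M : ℂ)⁻¹ * (autCard N : ℂ)⁻¹) := by
    field_simp
    rw [c2', mul_comm]
  rw [c3]
  -- The exponents of `v` agree since `T` and `T'` resolve `M` and `N`.
  have c4 : eulerForm k (K0.mk M) (K0.mk N) = -eulerForm k (cl A M.obj) (cl A N.obj) -
      2 * eulerForm k (T.cls (a - 1)) (T'.cls a) + (2 * eulerForm k (T.cls a) (cl A N.obj) +
      2 * eulerForm k (T.cls (a - 1)) (T'.cls (a - 1))) := by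
    change eulerForm k (cl A M.obj) (cl A N.obj) = _
    rw [h.cl_eq, h'.cl_eq]
    simp only [map_add, AddMonoidHom.add_apply]
    ring
  rw [c4, zpow_add₀ (vParam_ne_zero k) (-eulerForm k (cl A M.obj) (cl A N.obj) - _)]
  simp only [ProjComplex.cls]
  ring

end SameDegree

/-! ### Counting four-term exact sequences -/

section FourTerm

variable {A : Type u} [Ring A]

theorem card_linearEquiv_of_nonempty {X Y : Type*} [AddCommGroup X] [Module A X] [AddCommGroup Y]
    [Module A Y] (e : X ≃ₗ[A] Y) : Nat.card (X ≃ₗ[A] Y) = Nat.card (Y ≃ₗ[A] Y) :=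
  Nat.card_congr
    { toFun := fun f => e.symm.trans f
      invFun := fun f => e.trans f
      left_inv := fun f => by ext; simp
      right_inv := fun f => by ext; simp }

/-- The four-term exact sequence given by a map and by identifications of its kernel and its
cokernel. -/
def fourTermOf {M N X Y : FGModuleCat.{u} A} (q : Σ f : M.obj →ₗ[A] N.obj,
    (X.obj ≃ₗ[A] LinearMap.ker f) × ((N.obj ⧸ LinearMap.range f) ≃ₗ[A] Y.obj)) :
    FourTermExact M N X Y :=
  ⟨(q.1, (LinearMap.ker q.1).subtype ∘ₗ q.2.1.toLinearMap,
      q.2.2.toLinearMap ∘ₗ (LinearMap.range q.1).mkQ),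
    Subtype.val_injective.comp q.2.1.injective, fun x => by
      constructor
      · intro hx
        exact ⟨q.2.1.symm ⟨x, hx⟩, congrArg Subtype.val (q.2.1.apply_symm_apply ⟨x, hx⟩)⟩
      · rintro ⟨y, rfl⟩
        exact (q.2.1 y).2, fun x => by
      change q.2.2 (Submodule.Quotient.mk x) = 0 ↔ _
      rw [LinearEquiv.map_eq_zero_iff, Submodule.Quotient.mk_eq_zero]
      rfl, q.2.2.surjective.comp (Submodule.mkQ_surjective _)⟩

theorem fourTermOf_bijective (M N X Y : FGModuleCat.{u} A) :
    Function.Bijective (fourTermOf (M := M) (N := N) (X := X) (Y := Y)) := by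
  constructor
  · rintro ⟨f, e, g⟩ ⟨f', e', g'⟩ h
    have h0 := congrArg Subtype.val h
    have hf : f = f' := congrArg Prod.fst h0
    subst hf
    have he : e = e' := by
      ext x
      exact LinearMap.congr_fun (congrArg (fun p => p.2.1) h0) x
    have hg : g = g' := by
      ext x
      obtain ⟨y, rfl⟩ := Submodule.mkQ_surjective _ x
      exact LinearMap.congr_fun (congrArg (fun p => p.2.2) h0) y
    rw [he, hg]
  · rintro ⟨⟨f, e, g⟩, h3, h4, h5, h6⟩
    refine ⟨⟨f, LinearEquiv.ofBijective (LinearMap.codRestrict (LinearMap.ker f) e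
      fun x => (h4 _).2 ⟨x, rfl⟩) ⟨fun x y h => h3 (congrArg Subtype.val h), fun y => ?_⟩,
      (Submodule.quotEquivOfEq _ _ h5.linearMap_ker_eq.symm).trans
        (g.quotKerEquivOfSurjective h6)⟩, rfl⟩
    obtain ⟨x, hx⟩ := (h4 y.1).1 y.2
    exact ⟨x, Subtype.ext hx⟩

theorem card_fourTermExact [Finite A] (M N X Y : FGModuleCat.{u} A) :
    Nat.card (FourTermExact M N X Y) = Nat.card {f : M.obj →ₗ[A] N.obj //
      Nonempty (LinearMap.ker f ≃ₗ[A] X.obj) ∧ Nonempty ((N.obj ⧸ LinearMap.range f) ≃ₗ[A] Y.obj)} *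
      (autCard X * autCard Y) := by
  rw [← Nat.card_congr (Equiv.ofBijective _ (fourTermOf_bijective M N X Y))]
  have : ∀ f : M.obj →ₗ[A] N.obj, Finite ((X.obj ≃ₗ[A] LinearMap.ker f) ×
      ((N.obj ⧸ LinearMap.range f) ≃ₗ[A] Y.obj)) := fun f =>
    have : Finite (N.obj ⧸ LinearMap.range f) := Finite.of_surjective _ (Submodule.mkQ_surjective _)
    inferInstance
  refine card_sigma_of_torsor _ _ _ (fun f ⟨⟨e⟩, ⟨e'⟩⟩ => ?_) fun f e => ⟨⟨e.1.symm⟩, ⟨e.2⟩⟩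
  rw [Nat.card_prod, card_linearEquiv_of_nonempty e', autCard_eq, autCard_eq,
    ← card_linearEquiv_of_nonempty e]
  congr 1
  exact Nat.card_congr ⟨LinearEquiv.symm, LinearEquiv.symm, fun _ => rfl, fun _ => rfl⟩

end FourTerm

/-! ### Products of elements given by modules in different degrees -/

section DifferentDegrees

set_option linter.unusedSectionVars false

variable {A : Type u} [Ring A] {m : ℕ} {a b : ZMod m}

theorem IsTwoTerm.cls_eq_zero {T : ProjComplex A m} (hT : IsTwoTerm a T) {i : ZMod m} (hi : i ≠ a)
    (hi' : i + 1 ≠ a) : T.cls i = 0 :=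
  have := hT i hi hi'
  cl_of_subsingleton A (T.X i)

theorem cocycle_eq_zero (h1 : (1 : ZMod m) ≠ 0) (h2 : (2 : ZMod m) ≠ 0) (hab : b ≠ a)
    (hab' : b ≠ a + 1) {T T' : ProjComplex A m} (hT : IsTwoTerm a T) (hT' : IsTwoTerm b T')
    (hinj : Function.Injective (T'.d (b - 1) b)) (φ : Cocycle T T') : φ = 0 := by
  refine Cocycle.ext_succ fun i j hij x => ?_
  rw [Cocycle.zero_f, LinearMap.zero_apply]
  by_cases hi : i = a
  · subst hi hij
    by_cases hb : i + 1 + 1 = b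
    · have h3 := φ.cond i (i + 1) b x
      have := hT.subsingleton_succ h1 h2
      rw [Subsingleton.elim (T.d i (i + 1) x) 0, map_zero, add_zero] at h3
      have hb' : b - 1 = i + 1 := by rw [← hb, add_sub_cancel_right]
      rw [hb'] at hinj
      exact hinj (by rw [h3, map_zero])
    · have := hT' (i + 1) hab'.symm hb
      exact Subsingleton.elim _ _
  by_cases hi' : i + 1 = a
  · obtain rfl : j = a := hij.symm.trans hi'
    have := hT' j hab.symm hab'.symm
    exact Subsingleton.elim _ _
  · have := hT i hi hi'
    rw [Subsingleton.elim x 0, map_zero]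

/-- The cocycle with two given components. -/
theorem exists_cocycle (h1 : (1 : ZMod m) ≠ 0) (h2 : (2 : ZMod m) ≠ 0) {T T' : ProjComplex A m}
    (hT : IsTwoTerm (a - 1) T) (hT' : IsTwoTerm a T') (g : T.X (a - 1) →ₗ[A] T'.X a)
    (g' : T.X (a - 1 - 1) →ₗ[A] T'.X (a - 1))
    (hg : ∀ x, T'.d (a - 1) a (g' x) + g (T.d (a - 1 - 1) (a - 1) x) = 0) :
    ∃ φ : Cocycle T T', φ.f (a - 1) a = g := by
  classical
  have ha : a - 1 ≠ a := by simpa using h1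
  refine ⟨⟨fun i j => if h : i = a - 1 ∧ j = a then h.1 ▸ h.2 ▸ g else
    if h : i = a - 1 - 1 ∧ j = a - 1 then h.1 ▸ h.2 ▸ g' else 0, ?_, ?_⟩, by simp⟩
  · intro i j hij
    rw [dif_neg, dif_neg]
    · rintro ⟨rfl, rfl⟩; exact hij (sub_add_cancel _ _)
    · rintro ⟨rfl, rfl⟩; exact hij (sub_add_cancel _ _)
  · have hshape : ∀ i j : ZMod m, i + 1 ≠ j → (if h : i = a - 1 ∧ j = a then h.1 ▸ h.2 ▸ g else
        if h : i = a - 1 - 1 ∧ j = a - 1 then h.1 ▸ h.2 ▸ g' else 0 : T.X i →ₗ[A] T'.X j) = 0 := by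
      intro i j hij
      rw [dif_neg, dif_neg]
      · rintro ⟨rfl, rfl⟩; exact hij (sub_add_cancel _ _)
      · rintro ⟨rfl, rfl⟩; exact hij (sub_add_cancel _ _)
    intro i j l x
    by_cases hij : i + 1 = j
    swap
    · rw [hshape i j hij, T.d_eq_zero hij]; simp
    by_cases hjl : j + 1 = l
    swap
    · rw [hshape j l hjl, T'.d_eq_zero hjl]; simp
    by_cases hi : i = a - 1
    · subst hi
      obtain rfl : j = a := by rw [← hij, sub_add_cancel]
      subst hjl
      have := hT'.subsingleton_succ h1 h2
      exact Subsingleton.elim _ _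
    by_cases hi' : i = a - 1 - 1
    · subst hi'
      obtain rfl : j = a - 1 := by rw [← hij, sub_add_cancel]
      obtain rfl : l = a := by rw [← hjl, sub_add_cancel]
      have hne : ¬ (l - 1 - 1 = l - 1 ∧ l - 1 = l) := fun h => ha h.2
      rw [dif_neg hne]
      simpa using hg x
    · have := hT i hi (fun h => hi' (eq_sub_of_add_eq h))
      rw [Subsingleton.elim x 0]
      simp

theorem twist_apply {T T' : ProjComplex A m} (φ : Cocycle T T') (i j : ZMod m)
    (x : T'.X i × T.X i) :
    φ.twist.d i j x = ((T'.d i j x.1 + φ.f i j x.2, T.d i j x.2) : T'.X j × T.X j) := rfl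

section Twist

variable (h1 : (1 : ZMod m) ≠ 0) (h2 : (2 : ZMod m) ≠ 0) {T T' : ProjComplex A m}
  {M N : Type u} [AddCommGroup M] [Module A M] [AddCommGroup N] [Module A N]
  {p : T.X (a - 1) →ₗ[A] M} {p' : T'.X a →ₗ[A] N} (h : Resolves (a - 1) T p)
  (h' : Resolves a T' p')

include h h'

/-- Cocycles between resolutions in consecutive degrees induce maps of the modules. -/
theorem exists_map_of_cocycle (φ : Cocycle T T') :
    ∃ f : M →ₗ[A] N, ∀ x, f (p x) = p' (φ.f (a - 1) a x) := by
  have hk : LinearMap.ker p ≤ LinearMap.ker (p' ∘ₗ φ.f (a - 1) a) := by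
    intro x hx
    obtain ⟨y, rfl⟩ := (h.exact x).1 hx
    have h3 := φ.cond (a - 1 - 1) (a - 1) a y
    rw [LinearMap.mem_ker, LinearMap.comp_apply, eq_neg_of_add_eq_zero_right h3, map_neg,
      (h'.exact _).2 ⟨_, rfl⟩, neg_zero]
  refine ⟨(Submodule.liftQ _ _ hk) ∘ₗ (p.quotKerEquivOfSurjective h.surjective).symm.toLinearMap,
    fun x => ?_⟩
  have : (p.quotKerEquivOfSurjective h.surjective).symm (p x) = Submodule.Quotient.mk x := by
    rw [LinearEquiv.symm_apply_eq]; rfl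
  change Submodule.liftQ _ _ hk ((p.quotKerEquivOfSurjective h.surjective).symm (p x)) = _
  rw [this]
  rfl

include h1 h2

/-- The cocycles inducing a given map form a torsor under the homomorphisms `T_{a-1} → T'_{a-1}`,
that is, the homotopies between lifts of the map to the resolutions. -/
theorem card_cocycle_of_map (f : M →ₗ[A] N) :
    Nat.card {φ : Cocycle T T' // ∀ x, f (p x) = p' (φ.f (a - 1) a x)} =
      Nat.card (T.X (a - 1) →ₗ[A] T'.X (a - 1)) := by
  have hex : ∀ g : T.X (a - 1) →ₗ[A] T'.X a, (∀ x, f (p x) = p' (g x)) →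
      ∃ φ : Cocycle T T', φ.f (a - 1) a = g := by
    intro g hg
    obtain ⟨g', hg'⟩ := exists_comp_eq_of_range_le (T'.d (a - 1) a)
      (-(g ∘ₗ T.d (a - 1 - 1) (a - 1))) fun x => (h'.exact _).1 (by
        rw [LinearMap.neg_apply, map_neg, LinearMap.comp_apply, ← hg, (h.exact _).2 ⟨x, rfl⟩,
          map_zero, neg_zero])
    exact exists_cocycle h1 h2 h.twoTerm h'.twoTerm g g' fun x => by rw [hg']; simp
  have huniq : ∀ φ ψ : Cocycle T T', φ.f (a - 1) a = ψ.f (a - 1) a → φ = ψ := by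
    intro φ ψ hφψ
    refine Cocycle.ext_succ fun i j hij x => ?_
    by_cases hi : i = a - 1
    · subst hi
      obtain rfl : j = a := by rw [← hij, sub_add_cancel]
      rw [hφψ]
    by_cases hi' : i + 1 = a - 1
    · obtain rfl : j = a - 1 := hij.symm.trans hi'
      refine h'.injective ?_
      have h3 := φ.cond i (a - 1) a x
      have h4 := ψ.cond i (a - 1) a x
      rw [← hφψ] at h4
      exact add_right_cancel (h3.trans h4.symm)
    · have := h.twoTerm i hi hi'
      rw [Subsingleton.elim x 0, map_zero, map_zero]
  obtain ⟨g, hg⟩ := exists_comp_eq_of_range_le p' (f ∘ₗ p) fun x => h'.surjective _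
  have hc : ∀ s : T.X (a - 1) →ₗ[A] T'.X (a - 1), ∃ φ : Cocycle T T',
      φ.f (a - 1) a = g + T'.d (a - 1) a ∘ₗ s := fun s => hex _ fun x => by
    rw [LinearMap.add_apply, map_add, hg, LinearMap.comp_apply, LinearMap.comp_apply,
      (h'.exact _).2 ⟨_, rfl⟩, add_zero]
  choose c hc using hc
  refine (Nat.card_congr (Equiv.ofBijective (fun s => (⟨c s, fun x => ?_⟩ :
    {φ : Cocycle T T' // ∀ x, f (p x) = p' (φ.f (a - 1) a x)})) ⟨?_, ?_⟩)).symm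
  · rw [hc, LinearMap.add_apply, map_add, hg, LinearMap.comp_apply, LinearMap.comp_apply,
      (h'.exact _).2 ⟨_, rfl⟩, add_zero]
  · intro s s' hs
    have h3 := congrArg (fun φ => φ.1.f (a - 1) a) hs
    simp only [hc, add_right_inj] at h3
    ext x
    exact h'.injective (LinearMap.congr_fun h3 x)
  · rintro ⟨φ, hφ⟩
    obtain ⟨s, hs⟩ := exists_comp_eq_of_range_le (T'.d (a - 1) a) (φ.f (a - 1) a - g)
      fun x => (h'.exact _).1 (by
        rw [LinearMap.sub_apply, map_sub, hg, ← hφ, LinearMap.comp_apply, sub_self])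
    refine ⟨s, Subtype.ext (huniq _ _ ?_)⟩
    change (c s).f (a - 1) a = φ.f (a - 1) a
    rw [hc]
    ext x
    rw [LinearMap.add_apply, LinearMap.comp_apply, hs, LinearMap.sub_apply, add_sub_cancel]

/-- The homology of a twisted direct sum of resolutions in consecutive degrees: the cokernel of the
induced map. -/
theorem hasHomology_twist_coker (φ : Cocycle T T') {f : M →ₗ[A] N}
    (hf : ∀ x, f (p x) = p' (φ.f (a - 1) a x)) :
    HasHomology φ.twist a (N ⧸ LinearMap.range f) := by
  have hTa : Subsingleton (T.X a) := by
    have := h.twoTerm.subsingleton_succ h1 h2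
    rwa [sub_add_cancel] at this
  have hT' := h'.twoTerm.subsingleton_succ h1 h2
  have hd : ∀ z : T'.X a × T.X a, φ.twist.d a (a + 1) z = 0 := by
    intro z
    rw [twist_apply, Subsingleton.elim z.2 0, map_zero]
    exact Prod.ext (Subsingleton.elim _ _) (map_zero _)
  refine ⟨((LinearMap.range f).mkQ ∘ₗ p') ∘ₗ (LinearMap.fst A (T'.X a) (T.X a)) ∘ₗ
    (LinearMap.ker (φ.twist.d a (a + 1))).subtype, ?_, ?_⟩
  · intro y
    obtain ⟨y, rfl⟩ := Submodule.mkQ_surjective _ y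
    obtain ⟨x, rfl⟩ := h'.surjective y
    exact ⟨⟨((x, 0) : T'.X a × T.X a), hd _⟩, rfl⟩
  · rintro ⟨⟨n, x⟩, hz⟩
    change Submodule.Quotient.mk (p' n) = 0 ↔ _
    rw [Submodule.Quotient.mk_eq_zero]
    constructor
    · rintro ⟨y, hy⟩
      obtain ⟨w, rfl⟩ := h.surjective y
      rw [hf, ← sub_eq_zero, ← map_sub, h'.exact] at hy
      obtain ⟨u, hu⟩ := hy
      refine ⟨((-u, w) : T'.X (a - 1) × T.X (a - 1)), ?_⟩
      rw [twist_apply]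
      refine Prod.ext ?_ (Subsingleton.elim _ _)
      change T'.d (a - 1) a (-u) + φ.f (a - 1) a w = n
      rw [map_neg, hu]
      abel
    · rintro ⟨⟨y, w⟩, hy⟩
      have h3 : T'.d (a - 1) a y + φ.f (a - 1) a w = n := congrArg Prod.fst hy
      exact ⟨p w, by rw [hf, ← h3, map_add, (h'.exact _).2 ⟨y, rfl⟩, zero_add]⟩

/-- The homology of a twisted direct sum of resolutions in consecutive degrees: the kernel of the
induced map. -/
theorem hasHomology_twist_ker (φ : Cocycle T T') {f : M →ₗ[A] N}
    (hf : ∀ x, f (p x) = p' (φ.f (a - 1) a x)) :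
    HasHomology φ.twist (a - 1) (LinearMap.ker f) := by
  have hTa : Subsingleton (T.X a) := by
    have := h.twoTerm.subsingleton_succ h1 h2
    rwa [sub_add_cancel] at this
  have hd : ∀ z : T'.X (a - 1) × T.X (a - 1), φ.twist.d (a - 1) (a - 1 + 1) z = 0 ↔
      T'.d (a - 1) a z.1 + φ.f (a - 1) a z.2 = 0 := by
    intro z
    refine (φ.twist.mem_cyc (sub_add_cancel a 1)).trans ?_
    rw [twist_apply]
    exact ⟨fun h => congrArg Prod.fst h, fun h => Prod.ext h (Subsingleton.elim _ _)⟩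
  refine ⟨LinearMap.codRestrict _ (p ∘ₗ (LinearMap.snd A (T'.X (a - 1)) (T.X (a - 1))) ∘ₗ
    (LinearMap.ker (φ.twist.d (a - 1) (a - 1 + 1))).subtype) ?_, ?_, ?_⟩
  · rintro ⟨z, hz⟩
    change f (p z.2) = 0
    rw [hf, eq_neg_of_add_eq_zero_right ((hd z).1 hz), map_neg, (h'.exact _).2 ⟨_, rfl⟩, neg_zero]
  · rintro ⟨y, hy⟩
    obtain ⟨w, rfl⟩ := h.surjective y
    rw [LinearMap.mem_ker, hf] at hy
    obtain ⟨u, hu⟩ := (h'.exact _).1 hy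
    refine ⟨⟨((-u, w) : T'.X (a - 1) × T.X (a - 1)), (hd _).2 ?_⟩, rfl⟩
    rw [map_neg, hu, neg_add_cancel]
  · rintro ⟨⟨n, w⟩, hz⟩
    have h3 := (hd _).1 hz
    rw [Subtype.ext_iff]
    change p w = 0 ↔ _
    rw [h.exact]
    constructor
    · rintro ⟨y, rfl⟩
      have h4 := φ.cond (a - 1 - 1) (a - 1) a y
      refine ⟨((0, y) : T'.X (a - 1 - 1) × T.X (a - 1 - 1)), ?_⟩
      rw [twist_apply]
      refine Prod.ext ?_ rfl
      change T'.d (a - 1 - 1) (a - 1) 0 + φ.f (a - 1 - 1) (a - 1) y = n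
      rw [map_zero, zero_add]
      exact h'.injective (add_right_cancel (h4.trans h3.symm))
    · rintro ⟨⟨y, x⟩, hx⟩
      exact ⟨x, congrArg Prod.snd hx⟩

/-- A twisted direct sum of resolutions in consecutive degrees is the direct sum of resolutions of
the kernel and the cokernel of the induced map. -/
theorem exists_resolves_twist [IsHereditaryRing A] [IsNoetherianRing A] (φ : Cocycle T T')
    {f : M →ₗ[A] N} (hf : ∀ x, f (p x) = p' (φ.f (a - 1) a x)) :
    ∃ (S U : ProjComplex A m) (q : S.X (a - 1) →ₗ[A] LinearMap.ker f)
      (q' : U.X a →ₗ[A] (N ⧸ LinearMap.range f)), Nonempty (ComplexEquiv (directSum S U) φ.twist) ∧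
      Resolves (a - 1) S q ∧ Resolves a U q' := by
  have ha : a - 1 ≠ a := by simpa using h1
  have ha2 : a - 1 - 1 ≠ a := by
    rw [sub_sub, one_add_one_eq_two]; simpa using h2
  have hTa : Subsingleton (T.X a) := by
    have := h.twoTerm.subsingleton_succ h1 h2
    rwa [sub_add_cancel] at this
  have hT' := h'.twoTerm.subsingleton_succ h1 h2
  -- The summand `U` collects the homology in degree `a`; the complement `S` has no cycles in degree `a`.
  obtain ⟨S, U, ⟨e⟩, hS, hU, hUi, -, hS', -⟩ := exists_directSum φ.twist a h1
  -- elements of `S` as elements of the twisted direct sum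
  have hcomm : ∀ i j x, φ.twist.d i j (e.e i ((x, 0) : S.X i × U.X i)) =
      e.e j ((S.d i j x, 0) : S.X j × U.X j) := by
    intro i j x
    rw [← e.comm, directSum_d, map_zero]
  have hz : ∀ i x, e.e i ((x, 0) : S.X i × U.X i) = 0 → x = 0 := by
    intro i x hx
    rw [LinearEquiv.map_eq_zero_iff] at hx
    exact congrArg Prod.fst hx
  have hSt : IsTwoTerm (a - 1) S := by
    intro i hi hi'
    refine subsingleton_of_forall_eq 0 fun x => ?_
    by_cases hia : i = a
    · subst hia
      refine hS' x (hz _ _ ?_)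
      rw [← hcomm, twist_apply]
      rw [Subsingleton.elim (e.e i ((x, 0) : S.X i × U.X i) : T'.X i × T.X i).2 0, map_zero]
      exact Prod.ext (Subsingleton.elim _ _) (map_zero _)
    · have hT1 := h.twoTerm i hi hi'
      have hT2 := h'.twoTerm i hia fun h => hi (eq_sub_of_add_eq h)
      refine hz _ _ (show _ = (0 : T'.X i × T.X i) from Subsingleton.elim _ _)
  have hSi : Function.Injective (S.d (a - 1 - 1) (a - 1)) := by
    rw [injective_iff_map_eq_zero]
    intro x hx
    have h3 := hcomm (a - 1 - 1) (a - 1) x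
    rw [hx] at h3
    refine hz _ _ ?_
    have h4 : φ.twist.d (a - 1 - 1) (a - 1)
        (e.e (a - 1 - 1) ((x, 0) : S.X (a - 1 - 1) × U.X (a - 1 - 1))) =
        ((0, 0) : T'.X (a - 1) × T.X (a - 1)) := h3.trans (map_zero (e.e (a - 1)))
    have hT2 := h'.twoTerm (a - 1 - 1) ha2 (by rwa [sub_add_cancel])
    refine Prod.ext (show (_ : T'.X (a - 1 - 1)) = _ from Subsingleton.elim _ _) ?_
    refine h.injective ((congrArg Prod.snd h4).trans (map_zero _).symm)
  have hUh : HasHomology U a (N ⧸ LinearMap.range f) :=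
    (hasHomology_directSum_iff hS).1 (((hasHomology_twist_coker h1 h2 h h' φ hf).congr_left
      e.symm).congr_left (directSumComm S U))
  have hSh : HasHomology S (a - 1) (LinearMap.ker f) :=
    (hasHomology_directSum_iff (exactAt_sub_one hUi)).1
      ((hasHomology_twist_ker h1 h2 h h' φ hf).congr_left e.symm)
  obtain ⟨q, hq⟩ := resolves_of_hasHomology h1 h2 hSt hSi hSh
  obtain ⟨q', hq'⟩ := resolves_of_hasHomology h1 h2 hU hUi hUh
  exact ⟨S, U, q, q', ⟨e⟩, hq, hq'⟩

end Twist

end DifferentDegrees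

/-! ### The relations between elements given by modules in different degrees -/

section Relations

set_option linter.unusedSectionVars false

variable {A : Type u} [Ring A] {m : ℕ} {a b : ZMod m} (k : Type v) [Field k] [Algebra k A]
  [Module.Finite k A] [IsHereditaryRing A] [Finite k] [Finite A]
variable (h1 : (1 : ZMod m) ≠ 0) (h2 : (2 : ZMod m) ≠ 0)
include h1 h2

/-- The product of the classes of two-term complexes without cocycles between them. -/
theorem hallClass_mul_of_resolves (hab : b ≠ a) (hab' : b ≠ a + 1) {T T' : ProjComplex A m}
    (hT : IsTwoTerm a T) (hT' : IsTwoTerm b T') (hinj : Function.Injective (T'.d (b - 1) b)) :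
    hallClass k T * hallClass k T' = vParam k ^ (-eulerComplex k T T') •
      hallClass k (directSum T' T) := by
  have h0 := cocycle_eq_zero h1 h2 hab hab' hT hT' hinj
  have hu : Nat.card (Cocycle T T') = 1 := by
    have : Subsingleton (Cocycle T T') := ⟨fun φ ψ => (h0 φ).trans (h0 ψ).symm⟩
    exact Nat.card_unique
  rw [hallClass_mul_of_split k fun φ => ⟨0, by rw [h0 φ, h0 (Cocycle.cob 0)]⟩, hu, Nat.cast_one, mul_one]

theorem commute_of_hasWeight_zero {x : BridgelandHallAlgebra k A m} (h : HasWeight k a x 0)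
    (α : K0 A) : Commute (kap k a α) x := by
  have h3 := h α
  rwa [symEuler_zero, zpow_zero, one_smul] at h3

/-- Elements given by modules in distant degrees commute. -/
theorem modElt_commute (M N : FGModuleCat.{u} A) (hab : b ≠ a) (hab' : b ≠ a + 1)
    (hba : a ≠ b + 1) : modElt k M a * modElt k N b = modElt k N b * modElt k M a := by
  obtain ⟨T, p, h, e⟩ := exists_resolves_modElt k h1 h2 M a
  obtain ⟨T', p', h', e'⟩ := exists_resolves_modElt k h1 h2 N b
  have ha1 : a - 1 ≠ b := fun h => hba (by rw [← h, sub_add_cancel])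
  have ha2 : a - 1 + 1 ≠ b := by rw [sub_add_cancel]; exact hab.symm
  have hb1 : b - 1 ≠ a := fun h => hab' (by rw [← h, sub_add_cancel])
  have hb2 : b - 1 + 1 ≠ a := by rw [sub_add_cancel]; exact hab
  have c1 : Commute (hallClass k T) (hallClass k T') := by
    rw [Commute, SemiconjBy, hallClass_mul_of_resolves k h1 h2 hab hab' h.twoTerm h'.twoTerm h'.injective,
      hallClass_mul_of_resolves k h1 h2 hab.symm hba h'.twoTerm h.twoTerm h.injective,
      hallClass_congr k (directSumComm T T'), eulerComplex_twoTerm_left k h1 h.twoTerm,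
      eulerComplex_twoTerm_right k h1 h.twoTerm, h'.twoTerm.cls_eq_zero hab.symm hab'.symm,
      h'.twoTerm.cls_eq_zero ha1 ha2]
    simp
  have c2 : ∀ α, Commute (kap k a α) (hallClass k T') := fun α =>
    commute_of_hasWeight_zero k h1 h2 (by
      have h3 := hasWeight_hallClass k h1 h2 a T'
      rwa [h'.twoTerm.cls_eq_zero hab.symm hab'.symm, h'.twoTerm.cls_eq_zero ha1 ha2, sub_zero] at h3) α
  have c3 : ∀ α, Commute (kap k b α) (hallClass k T) := fun α =>
    commute_of_hasWeight_zero k h1 h2 (by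
      have h3 := hasWeight_hallClass k h1 h2 b T
      rwa [h.twoTerm.cls_eq_zero hab hba.symm, h.twoTerm.cls_eq_zero hb1 hb2, sub_zero] at h3) α
  have c4 : ∀ α β : K0 A, Commute (kap k a α) (kap k b β) := fun α β =>
    commute_of_hasWeight_zero k h1 h2 (by
      have h3 := hasWeight_kap k h1 h2 a b β
      rwa [if_neg (by tauto), if_neg (by tauto), sub_zero] at h3) α
  have c5 : Commute (resElt k a T) (resElt k b T') := by
    refine ((Commute.mul_right ?_ ?_).smul_right _).smul_left _
    · exact (c4 _ _).mul_left (c3 _).symm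
    · exact (c2 _).mul_left c1
  rw [e, e']
  exact (c5.smul_right _).smul_left _

/-- The product formula for the elements of resolutions in consecutive degrees, with the elements `K`
moved to the left. -/
theorem resElt_mul_resElt_of_adjacent {T T' : ProjComplex A m}
    {M N : Type u} [AddCommGroup M] [Module A M] [Module.Finite A M] [AddCommGroup N] [Module A N]
    [Module.Finite A N] {p : T.X (a - 1) →ₗ[A] M} {p' : T'.X a →ₗ[A] N} (h : Resolves (a - 1) T p)
    (h' : Resolves a T' p') :
    resElt k (a - 1) T * resElt k a T' =
      vParam k ^ (eulerForm k (T.cls (a - 1 - 1)) (cl A M) + eulerForm k (T'.cls (a - 1)) (cl A N) -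
        symEuler k (T'.cls (a - 1)) (T.cls (a - 1)) - eulerForm k (T.cls (a - 1)) (T'.cls (a - 1)) +
        symEuler k (T.cls (a - 1 - 1)) (T'.cls (a - 1))) •
      ∑ φ : Cocycle T T', (kap k a (-T'.cls (a - 1)) * kap k (a - 1) (-T.cls (a - 1 - 1)) *
        hallClass k φ.twist) := by
  have ha : a - 1 ≠ a := by simpa using h1
  have ha2 : a - 1 - 1 ≠ a := by
    rw [sub_sub, one_add_one_eq_two]; simpa using h2
  have e1 := kap_mul_comm k h1 h2 a (-T'.cls (a - 1)) T
  have hTa : T.cls a = 0 := h.twoTerm.cls_eq_zero ha.symm (fun h => h2 (by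
    rw [eq_sub_iff_add_eq, add_assoc, one_add_one_eq_two, add_eq_left] at h; exact h))
  have e2 := hasWeight_kap k h1 h2 (a - 1) a (-T'.cls (a - 1)) (-T.cls (a - 1 - 1))
  rw [if_pos (Or.inr (sub_add_cancel a 1)), if_neg (by
    rw [sub_add_cancel]; tauto), sub_zero] at e2
  have e3 := hallClass_mul k T T'
  rw [eulerComplex_twoTerm_left k h1 h.twoTerm,
    h'.twoTerm.cls_eq_zero ha2 (by rwa [sub_add_cancel]), map_zero, add_zero] at e3
  have e4 := congrArg (vParam k ^ (eulerForm k (T.cls (a - 1)) (T'.cls (a - 1))) • ·) e3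
  beta_reduce at e4
  rw [smul_smul, ← zpow_add₀ (vParam_ne_zero k), add_neg_cancel, zpow_zero, one_smul] at e4
  have e5 := mul_mul_mul_comm_of_smul (x := kap k (a - 1) (-T.cls (a - 1 - 1))) (w := hallClass k T') e1
  rw [hTa, e2] at e5
  rw [← Finset.mul_sum, ← e4, resElt, resElt, smul_mul_smul_comm, mul_smul_comm]
  have e6 := congrArg (vParam k ^ (-symEuler k (-T'.cls (a - 1)) (0 - T.cls (a - 1))) • ·) e5
  beta_reduce at e6
  rw [smul_smul (vParam k ^ (-symEuler k (-T'.cls (a - 1)) (0 - T.cls (a - 1)))),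
    ← zpow_add₀ (vParam_ne_zero k), neg_add_cancel, zpow_zero, one_smul] at e6
  rw [← e6, smul_mul_assoc, smul_smul, smul_smul, smul_smul, ← zpow_add₀ (vParam_ne_zero k),
    ← zpow_add₀ (vParam_ne_zero k), ← zpow_add₀ (vParam_ne_zero k), ← zpow_add₀ (vParam_ne_zero k),
    h.cl_eq, h'.cl_eq]
  congr 2
  simp only [symEuler, map_add, map_sub, map_neg, map_zero, AddMonoidHom.add_apply,
    AddMonoidHom.sub_apply, AddMonoidHom.neg_apply, AddMonoidHom.zero_apply]
  ring

/-- In the reversed order there are no cocycles, so that the product of the elements of two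
resolutions is given by their direct sum `W`. -/
theorem kap_mul_resElt_mul_resElt {S U W : ProjComplex A m}
    {X Y : Type u} [AddCommGroup X] [Module A X] [Module.Finite A X] [AddCommGroup Y] [Module A Y]
    [Module.Finite A Y] {q : S.X (a - 1) →ₗ[A] X} {q' : U.X a →ₗ[A] Y} (h : Resolves (a - 1) S q)
    (h' : Resolves a U q') (e : ComplexEquiv (directSum S U) W) (ι : K0 A) :
    kap k a ι * resElt k a U * resElt k (a - 1) S =
      vParam k ^ (eulerForm k (U.cls (a - 1)) (cl A Y) + eulerForm k (S.cls (a - 1 - 1)) (cl A X) +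
        symEuler k (S.cls (a - 1 - 1)) (U.cls (a - 1)) - eulerForm k (U.cls (a - 1)) (S.cls (a - 1))) •
      (kap k a (ι - U.cls (a - 1)) * kap k (a - 1) (-S.cls (a - 1 - 1)) * hallClass k W) := by
  have ha : a - 1 ≠ a := by simpa using h1
  have ha2 : a - 1 - 1 ≠ a := by
    rw [sub_sub, one_add_one_eq_two]; simpa using h2
  have hSa : S.cls a = 0 := h.twoTerm.cls_eq_zero ha.symm (fun h => h2 (by
    rw [eq_sub_iff_add_eq, add_assoc, one_add_one_eq_two, add_eq_left] at h; exact h))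
  have e1 := kap_mul_comm k h1 h2 (a - 1) (-S.cls (a - 1 - 1)) U
  rw [h'.twoTerm.cls_eq_zero ha2 (by rwa [sub_add_cancel]), sub_zero] at e1
  have e2 := hallClass_mul_of_resolves k h1 h2 ha (fun h => h2 (by
    rw [eq_comm, eq_sub_iff_add_eq, add_assoc, one_add_one_eq_two, add_eq_left] at h; exact h))
    h'.twoTerm h.twoTerm h.injective
  rw [hallClass_congr k e, eulerComplex_twoTerm_left k h1 h'.twoTerm, hSa, map_zero, zero_add] at e2
  have e5 := mul_mul_mul_comm_of_smul (x := kap k a (-U.cls (a - 1))) (w := hallClass k S) e1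
  rw [e2] at e5
  have e6 := congrArg (vParam k ^ (-symEuler k (-S.cls (a - 1 - 1)) (U.cls (a - 1))) • ·) e5
  beta_reduce at e6
  rw [smul_smul _ _ (_ * _), ← zpow_add₀ (vParam_ne_zero k), neg_add_cancel, zpow_zero, one_smul] at e6
  rw [resElt, resElt, mul_assoc (kap k a ι), smul_mul_smul_comm, ← e6, sub_eq_add_neg ι,
    kap_add k h1 h2 a ι]
  simp only [mul_smul_comm, smul_smul, ← mul_assoc]
  simp only [← zpow_add₀ (vParam_ne_zero k)]
  rw [h.cl_eq, h'.cl_eq, add_sub_cancel_left, add_sub_cancel_left]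
  congr 2
  simp only [symEuler, map_add, map_neg, AddMonoidHom.neg_apply]
  ring

/-- The relation between the elements given by modules in consecutive degrees. -/
theorem modElt_mul_modElt_of_adjacent (M N : FGModuleCat.{u} A) :
    modElt k M (a - 1) * modElt k N a = ∑ᶠ q : IsoMod A × IsoMod A,
      (vParam k ^ eulerForm k (K0.mk M - K0.mk q.1.out) (K0.mk q.1.out - K0.mk q.2.out) *
        gammaNumber M N q.1.out q.2.out) •
      (kap k a (K0.mk M - K0.mk q.1.out) * modElt k q.2.out a * modElt k q.1.out (a - 1)) := by
  have ha : a - 1 ≠ a := by simpa using h1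
  have ha2 : a - 1 - 1 ≠ a := by
    rw [sub_sub, one_add_one_eq_two]; simpa using h2
  have ha3 : a ≠ a - 1 - 1 + 1 := by rw [sub_add_cancel]; exact ha.symm
  have ha4 : a + 1 ≠ a - 1 := fun h => h2 (by
    rw [eq_sub_iff_add_eq, add_assoc, one_add_one_eq_two, add_eq_left] at h; exact h)
  obtain ⟨T, p, h, e⟩ := exists_resolves_modElt k h1 h2 M (a - 1)
  obtain ⟨T', p', h', e'⟩ := exists_resolves_modElt k h1 h2 N a
  choose F hF using exists_map_of_cocycle h h'
  let X : (M.obj →ₗ[A] N.obj) → FGModuleCat.{u} A := fun f => FGModuleCat.of A (LinearMap.ker f)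
  let Y : (M.obj →ₗ[A] N.obj) → FGModuleCat.{u} A := fun f =>
    FGModuleCat.of A (N.obj ⧸ LinearMap.range f)
  let c : (M.obj →ₗ[A] N.obj) → IsoMod A × IsoMod A := fun f => (IsoMod.mk (X f), IsoMod.mk (Y f))
  let u : IsoMod A × IsoMod A → BridgelandHallAlgebra k A m := fun q =>
    (vParam k ^ eulerForm k (K0.mk M - K0.mk q.1.out) (K0.mk q.1.out - K0.mk q.2.out) *
        ((autCard q.1.out : ℂ) * (autCard q.2.out : ℂ))) •
      (kap k a (K0.mk M - K0.mk q.1.out) * modElt k q.2.out a * modElt k q.1.out (a - 1))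
  have key : resElt k (a - 1) T * resElt k a T' =
      vParam k ^ (-(2 * eulerForm k (T.cls (a - 1)) (T'.cls (a - 1)))) •
        ∑ φ : Cocycle T T', u (c (F φ)) := by
    rw [resElt_mul_resElt_of_adjacent k h1 h2 h h', Finset.smul_sum, Finset.smul_sum]
    refine Finset.sum_congr rfl fun φ _ => ?_
    obtain ⟨S, U, q, q', ⟨f⟩, hS, hU⟩ := exists_resolves_twist h1 h2 h h' φ (hF φ)
    obtain ⟨eX⟩ := nonempty_equiv_out (X (F φ))
    obtain ⟨eY⟩ := nonempty_equiv_out (Y (F φ))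
    have hX : K0.mk (IsoMod.mk (X (F φ))).out = cl A (LinearMap.ker (F φ)) := (cl_congr eX).symm
    have hY : K0.mk (IsoMod.mk (Y (F φ))).out = cl A (N.obj ⧸ LinearMap.range (F φ)) :=
      (cl_congr eY).symm
    have hu : u (c (F φ)) = vParam k ^ eulerForm k (cl A M.obj - cl A (LinearMap.ker (F φ)))
        (cl A (LinearMap.ker (F φ)) - cl A (N.obj ⧸ LinearMap.range (F φ))) •
        (kap k a (cl A M.obj - cl A (LinearMap.ker (F φ))) * resElt k a U * resElt k (a - 1) S) := by
      rw [resElt_eq_smul_modElt k h1 h2 (hU.congr_right eY),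
        resElt_eq_smul_modElt k h1 h2 (hS.congr_right eX), mul_smul_comm, mul_smul_comm,
        smul_mul_assoc, smul_smul, smul_smul]
      simp only [u, c, hX, hY, mul_assoc]
      rfl
    -- The classes of the modules of `S` and `U` are determined by those of `T`, `T'` and the kernel.
    have k1 := ProjComplex.cls_congr f a
    have k2 := ProjComplex.cls_congr f (a - 1)
    have k3 := ProjComplex.cls_congr f (a - 1 - 1)
    rw [Cocycle.twist_cls, Cocycle.twist_cls, hS.twoTerm.cls_eq_zero ha.symm ha4,
      h.twoTerm.cls_eq_zero ha.symm ha4, zero_add, add_zero] at k1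
    rw [Cocycle.twist_cls, Cocycle.twist_cls, hS.cl_eq, h.cl_eq] at k2
    rw [Cocycle.twist_cls, Cocycle.twist_cls, hU.twoTerm.cls_eq_zero ha2 (by rwa [sub_add_cancel]),
      h'.twoTerm.cls_eq_zero ha2 (by rwa [sub_add_cancel]), zero_add, add_zero] at k3
    rw [hU.cl_eq, h'.cl_eq] at k1
    rw [k3] at k2
    have k4 : U.cls (a - 1) = T'.cls (a - 1) + cl A M.obj - cl A (LinearMap.ker (F φ)) := by
      rw [eq_sub_iff_add_eq, ← add_left_cancel_iff (a := T.cls (a - 1 - 1))]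
      calc _ = T.cls (a - 1 - 1) + cl A (LinearMap.ker (F φ)) + U.cls (a - 1) := by abel
        _ = _ := k2
        _ = _ := by abel
    have k5 : cl A (N.obj ⧸ LinearMap.range (F φ)) =
        cl A N.obj - cl A M.obj + cl A (LinearMap.ker (F φ)) := by
      rw [k4] at k1
      rw [← add_left_cancel_iff (a := T'.cls (a - 1) + cl A M.obj - cl A (LinearMap.ker (F φ))), k1]
      abel
    have k6 : cl A M.obj - cl A (LinearMap.ker (F φ)) - U.cls (a - 1) = -T'.cls (a - 1) := by
      rw [k4]; abel
    rw [hu, kap_mul_resElt_mul_resElt k h1 h2 hS hU f, k6, k3, smul_smul, smul_smul,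
      ← zpow_add₀ (vParam_ne_zero k), ← zpow_add₀ (vParam_ne_zero k), hS.cl_eq, k3, h.cl_eq, k4, k5]
    congr 2
    simp only [symEuler, map_add, map_sub, AddMonoidHom.add_apply, AddMonoidHom.sub_apply]
    ring
  rw [e, e', smul_mul_smul_comm, key, sum_eq_finsum_card (fun φ => c (F φ)) u, smul_smul,
    smul_finsum]
  refine finsum_congr fun q => ?_
  simp only [u]
  rw [smul_smul, smul_smul]
  congr 1
  -- Every map `M → N` is induced by the same number of cocycles.
  have n1 : Nat.card {φ : Cocycle T T' // c (F φ) = q} =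
      Nat.card {f : M.obj →ₗ[A] N.obj // c f = q} *
        Nat.card (T.X (a - 1) →ₗ[A] T'.X (a - 1)) := by
    have n2 : Nat.card (Σ f : M.obj →ₗ[A] N.obj, {φ : Cocycle T T' // c f = q ∧
        ∀ x, f (p x) = p' (φ.f (a - 1) a x)}) = Nat.card {f : M.obj →ₗ[A] N.obj // c f = q} *
        Nat.card (T.X (a - 1) →ₗ[A] T'.X (a - 1)) := by
      refine card_sigma_of_torsor _ _ _ (fun f hf => ?_) fun f φ => φ.2.1
      rw [← card_cocycle_of_map h1 h2 h h' f]
      exact Nat.card_congr (Equiv.subtypeEquivRight fun φ => and_iff_right hf)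
    rw [← n2]
    refine Nat.card_congr
      { toFun := fun φ => ⟨F φ.1, φ.1, φ.2, hF φ.1⟩
        invFun := fun r => ⟨r.2.1, ?_⟩
        left_inv := fun φ => rfl
        right_inv := ?_ }
    · have : F r.2.1 = r.1 := by
        ext x
        obtain ⟨y, rfl⟩ := h.surjective x
        rw [hF, r.2.2.2]
      rw [this]
      exact r.2.2.1
    · rintro ⟨f, φ, hφ, hφ'⟩
      have : F φ = f := by
        ext x
        obtain ⟨y, rfl⟩ := h.surjective x
        rw [hF, hφ']
      subst this
      rfl
  have n3 : Nat.card {f : M.obj →ₗ[A] N.obj // c f = q} * (autCard q.1.out * autCard q.2.out) =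
      Nat.card (FourTermExact M N q.1.out q.2.out) := by
    rw [card_fourTermExact]
    congr 1
    refine Nat.card_congr (Equiv.subtypeEquivRight fun f => ?_)
    rw [Prod.ext_iff]
    exact and_congr isoMod_mk_eq_iff isoMod_mk_eq_iff
  have n3' := congrArg (Nat.cast : ℕ → ℂ) n3
  simp only [Nat.cast_mul] at n3'
  rw [n1, gammaNumber, ← n3', Nat.cast_mul, card_hom_projective k, zpow_neg]
  have hv := zpow_ne_zero (2 * eulerForm k (T.cls (a - 1)) (T'.cls (a - 1))) (vParam_ne_zero k)
  have hMa := autCard_ne_zero M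
  have hNa := autCard_ne_zero N
  simp only [ProjComplex.cls] at hv ⊢
  field_simp

end Relations

/-! ### The homomorphism from the lattice algebra -/

section FiniteIso

variable {A : Type u} [Ring A]

/-- There are only finitely many modules of bounded cardinality, up to isomorphism. -/
theorem finite_isoMod_card_le [Finite A] (n : ℕ) :
    {q : IsoMod A | Nat.card q.out.obj ≤ n}.Finite := by
  have : Finite (Submodule A (Fin n → A)) := Finite.of_injective _ SetLike.coe_injective
  refine (Set.finite_range fun S : Submodule A (Fin n → A) =>
    IsoMod.mk (FGModuleCat.of A ((Fin n → A) ⧸ S))).subset fun q hq => ?_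
  have := Fintype.ofFinite q.out.obj
  rw [Set.mem_ofPred_eq, Nat.card_eq_fintype_card] at hq
  obtain ⟨f⟩ : Nonempty (q.out.obj ↪ Fin n) :=
    Function.Embedding.nonempty_of_card_le (by simpa using hq)
  have hs : Function.Surjective (Function.invFun f) := Function.invFun_surjective f.injective
  let g : (Fin n → A) →ₗ[A] q.out.obj := Fintype.linearCombination A (Function.invFun f)
  have hg : Function.Surjective g := by
    classical
    intro x
    obtain ⟨i, rfl⟩ := hs x
    exact ⟨Pi.single i 1, by simp [g, Fintype.linearCombination_apply_single]⟩
  exact ⟨LinearMap.ker g, isoMod_mk_eq_iff.2 ⟨g.quotKerEquivOfSurjective hg⟩⟩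

theorem finite_support_ringelHallNumber [Finite A] (M N : FGModuleCat.{u} A) :
    {L : IsoMod A | ringelHallNumber M N L.out ≠ 0}.Finite := by
  refine (finite_isoMod_card_le (Nat.card N.obj * Nat.card M.obj)).subset fun L hL => ?_
  have h0 : extCard M.obj N.obj L.out.obj ≠ 0 := by
    intro h
    exact hL (by rw [ringelHallNumber, h]; simp)
  have h3 := extCard_mul_card_aut M.obj N.obj L.out.obj
  rw [card_exactPair, card_iso_obj] at h3
  have h4 : Nat.card (LinearExactPair A M.obj N.obj L.out.obj) ≠ 0 := by
    intro h
    rw [h, zero_mul] at h3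
    have h5 := autCard_ne_zero L.out
    rcases Nat.mul_eq_zero.1 h3 with h | h
    · exact h0 h
    · exact h5 (by rw [h, Nat.cast_zero])
  obtain ⟨⟨⟨f, g⟩, hi, he, hs⟩⟩ := (Nat.card_ne_zero.1 h4).1
  obtain ⟨s, hs'⟩ := hs.hasRightInverse
  rw [Set.mem_ofPred_eq, ← Nat.card_prod]
  refine Nat.card_le_card_of_surjective (fun p : N.obj × M.obj => f p.1 + s p.2) fun x => ?_
  obtain ⟨y, hy⟩ := (he (x - s (g x))).1 (by rw [map_sub]; exact sub_eq_zero.2 (hs' _).symm)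
  exact ⟨(y, g x), by
    change f y + s (g x) = x
    rw [hy, sub_add_cancel]⟩

theorem finite_support_gammaNumber [Finite A] (M N : FGModuleCat.{u} A) :
    {q : IsoMod A × IsoMod A | gammaNumber M N q.1.out q.2.out ≠ 0}.Finite := by
  refine ((finite_isoMod_card_le (Nat.card M.obj)).prod
    (finite_isoMod_card_le (Nat.card N.obj))).subset fun q hq => ?_
  have h4 : Nat.card (FourTermExact M N q.1.out q.2.out) ≠ 0 := by
    intro h
    exact hq (by rw [gammaNumber, h]; simp)
  obtain ⟨⟨⟨f, g, h⟩, h1, h2, h3, h4⟩⟩ := (Nat.card_ne_zero.1 h4).1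
  exact ⟨Nat.card_le_card_of_injective g h1, Nat.card_le_card_of_surjective h h4⟩

end FiniteIso

section Hom

set_option linter.unusedSectionVars false

variable {A : Type u} [Ring A] {m : ℕ} (k : Type v) [Field k] [Algebra k A]
  [Module.Finite k A] [IsHereditaryRing A] [Finite k] [Finite A]

/-- The images of the generators of the lattice algebra. -/
noncomputable def genElt : LatticeGen A m → BridgelandHallAlgebra k A m
  | .Z q i => modElt k q.out (-i)
  | .K α i => kap k (-i) α

variable (h1 : (1 : ZMod m) ≠ 0) (h2 : (2 : ZMod m) ≠ 0)
include h1 h2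

theorem lift_freeZ_mk (M : FGModuleCat.{u} A) (i : ZMod m) :
    FreeAlgebra.lift ℂ (genElt k) (freeZ (IsoMod.mk M) i) = modElt k M (-i) := by
  rw [freeZ, FreeAlgebra.lift_ι_apply]
  obtain ⟨e⟩ := nonempty_equiv_out M
  exact (modElt_congr k h1 h2 e _).symm

omit h1 h2 in
theorem lift_freeZ (q : IsoMod A) (i : ZMod m) :
    FreeAlgebra.lift ℂ (genElt k) (freeZ q i) = modElt k q.out (-i) :=
  FreeAlgebra.lift_ι_apply _ _

omit h1 h2 in
theorem lift_freeK (α : K0 A) (i : ZMod m) :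
    FreeAlgebra.lift ℂ (genElt k) (freeK α i) = kap k (-i) α :=
  FreeAlgebra.lift_ι_apply _ _

/-- The generators of Bridgeland's Hall algebra satisfy the relations of the lattice algebra. The index
`i` of the lattice algebra corresponds to the degree `-i`. -/
theorem lift_genElt_rel {x y : FreeAlgebra ℂ (LatticeGen A m)} (h : LatticeRel k A m x y) :
    FreeAlgebra.lift ℂ (genElt k) x = FreeAlgebra.lift ℂ (genElt k) y := by
  have hz : ((m : ZMod m) : ZMod m) = 0 := by simp
  induction h with
  | K_zero i => rw [lift_freeK, map_one, kap_zero k h1 h2]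
  | Z_zero M hM i => rw [lift_freeZ_mk k h1 h2, map_one, modElt_of_subsingleton k h1 h2 M hM]
  | K_add α β i => rw [map_mul, lift_freeK, lift_freeK, lift_freeK, kap_add k h1 h2]
  | K_K α β i j =>
    rw [map_smul, map_mul, map_mul, lift_freeK, lift_freeK, hasWeight_kap k h1 h2 (-i) (-j) β α]
    congr 1
    have c1 : (-i = -j ∨ -i + 1 = -j) ↔ (i = j ∨ i = j + 1) := by
      refine or_congr neg_inj ⟨fun h => ?_, fun h => ?_⟩
      · linear_combination -h
      · linear_combination -h
    have c2 : (-i - 1 = -j ∨ -i - 1 + 1 = -j) ↔ (i = (m : ZMod m) - 1 + j ∨ i = j) := by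
      rw [sub_add_cancel, hz]
      refine or_congr ⟨fun h => ?_, fun h => ?_⟩ neg_inj
      · linear_combination -h
      · linear_combination -h
    simp only [c1, c2]
    by_cases hij : i = j
    · subst hij
      simp [h1]
    by_cases hij' : i = j + 1
    · subst hij'
      have : ¬ j + 1 = (m : ZMod m) - 1 + j := by
        rw [hz]
        intro h
        exact h2 (by linear_combination h)
      simp only [this, h1, if_true, or_true, if_false, add_eq_left, or_false, sub_zero]
    · by_cases h3 : i = (m : ZMod m) - 1 + j
      · simp only [hij, hij', h3.symm, if_true, if_false, or_false, zero_sub,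
          symEuler_neg]
      · simp only [hij, hij', h3, if_false, or_self, sub_zero, symEuler_zero, zpow_zero]
  | K_Z α M i j =>
    rw [map_smul, map_mul, map_mul, lift_freeK, lift_freeZ_mk k h1 h2,
      hasWeight_modElt k h1 h2 M (-i) (-j) α]
    congr 1
    have c2 : (-i = -j + 1) ↔ (i = (m : ZMod m) - 1 + j) := by
      rw [hz]
      refine ⟨fun h => ?_, fun h => ?_⟩
      · linear_combination -h
      · linear_combination -h
    simp only [c2, neg_inj]
    by_cases hij : i = j
    · subst hij
      have : ¬ i = (m : ZMod m) - 1 + i := by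
        rw [hz]
        intro h
        exact h1 (by linear_combination h)
      simp only [this, if_true, if_false, sub_zero]
    · by_cases h3 : i = (m : ZMod m) - 1 + j
      · simp only [hij, h3.symm, if_true, if_false, zero_sub, symEuler_neg]
      · simp only [hij, h3, if_false, sub_zero, symEuler_zero, zpow_zero]
  | Z_Z_same M N i =>
    rw [map_smul, map_mul, lift_freeZ_mk k h1 h2, lift_freeZ_mk k h1 h2,
      modElt_mul_modElt k h1 h2, map_finsum]
    · simp only [map_smul, lift_freeZ]
    · refine (finite_support_ringelHallNumber M N).subset fun L hL h => hL ?_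
      beta_reduce
      rw [h, zero_smul]
  | Z_Z_adjacent M N i =>
    rw [map_mul, lift_freeZ_mk k h1 h2, lift_freeZ_mk k h1 h2, neg_add', map_finsum,
      modElt_mul_modElt_of_adjacent k h1 h2]
    · simp only [map_smul, map_mul, lift_freeZ, lift_freeK, neg_add']
    · refine (finite_support_gammaNumber M N).subset fun q hq h => hq ?_
      beta_reduce
      rw [h, mul_zero, zero_smul]
  | Z_Z_far M N i j h₀ h₁ h₂ =>
    rw [map_mul, map_mul, lift_freeZ_mk k h1 h2, lift_freeZ_mk k h1 h2]
    rw [hz] at h₂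
    refine modElt_commute k h1 h2 M N (fun h => h₀ ?_) (fun h => h₁ ?_) (fun h => h₂ ?_)
    · linear_combination h
    · linear_combination h
    · linear_combination -h

/-- The homomorphism from the lattice algebra to Bridgeland's Hall algebra. -/
noncomputable def latticeHom : LatticeAlgebra k A m →ₐ[ℂ] BridgelandHallAlgebra k A m :=
  RingQuot.liftAlgHom ℂ ⟨FreeAlgebra.lift ℂ (genElt k), fun _ _ h => lift_genElt_rel k h1 h2 h⟩

theorem latticeHom_latticeZ (M : FGModuleCat.{u} A) (i : ZMod m) :
    latticeHom k h1 h2 (latticeZ k M i) = modElt k M (-i) := by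
  rw [latticeHom, latticeZ, RingQuot.liftAlgHom_mkAlgHom_apply, lift_freeZ_mk k h1 h2]

theorem latticeHom_latticeK (α : K0 A) (i : ZMod m) :
    latticeHom k h1 h2 (latticeK k α i) = kap k (-i) α := by
  rw [latticeHom, latticeK, RingQuot.liftAlgHom_mkAlgHom_apply, lift_freeK]

end Hom

/-! ### Surjectivity -/

section Surjective

set_option linter.unusedSectionVars false

variable {A : Type u} [Ring A] {m : ℕ} (k : Type v) [Field k] [Algebra k A]
  [Module.Finite k A] [IsHereditaryRing A] [Finite k] [Finite A]
variable (h1 : (1 : ZMod m) ≠ 0) (h2 : (2 : ZMod m) ≠ 0)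
include h1 h2

theorem kap_mem_range (a : ZMod m) (α : K0 A) : kap k a α ∈ (latticeHom (A := A) k h1 h2).range :=
  ⟨latticeK k α (-a), by
    change latticeHom k h1 h2 _ = _
    rw [latticeHom_latticeK, neg_neg]⟩

theorem modElt_mem_range (M : FGModuleCat.{u} A) (a : ZMod m) :
    modElt k M a ∈ (latticeHom (A := A) k h1 h2).range :=
  ⟨latticeZ k M (-a), by
    change latticeHom k h1 h2 _ = _
    rw [latticeHom_latticeZ, neg_neg]⟩

theorem hallClass_mem_range_of_resolves {a : ZMod m} {T : ProjComplex A m} (hT : IsTwoTerm a T)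
    (hinj : Function.Injective (T.d (a - 1) a)) :
    hallClass k T ∈ (latticeHom (A := A) k h1 h2).range := by
  obtain ⟨X, hX⟩ := exists_hasHomology T a
  obtain ⟨p, hp⟩ := resolves_of_hasHomology h1 h2 hT hinj hX
  have h3 : resElt k a T ∈ (latticeHom (A := A) k h1 h2).range := by
    rw [resElt_eq_smul_modElt k h1 h2 hp]
    exact Subalgebra.smul_mem _ (modElt_mem_range k h1 h2 X a) _
  have h4 : hallClass k T = vParam k ^ (-eulerForm k (T.cls (a - 1)) (T.cls a - T.cls (a - 1))) •
      (kap k a (T.cls (a - 1)) * resElt k a T) := by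
    rw [resElt, mul_smul_comm, smul_smul, ← zpow_add₀ (vParam_ne_zero k), neg_add_cancel, zpow_zero,
      one_smul, ← mul_assoc, kap_mul_kap_neg k h1 h2, one_mul]
  rw [h4]
  exact Subalgebra.smul_mem _ (mul_mem (kap_mem_range k h1 h2 _ _) h3) _

/-- The class of a complex `N ⊕ T` with `T` a two-term complex is, up to classes of complexes with
smaller homology, a multiple of the product of the classes of `T` and `N`. -/
theorem hallClass_mem_range (M : ProjComplex A m) :
    hallClass k M ∈ (latticeHom (A := A) k h1 h2).range := by
  obtain ⟨n, hn⟩ : ∃ n : ℕ, tdim k M + hdim k M ≤ n := ⟨_, Int.self_le_toNat _⟩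
  induction n using Nat.strong_induction_on generalizing M with
  | _ n ih =>
    by_cases h0 : ∀ i, Subsingleton (M.X i)
    · rw [hallClass_zero k h0]
      exact one_mem _
    obtain ⟨a, N, T, ⟨e⟩, hN, hT, hinj, hlt, -⟩ := exists_directSum_tdim_lt k h1 M h0
    have hd := hdim_congr k e
    have htd := tdim_congr k e
    rw [hdim_directSum] at hd
    rw [tdim_twist] at htd
    have hT0 := hdim_nonneg k T
    have hN0 := hdim_nonneg k N
    have hNt := tdim_nonneg k N
    have hMt := tdim_nonneg k M
    have hih : ∀ L : ProjComplex A m, tdim k L + hdim k L < tdim k M + hdim k M →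
        hallClass k L ∈ (latticeHom (A := A) k h1 h2).range := by
      intro L hL
      have hL0 := hdim_nonneg k L
      have hLt := tdim_nonneg k L
      exact ih (tdim k L + hdim k L).toNat (by omega) L (Int.self_le_toNat _)
    have hNr := hih N (by omega)
    have hTr := hallClass_mem_range_of_resolves k h1 h2 hT hinj
    have hprod := hallClass_mul k T N
    classical
    have hpr : ∑ φ : Cocycle T N, hallClass k φ.twist ∈ (latticeHom (A := A) k h1 h2).range := by
      have h3 := congrArg (vParam k ^ (eulerComplex k T N) • ·) hprod
      beta_reduce at h3
      rw [smul_smul, ← zpow_add₀ (vParam_ne_zero k), add_neg_cancel, zpow_zero, one_smul] at h3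
      rw [← h3]
      exact Subalgebra.smul_mem _ (mul_mem hTr hNr) _
    rw [← Finset.sum_filter_add_sum_filter_not Finset.univ (fun φ => ∃ s, φ = Cocycle.cob s)] at hpr
    have hlow : ∑ φ : Cocycle T N with ¬ ∃ s, φ = Cocycle.cob s, hallClass k φ.twist ∈
        (latticeHom (A := A) k h1 h2).range := by
      refine sum_mem fun φ hφ => hih _ ?_
      have h3 := (cob_or_hdim_lt k h1 h2 hT hN φ).resolve_left (Finset.mem_filter.1 hφ).2
      have h4 := tdim_twist k φ
      omega
    -- The cocycles which are coboundaries all contribute the class of `N ⊕ T`.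
    have hmain := sub_mem hpr hlow
    rw [add_sub_cancel_right, Finset.sum_congr rfl (g := fun _ => hallClass k M), Finset.sum_const,
      ← Nat.cast_smul_eq_nsmul ℂ] at hmain
    · have hc : ((Finset.univ.filter fun φ : Cocycle T N => ∃ s, φ = Cocycle.cob s).card : ℂ) ≠ 0 := by
        rw [Nat.cast_ne_zero]
        refine Finset.card_ne_zero.2 ⟨Cocycle.cob 0, ?_⟩
        exact Finset.mem_filter.2 ⟨Finset.mem_univ _, 0, rfl⟩
      have h3 := Subalgebra.smul_mem _ hmain
        ((Finset.univ.filter fun φ : Cocycle T N => ∃ s, φ = Cocycle.cob s).card : ℂ)⁻¹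
      rwa [smul_smul, inv_mul_cancel₀ hc, one_smul] at h3
    · intro φ hφ
      obtain ⟨s, rfl⟩ := (Finset.mem_filter.1 hφ).2
      exact (hallClass_congr k (Cocycle.cobTwist s)).trans (hallClass_congr k e)

/-- The inverses of the classes of acyclic complexes are in the image of the lattice algebra. -/
theorem exists_inverse_mem_range (M : ProjComplex A m) (hM : M.obj.Acyclic) :
    ∃ y ∈ (latticeHom (A := A) k h1 h2).range, hallClass k M * y = 1 := by
  refine acyclic_induction k h1
    (motive := fun M => ∃ y ∈ (latticeHom (A := A) k h1 h2).range, hallClass k M * y = 1) ?_ ?_ ?_ M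
    ((acyclic_iff_exactAt M).1 hM)
  · intro M N e h
    rwa [← hallClass_congr k e]
  · intro M h0
    exact ⟨1, one_mem _, by rw [hallClass_zero k h0, one_mul]⟩
  · rintro a N K hK ⟨y, hy, hy'⟩
    have h3 := hK.mul_right k h1 N
    refine ⟨vParam k ^ (eulerForm k (N.cls (a - 1) - N.cls a) (K.cls a)) •
      (kap k a (-K.cls a) * y), Subalgebra.smul_mem _ (mul_mem (kap_mem_range k h1 h2 _ _) hy) _, ?_⟩
    rw [mul_smul_comm, ← smul_mul_assoc, ← h3, hallClass_eq_kap k h1 h2 hK, mul_assoc, ← mul_assoc (kap k a _),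
      kap_mul_kap_neg k h1 h2, one_mul, hy']

/-- The Hall algebra is generated by the classes of complexes and the inverses of those of acyclic
complexes. -/
theorem latticeHom_surjective : Function.Surjective (latticeHom (A := A) k h1 h2) := by
  rw [← AlgHom.range_eq_top, eq_top_iff]
  have key : ∀ x : TwistedHall A m, hallMap k x ∈ (latticeHom (A := A) k h1 h2).range := by
    intro x
    induction x using Finsupp.induction_linear with
    | zero => rw [map_zero]; exact zero_mem _
    | add x y hx hy => rw [map_add]; exact add_mem hx hy
    | single q c =>
      obtain ⟨M, rfl⟩ := Quotient.exists_rep q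
      have : (Finsupp.single (Quotient.mk _ M) c : TwistedHall A m) = c • hallBasis M := by
        rw [hallBasis, Finsupp.smul_single, smul_eq_mul, mul_one]
      rw [this, map_smul]
      exact Subalgebra.smul_mem _ (hallClass_mem_range k h1 h2 M) _
  rintro x -
  obtain ⟨x, rfl⟩ := RingQuot.mkAlgHom_surjective ℂ _ x
  induction x using FreeAlgebra.induction with
  | grade0 c => rw [AlgHom.commutes]; exact Subalgebra.algebraMap_mem _ _
  | grade1 x =>
    rcases x with x | s
    · exact key x
    · obtain ⟨_, M, n, hM, rfl⟩ := s
      obtain ⟨y, hy, hy'⟩ := exists_inverse_mem_range k h1 h2 M hM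
      set s : acyclicSet k A m := ⟨_, M, n, hM, rfl⟩ with hs
      let q := RingQuot.mkAlgHom ℂ (LocRel (hallMul k A m) (hallBasis (zeroComplex A m))
        (acyclicSet k A m))
      change q (FreeAlgebra.ι ℂ (Sum.inr s)) ∈ _
      have e1 : q (FreeAlgebra.ι ℂ (Sum.inr s)) * hallMap k s.1 = 1 := by
        change q _ * q (FreeAlgebra.ι ℂ (Sum.inl s.1)) = 1
        rw [← map_mul, RingQuot.mkAlgHom_rel ℂ (LocRel.inv_mul s), map_one]
      have e2 : hallMap k s.1 * (vParam k ^ (-n) • y) = 1 := by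
        rw [hs]
        change hallMap k (vParam k ^ n • hallBasis M) * _ = 1
        rw [map_smul, smul_mul_assoc, mul_smul_comm, smul_smul, ← zpow_add₀ (vParam_ne_zero k),
          add_neg_cancel, zpow_zero, one_smul]
        exact hy'
      rw [left_inv_eq_right_inv e1 e2]
      exact Subalgebra.smul_mem _ hy _
  | mul x y hx hy => rw [map_mul]; exact mul_mem hx hy
  | add x y hx hy => rw [map_add]; exact add_mem hx hy

end Surjective

/-! ### Iterated extensions -/

section Iterated

variable {A : Type u} [Ring A] {m : ℕ}

/-- An extension of `M` by an extension of `M'` by `N`, seen as an extension of an extension of `M`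
by `M'` by `N`. -/
noncomputable def cocycleAssoc (M M' N : ProjComplex A m)
    (q : Σ φ : Cocycle M' N, Cocycle M φ.twist) : Σ χ : Cocycle M M', Cocycle χ.twist N :=
  ⟨⟨fun i j => LinearMap.snd A (N.X j) (M'.X j) ∘ₗ q.2.f i j,
      fun i j h => by rw [q.2.shape i j h]; rfl,
      fun i j l x => congrArg Prod.snd (q.2.cond i j l x)⟩,
    ⟨fun i j => (q.1.f i j).coprod (LinearMap.fst A (N.X j) (M'.X j) ∘ₗ q.2.f i j),
      fun i j h => by
        rw [q.2.shape i j h, q.1.shape i j h]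
        exact LinearMap.ext fun x => add_zero (0 : N.X j),
      fun i j l x => by
        have e1 := q.1.cond i j l x.1
        have e2 := congrArg Prod.fst (q.2.cond i j l x.2)
        change (N.d j l (q.2.f i j x.2).1 + q.1.f j l (q.2.f i j x.2).2) +
          (q.2.f j l (M.d i j x.2)).1 = 0 at e2
        change N.d j l (q.1.f i j x.1 + (q.2.f i j x.2).1) +
          (q.1.f j l (M'.d i j x.1 + (q.2.f i j x.2).2) + (q.2.f j l (M.d i j x.2)).1) = 0
        rw [map_add, map_add]
        rw [← add_zero (0 : N.X l)]
        nth_rw 1 [← e1]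
        rw [← e2]
        abel⟩⟩

theorem cocycleAssoc_injective (M M' N : ProjComplex A m) :
    Function.Injective (cocycleAssoc M M' N) := by
  rintro ⟨φ, ψ⟩ ⟨φ', ψ'⟩ h
  have e1 : ∀ i j (x : M'.X i) (y : M.X i),
      φ.f i j x + (ψ.f i j y).1 = φ'.f i j x + (ψ'.f i j y).1 := fun i j x y =>
    congrArg (fun q : Σ χ : Cocycle M M', Cocycle χ.twist N =>
      q.2.f i j ((x, y) : M'.X i × M.X i)) h
  have e2 : ∀ i j (y : M.X i), (ψ.f i j y).2 = (ψ'.f i j y).2 := fun i j y =>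
    congrArg (fun q : Σ χ : Cocycle M M', Cocycle χ.twist N => q.1.f i j y) h
  obtain rfl : φ = φ' := by
    ext i j x
    have := e1 i j x 0
    rw [map_zero, map_zero] at this
    exact add_right_cancel this
  congr 1
  refine Cocycle.ext (funext fun i => funext fun j => LinearMap.ext fun y => ?_)
  refine Prod.ext ?_ (e2 i j y)
  have := e1 i j 0 y
  exact add_left_cancel this

theorem cocycleAssoc_surjective (M M' N : ProjComplex A m) :
    Function.Surjective (cocycleAssoc M M' N) := by
  rintro ⟨χ, ω⟩
  refine ⟨⟨⟨fun i j => ω.f i j ∘ₗ LinearMap.inl A (M'.X i) (M.X i),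
      fun i j h => by rw [ω.shape i j h]; rfl, fun i j l x => ?_⟩,
    ⟨fun i j => (ω.f i j ∘ₗ LinearMap.inr A (M'.X i) (M.X i)).prod (χ.f i j),
      fun i j h => by rw [ω.shape i j h, χ.shape i j h]; rfl, fun i j l x => ?_⟩⟩, ?_⟩
  · have e := ω.cond i j l ((x, 0) : M'.X i × M.X i)
    rw [Cocycle.twist_d] at e
    simp only [map_zero, add_zero] at e
    exact e
  · have e := ω.cond i j l ((0, x) : M'.X i × M.X i)
    rw [Cocycle.twist_d] at e
    simp only [map_zero, zero_add] at e
    refine Prod.ext ?_ (χ.cond i j l x)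
    change (N.d j l (ω.f i j ((0, x) : M'.X i × M.X i)) +
      ω.f j l ((χ.f i j x, 0) : M'.X j × M.X j)) +
      ω.f j l ((0, M.d i j x) : M'.X j × M.X j) = 0
    rw [add_assoc, ← map_add, ← e]
    congr 2
    exact Prod.ext (add_zero _) (zero_add _)
  · refine Sigma.ext rfl (heq_of_eq (Cocycle.ext (funext fun i => funext fun j => ?_)))
    exact LinearMap.coprod_comp_inl_inr (M := M'.X i) (M₂ := M.X i) (M₃ := N.X j) (ω.f i j)

/-- The middle terms of corresponding iterated extensions agree. -/
noncomputable def cocycleAssocTwist {M M' N : ProjComplex A m}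
    (q : Σ φ : Cocycle M' N, Cocycle M φ.twist) :
    ComplexEquiv q.2.twist (cocycleAssoc M M' N q).2.twist where
  e i := LinearEquiv.prodAssoc A (N.X i) (M'.X i) (M.X i)
  comm i j x := by
    refine Prod.ext ?_ (Prod.ext rfl rfl)
    change (N.d i j x.1.1 + q.1.f i j x.1.2) + (q.2.f i j x.2).1 =
      N.d i j x.1.1 + (q.1.f i j x.1.2 + (q.2.f i j x.2).1)
    exact add_assoc _ _ _

/-- Cocycles with values in a direct sum. -/
noncomputable def cocycleDirectSum (M N K : ProjComplex A m) :
    Cocycle M (directSum N K) ≃ Cocycle M N × Cocycle M K where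
  toFun ψ := (⟨fun i j => LinearMap.fst A (N.X j) (K.X j) ∘ₗ ψ.f i j,
      fun i j h => by rw [ψ.shape i j h]; rfl, fun i j l x => by
        have e := ψ.cond i j l x
        rw [directSum_d] at e
        exact congrArg Prod.fst e⟩,
    ⟨fun i j => LinearMap.snd A (N.X j) (K.X j) ∘ₗ ψ.f i j,
      fun i j h => by rw [ψ.shape i j h]; rfl, fun i j l x => by
        have e := ψ.cond i j l x
        rw [directSum_d] at e
        exact congrArg Prod.snd e⟩)
  invFun p := ⟨fun i j => (p.1.f i j).prod (p.2.f i j),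
    fun i j h => by rw [p.1.shape i j h, p.2.shape i j h]; rfl, fun i j l x => by
      rw [directSum_d]
      exact Prod.ext (p.1.cond i j l x) (p.2.cond i j l x)⟩
  left_inv _ := rfl
  right_inv _ := rfl

/-- An extension by `N ⊕ K` is the direct sum of `K` and of an extension by `N` if its component
in `K` is a coboundary. -/
noncomputable def cocycleDirectSumTwist {M N K : ProjComplex A m} (α : Cocycle M N)
    (s : ∀ i, M.X i →ₗ[A] K.X i) :
    ComplexEquiv ((cocycleDirectSum M N K).symm (α, Cocycle.cob s)).twist
      (directSum α.twist K) where
  e i :=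
    { toFun := fun x => ((x.1.1, x.2), x.1.2 + s i x.2)
      invFun := fun y => ((y.1.1, y.2 - s i y.1.2), y.1.2)
      map_add' := fun x y => by
        refine Prod.ext rfl ?_
        change (x.1.2 + y.1.2) + s i (x.2 + y.2) = (x.1.2 + s i x.2) + (y.1.2 + s i y.2)
        rw [map_add, add_add_add_comm]
      map_smul' := fun c x => by
        refine Prod.ext rfl ?_
        change c • x.1.2 + s i (c • x.2) = c • (x.1.2 + s i x.2)
        rw [map_smul, smul_add]
      left_inv := fun x => by
        refine Prod.ext (Prod.ext rfl ?_) rfl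
        exact add_sub_cancel_right _ _
      right_inv := fun y => by
        refine Prod.ext rfl ?_
        exact sub_add_cancel _ _ }
  comm i j x := by
    rw [directSum_d]
    refine Prod.ext (Prod.ext ?_ rfl) ?_
    · change ((directSum N K).d i j x.1 + _).1 = N.d i j x.1.1 + α.f i j x.2
      rw [directSum_d]
      rfl
    change ((directSum N K).d i j x.1 + _).2 + s j (M.d i j x.2) = K.d i j (x.1.2 + s i x.2)
    rw [directSum_d]
    change (K.d i j x.1.2 + (Cocycle.cob s).f i j x.2) + s j (M.d i j x.2) = _
    rw [Cocycle.cob_f, map_add]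
    abel

/-- A complex is not changed by an extension by a zero complex. -/
noncomputable def twistZeroLeft {M Z : ProjComplex A m} (hZ : ∀ i, Subsingleton (Z.X i))
    (φ : Cocycle M Z) : ComplexEquiv φ.twist M where
  e i :=
    { toFun := fun x => x.2
      invFun := fun x => (0, x)
      map_add' := fun _ _ => rfl
      map_smul' := fun _ _ => rfl
      left_inv := fun _ => Prod.ext ((hZ i).elim _ _) rfl
      right_inv := fun _ => rfl }
  comm _ _ _ := rfl

/-- A complex is not changed by an extension of a zero complex. -/
noncomputable def twistZeroRight {N Z : ProjComplex A m} (hZ : ∀ i, Subsingleton (Z.X i))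
    (φ : Cocycle Z N) : ComplexEquiv φ.twist N where
  e i :=
    { toFun := fun x => x.1
      invFun := fun x => (x, 0)
      map_add' := fun _ _ => rfl
      map_smul' := fun _ _ => rfl
      left_inv := fun x => Prod.ext rfl ((hZ i).elim _ _)
      right_inv := fun _ => rfl }
  comm i j x := by
    change N.d i j x.1 + φ.f i j x.2 = N.d i j x.1
    rw [(hZ i).elim x.2 0, map_zero, add_zero]

theorem subsingleton_cocycle_left {N Z : ProjComplex A m} (hZ : ∀ i, Subsingleton (Z.X i)) :
    Subsingleton (Cocycle Z N) :=
  ⟨fun φ ψ => by ext i j x; rw [(hZ i).elim x 0, map_zero, map_zero]⟩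

theorem subsingleton_cocycle_right {M Z : ProjComplex A m} (hZ : ∀ i, Subsingleton (Z.X i)) :
    Subsingleton (Cocycle M Z) :=
  ⟨fun φ ψ => by ext i j x; exact (hZ j).elim _ _⟩

end Iterated

/-! ### Functions on complexes and the right action of the Hall algebra -/

section TestFunctions

set_option linter.unusedSectionVars false

variable (A : Type u) [Ring A] (m : ℕ)

/-- The complex valued functions of a complex `N` and of a family `κ` of classes which depend only
on the isomorphism class of `N` and are not changed when a contractible complex in the degrees
`a - 1` and `a` is added to `N` and its class is added to `κ a`: the functions of the virtual
complex obtained from `N` by removing contractible summands of classes `κ`. -/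
def testSpace : Submodule ℂ (ProjComplex A m → (ZMod m → K0 A) → ℂ) where
  carrier := {F | (∀ M N, ComplexEquiv M N → ∀ κ, F M κ = F N κ) ∧
    ∀ a N K, IsContractible a K → ∀ κ, F (directSum N K) (κ + Pi.single a (K.cls a)) = F N κ}
  zero_mem' := ⟨fun _ _ _ _ => rfl, fun _ _ _ _ _ => rfl⟩
  add_mem' := fun hF hG => ⟨fun M N e κ => congrArg₂ (· + ·) (hF.1 M N e κ) (hG.1 M N e κ),
    fun a N K hK κ => congrArg₂ (· + ·) (hF.2 a N K hK κ) (hG.2 a N K hK κ)⟩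
  smul_mem' := fun c _ hF => ⟨fun M N e κ => congrArg (c * ·) (hF.1 M N e κ),
    fun a N K hK κ => congrArg (c * ·) (hF.2 a N K hK κ)⟩

variable {A m}

theorem testSpace_congr (F : testSpace A m) {M N : ProjComplex A m} (e : ComplexEquiv M N)
    (κ : ZMod m → K0 A) : F.1 M κ = F.1 N κ := F.2.1 M N e κ

theorem testSpace_directSum (F : testSpace A m) {a : ZMod m} (N : ProjComplex A m)
    {K : ProjComplex A m} (hK : IsContractible a K) (κ : ZMod m → K0 A) :
    F.1 (directSum N K) (κ + Pi.single a (K.cls a)) = F.1 N κ := F.2.2 a N K hK κ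

theorem testSpace_directSum' (F : testSpace A m) {a : ZMod m} (N : ProjComplex A m)
    {K : ProjComplex A m} (hK : IsContractible a K) (κ : ZMod m → K0 A) :
    F.1 (directSum N K) κ = F.1 N (κ - Pi.single a (K.cls a)) := by
  rw [← testSpace_directSum F N hK, sub_add_cancel]

/-- The modules of a contractible complex in the degrees `a - 1` and `a`. -/
theorem IsContractible.cls_eq {a : ZMod m} {K : ProjComplex A m} (hK : IsContractible a K)
    (h1 : (1 : ZMod m) ≠ 0) (i : ZMod m) :
    K.cls i = (Pi.single a (K.cls a) : ZMod m → K0 A) i +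
      (Pi.single a (K.cls a) : ZMod m → K0 A) (i + 1) := by
  by_cases hia : i = a
  · subst hia
    rw [Pi.single_eq_same, Pi.single_eq_of_ne (by simpa using h1), add_zero]
  by_cases hib : i + 1 = a
  · obtain rfl : i = a - 1 := eq_sub_of_add_eq hib
    rw [sub_add_cancel, Pi.single_eq_same, Pi.single_eq_of_ne hia, zero_add, hK.cls_pred]
  · rw [Pi.single_eq_of_ne hia, Pi.single_eq_of_ne hib, add_zero]
    have := hK.twoTerm i hia hib
    exact cl_of_subsingleton A _

variable (k : Type v) [Field k] [Algebra k A] [Module.Finite k A] [IsHereditaryRing A]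

theorem finite_support_eulerForm (M : ProjComplex A m) (g : ZMod m → K0 A) :
    (Function.support fun i => eulerForm k (M.cls i) (g i)).Finite := by
  refine M.supp.finite_toSet.subset fun i hi => ?_
  by_contra h
  exact hi (by simp [M.cls_eq_zero h])

theorem finsum_eulerForm_add (M : ProjComplex A m) (g g' : ZMod m → K0 A) :
    ∑ᶠ i, eulerForm k (M.cls i) (g i + g' i) =
      ∑ᶠ i, eulerForm k (M.cls i) (g i) + ∑ᶠ i, eulerForm k (M.cls i) (g' i) := by
  simp only [map_add]
  exact finsum_add_distrib (finite_support_eulerForm k M g) (finite_support_eulerForm k M g')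

theorem finsum_eulerForm_twist {M N : ProjComplex A m} (φ : Cocycle M N) (g : ZMod m → K0 A) :
    ∑ᶠ i, eulerForm k (φ.twist.cls i) (g i) =
      ∑ᶠ i, eulerForm k (M.cls i) (g i) + ∑ᶠ i, eulerForm k (N.cls i) (g i) := by
  simp only [Cocycle.twist_cls, map_add, AddMonoidHom.add_apply]
  rw [finsum_add_distrib (finite_support_eulerForm k N g) (finite_support_eulerForm k M g), add_comm]

theorem finsum_eulerForm_twoTerm {a : ZMod m} (h1 : (1 : ZMod m) ≠ 0) {T : ProjComplex A m}
    (hT : IsTwoTerm a T) (g : ZMod m → K0 A) : ∑ᶠ i, eulerForm k (T.cls i) (g i) =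
      eulerForm k (T.cls a) (g a) + eulerForm k (T.cls (a - 1)) (g (a - 1)) := by
  classical
  rw [finsum_eq_sum_of_support_subset (s := {a, a - 1}), Finset.sum_pair]
  · exact (by simpa using h1 : a - 1 ≠ a).symm
  · intro i hi
    by_contra h
    simp only [Finset.coe_insert, Finset.coe_singleton, Set.mem_insert_iff, Set.mem_singleton_iff,
      not_or] at h
    have := hT i h.1 fun h' => h.2 (eq_sub_of_add_eq h')
    exact hi (by simp [ProjComplex.cls, cl_of_subsingleton A (T.X i)])

/-- The part of the exponent of `v` in the action of `M` that comes from the contractible summands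
to be removed: a summand of class `α` in the degrees `i - 1` and `i` contributes
`⟨M_{i-1}, α⟩ + ⟨M_i, α⟩` to the Euler form, and the factor `v ^ (2⟨M_{i-1}, α⟩)` to the number of
cocycles. -/
noncomputable def kappaWeight (M : ProjComplex A m) (κ : ZMod m → K0 A) : ℤ :=
  ∑ᶠ i, eulerForm k (M.cls i) (κ i - κ (i + 1))

theorem eulerComplex_congr_left {M M' : ProjComplex A m} (e : ComplexEquiv M M')
    (N : ProjComplex A m) : eulerComplex k M N = eulerComplex k M' N := by
  simp only [eulerComplex_eq, ProjComplex.cls_congr e]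

theorem eulerComplex_congr_right (M : ProjComplex A m) {N N' : ProjComplex A m}
    (e : ComplexEquiv N N') : eulerComplex k M N = eulerComplex k M N' := by
  simp only [eulerComplex_eq, ProjComplex.cls_congr e]

theorem eulerComplex_twist_left {M N : ProjComplex A m} (φ : Cocycle M N) (L : ProjComplex A m) :
    eulerComplex k φ.twist L = eulerComplex k M L + eulerComplex k N L := by
  simp only [eulerComplex_eq]
  exact finsum_eulerForm_twist k φ _

theorem eulerComplex_twist_right (L : ProjComplex A m) {M N : ProjComplex A m} (φ : Cocycle M N) :
    eulerComplex k L φ.twist = eulerComplex k L M + eulerComplex k L N := by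
  simp only [eulerComplex_eq, Cocycle.twist_cls]
  rw [finsum_eulerForm_add, add_comm]

theorem kappaWeight_twist {M N : ProjComplex A m} (φ : Cocycle M N) (κ : ZMod m → K0 A) :
    kappaWeight k φ.twist κ = kappaWeight k M κ + kappaWeight k N κ :=
  finsum_eulerForm_twist k φ _

theorem kappaWeight_congr {M N : ProjComplex A m} (e : ComplexEquiv M N) (κ : ZMod m → K0 A) :
    kappaWeight k M κ = kappaWeight k N κ := by
  simp only [kappaWeight, ProjComplex.cls_congr e]

variable [Finite k] [Finite A]

/-- The effect of a contractible summand on the weights in the action of a complex. -/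
theorem weight_directSum (h1 : (1 : ZMod m) ≠ 0) {a : ZMod m} {K : ProjComplex A m}
    (hK : IsContractible a K) (M N : ProjComplex A m) (κ : ZMod m → K0 A) :
    vParam k ^ (-eulerComplex k M (directSum N K) +
      kappaWeight k M (κ + Pi.single a (K.cls a))) * (Nat.card (Cocycle M K) : ℂ) =
      vParam k ^ (-eulerComplex k M N + kappaWeight k M κ) := by
  have hba : a - 1 ≠ a := by simpa using h1
  have e1 : kappaWeight k M (κ + Pi.single a (K.cls a)) = kappaWeight k M κ +
      (eulerForm k (M.cls a) (K.cls a) - eulerForm k (M.cls (a - 1)) (K.cls a)) := by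
    classical
    have : ∑ᶠ i, eulerForm k (M.cls i) ((Pi.single a (K.cls a) : ZMod m → K0 A) i -
        (Pi.single a (K.cls a) : ZMod m → K0 A) (i + 1)) =
        eulerForm k (M.cls a) (K.cls a) - eulerForm k (M.cls (a - 1)) (K.cls a) := by
      rw [finsum_eq_sum_of_support_subset (s := {a, a - 1}), Finset.sum_pair hba.symm]
      · rw [Pi.single_eq_same, Pi.single_eq_of_ne (by simpa using h1), sub_add_cancel,
          Pi.single_eq_same, Pi.single_eq_of_ne hba, sub_zero, zero_sub, map_neg]
        exact (sub_eq_add_neg _ _).symm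
      · intro i hi
        by_contra h
        simp only [Finset.coe_insert, Finset.coe_singleton, Set.mem_insert_iff,
          Set.mem_singleton_iff, not_or] at h
        refine hi ?_
        beta_reduce
        rw [Pi.single_eq_of_ne h.1, Pi.single_eq_of_ne fun h' => h.2 (eq_sub_of_add_eq h'),
          sub_zero, map_zero]
    rw [kappaWeight, kappaWeight, ← this, ← finsum_eulerForm_add]
    refine finsum_congr fun i => ?_
    rw [Pi.add_apply, Pi.add_apply]
    congr 1
    abel
  rw [e1, eulerComplex_twist_right, eulerComplex_twoTerm_right k h1 hK.twoTerm, hK.cls_pred,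
    Nat.card_congr (hK.cocycleEquivRight h1 M), card_hom_projective k, ← zpow_add₀ (vParam_ne_zero k)]
  congr 1
  have : cl A (K.X (a - 1)) = K.cls a := hK.cls_pred
  rw [this]
  change _ + 2 * eulerForm k (M.cls (a - 1)) (K.cls a) = _
  ring

/-- The action of a complex on test functions. -/
noncomputable def actFun (M : ProjComplex A m) (F : ProjComplex A m → (ZMod m → K0 A) → ℂ)
    (N : ProjComplex A m) (κ : ZMod m → K0 A) : ℂ :=
  vParam k ^ (-eulerComplex k M N + kappaWeight k M κ) * ∑ φ : Cocycle M N, F φ.twist κ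

theorem actFun_mem (h1 : (1 : ZMod m) ≠ 0) (M : ProjComplex A m) (F : testSpace A m) :
    actFun k M F.1 ∈ testSpace A m := by
  constructor
  · intro N N' e κ
    rw [actFun, actFun, eulerComplex_congr_right k M e]
    congr 1
    refine Fintype.sum_equiv (Cocycle.congr (.refl M) e) _ _ fun φ => ?_
    exact testSpace_congr F (Cocycle.congrTwist _ _ φ) κ
  · intro a N K hK κ
    rw [actFun, actFun, ← weight_directSum k h1 hK M N κ, mul_assoc]
    congr 1
    -- Cocycles with values in `K` are coboundaries, hence do not change the value of `F`.
    rw [← (cocycleDirectSum M N K).symm.sum_comp, Fintype.sum_prod_type_right,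
      Finset.sum_congr rfl (g := fun _ => ∑ α : Cocycle M N, F.1 α.twist κ), Finset.sum_const,
      Finset.card_univ, Nat.card_eq_fintype_card, nsmul_eq_mul]
    intro χ _
    obtain ⟨s, rfl⟩ := hK.eq_cob_right h1 χ
    refine Finset.sum_congr rfl fun α _ => ?_
    rw [testSpace_congr F (cocycleDirectSumTwist α s), testSpace_directSum F _ hK]

/-- The action of a complex on the space of test functions. -/
noncomputable def act (h1 : (1 : ZMod m) ≠ 0) (M : ProjComplex A m) :
    Module.End ℂ (testSpace A m) where
  toFun F := ⟨actFun k M F.1, actFun_mem k h1 M F⟩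
  map_add' F G := by
    refine Subtype.ext (funext fun N => funext fun κ => ?_)
    change actFun k M (F.1 + G.1) N κ = actFun k M F.1 N κ + actFun k M G.1 N κ
    simp only [actFun, Pi.add_apply, Finset.sum_add_distrib, mul_add]
  map_smul' c F := by
    refine Subtype.ext (funext fun N => funext fun κ => ?_)
    change actFun k M (c • F.1) N κ = c * actFun k M F.1 N κ
    simp only [actFun, Pi.smul_apply, smul_eq_mul, ← Finset.mul_sum]
    ring

variable (h1 : (1 : ZMod m) ≠ 0)
include h1

theorem act_apply (M : ProjComplex A m) (F : testSpace A m) (N : ProjComplex A m)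
    (κ : ZMod m → K0 A) : (act k h1 M F).1 N κ =
      vParam k ^ (-eulerComplex k M N + kappaWeight k M κ) * ∑ φ : Cocycle M N, F.1 φ.twist κ := rfl

theorem act_congr {M M' : ProjComplex A m} (e : ComplexEquiv M M') : act k h1 M = act k h1 M' := by
  refine LinearMap.ext fun F => Subtype.ext (funext fun N => funext fun κ => ?_)
  rw [act_apply, act_apply, eulerComplex_congr_left k e, kappaWeight_congr k e]
  congr 1
  refine Fintype.sum_equiv (Cocycle.congr e (.refl N)) _ _ fun φ => ?_
  exact testSpace_congr F (Cocycle.congrTwist _ _ φ) κ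

/-- The action of a product in the Hall algebra. -/
theorem act_mul_act (M M' : ProjComplex A m) : act k h1 M' * act k h1 M =
    vParam k ^ (-eulerComplex k M M') • ∑ χ : Cocycle M M', act k h1 χ.twist := by
  refine LinearMap.ext fun F => Subtype.ext (funext fun N => funext fun κ => ?_)
  have e1 : ((vParam k ^ (-eulerComplex k M M') • ∑ χ : Cocycle M M', act k h1 χ.twist) F).1 N κ =
      vParam k ^ (-eulerComplex k M M') * ∑ χ : Cocycle M M', (act k h1 χ.twist F).1 N κ := by
    rw [LinearMap.smul_apply, LinearMap.sum_apply]
    change vParam k ^ (-eulerComplex k M M') *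
      (∑ χ : Cocycle M M', act k h1 χ.twist F : testSpace A m).1 N κ = _
    rw [AddSubmonoidClass.coe_finsetSum, Finset.sum_apply, Finset.sum_apply]
  rw [e1]
  change (act k h1 M' (act k h1 M F)).1 N κ = _
  simp only [act_apply, eulerComplex_twist_left, eulerComplex_twist_right, kappaWeight_twist]
  rw [← Finset.mul_sum, ← Finset.mul_sum, ← mul_assoc, ← mul_assoc, ← zpow_add₀ (vParam_ne_zero k),
    ← zpow_add₀ (vParam_ne_zero k)]
  congr 1
  · congr 1
    ring
  · rw [← Fintype.sum_sigma', ← Fintype.sum_sigma']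
    refine Fintype.sum_bijective (cocycleAssoc M M' N)
      ⟨cocycleAssoc_injective M M' N, cocycleAssoc_surjective M M' N⟩ _ _ fun q => ?_
    exact testSpace_congr F (cocycleAssocTwist q) κ

theorem act_zero {Z : ProjComplex A m} (hZ : ∀ i, Subsingleton (Z.X i)) : act k h1 Z = 1 := by
  refine LinearMap.ext fun F => Subtype.ext (funext fun N => funext fun κ => ?_)
  have hc : ∀ i, Z.cls i = 0 := fun i => have := hZ i; cl_of_subsingleton A _
  have := subsingleton_cocycle_left (N := N) hZ
  rw [act_apply, Fintype.sum_subsingleton _ 0, testSpace_congr F (twistZeroRight hZ 0),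
    eulerComplex_eq, kappaWeight]
  simp [hc]

/-- Evaluation of the action at the zero complex. -/
theorem act_apply_zero (M : ProjComplex A m) (F : testSpace A m) {Z : ProjComplex A m}
    (hZ : ∀ i, Subsingleton (Z.X i)) (κ : ZMod m → K0 A) : (act k h1 M F).1 Z κ =
      vParam k ^ kappaWeight k M κ * F.1 M κ := by
  have hc : ∀ i, Z.cls i = 0 := fun i => have := hZ i; cl_of_subsingleton A _
  have := subsingleton_cocycle_right (M := M) hZ
  rw [act_apply, Fintype.sum_subsingleton _ 0, testSpace_congr F (twistZeroLeft hZ 0),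
    eulerComplex_eq]
  simp [hc]

omit h1 in
/-- The exponent of `v` in the action of the element `K_α`. -/
noncomputable def transWeight (a : ZMod m) (α : K0 A) (N : ProjComplex A m) (κ : ZMod m → K0 A) :
    ℤ := eulerForm k α (N.cls a - N.cls (a - 1) - κ (a + 1) + κ (a - 1))

omit h1 in
/-- The action of the element `K_α` in the degrees `a - 1` and `a` on functions. -/
noncomputable def translateFun (a : ZMod m) (α : K0 A)
    (F : ProjComplex A m → (ZMod m → K0 A) → ℂ) (N : ProjComplex A m) (κ : ZMod m → K0 A) : ℂ :=
  vParam k ^ transWeight k a α N κ * F N (κ - Pi.single a α)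

theorem translateFun_mem (a : ZMod m) (α : K0 A) (F : testSpace A m) :
    translateFun k a α F.1 ∈ testSpace A m := by
  constructor
  · intro N N' e κ
    rw [translateFun, translateFun, testSpace_congr F e, transWeight, transWeight,
      ProjComplex.cls_congr e, ProjComplex.cls_congr e]
  · intro b N K hK κ
    rw [translateFun, translateFun, add_sub_right_comm, testSpace_directSum F N hK, transWeight,
      transWeight, Cocycle.twist_cls, Cocycle.twist_cls, hK.cls_eq h1 a, hK.cls_eq h1 (a - 1),
      Pi.add_apply, Pi.add_apply, sub_add_cancel]
    congr 3
    abel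

/-- The action of the element `K_α` in the degrees `a - 1` and `a` on test functions. -/
noncomputable def translate (a : ZMod m) (α : K0 A) : Module.End ℂ (testSpace A m) where
  toFun F := ⟨translateFun k a α F.1, translateFun_mem k h1 a α F⟩
  map_add' F G := by
    refine Subtype.ext (funext fun N => funext fun κ => ?_)
    change translateFun k a α (F.1 + G.1) N κ =
      translateFun k a α F.1 N κ + translateFun k a α G.1 N κ
    simp only [translateFun, Pi.add_apply, mul_add]
  map_smul' c F := by
    refine Subtype.ext (funext fun N => funext fun κ => ?_)
    change translateFun k a α (c • F.1) N κ = c * translateFun k a α F.1 N κ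
    simp only [translateFun, Pi.smul_apply, smul_eq_mul]
    ring

theorem translate_apply (a : ZMod m) (α : K0 A) (F : testSpace A m) (N : ProjComplex A m)
    (κ : ZMod m → K0 A) : (translate k h1 a α F).1 N κ =
      vParam k ^ transWeight k a α N κ * F.1 N (κ - Pi.single a α) := rfl

theorem translate_mul (a : ZMod m) (α β : K0 A) :
    translate k h1 a α * translate k h1 a β = translate k h1 a (α + β) := by
  refine LinearMap.ext fun F => Subtype.ext (funext fun N => funext fun κ => ?_)
  change (translate k h1 a α (translate k h1 a β F)).1 N κ = _
  rw [translate_apply, translate_apply, translate_apply, ← mul_assoc, ← zpow_add₀ (vParam_ne_zero k), sub_sub,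
    ← Pi.single_add]
  congr 2
  rw [transWeight, transWeight, transWeight, Pi.sub_apply, Pi.sub_apply,
    Pi.single_eq_of_ne (by simpa using h1), Pi.single_eq_of_ne (by simpa using h1), sub_zero,
    sub_zero, map_add (eulerForm k) α β, AddMonoidHom.add_apply]

theorem translate_zero (a : ZMod m) : translate k h1 a (0 : K0 A) = 1 := by
  refine LinearMap.ext fun F => Subtype.ext (funext fun N => funext fun κ => ?_)
  rw [translate_apply, transWeight, map_zero, AddMonoidHom.zero_apply, zpow_zero, one_mul,
    Pi.single_zero, sub_zero]
  rfl

theorem isUnit_translate (a : ZMod m) (α : K0 A) : IsUnit (translate k h1 a α) :=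
  ⟨⟨translate k h1 a α, translate k h1 a (-α), by rw [translate_mul, add_neg_cancel, translate_zero],
    by rw [translate_mul, neg_add_cancel, translate_zero]⟩, rfl⟩

/-- A contractible complex of class `α` acts as `K_α`. -/
theorem act_eq_translate {a : ZMod m} {K : ProjComplex A m} (hK : IsContractible a K) :
    act k h1 K = translate k h1 a (K.cls a) := by
  refine LinearMap.ext fun F => Subtype.ext (funext fun N => funext fun κ => ?_)
  rw [act_apply, translate_apply, Finset.sum_congr rfl
    (g := fun _ => F.1 N (κ - Pi.single a (K.cls a))), Finset.sum_const, Finset.card_univ,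
    ← Nat.card_eq_fintype_card, nsmul_eq_mul, ← mul_assoc, Nat.card_congr (hK.cocycleEquivLeft h1 N),
    card_hom_projective k, ← zpow_add₀ (vParam_ne_zero k)]
  · congr 2
    rw [eulerComplex_twoTerm_left k h1 hK.twoTerm, kappaWeight,
      finsum_eulerForm_twoTerm k h1 hK.twoTerm, hK.cls_pred, transWeight, sub_add_cancel]
    change _ + 2 * eulerForm k (K.cls a) (N.cls a) = _
    simp only [map_sub, map_add]
    ring
  · intro φ _
    obtain ⟨s, rfl⟩ := hK.eq_cob_left h1 φ
    rw [testSpace_congr F (Cocycle.cobTwist s), testSpace_directSum' F _ hK]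

/-- Acyclic complexes act by invertible operators. -/
theorem isUnit_act (M : ProjComplex A m) (hM : ∀ i, ExactAt M i) : IsUnit (act k h1 M) := by
  refine acyclic_induction k h1 (motive := fun M => IsUnit (act k h1 M)) ?_ ?_ ?_ M hM
  · intro M N e h
    rwa [← act_congr k h1 e]
  · intro M h0
    rw [act_zero k h1 h0]
    exact isUnit_one
  · intro a N K hK hN
    have h3 := act_mul_act k h1 K N
    rw [Finset.sum_congr rfl (g := fun _ => act k h1 (directSum N K)), Finset.sum_const,
      Finset.card_univ, ← Nat.cast_smul_eq_nsmul ℂ, smul_smul] at h3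
    · have h4 : IsUnit (act k h1 N * act k h1 K) := by
        rw [act_eq_translate k h1 hK]
        exact hN.mul (isUnit_translate k h1 _ _)
      rw [h3] at h4
      have hc : vParam k ^ (-eulerComplex k K N) * (Fintype.card (Cocycle K N) : ℂ) ≠ 0 :=
        mul_ne_zero (zpow_ne_zero _ (vParam_ne_zero k))
          (Nat.cast_ne_zero.2 (@Fintype.card_ne_zero _ _ ⟨0⟩))
      exact (isUnit_smul_iff (Units.mk0 _ hc) _).1 h4
    · intro φ _
      obtain ⟨s, rfl⟩ := hK.eq_cob_left h1 φ
      exact act_congr k h1 (Cocycle.cobTwist s)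

end TestFunctions

/-! ### The pairing of Bridgeland's Hall algebra with test functions -/

section Pairing

open MulOpposite

set_option linter.unusedSectionVars false

variable {A : Type u} [Ring A] {m : ℕ} (k : Type v) [Field k] [Algebra k A] [Module.Finite k A]
  [IsHereditaryRing A] [Finite k] [Finite A] (h1 : (1 : ZMod m) ≠ 0)

/-- The action of the vector space underlying the twisted Hall algebra. -/
noncomputable def actHall : TwistedHall A m →ₗ[ℂ] Module.End ℂ (testSpace A m) :=
  Finsupp.linearCombination ℂ fun q : IsoComplex A m => act k h1 q.out

theorem actHall_hallBasis (M : ProjComplex A m) : actHall k h1 (hallBasis M) = act k h1 M := by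
  rw [actHall, hallBasis, Finsupp.linearCombination_single, one_smul]
  obtain ⟨e⟩ := isoComplex_eq_iff.1
    (Quotient.out_eq (Quotient.mk (isIsomorphicSetoid (ProjComplex A m)) M))
  exact act_congr k h1 e

theorem actHall_mul (x y : TwistedHall A m) :
    actHall k h1 (hallMul k A m x y) = actHall k h1 y * actHall k h1 x := by
  have hb : ∀ (q : IsoComplex A m) (c : ℂ), ∃ M : ProjComplex A m,
      (Finsupp.single q c : TwistedHall A m) = c • hallBasis M := by
    intro q c
    obtain ⟨M, rfl⟩ := Quotient.exists_rep q
    exact ⟨M, by rw [hallBasis, Finsupp.smul_single, smul_eq_mul, mul_one]⟩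
  induction x using Finsupp.induction_linear with
  | zero => simp
  | add x x' hx hx' => rw [map_add, LinearMap.add_apply, map_add, hx, hx', map_add, mul_add]
  | single q c =>
    obtain ⟨M, hM⟩ := hb q c
    rw [hM]
    induction y using Finsupp.induction_linear with
    | zero => simp
    | add y y' hy hy' => rw [map_add, map_add, hy, hy', map_add, add_mul]
    | single q' c' =>
      obtain ⟨M', hM'⟩ := hb q' c'
      simp only [hM', map_smul, LinearMap.smul_apply, hallMul_hallBasis, map_sum,
        actHall_hallBasis, smul_mul_smul_comm, act_mul_act, smul_smul, mul_assoc]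

theorem isUnit_actHall {x : TwistedHall A m} (hx : x ∈ acyclicSet k A m) :
    IsUnit (actHall k h1 x) := by
  obtain ⟨M, n, hM, rfl⟩ := hx
  rw [map_smul, actHall_hallBasis]
  exact (isUnit_smul_iff (Units.mk0 _ (zpow_ne_zero n (vParam_ne_zero k))) _).2
    (isUnit_act k h1 M ((acyclic_iff_exactAt M).1 hM))

/-- The right action of Bridgeland's Hall algebra on the space of test functions. -/
noncomputable def rightAction :
    BridgelandHallAlgebra k A m →ₐ[ℂ] (Module.End ℂ (testSpace A m))ᵐᵒᵖ :=
  RingQuot.liftAlgHom ℂ ⟨FreeAlgebra.lift ℂ (Sum.elim (fun x => op (actHall k h1 x))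
    fun s => op (Ring.inverse (actHall k h1 s.1))), fun x y h => by
      induction h with
      | add x y =>
        rw [map_add]
        simp only [FreeAlgebra.lift_ι_apply, Sum.elim_inl, map_add]
        rfl
      | smul c x =>
        rw [map_smul]
        simp only [FreeAlgebra.lift_ι_apply, Sum.elim_inl, map_smul, op_smul]
      | mul x y =>
        rw [map_mul]
        simp only [FreeAlgebra.lift_ι_apply, Sum.elim_inl, actHall_mul, op_mul]
      | one =>
        rw [map_one, FreeAlgebra.lift_ι_apply, Sum.elim_inl, actHall_hallBasis,
          act_zero k h1 subsingleton_zeroComplex, op_one]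
      | mul_inv s =>
        rw [map_one, map_mul, FreeAlgebra.lift_ι_apply, FreeAlgebra.lift_ι_apply, Sum.elim_inl,
          Sum.elim_inr, ← op_mul, Ring.inverse_mul_cancel _ (isUnit_actHall k h1 s.2), op_one]
      | inv_mul s =>
        rw [map_one, map_mul, FreeAlgebra.lift_ι_apply, FreeAlgebra.lift_ι_apply, Sum.elim_inl,
          Sum.elim_inr, ← op_mul, Ring.mul_inverse_cancel _ (isUnit_actHall k h1 s.2), op_one]⟩

theorem rightAction_hallClass (M : ProjComplex A m) :
    rightAction k h1 (hallClass k M) = op (act k h1 M) := by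
  rw [rightAction, hallClass, RingQuot.liftAlgHom_mkAlgHom_apply, FreeAlgebra.lift_ι_apply,
    Sum.elim_inl, actHall_hallBasis]

theorem rightAction_kap (a : ZMod m) (α : K0 A) :
    rightAction k h1 (kap k a α) = op (translate k h1 a α) := by
  obtain ⟨K, K', hK, hK', hα, e⟩ := exists_kap_mul k h1 a α
  have h3 := congrArg (fun x => unop (rightAction k h1 x)) e
  simp only [map_mul, unop_mul, rightAction_hallClass, unop_op, act_eq_translate k h1 hK,
    act_eq_translate k h1 hK'] at h3
  refine unop_injective ((isUnit_translate k h1 a (K'.cls a)).mul_right_injective ?_)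
  beta_reduce
  rw [h3, unop_op, translate_mul, hα, add_sub_cancel]

/-- The products of elements `K_α`. -/
noncomputable def kapWord (w : List (ZMod m × K0 A)) : BridgelandHallAlgebra k A m :=
  (w.map fun p => kap k p.1 p.2).prod

theorem kapWord_cons (p : ZMod m × K0 A) (w : List (ZMod m × K0 A)) :
    kapWord k (p :: w) = kap k p.1 p.2 * kapWord k w := List.prod_cons

theorem kapWord_append (w w' : List (ZMod m × K0 A)) :
    kapWord k (w ++ w') = kapWord k w * kapWord k w' := by
  rw [kapWord, List.map_append, List.prod_append]; rfl

/-- The total degree of a word in the `K_α`. -/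
def wordDegree (w : List (ZMod m × K0 A)) : ZMod m → K0 A :=
  (w.map fun p => Pi.single p.1 p.2).sum

theorem exists_rightAction_kapWord (w : List (ZMod m × K0 A)) (N : ProjComplex A m)
    (κ : ZMod m → K0 A) : ∃ n : ℤ, ∀ F : testSpace A m,
      (unop (rightAction k h1 (kapWord k w)) F).1 N κ =
        vParam k ^ n * F.1 N (κ - wordDegree w) := by
  induction w with
  | nil =>
    refine ⟨0, fun F => ?_⟩
    rw [kapWord, List.map_nil, List.prod_nil, map_one, wordDegree, List.map_nil, List.sum_nil,
      sub_zero, zpow_zero, one_mul]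
    rfl
  | cons p w ih =>
    obtain ⟨n, hn⟩ := ih
    refine ⟨n + transWeight k p.1 p.2 N (κ - wordDegree w), fun F => ?_⟩
    rw [kapWord_cons, map_mul, unop_mul, rightAction_kap]
    refine (hn (translate k h1 p.1 p.2 F)).trans ?_
    rw [translate_apply, ← mul_assoc, ← zpow_add₀ (vParam_ne_zero k), sub_sub]
    congr 2
    rw [wordDegree, wordDegree, List.map_cons, List.sum_cons, add_comm]

/-- The pairing with a test function: the value at the zero complex of the function obtained by the
right action. -/
noncomputable def pairing (F : testSpace A m) : BridgelandHallAlgebra k A m →ₗ[ℂ] ℂ where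
  toFun x := (unop (rightAction k h1 x) F).1 (zeroComplex A m) 0
  map_add' x y := by rw [map_add]; rfl
  map_smul' c x := by rw [map_smul]; rfl

/-- Up to a power of `v`, the pairing of a product of a class and elements `K_α` evaluates the test
function at the corresponding virtual complex. -/
theorem exists_pairing_eq (N : ProjComplex A m) (w : List (ZMod m × K0 A)) :
    ∃ n : ℤ, ∀ F : testSpace A m, pairing k h1 F (hallClass k N * kapWord k w) =
      vParam k ^ n * F.1 N (-wordDegree w) := by
  obtain ⟨n, hn⟩ := exists_rightAction_kapWord k h1 w (zeroComplex A m) 0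
  refine ⟨n + kappaWeight k N (-wordDegree w), fun F => ?_⟩
  have h3 := hn (act k h1 N F)
  rw [act_apply_zero k h1 N F subsingleton_zeroComplex, ← mul_assoc,
    ← zpow_add₀ (vParam_ne_zero k), zero_sub] at h3
  rw [← h3]
  change (unop (rightAction k h1 (hallClass k N * kapWord k w)) F).1 (zeroComplex A m) 0 = _
  rw [map_mul, unop_mul, rightAction_hallClass]
  rfl

end Pairing

section Indicator

variable {A : Type u} [Ring A] [IsNoetherianRing A] {m : ℕ}

omit [IsNoetherianRing A] in
theorem IsContractible.beta_eq {a : ZMod m} {K : ProjComplex A m} (hK : IsContractible a K)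
    (i : ZMod m) : beta K i = (Pi.single a (K.cls a) : ZMod m → K0 A) i := by
  by_cases hia : i = a
  · subst hia
    rw [Pi.single_eq_same, beta]
    exact cl_congr ((LinearEquiv.ofEq _ _ (LinearMap.range_eq_top.2 hK.bijective.2)).trans
      Submodule.topEquiv)
  · rw [Pi.single_eq_of_ne hia]
    by_cases hib : i + 1 = a
    · obtain rfl : i = a - 1 := eq_sub_of_add_eq hib
      have h3 : LinearMap.range (K.d (a - 1 - 1) (a - 1)) = ⊥ := by
        rw [eq_bot_iff]
        rintro _ ⟨x, rfl⟩
        exact hK.bijective.1 (by rw [K.d_d, map_zero])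
      have : Subsingleton (LinearMap.range (K.d (a - 1 - 1) (a - 1))) := by
        rw [h3]
        infer_instance
      exact cl_of_subsingleton A _
    · have := hK.twoTerm i hia hib
      exact cl_of_subsingleton A _

open scoped Classical in
/-- The test function that detects the homology modules of a complex and the classes of its modules
of boundaries. -/
noncomputable def indicator (h : ZMod m → IsoMod A) (β : ZMod m → K0 A) : testSpace A m :=
  ⟨fun N κ => if (∀ i, HasHomology N i (h i).out.obj) ∧ (∀ i, beta N i - κ i = β i) then 1 else 0, by
    constructor
    · intro M N e κ
      refine if_congr (and_congr (forall_congr' fun i => ⟨fun h => h.congr_left e,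
        fun h => h.congr_left e.symm⟩) (forall_congr' fun i => ?_)) rfl rfl
      rw [beta_congr e]
    · intro a N K hK κ
      refine if_congr (and_congr (forall_congr' fun i => hasHomology_directSum_iff (hK.exactAt i))
        (forall_congr' fun i => ?_)) rfl rfl
      rw [beta_directSum, hK.beta_eq, Pi.add_apply, add_sub_add_right_eq_sub]⟩

open scoped Classical in
theorem indicator_apply (h : ZMod m → IsoMod A) (β : ZMod m → K0 A) (N : ProjComplex A m)
    (κ : ZMod m → K0 A) : (indicator h β).1 N κ =
      if (∀ i, HasHomology N i (h i).out.obj) ∧ (∀ i, beta N i - κ i = β i) then 1 else 0 := rfl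

end Indicator

/-! ### The relations of the lattice algebra up to terms of lower weight -/

section Relations

set_option linter.unusedSectionVars false

variable {A : Type u} [Ring A] {m : ℕ} (k : Type v) [Field k] [Algebra k A]
  [Module.Finite k A] [IsHereditaryRing A] [Finite k] [Finite A]

/-- The weight of an isomorphism class of modules: its dimension (the dimension of the space of
maps from the free module of rank one). -/
noncomputable def weight (q : IsoMod A) : ℕ := (dimK A k (cl A q.out.obj)).toNat

theorem weight_eq (q : IsoMod A) : (weight k q : ℤ) = dimK A k (cl A q.out.obj) :=
  Int.toNat_of_nonneg (dimK_nonneg k _)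

/-- The class of the zero module. -/
def zeroMod (A : Type u) [Ring A] : IsoMod A := IsoMod.mk (FGModuleCat.of A PUnit.{u + 1})

theorem subsingleton_zeroMod_out : Subsingleton (zeroMod A).out.obj := by
  obtain ⟨e⟩ := nonempty_equiv_out (FGModuleCat.of A PUnit.{u + 1})
  exact e.symm.injective.subsingleton (β := PUnit)

theorem weight_zeroMod : weight k (zeroMod A) = 0 := by
  have := subsingleton_zeroMod_out (A := A)
  rw [weight, cl_of_subsingleton, map_zero]
  rfl

/-- The generator `Z_q^{(i)}` for an isomorphism class `q`. -/
noncomputable def genZ (q : IsoMod A) (i : ZMod m) : LatticeAlgebra k A m :=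
  RingQuot.mkAlgHom ℂ (LatticeRel k A m) (freeZ q i)

theorem isoMod_mk_out (q : IsoMod A) : IsoMod.mk q.out = q := Quotient.out_eq q

theorem genZ_zeroMod (i : ZMod m) : genZ k (zeroMod A) i = 1 := by
  have := subsingleton_zeroMod_out (A := A)
  rw [genZ, ← isoMod_mk_out (zeroMod A), RingQuot.mkAlgHom_rel ℂ (LatticeRel.Z_zero _ this i),
    map_one]

theorem latticeK_zero (i : ZMod m) : latticeK k (0 : K0 A) i = 1 := by
  rw [latticeK, RingQuot.mkAlgHom_rel ℂ (LatticeRel.K_zero i), map_one]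

theorem latticeK_mul (α β : K0 A) (i : ZMod m) :
    latticeK k α i * latticeK k β i = latticeK k (α + β) i := by
  rw [latticeK, latticeK, latticeK, ← map_mul, RingQuot.mkAlgHom_rel ℂ (LatticeRel.K_add α β i)]

theorem exists_latticeK_mul_latticeK (α β : K0 A) (i j : ZMod m) :
    ∃ n : ℤ, latticeK k α i * latticeK k β j = vParam k ^ n • (latticeK k β j * latticeK k α i) := by
  have h := RingQuot.mkAlgHom_rel ℂ (LatticeRel.K_K (k := k) α β i j)
  rw [map_mul, map_smul, map_mul] at h
  split_ifs at h
  · exact ⟨_, h⟩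
  · exact ⟨_, h⟩
  · exact ⟨0, by rw [zpow_zero]; exact h⟩

theorem exists_latticeK_mul_genZ (α : K0 A) (q : IsoMod A) (i j : ZMod m) :
    ∃ n : ℤ, latticeK k α i * genZ k q j = vParam k ^ n • (genZ k q j * latticeK k α i) := by
  have h := RingQuot.mkAlgHom_rel ℂ (LatticeRel.K_Z (k := k) α q.out i j)
  rw [isoMod_mk_out, map_mul, map_smul, map_mul] at h
  split_ifs at h
  · exact ⟨_, h⟩
  · exact ⟨_, h⟩
  · exact ⟨0, by rw [zpow_zero]; exact h⟩

/-- The product of two generators of the same index. -/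
theorem genZ_mul_genZ (p q : IsoMod A) (i : ZMod m) : ∃ (T : Finset (IsoMod A)) (c : IsoMod A → ℂ),
    genZ k p i * genZ k q i = ∑ L ∈ T, c L • genZ k L i ∧
      ∀ L ∈ T, weight k L = weight k p + weight k q := by
  have hf := finite_support_ringelHallNumber p.out q.out
  refine ⟨hf.toFinset, fun L => vParam k ^ eulerForm k (K0.mk p.out) (K0.mk q.out) *
    ringelHallNumber p.out q.out L.out, ?_, fun L hL => ?_⟩
  · have h := RingQuot.mkAlgHom_rel ℂ (LatticeRel.Z_Z_same (k := k) p.out q.out i)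
    rw [isoMod_mk_out, isoMod_mk_out, map_mul, map_smul,
      finsum_eq_sum_of_support_subset (s := hf.toFinset), map_sum, Finset.smul_sum] at h
    · refine h.trans (Finset.sum_congr rfl fun L _ => ?_)
      rw [map_smul, smul_smul]
      rfl
    · intro L hL
      rw [Set.Finite.coe_toFinset]
      intro h0
      refine hL ?_
      beta_reduce
      rw [h0, zero_smul]
  · rw [Set.Finite.mem_toFinset] at hL
    have h0 : extCard p.out.obj q.out.obj L.out.obj ≠ 0 := by
      intro h
      exact hL (by rw [ringelHallNumber, h]; simp)
    have h3 := extCard_mul_card_aut p.out.obj q.out.obj L.out.obj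
    rw [card_exactPair, card_iso_obj] at h3
    have h4 : Nat.card (LinearExactPair A p.out.obj q.out.obj L.out.obj) ≠ 0 := by
      intro h
      rw [h, zero_mul] at h3
      rcases Nat.mul_eq_zero.1 h3 with h | h
      · exact h0 h
      · exact autCard_ne_zero L.out (by rw [h, Nat.cast_zero])
    obtain ⟨⟨⟨f, g⟩, hi, he, hs⟩⟩ := (Nat.card_ne_zero.1 h4).1
    have h5 := congrArg (dimK A k) (cl_of_exact f g hi hs he)
    rw [map_add, ← weight_eq, ← weight_eq, ← weight_eq] at h5
    omega

theorem weight_add_lt {M N : Type u} [AddCommGroup M] [Module A M] [Module.Finite A M]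
    [AddCommGroup N] [Module A N] [Module.Finite A N] {f : M →ₗ[A] N} (hf : f ≠ 0) :
    dimK A k (cl A (LinearMap.ker f)) + dimK A k (cl A (N ⧸ LinearMap.range f)) <
      dimK A k (cl A M) + dimK A k (cl A N) := by
  refine add_lt_add_of_lt_of_le (dimK_lt_of_injective k (LinearMap.ker f).subtype
    Subtype.val_injective fun hs => hf ?_) ?_
  · ext x
    obtain ⟨y, rfl⟩ := hs x
    exact y.2
  · rw [cl_of_exact (LinearMap.range f).subtype (LinearMap.range f).mkQ Subtype.val_injective
      (Submodule.mkQ_surjective _) (LinearMap.exact_subtype_mkQ _), map_add]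
    exact le_add_of_nonneg_left (dimK_nonneg k _)

theorem weight_of_equiv {q : IsoMod A} {X : Type u} [AddCommGroup X] [Module A X]
    [Module.Finite A X] (e : X ≃ₗ[A] q.out.obj) : (weight k q : ℤ) = dimK A k (cl A X) := by
  rw [weight_eq, cl_congr e]

/-- The structure constants of the relation between generators of adjacent indices: the summand
with `f = 0` has coefficient one, and the other ones have lower weight. -/
theorem gammaNumber_eq_one_or (M N : FGModuleCat.{u} A) (X Y : IsoMod A)
    (h : gammaNumber M N X.out Y.out ≠ 0) :
    (IsoMod.mk M = X ∧ IsoMod.mk N = Y) ∨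
      (weight k X + weight k Y : ℤ) < dimK A k (cl A M.obj) + dimK A k (cl A N.obj) := by
  have h4 : Nat.card (FourTermExact M N X.out Y.out) ≠ 0 := by
    intro h'
    exact h (by rw [gammaNumber, h']; simp)
  rw [card_fourTermExact] at h4
  obtain ⟨⟨f, ⟨e⟩, ⟨e'⟩⟩⟩ := (Nat.card_ne_zero.1 (left_ne_zero_of_mul h4)).1
  by_cases hf : f = 0
  · left
    subst hf
    exact ⟨isoMod_mk_eq_iff.2 ⟨((LinearEquiv.ofEq _ _ LinearMap.ker_zero).trans
        Submodule.topEquiv).symm.trans e⟩,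
      isoMod_mk_eq_iff.2 ⟨((Submodule.quotEquivOfEqBot _ LinearMap.range_zero).symm).trans e'⟩⟩
  · right
    rw [weight_of_equiv k e, weight_of_equiv k e']
    exact weight_add_lt k hf

theorem gammaNumber_self (M N : FGModuleCat.{u} A) : gammaNumber M N M N = 1 := by
  rw [gammaNumber, card_fourTermExact]
  have : Nat.card {f : M.obj →ₗ[A] N.obj // Nonempty (LinearMap.ker f ≃ₗ[A] M.obj) ∧
      Nonempty ((N.obj ⧸ LinearMap.range f) ≃ₗ[A] N.obj)} = 1 := by
    refine Nat.card_eq_one_iff_unique.2 ⟨⟨?_⟩, ⟨0, ⟨(LinearEquiv.ofEq _ _ LinearMap.ker_zero).trans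
      Submodule.topEquiv⟩, ⟨Submodule.quotEquivOfEqBot _ LinearMap.range_zero⟩⟩⟩
    have h0 : ∀ f : M.obj →ₗ[A] N.obj, Nonempty (LinearMap.ker f ≃ₗ[A] M.obj) → f = 0 := by
      rintro f ⟨e⟩
      have hinj : Function.Injective ((LinearMap.ker f).subtype ∘ₗ e.symm.toLinearMap) :=
        Subtype.val_injective.comp e.symm.injective
      ext x
      obtain ⟨y, rfl⟩ := Finite.surjective_of_injective hinj x
      exact (e.symm y).2
    rintro ⟨f, hf, -⟩ ⟨g, hg, -⟩
    exact Subtype.ext ((h0 f hf).trans (h0 g hg).symm)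
  rw [this, one_mul, Nat.cast_mul]
  exact div_self (mul_ne_zero (autCard_ne_zero M) (autCard_ne_zero N))

/-- The span of the products `K Z Z` of weight less than `n`. -/
def lowerPairs (A : Type u) [Ring A] (m : ℕ) [Algebra k A] [Module.Finite k A]
    [IsHereditaryRing A] (n : ℕ) : Submodule ℂ (LatticeAlgebra k A m) :=
  Submodule.span ℂ {x | ∃ (α : K0 A) (r a b : ZMod m) (p p' : IsoMod A),
    weight k p + weight k p' < n ∧ x = latticeK k α r * (genZ k p a * genZ k p' b)}

/-- Generators of adjacent indices commute up to terms of lower weight, by the relation for adjacent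
indices, whose leading coefficient is one. -/
theorem genZ_mul_genZ_succ_sub_mem (p q : IsoMod A) (i : ZMod m) :
    genZ k p (i + 1) * genZ k q i - genZ k q i * genZ k p (i + 1) ∈
      lowerPairs k A m (weight k p + weight k q) := by
  have hf := finite_support_gammaNumber p.out q.out
  have h := RingQuot.mkAlgHom_rel ℂ (LatticeRel.Z_Z_adjacent (k := k) p.out q.out i)
  classical
  rw [isoMod_mk_out, isoMod_mk_out, map_mul,
    finsum_eq_sum_of_support_subset (s := hf.toFinset ∪ {(p, q)}), map_sum] at h
  · change genZ k p (i + 1) * genZ k q i = _ at h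
    rw [h, ← Finset.sum_erase_add _ _ (Finset.mem_union_right _ (Finset.mem_singleton_self (p, q)))]
    have e1 : RingQuot.mkAlgHom ℂ (LatticeRel k A m)
        ((vParam k ^ eulerForm k (K0.mk p.out - K0.mk p.out) (K0.mk p.out - K0.mk q.out) *
            gammaNumber p.out q.out p.out q.out) •
          (freeK (K0.mk p.out - K0.mk p.out) i * freeZ q i * freeZ p (i + 1))) =
        genZ k q i * genZ k p (i + 1) := by
      rw [gammaNumber_self, sub_self, map_zero, AddMonoidHom.zero_apply, zpow_zero, mul_one,
        one_smul, map_mul, map_mul]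
      change latticeK k 0 i * genZ k q i * genZ k p (i + 1) = _
      rw [latticeK_zero, one_mul]
    rw [e1, add_sub_cancel_right]
    refine sum_mem fun t ht => ?_
    rw [map_smul, map_mul, map_mul]
    by_cases h0 : gammaNumber p.out q.out t.1.out t.2.out = 0
    · rw [h0, mul_zero, zero_smul]
      exact zero_mem _
    refine Submodule.smul_mem _ _ (Submodule.subset_span ⟨_, _, _, _, _, _, ?_, mul_assoc _ _ _⟩)
    rcases gammaNumber_eq_one_or k _ _ _ _ h0 with ⟨h3, h4⟩ | h3
    · rw [isoMod_mk_out] at h3 h4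
      exact absurd (Prod.ext h3.symm h4.symm) (Finset.mem_erase.1 ht).1
    · rw [← weight_eq, ← weight_eq] at h3
      omega
  · intro t ht
    rw [Finset.coe_union, Set.Finite.coe_toFinset]
    refine Or.inl fun h0 => ht ?_
    beta_reduce
    rw [h0, mul_zero, zero_smul]

/-- Generators of different indices commute up to terms of lower weight. -/
theorem genZ_mul_genZ_sub_mem (p q : IsoMod A) {i j : ZMod m} (hij : i ≠ j) :
    genZ k p i * genZ k q j - genZ k q j * genZ k p i ∈
      lowerPairs k A m (weight k p + weight k q) := by
  by_cases h3 : i = j + 1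
  · subst h3
    exact genZ_mul_genZ_succ_sub_mem k p q j
  by_cases h4 : j = i + 1
  · subst h4
    rw [← neg_mem_iff, neg_sub, add_comm (weight k p)]
    exact genZ_mul_genZ_succ_sub_mem k q p i
  · have h := RingQuot.mkAlgHom_rel ℂ (LatticeRel.Z_Z_far (k := k) p.out q.out i j
      (sub_ne_zero.2 hij) (fun h => h3 (by rw [← h]; ring)) (fun h => h4 ?_))
    · rw [isoMod_mk_out, isoMod_mk_out, map_mul, map_mul] at h
      rw [show genZ k p i * genZ k q j - genZ k q j * genZ k p i = 0 from sub_eq_zero.2 h]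
      exact zero_mem _
    · rw [show ((m : ZMod m) : ZMod m) = 0 by simp] at h
      linear_combination -h

end Relations

/-! ### The weight filtration of the lattice algebra -/

section Filtration

set_option linter.unusedSectionVars false

variable {A : Type u} [Ring A] {m : ℕ} (k : Type v) [Field k] [Algebra k A]
  [Module.Finite k A] [IsHereditaryRing A] [Finite k] [Finite A]

/-- The product of the generators `Z_{h i}^{(i)}`, for the indices `i` in a list. -/
noncomputable def prodZ (l : List (ZMod m)) (h : ZMod m → IsoMod A) : LatticeAlgebra k A m :=
  (l.map fun i => genZ k (h i) i).prod

/-- The products of generators `K_α^{(i)}`. -/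
noncomputable def prodK (w : List (ZMod m × K0 A)) : LatticeAlgebra k A m :=
  (w.map fun p => latticeK k p.2 p.1).prod

/-- The weight of a family of modules. -/
noncomputable def listWeight (l : List (ZMod m)) (h : ZMod m → IsoMod A) : ℕ :=
  (l.map fun i => weight k (h i)).sum

theorem prodZ_cons (i : ZMod m) (l : List (ZMod m)) (h : ZMod m → IsoMod A) :
    prodZ k (i :: l) h = genZ k (h i) i * prodZ k l h := List.prod_cons

theorem prodK_cons (p : ZMod m × K0 A) (w : List (ZMod m × K0 A)) :
    prodK k (p :: w) = latticeK k p.2 p.1 * prodK k w := List.prod_cons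

theorem prodK_append (w w' : List (ZMod m × K0 A)) :
    prodK k (w ++ w') = prodK k w * prodK k w' := by
  rw [prodK, List.map_append, List.prod_append]; rfl

theorem listWeight_cons (i : ZMod m) (l : List (ZMod m)) (h : ZMod m → IsoMod A) :
    listWeight k (i :: l) h = weight k (h i) + listWeight k l h := List.sum_cons

theorem prodZ_congr {l : List (ZMod m)} {h h' : ZMod m → IsoMod A} (hh : ∀ i ∈ l, h i = h' i) :
    prodZ k l h = prodZ k l h' := by
  rw [prodZ, prodZ, List.map_congr_left fun i hi => by rw [hh i hi]]

theorem listWeight_congr {l : List (ZMod m)} {h h' : ZMod m → IsoMod A}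
    (hh : ∀ i ∈ l, h i = h' i) : listWeight k l h = listWeight k l h' := by
  rw [listWeight, listWeight, List.map_congr_left fun i hi => by rw [hh i hi]]

/-- The span of the products of weight less than `n` of generators `Z` with different indices and
of generators `K`. -/
def filtration (A : Type u) [Ring A] (m : ℕ) [Algebra k A] [Module.Finite k A]
    [IsHereditaryRing A] (n : ℕ) : Submodule ℂ (LatticeAlgebra k A m) :=
  Submodule.span ℂ {x | ∃ (l : List (ZMod m)) (h : ZMod m → IsoMod A) (w : List (ZMod m × K0 A)),
    l.Nodup ∧ listWeight k l h < n ∧ x = prodZ k l h * prodK k w}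

theorem prodZ_mul_prodK_mem {l : List (ZMod m)} (hl : l.Nodup) {h : ZMod m → IsoMod A} {n : ℕ}
    (hn : listWeight k l h < n) (w : List (ZMod m × K0 A)) :
    prodZ k l h * prodK k w ∈ filtration k A m n :=
  Submodule.subset_span ⟨l, h, w, hl, hn, rfl⟩

theorem prodZ_mem {l : List (ZMod m)} (hl : l.Nodup) {h : ZMod m → IsoMod A} {n : ℕ}
    (hn : listWeight k l h < n) : prodZ k l h ∈ filtration k A m n := by
  have := prodZ_mul_prodK_mem k hl hn []
  rwa [prodK, List.map_nil, List.prod_nil, mul_one] at this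

theorem filtration_mono {n n' : ℕ} (h : n ≤ n') : filtration k A m n ≤ filtration k A m n' :=
  Submodule.span_mono fun _ ⟨l, g, w, hl, hn, e⟩ => ⟨l, g, w, hl, hn.trans_le h, e⟩

theorem filtration_zero : filtration k A m 0 = ⊥ := by
  rw [filtration, Submodule.span_eq_bot]
  rintro x ⟨l, h, w, -, hn, -⟩
  exact absurd hn (Nat.not_lt_zero _)

theorem mul_prodK_mem {n : ℕ} {x : LatticeAlgebra k A m} (hx : x ∈ filtration k A m n)
    (w : List (ZMod m × K0 A)) : x * prodK k w ∈ filtration k A m n := by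
  induction hx using Submodule.span_induction with
  | mem x hx =>
    obtain ⟨l, h, w', hl, hn, rfl⟩ := hx
    rw [mul_assoc, ← prodK_append]
    exact prodZ_mul_prodK_mem k hl hn _
  | zero => rw [zero_mul]; exact zero_mem _
  | add x y _ _ hx hy => rw [add_mul]; exact add_mem hx hy
  | smul c x _ hx => rw [smul_mul_assoc]; exact Submodule.smul_mem _ _ hx

theorem exists_latticeK_mul_prodZ (α : K0 A) (i : ZMod m) (l : List (ZMod m))
    (h : ZMod m → IsoMod A) :
    ∃ n : ℤ, latticeK k α i * prodZ k l h = vParam k ^ n • (prodZ k l h * latticeK k α i) := by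
  induction l with
  | nil => exact ⟨0, by rw [prodZ, List.map_nil, List.prod_nil, mul_one, one_mul, zpow_zero, one_smul]⟩
  | cons j l ih =>
    obtain ⟨n, hn⟩ := ih
    obtain ⟨n', hn'⟩ := exists_latticeK_mul_genZ k α (h j) i j
    refine ⟨n' + n, ?_⟩
    rw [prodZ_cons, ← mul_assoc, hn', smul_mul_assoc, mul_assoc, hn, mul_smul_comm, smul_smul,
      ← zpow_add₀ (vParam_ne_zero k), mul_assoc]

theorem latticeK_mul_mem {n : ℕ} {x : LatticeAlgebra k A m} (hx : x ∈ filtration k A m n)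
    (α : K0 A) (i : ZMod m) : latticeK k α i * x ∈ filtration k A m n := by
  induction hx using Submodule.span_induction with
  | mem x hx =>
    obtain ⟨l, h, w, hl, hn, rfl⟩ := hx
    obtain ⟨n', hn'⟩ := exists_latticeK_mul_prodZ k α i l h
    rw [← mul_assoc, hn', smul_mul_assoc, mul_assoc]
    exact Submodule.smul_mem _ _ (prodZ_mul_prodK_mem k hl hn ((i, α) :: w))
  | zero => rw [mul_zero]; exact zero_mem _
  | add x y _ _ hx hy => rw [mul_add]; exact add_mem hx hy
  | smul c x _ hx => rw [mul_smul_comm]; exact Submodule.smul_mem _ _ hx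

open scoped Classical in
/-- Multiplication of an ordered product by a generator with an index that occurs in it, up to
terms of lower weight: the generator is moved to the factor with the same index. The hypothesis `ih`
is the compatibility of the filtration with multiplication in lower total weight. -/
theorem genZ_mul_prodZ_sub_mem {N : ℕ} (ih : ∀ (q : IsoMod A) (i : ZMod m) (d : ℕ),
      weight k q + d ≤ N → ∀ y ∈ filtration k A m d, genZ k q i * y ∈
        filtration k A m (d + weight k q))
    (q : IsoMod A) (i : ZMod m) {T : Finset (IsoMod A)} {c : IsoMod A → ℂ}
    {h : ZMod m → IsoMod A} (hT : genZ k q i * genZ k (h i) i = ∑ L ∈ T, c L • genZ k L i)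
    (l : List (ZMod m)) (hl : l.Nodup) (hi : i ∈ l) (hN : weight k q + listWeight k l h ≤ N) :
    genZ k q i * prodZ k l h - ∑ L ∈ T, c L • prodZ k l (Function.update h i L) ∈
      filtration k A m (weight k q + listWeight k l h) := by
  induction l with
  | nil => exact absurd hi List.not_mem_nil
  | cons j l ih' =>
    rw [List.nodup_cons] at hl
    rw [listWeight_cons] at hN ⊢
    by_cases hij : i = j
    · subst hij
      have : ∀ L, prodZ k (i :: l) (Function.update h i L) = genZ k L i * prodZ k l h := by
        intro L
        rw [prodZ_cons, Function.update_self, prodZ_congr k fun j hj =>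
          Function.update_of_ne (ne_of_mem_of_not_mem hj hl.1) L h]
      simp only [this]
      rw [prodZ_cons, ← mul_assoc, hT, Finset.sum_mul]
      simp only [smul_mul_assoc]
      rw [sub_self]
      exact zero_mem _
    · have hi' : i ∈ l := (List.mem_cons.1 hi).resolve_left hij
      have h3 := ih' hl.2 hi' (by omega)
      have : ∀ L, prodZ k (j :: l) (Function.update h i L) =
          genZ k (h j) j * prodZ k l (Function.update h i L) := by
        intro L
        rw [prodZ_cons, Function.update_of_ne (Ne.symm hij)]
      simp only [this]
      have h4 := ih (h j) j _ (by omega) _ h3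
      rw [mul_sub, Finset.mul_sum] at h4
      simp only [mul_smul_comm] at h4
      have h5 : ∀ x ∈ lowerPairs k A m (weight k q + weight k (h j)), x * prodZ k l h ∈
          filtration k A m (weight k q + (weight k (h j) + listWeight k l h)) := by
        intro x hx
        induction hx using Submodule.span_induction with
        | mem x hx =>
          obtain ⟨α, r, a, b, p, p', hp, rfl⟩ := hx
          rw [mul_assoc, mul_assoc]
          refine latticeK_mul_mem k ?_ _ _
          -- The product `prodZ k l h` lies in step `listWeight k l h + 1` of the filtration, as the
          -- bound in its definition is strict.
          have h6 := ih p' b (listWeight k l h + 1) (by omega) _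
            (prodZ_mem k hl.2 (h := h) (Nat.lt_succ_self _))
          refine filtration_mono k ?_ (ih p a _ ?_ _ h6)
          · omega
          · omega
        | zero => rw [zero_mul]; exact zero_mem _
        | add x y _ _ hx hy => rw [add_mul]; exact add_mem hx hy
        | smul c x _ hx => rw [smul_mul_assoc]; exact Submodule.smul_mem _ _ hx
      have h7 := add_mem (h5 _ (genZ_mul_genZ_sub_mem k q (h j) hij))
        (filtration_mono k (by omega) h4)
      convert h7 using 1
      rw [prodZ_cons, sub_mul, mul_assoc, mul_assoc]
      abel

/-- The filtration is compatible with multiplication by the generators `Z`. The induction on the total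
weight `N` makes the commutators with other factors, which have lower weight, available. -/
theorem genZ_mul_mem (N : ℕ) : ∀ (q : IsoMod A) (i : ZMod m) (d : ℕ), weight k q + d ≤ N →
    ∀ y ∈ filtration k A m d, genZ k q i * y ∈ filtration k A m (d + weight k q) := by
  classical
  induction N with
  | zero =>
    intro q i d hd y hy
    obtain rfl : d = 0 := by omega
    rw [filtration_zero, Submodule.mem_bot] at hy
    rw [hy, mul_zero]
    exact zero_mem _
  | succ N ih =>
    intro q i d hd y hy
    induction hy using Submodule.span_induction with
    | mem x hx =>
      obtain ⟨l, h, w, hl, hn, rfl⟩ := hx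
      rw [← mul_assoc]
      refine mul_prodK_mem k ?_ w
      by_cases hi : i ∈ l
      · obtain ⟨T, c, hT, hw⟩ := genZ_mul_genZ k q (h i) i
        have h3 := genZ_mul_prodZ_sub_mem k ih q i hT l hl hi (by omega)
        rw [← sub_add_cancel (genZ k q i * prodZ k l h)
          (∑ L ∈ T, c L • prodZ k l (Function.update h i L))]
        refine add_mem (filtration_mono k (by omega) h3) (sum_mem fun L hL =>
          Submodule.smul_mem _ _ (prodZ_mem k hl ?_))
        have h4 : listWeight k l (Function.update h i L) = listWeight k l h + weight k q := by
          have hper := List.perm_cons_erase hi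
          have e1 : ∀ g : ZMod m → IsoMod A, listWeight k l g = weight k (g i) + listWeight k (l.erase i) g := by
            intro g
            rw [← listWeight_cons]
            exact (hper.map fun i => weight k (g i)).sum_eq
          rw [e1, e1 h, Function.update_self, hw L hL, listWeight_congr k (h' := h)]
          · ring
          · intro j hj
            exact Function.update_of_ne (ne_of_mem_of_not_mem hj hl.not_mem_erase) L h
        omega
      · have h3 : genZ k q i * prodZ k l h = prodZ k (i :: l) (Function.update h i q) := by
          rw [prodZ_cons, Function.update_self]
          congr 1
          exact prodZ_congr k fun j hj =>
            (Function.update_of_ne (ne_of_mem_of_not_mem hj hi) q h).symm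
        rw [h3]
        refine prodZ_mem k (List.nodup_cons.2 ⟨hi, hl⟩) ?_
        rw [listWeight_cons, Function.update_self, listWeight_congr k (h' := h)]
        · omega
        · exact fun j hj => Function.update_of_ne (ne_of_mem_of_not_mem hj hi) q h
    | zero => rw [mul_zero]; exact zero_mem _
    | add x y _ _ hx hy => rw [mul_add]; exact add_mem hx hy
    | smul c x _ hx => rw [mul_smul_comm]; exact Submodule.smul_mem _ _ hx

/-- The filtration is exhaustive. -/
theorem exists_mem_filtration (x : LatticeAlgebra k A m) : ∃ n, x ∈ filtration k A m n := by
  obtain ⟨x, rfl⟩ := RingQuot.mkAlgHom_surjective ℂ _ x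
  -- Left multiplication by any element shifts the filtration by a bounded amount.
  have key : ∀ (n : ℕ), ∃ n', ∀ y ∈ filtration k A m n,
      RingQuot.mkAlgHom ℂ (LatticeRel k A m) x * y ∈ filtration k A m n' := by
    induction x using FreeAlgebra.induction with
    | grade0 c =>
      intro n
      refine ⟨n, fun y hy => ?_⟩
      rw [AlgHom.commutes, ← Algebra.smul_def]
      exact Submodule.smul_mem _ _ hy
    | grade1 x =>
      intro n
      cases x with
      | Z q i => exact ⟨_, genZ_mul_mem k _ q i n le_rfl⟩
      | K α i => exact ⟨n, fun y hy => latticeK_mul_mem k hy α i⟩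
    | mul x y hx hy =>
      intro n
      obtain ⟨n', hn'⟩ := hy n
      obtain ⟨n'', hn''⟩ := hx n'
      refine ⟨n'', fun z hz => ?_⟩
      rw [map_mul, mul_assoc]
      exact hn'' _ (hn' _ hz)
    | add x y hx hy =>
      intro n
      obtain ⟨n', hn'⟩ := hx n
      obtain ⟨n'', hn''⟩ := hy n
      refine ⟨max n' n'', fun z hz => ?_⟩
      rw [map_add, add_mul]
      exact add_mem (filtration_mono k (le_max_left _ _) (hn' _ hz))
        (filtration_mono k (le_max_right _ _) (hn'' _ hz))
  obtain ⟨n, hn⟩ := key 1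
  have h1 : (1 : LatticeAlgebra k A m) ∈ filtration k A m 1 := by
    have := prodZ_mem k (l := ([] : List (ZMod m))) List.nodup_nil
      (h := fun _ => zeroMod A) (n := 1) Nat.zero_lt_one
    rwa [prodZ, List.map_nil, List.prod_nil] at this
  refine ⟨n, ?_⟩
  have := hn 1 h1
  rwa [mul_one] at this

end Filtration

/-! ### Standard products -/

section Standard

set_option linter.unusedSectionVars false

variable {A : Type u} [Ring A] {m : ℕ} (k : Type v) [Field k] [Algebra k A]
  [Module.Finite k A] [IsHereditaryRing A] [Finite k] [Finite A]

open scoped Classical in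
/-- The family which agrees with `h` on a list of indices and is zero otherwise. -/
noncomputable def restrictFamily (l : List (ZMod m)) (h : ZMod m → IsoMod A) (i : ZMod m) :
    IsoMod A := if i ∈ l then h i else zeroMod A

theorem restrictFamily_of_mem {l : List (ZMod m)} (h : ZMod m → IsoMod A) {i : ZMod m}
    (hi : i ∈ l) : restrictFamily l h i = h i := if_pos hi

theorem restrictFamily_of_notMem {l : List (ZMod m)} (h : ZMod m → IsoMod A) {i : ZMod m}
    (hi : i ∉ l) : restrictFamily l h i = zeroMod A := if_neg hi

open scoped Classical in
theorem update_restrictFamily (l : List (ZMod m)) (h : ZMod m → IsoMod A) (i : ZMod m) :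
    Function.update (restrictFamily l h) i (h i) = restrictFamily (i :: l) h := by
  funext j
  by_cases hij : j = i
  · subst hij
    rw [Function.update_self, restrictFamily_of_mem h List.mem_cons_self]
  · rw [Function.update_of_ne hij]
    simp only [restrictFamily, List.mem_cons, hij, false_or]

theorem listWeight_toList (s : Finset (ZMod m)) (h : ZMod m → IsoMod A) :
    listWeight k s.toList h = ∑ i ∈ s, weight k (h i) := Finset.sum_map_toList s _

open scoped Classical in
theorem listWeight_restrictFamily {l : List (ZMod m)} (hl : l.Nodup) (h : ZMod m → IsoMod A)
    {s : Finset (ZMod m)} (hs : ∀ i ∈ l, i ∈ s) :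
    listWeight k s.toList (restrictFamily l h) = listWeight k l h := by
  rw [listWeight_toList, listWeight, ← List.sum_toFinset _ hl]
  rw [← Finset.sum_subset (s₁ := l.toFinset) (fun i hi => hs i (List.mem_toFinset.1 hi))]
  · exact Finset.sum_congr rfl fun i hi => by
      rw [restrictFamily_of_mem h (List.mem_toFinset.1 hi)]
  · intro i _ hi
    rw [restrictFamily_of_notMem h fun h' => hi (List.mem_toFinset.2 h'), weight_zeroMod]

theorem prodZ_zeroMod (l : List (ZMod m)) : prodZ k l (fun _ => zeroMod A) = 1 := by
  induction l with
  | nil => rfl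
  | cons i l ih => rw [prodZ_cons, ih, genZ_zeroMod, one_mul]

/-- Up to terms of lower weight, products of generators with different indices do not depend on the
order of the factors. -/
theorem prodZ_sub_prodZ_mem {l : List (ZMod m)} (hl : l.Nodup) (h : ZMod m → IsoMod A)
    {s : Finset (ZMod m)} (hs : ∀ i ∈ l, i ∈ s) :
    prodZ k l h - prodZ k s.toList (restrictFamily l h) ∈ filtration k A m (listWeight k l h) := by
  classical
  induction l with
  | nil =>
    have : restrictFamily ([] : List (ZMod m)) h = fun _ => zeroMod A :=
      funext fun i => restrictFamily_of_notMem h List.not_mem_nil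
    rw [this, prodZ_zeroMod, prodZ, List.map_nil, List.prod_nil, sub_self]
    exact zero_mem _
  | cons i l ih =>
    rw [List.nodup_cons] at hl
    have hs' : ∀ j ∈ l, j ∈ s := fun j hj => hs j (List.mem_cons_of_mem _ hj)
    have h3 := genZ_mul_mem k _ (h i) i _ le_rfl _ (ih hl.2 hs')
    have hw := listWeight_restrictFamily k hl.2 h hs'
    have h4 := genZ_mul_prodZ_sub_mem k (genZ_mul_mem k _) (h i) i
      (h := restrictFamily l h) (T := {h i}) (c := fun _ => 1) (by
        rw [restrictFamily_of_notMem h hl.1, genZ_zeroMod, mul_one, Finset.sum_singleton, one_smul])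
      s.toList s.nodup_toList (Finset.mem_toList.2 (hs i List.mem_cons_self)) le_rfl
    rw [hw, Finset.sum_singleton, one_smul, update_restrictFamily] at h4
    rw [listWeight_cons]
    rw [add_comm] at h3
    convert add_mem h3 h4 using 1
    rw [prodZ_cons, mul_sub]
    abel

theorem prodK_map_zero (l : List (ZMod m)) {g : ZMod m → K0 A} (hg : ∀ i ∈ l, g i = 0) :
    prodK k (l.map fun i => (i, g i)) = 1 := by
  induction l with
  | nil => rfl
  | cons i l ih =>
    rw [List.map_cons, prodK_cons, ih fun j hj => hg j (List.mem_cons_of_mem _ hj),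
      hg i List.mem_cons_self, latticeK_zero, one_mul]

theorem exists_latticeK_mul_prodK (α : K0 A) (i : ZMod m) {l : List (ZMod m)} (hl : l.Nodup)
    (hi : i ∈ l) (g : ZMod m → K0 A) :
    ∃ n : ℤ, latticeK k α i * prodK k (l.map fun j => (j, g j)) =
      vParam k ^ n • prodK k (l.map fun j => (j, (Pi.single i α + g : ZMod m → K0 A) j)) := by
  induction l with
  | nil => exact absurd hi List.not_mem_nil
  | cons j l ih =>
    rw [List.nodup_cons] at hl
    rw [List.map_cons, List.map_cons, prodK_cons, prodK_cons, ← mul_assoc, Pi.add_apply]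
    by_cases hij : i = j
    · subst hij
      refine ⟨0, ?_⟩
      rw [Pi.single_eq_same, latticeK_mul, zpow_zero, one_smul]
      congr 2
      refine List.map_congr_left fun j hj => ?_
      rw [Pi.add_apply, Pi.single_eq_of_ne (ne_of_mem_of_not_mem hj hl.1), zero_add]
    · obtain ⟨n, hn⟩ := ih hl.2 ((List.mem_cons.1 hi).resolve_left hij)
      obtain ⟨n', hn'⟩ := exists_latticeK_mul_latticeK k α (g j) i j
      refine ⟨n' + n, ?_⟩
      rw [Pi.single_eq_of_ne (Ne.symm hij), zero_add, hn', smul_mul_assoc, mul_assoc, hn,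
        mul_smul_comm, smul_smul, ← zpow_add₀ (vParam_ne_zero k)]

theorem exists_prodK_eq (w : List (ZMod m × K0 A)) {s : Finset (ZMod m)}
    (hs : ∀ p ∈ w, p.1 ∈ s) : ∃ n : ℤ, prodK k w =
      vParam k ^ n • prodK k (s.toList.map fun j => (j, wordDegree w j)) := by
  induction w with
  | nil =>
    refine ⟨0, ?_⟩
    rw [prodK_map_zero k s.toList (g := wordDegree []) fun _ _ => rfl, zpow_zero, one_smul]
    rfl
  | cons p w ih =>
    obtain ⟨n, hn⟩ := ih fun q hq => hs q (List.mem_cons_of_mem _ hq)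
    obtain ⟨n', hn'⟩ := exists_latticeK_mul_prodK k p.2 p.1 s.nodup_toList
      (Finset.mem_toList.2 (hs p List.mem_cons_self)) (wordDegree w)
    refine ⟨n + n', ?_⟩
    rw [prodK_cons, hn, mul_smul_comm, hn', smul_smul, ← zpow_add₀ (vParam_ne_zero k)]
    rfl

/-- Up to powers of `v`, products of generators `K` depend only on their degree. -/
theorem exists_prodK_eq_of_wordDegree_eq {w w' : List (ZMod m × K0 A)}
    (h : wordDegree w = wordDegree w') : ∃ n : ℤ, prodK k w = vParam k ^ n • prodK k w' := by
  classical
  let s : Finset (ZMod m) := ((w ++ w').map Prod.fst).toFinset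
  obtain ⟨n, hn⟩ := exists_prodK_eq k w (s := s) fun p hp => List.mem_toFinset.2
    (List.mem_map_of_mem (List.mem_append_left _ hp))
  obtain ⟨n', hn'⟩ := exists_prodK_eq k w' (s := s) fun p hp => List.mem_toFinset.2
    (List.mem_map_of_mem (List.mem_append_right _ hp))
  refine ⟨n - n', ?_⟩
  rw [hn, hn', h, smul_smul, ← zpow_add₀ (vParam_ne_zero k), sub_add_cancel]

open scoped Classical in
/-- An enumeration of the support of a family of modules (empty if the support is infinite). -/
noncomputable def supportList (h : ZMod m → IsoMod A) : List (ZMod m) :=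
  if hf : {i | h i ≠ zeroMod A}.Finite then hf.toFinset.toList else []

theorem nodup_supportList (h : ZMod m → IsoMod A) : (supportList h).Nodup := by
  rw [supportList]
  split_ifs
  · exact Finset.nodup_toList _
  · exact List.nodup_nil

theorem mem_supportList {h : ZMod m → IsoMod A} (hf : {i | h i ≠ zeroMod A}.Finite) {i : ZMod m} :
    i ∈ supportList h ↔ h i ≠ zeroMod A := by
  rw [supportList, dif_pos hf, Finset.mem_toList, Set.Finite.mem_toFinset]
  rfl

theorem restrictFamily_supportList {h : ZMod m → IsoMod A} (hf : {i | h i ≠ zeroMod A}.Finite) :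
    restrictFamily (supportList h) h = h := by
  funext i
  by_cases hi : i ∈ supportList h
  · exact restrictFamily_of_mem h hi
  · rw [restrictFamily_of_notMem h hi]
    rw [mem_supportList hf, not_not] at hi
    exact hi.symm

open scoped Classical in
/-- A word in the symbols `K_α^{(i)}` of given degree (empty if there is no such word, which happens
when the degree has infinite support). -/
noncomputable def degreeWord (g : ZMod m → K0 A) : List (ZMod m × K0 A) :=
  if hg : ∃ w, wordDegree w = g then hg.choose else []

theorem wordDegree_degreeWord (w : List (ZMod m × K0 A)) :
    wordDegree (degreeWord (wordDegree w)) = wordDegree w := by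
  have hg : ∃ w', wordDegree w' = wordDegree w := ⟨w, rfl⟩
  rw [degreeWord, dif_pos hg]
  exact hg.choose_spec

/-- The indices of the standard products of weight `n`: finitely supported families of modules, and
degrees of words in the symbols `K_α^{(i)}`. -/
abbrev StdIndex (A : Type u) [Ring A] (m : ℕ) [Algebra k A] [Module.Finite k A]
    [IsHereditaryRing A] (n : ℕ) : Type _ :=
  {t : (ZMod m → IsoMod A) × (ZMod m → K0 A) // {i | t.1 i ≠ zeroMod A}.Finite ∧
    listWeight k (supportList t.1) t.1 = n ∧ wordDegree (degreeWord t.2) = t.2}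

/-- The standard products. -/
noncomputable def stdElt {n : ℕ} (t : StdIndex k A m n) : LatticeAlgebra k A m :=
  prodZ k (supportList t.1.1) t.1.1 * prodK k (degreeWord t.1.2)

/-- The standard products of weight `n` span the subquotient of weight `n` of the filtration. -/
theorem filtration_succ_le (n : ℕ) : filtration k A m (n + 1) ≤
    filtration k A m n ⊔ Submodule.span ℂ (Set.range (stdElt (A := A) (m := m) (n := n) k)) := by
  classical
  refine Submodule.span_le.2 ?_
  rintro _ ⟨l, h, w, hl, hn, rfl⟩
  rcases Nat.lt_succ_iff_lt_or_eq.1 hn with hn | hn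
  · exact Submodule.mem_sup_left (prodZ_mul_prodK_mem k hl hn w)
  have hsub : ∀ i, restrictFamily l h i ≠ zeroMod A → i ∈ l := by
    intro i hi
    by_contra hil
    exact hi (restrictFamily_of_notMem h hil)
  have hf : {i | restrictFamily l h i ≠ zeroMod A}.Finite :=
    l.toFinset.finite_toSet.subset fun i hi => List.mem_toFinset.2 (hsub i hi)
  have hs : ∀ i ∈ l, i ∈ l.toFinset := fun i hi => List.mem_toFinset.2 hi
  have hs' : ∀ i ∈ supportList (restrictFamily l h), i ∈ l.toFinset := fun i hi =>
    List.mem_toFinset.2 (hsub i ((mem_supportList hf).1 hi))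
  have hw := listWeight_restrictFamily k hl h hs
  have hw' := listWeight_restrictFamily k (nodup_supportList _) (restrictFamily l h) hs'
  have h3 := prodZ_sub_prodZ_mem k hl h hs
  have h4 := prodZ_sub_prodZ_mem k (nodup_supportList _) (restrictFamily l h) hs'
  rw [restrictFamily_supportList hf] at h4 hw'
  rw [← hw', hw, hn] at h4
  rw [hn] at h3
  have h5 := mul_prodK_mem k (sub_mem h3 h4) w
  rw [sub_sub_sub_cancel_right, sub_mul] at h5
  obtain ⟨a, ha⟩ := exists_prodK_eq_of_wordDegree_eq k (wordDegree_degreeWord w).symm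
  change prodZ k l h * prodK k w ∈ _
  rw [← sub_add_cancel (prodZ k l h * prodK k w)
    (prodZ k (supportList (restrictFamily l h)) (restrictFamily l h) * prodK k w)]
  refine add_mem (Submodule.mem_sup_left h5) (Submodule.mem_sup_right ?_)
  rw [ha, mul_smul_comm]
  refine Submodule.smul_mem _ _ (Submodule.subset_span
    ⟨⟨(restrictFamily l h, wordDegree w), hf, ?_, wordDegree_degreeWord w⟩, rfl⟩)
  rw [← hw', hw, hn]

end Standard

/-! ### Injectivity -/

section Injective

set_option linter.unusedSectionVars false

variable {A : Type u} [Ring A] {m : ℕ} (k : Type v) [Field k] [Algebra k A]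
  [Module.Finite k A] [IsHereditaryRing A] [Finite k] [Finite A]

theorem Resolves.hasHomology {a : ZMod m} {T : ProjComplex A m} {X : Type u} [AddCommGroup X]
    [Module A X] {p : T.X a →ₗ[A] X} (h : Resolves a T p) (h1 : (1 : ZMod m) ≠ 0)
    (h2 : (2 : ZMod m) ≠ 0) : HasHomology T a X := by
  have hs := h.twoTerm.subsingleton_succ h1 h2
  refine ⟨p ∘ₗ (LinearMap.ker (T.d a (a + 1))).subtype, fun x => ?_, fun z => h.exact z.1⟩
  obtain ⟨y, rfl⟩ := h.surjective x
  exact ⟨⟨y, Subsingleton.elim _ _⟩, rfl⟩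

theorem Resolves.exactAt {a : ZMod m} {T : ProjComplex A m} {X : Type u} [AddCommGroup X]
    [Module A X] {p : T.X a →ₗ[A] X} (h : Resolves a T p) {i : ZMod m} (hi : i ≠ a) :
    ExactAt T i := by
  by_cases hib : i + 1 = a
  · obtain rfl : i = a - 1 := eq_sub_of_add_eq hib
    intro x hx
    rw [sub_add_cancel] at hx
    rw [h.injective (hx.trans (map_zero _).symm)]
    exact ⟨0, map_zero _⟩
  · exact exactAt_of_subsingleton (h.twoTerm i hi hib)

theorem Resolves.hdim_eq {a : ZMod m} {T : ProjComplex A m} {X : Type u} [AddCommGroup X]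
    [Module A X] [Module.Finite A X] {p : T.X a →ₗ[A] X} (h : Resolves a T p)
    (h1 : (1 : ZMod m) ≠ 0) (h2 : (2 : ZMod m) ≠ 0) : hdim k T = dimK A k (cl A X) := by
  rw [hdim, finsum_eq_single _ a, (h.hasHomology h1 h2).hcl_eq]
  intro i hi
  rw [(h.exactAt hi).hasHomology.hcl_eq, cl_of_subsingleton, map_zero]

/-- The span of the classes of complexes with homology of dimension less than `n`. -/
def lowerClasses (A : Type u) [Ring A] (m : ℕ) [Algebra k A] [Module.Finite k A]
    [IsHereditaryRing A] (n : ℤ) : Submodule ℂ (BridgelandHallAlgebra k A m) :=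
  Submodule.span ℂ {x | ∃ N : ProjComplex A m, hdim k N < n ∧ x = hallClass k N}

theorem hallClass_mem_lowerClasses {N : ProjComplex A m} {n : ℤ} (h : hdim k N < n) :
    hallClass k N ∈ lowerClasses k A m n := Submodule.subset_span ⟨N, h, rfl⟩

theorem hallClass_mul_mem_lowerClasses (T : ProjComplex A m) {n : ℤ}
    {x : BridgelandHallAlgebra k A m} (hx : x ∈ lowerClasses k A m n) :
    hallClass k T * x ∈ lowerClasses k A m (hdim k T + n) := by
  induction hx using Submodule.span_induction with
  | mem x hx =>
    obtain ⟨N, hN, rfl⟩ := hx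
    rw [hallClass_mul]
    refine Submodule.smul_mem _ _ (sum_mem fun φ _ => hallClass_mem_lowerClasses k ?_)
    have := hdim_twist_le k φ
    omega
  | zero => rw [mul_zero]; exact zero_mem _
  | add x y _ _ hx hy => rw [mul_add]; exact add_mem hx hy
  | smul c x _ hx => rw [mul_smul_comm]; exact Submodule.smul_mem _ _ hx

variable (h1 : (1 : ZMod m) ≠ 0) (h2 : (2 : ZMod m) ≠ 0)
include h1 h2

theorem kap_mul_mem_lowerClasses (a : ZMod m) (α : K0 A) {n : ℤ}
    {x : BridgelandHallAlgebra k A m} (hx : x ∈ lowerClasses k A m n) :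
    ∃ y ∈ lowerClasses k A m n, kap k a α * x = y * kap k a α := by
  induction hx using Submodule.span_induction with
  | mem x hx =>
    obtain ⟨N, hN, rfl⟩ := hx
    refine ⟨vParam k ^ symEuler k α (N.cls a - N.cls (a - 1)) • hallClass k N,
      Submodule.smul_mem _ _ (hallClass_mem_lowerClasses k hN), ?_⟩
    rw [kap_mul_comm k h1 h2, smul_mul_assoc]
  | zero => exact ⟨0, zero_mem _, by rw [mul_zero, zero_mul]⟩
  | add x y _ _ hx hy =>
    obtain ⟨x', hx', e⟩ := hx
    obtain ⟨y', hy', e'⟩ := hy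
    exact ⟨_, add_mem hx' hy', by rw [mul_add, e, e', add_mul]⟩
  | smul c x _ hx =>
    obtain ⟨x', hx', e⟩ := hx
    exact ⟨_, Submodule.smul_mem _ c hx', by rw [mul_smul_comm, e, smul_mul_assoc]⟩

/-- The product of a two-term complex with a complex without homology in the same degree: the
leading term is the direct sum. -/
theorem exists_hallClass_mul_eq {a : ZMod m} {T N : ProjComplex A m} (hT : IsTwoTerm a T)
    (hN : ExactAt N a) : ∃ c : ℂ, c ≠ 0 ∧ ∃ r ∈ lowerClasses k A m (hdim k T + hdim k N),
      hallClass k T * hallClass k N = c • hallClass k (directSum N T) + r := by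
  classical
  have hprod := hallClass_mul k T N
  rw [← Finset.sum_filter_add_sum_filter_not Finset.univ (fun φ => ∃ s, φ = Cocycle.cob s),
    Finset.sum_congr rfl (g := fun _ => hallClass k (directSum N T)), Finset.sum_const,
    ← Nat.cast_smul_eq_nsmul ℂ, smul_add, smul_smul] at hprod
  · refine ⟨_, ?_, _, ?_, hprod⟩
    · refine mul_ne_zero (zpow_ne_zero _ (vParam_ne_zero k)) ?_
      rw [Nat.cast_ne_zero]
      refine Finset.card_ne_zero.2 ⟨Cocycle.cob 0, ?_⟩
      exact Finset.mem_filter.2 ⟨Finset.mem_univ _, 0, rfl⟩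
    · refine Submodule.smul_mem _ _ (sum_mem fun φ hφ => hallClass_mem_lowerClasses k ?_)
      exact (cob_or_hdim_lt k h1 h2 hT hN φ).resolve_left (Finset.mem_filter.1 hφ).2
  · intro φ hφ
    obtain ⟨s, rfl⟩ := (Finset.mem_filter.1 hφ).2
    exact hallClass_congr k (Cocycle.cobTwist s)

/-- The leading term of the image of a product of generators with different indices. -/
theorem exists_latticeHom_prodZ {l : List (ZMod m)} (hl : l.Nodup) (h : ZMod m → IsoMod A) :
    ∃ (N : ProjComplex A m) (w : List (ZMod m × K0 A)) (c : ℂ), c ≠ 0 ∧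
      (∃ r ∈ lowerClasses k A m (listWeight k l h),
        latticeHom k h1 h2 (prodZ k l h) = (c • hallClass k N + r) * kapWord k w) ∧
      hdim k N = listWeight k l h ∧ ∀ j, HasHomology N j (restrictFamily l h (-j)).out.obj := by
  induction l with
  | nil =>
    have hz := subsingleton_zeroComplex (A := A) (m := m)
    refine ⟨zeroComplex A m, [], 1, one_ne_zero, ⟨0, zero_mem _, ?_⟩, ?_, fun j => ?_⟩
    · rw [prodZ, List.map_nil, List.prod_nil, map_one, hallClass_zeroComplex, add_zero, one_smul,
        kapWord, List.map_nil, List.prod_nil, mul_one]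
    · rw [hdim]
      simp only [(exactAt_of_subsingleton (hz _)).hasHomology.hcl_eq, cl_of_subsingleton, map_zero,
        finsum_zero]
      rfl
    · rw [restrictFamily_of_notMem h List.not_mem_nil]
      have := subsingleton_zeroMod_out (A := A)
      exact (exactAt_of_subsingleton (hz j)).hasHomology.congr_right
        (LinearEquiv.ofSubsingleton _ _)
  | cons i l ih =>
    rw [List.nodup_cons] at hl
    obtain ⟨N, w, c, hc, ⟨r, hr, e⟩, hd, hN⟩ := ih hl.2
    obtain ⟨T, p, hT, eT⟩ := exists_resolves_modElt k h1 h2 (h i).out (-i)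
    have hNi : ExactAt N (-i) := by
      have h3 := hN (-i)
      rw [neg_neg, restrictFamily_of_notMem h hl.1] at h3
      have := subsingleton_zeroMod_out (A := A)
      exact h3.exactAt
    have hdT : hdim k T = weight k (h i) := by rw [hT.hdim_eq k h1 h2, weight_eq]
    obtain ⟨c', hc', r', hr', e'⟩ := exists_hallClass_mul_eq k h1 h2 hT.twoTerm hNi
    have hr2 : c • r' + hallClass k T * r ∈ lowerClasses k A m (listWeight k (i :: l) h) := by
      rw [listWeight_cons, Nat.cast_add, ← hdT]
      refine add_mem (Submodule.smul_mem _ _ ?_) (hallClass_mul_mem_lowerClasses k T hr)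
      rw [← hd]
      exact hr'
    obtain ⟨r'', hr'', e''⟩ := kap_mul_mem_lowerClasses k h1 h2 (-i) (-T.cls (-i - 1)) hr2
    obtain ⟨c0, hc0, e3⟩ : ∃ c0 : ℂ, c0 ≠ 0 ∧ latticeHom k h1 h2 (genZ k (h i) i) =
        c0 • (kap k (-i) (-T.cls (-i - 1)) * hallClass k T) := by
      refine ⟨(autCard (h i).out : ℂ)⁻¹ *
        vParam k ^ eulerForm k (T.cls (-i - 1)) (T.cls (-i) - T.cls (-i - 1)),
        mul_ne_zero (inv_ne_zero (autCard_ne_zero _)) (zpow_ne_zero _ (vParam_ne_zero k)), ?_⟩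
      rw [← isoMod_mk_out (h i)]
      refine (latticeHom_latticeZ k h1 h2 _ i).trans ?_
      rw [isoMod_mk_out, eT, resElt, smul_smul]
    obtain ⟨c1, hc1, e5⟩ : ∃ c1 : ℂ, c1 ≠ 0 ∧
        kap k (-i) (-T.cls (-i - 1)) * hallClass k (directSum N T) =
        c1 • (hallClass k (directSum N T) * kap k (-i) (-T.cls (-i - 1))) :=
      ⟨_, zpow_ne_zero _ (vParam_ne_zero k), kap_mul_comm k h1 h2 _ _ _⟩
    refine ⟨directSum N T, (-i, -T.cls (-i - 1)) :: w, c0 * (c * c' * c1),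
      mul_ne_zero hc0 (mul_ne_zero (mul_ne_zero hc hc') hc1),
      ⟨c0 • r'', Submodule.smul_mem _ _ hr'', ?_⟩, ?_, fun j => ?_⟩
    · have e4 : hallClass k T * (c • hallClass k N + r) =
          (c * c') • hallClass k (directSum N T) + (c • r' + hallClass k T * r) := by
        rw [mul_add, mul_smul_comm, e', smul_add, smul_smul, add_assoc]
      have e6 : kap k (-i) (-T.cls (-i - 1)) * (hallClass k T * (c • hallClass k N + r)) =
          ((c * c' * c1) • hallClass k (directSum N T) + r'') * kap k (-i) (-T.cls (-i - 1)) := by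
        rw [e4, mul_add, e'', mul_smul_comm, e5, smul_smul, add_mul, smul_mul_assoc]
      rw [prodZ_cons, map_mul, e3, e, kapWord_cons, smul_mul_assoc, ← mul_assoc, mul_assoc (kap k _ _),
        e6, mul_smul c0, ← smul_add, smul_mul_assoc, mul_assoc]
    · rw [hdim_directSum, hd, hdT, listWeight_cons, Nat.cast_add, add_comm]
    · by_cases hj : j = -i
      · subst hj
        rw [neg_neg, restrictFamily_of_mem h List.mem_cons_self]
        exact (hNi.hasHomology.directSum (hT.hasHomology h1 h2)).congr_right
          LinearEquiv.uniqueProd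
      · refine (hasHomology_directSum_iff (hT.exactAt hj)).2 ?_
        have : restrictFamily (i :: l) h (-j) = restrictFamily l h (-j) := by
          have : -j ≠ i := fun h' => hj (by rw [← h', neg_neg])
          simp only [restrictFamily, List.mem_cons, this, false_or]
        rw [this]
        exact hN j

omit h2 in
/-- Complexes with homology of small dimension pair trivially with the test functions. -/
theorem pairing_lowerClasses {h : ZMod m → IsoMod A} {N : ProjComplex A m}
    (hN : ∀ j, HasHomology N j (h j).out.obj) (β : ZMod m → K0 A) {n : ℤ} (hn : n ≤ hdim k N)
    {x : BridgelandHallAlgebra k A m} (hx : x ∈ lowerClasses k A m n) (w : List (ZMod m × K0 A)) :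
    pairing k h1 (indicator h β) (x * kapWord k w) = 0 := by
  induction hx using Submodule.span_induction with
  | mem x hx =>
    obtain ⟨N', hN', rfl⟩ := hx
    obtain ⟨a, ha⟩ := exists_pairing_eq k h1 N' w
    rw [ha, indicator_apply, if_neg, mul_zero]
    rintro ⟨h3, -⟩
    refine (lt_irrefl (hdim k N')) (hN'.trans_le (hn.trans_eq ?_))
    exact finsum_congr fun i => by rw [(hN i).hcl_eq, (h3 i).hcl_eq]
  | zero => rw [zero_mul, map_zero]
  | add x y _ _ hx hy => rw [add_mul, map_add, hx, hy, add_zero]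
  | smul c x _ hx => rw [smul_mul_assoc, map_smul, hx, smul_zero]

theorem latticeHom_prodK (w : List (ZMod m × K0 A)) :
    latticeHom k h1 h2 (prodK k w) = kapWord k (w.map fun p => (-p.1, p.2)) := by
  induction w with
  | nil => exact map_one _
  | cons p w ih =>
    rw [prodK_cons, map_mul, ih, latticeHom_latticeK, List.map_cons, kapWord_cons]

omit k [Field k] [Algebra k A] [Module.Finite k A] [IsHereditaryRing A] [Finite k] [Finite A]
  h1 h2 in
theorem wordDegree_map_neg (w : List (ZMod m × K0 A)) (i : ZMod m) :
    wordDegree (w.map fun p => (-p.1, p.2)) i = wordDegree w (-i) := by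
  induction w with
  | nil => rfl
  | cons p w ih =>
    have e : ∀ (q : ZMod m × K0 A) w, wordDegree (q :: w) = Pi.single q.1 q.2 + wordDegree w :=
      fun q w => List.sum_cons
    rw [List.map_cons, e, e, Pi.add_apply, Pi.add_apply, ih]
    congr 1
    by_cases h : i = -p.1
    · subst h
      rw [neg_neg, Pi.single_eq_same, Pi.single_eq_same]
    · rw [Pi.single_eq_of_ne h, Pi.single_eq_of_ne fun h' => h (by rw [← h', neg_neg])]

omit k [Field k] [Algebra k A] [Module.Finite k A] [IsHereditaryRing A] [Finite k] [Finite A]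
  h1 h2 in
theorem wordDegree_append (w w' : List (ZMod m × K0 A)) :
    wordDegree (w ++ w') = wordDegree w + wordDegree w' := by
  rw [wordDegree, List.map_append, List.sum_append]
  rfl

/-- The images of the standard products of weight `n` are linearly independent modulo terms of
lower weight: they are separated by test functions. -/
theorem exists_test {n : ℕ} (t : StdIndex k A m n) : ∃ F : testSpace A m,
    (∀ x ∈ filtration k A m n, pairing k h1 F (latticeHom k h1 h2 x) = 0) ∧
    pairing k h1 F (latticeHom k h1 h2 (stdElt k t)) ≠ 0 ∧
    ∀ t' : StdIndex k A m n, t' ≠ t → pairing k h1 F (latticeHom k h1 h2 (stdElt k t')) = 0 := by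
  -- A choice of leading terms, depending only on the family of modules.
  obtain ⟨f, hf⟩ := Classical.axiomOfChoice (r := fun (h : ZMod m → IsoMod A)
      (p : ProjComplex A m × List (ZMod m × K0 A) × ℂ) => p.2.2 ≠ 0 ∧
      (∃ r ∈ lowerClasses k A m (listWeight k (supportList h) h),
        latticeHom k h1 h2 (prodZ k (supportList h) h) =
          (p.2.2 • hallClass k p.1 + r) * kapWord k p.2.1) ∧
      hdim k p.1 = listWeight k (supportList h) h ∧
      ∀ j, HasHomology p.1 j (restrictFamily (supportList h) h (-j)).out.obj) fun h => by
    obtain ⟨N, w, c, hN⟩ := exists_latticeHom_prodZ k h1 h2 (nodup_supportList h) h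
    exact ⟨(N, w, c), hN⟩
  let N : (ZMod m → IsoMod A) → ProjComplex A m := fun h => (f h).1
  let w : (ZMod m → IsoMod A) → List (ZMod m × K0 A) := fun h => (f h).2.1
  let c : (ZMod m → IsoMod A) → ℂ := fun h => (f h).2.2
  have hc : ∀ h, c h ≠ 0 := fun h => (hf h).1
  have hr : ∀ h, ∃ r ∈ lowerClasses k A m (listWeight k (supportList h) h),
      latticeHom k h1 h2 (prodZ k (supportList h) h) =
        (c h • hallClass k (N h) + r) * kapWord k (w h) := fun h => (hf h).2.1
  have hd : ∀ h, hdim k (N h) = listWeight k (supportList h) h := fun h => (hf h).2.2.1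
  have hH : ∀ h j, HasHomology (N h) j (restrictFamily (supportList h) h (-j)).out.obj :=
    fun h => (hf h).2.2.2
  let h := t.1.1
  let W : StdIndex k A m n → List (ZMod m × K0 A) := fun t' =>
    w t'.1.1 ++ (degreeWord t'.1.2).map fun p => (-p.1, p.2)
  -- The test function detects the homology `h` and the classes of boundaries of the virtual complex
  -- of the standard product `t`.
  let β : ZMod m → K0 A := fun i => beta (N h) i + wordDegree (W t) i
  have hNh : ∀ j, HasHomology (N h) j (h (-j)).out.obj := by
    have h3 := hH h
    rw [restrictFamily_supportList t.2.1] at h3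
    exact h3
  have hn : hdim k (N h) = n := by rw [hd]; exact congrArg Nat.cast t.2.2.1
  have hstd : ∀ t' : StdIndex k A m n, ∃ a : ℤ,
      pairing k h1 (indicator (fun j => h (-j)) β) (latticeHom k h1 h2 (stdElt k t')) =
      c t'.1.1 * (vParam k ^ a *
        (indicator (fun j => h (-j)) β).1 (N t'.1.1) (-wordDegree (W t'))) := by
    intro t'
    obtain ⟨a, ha⟩ := exists_pairing_eq k h1 (N t'.1.1) (W t')
    obtain ⟨r, hr', e⟩ := hr t'.1.1
    refine ⟨a, ?_⟩
    rw [stdElt, map_mul, e, latticeHom_prodK, mul_assoc, ← kapWord_append, add_mul, map_add,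
      pairing_lowerClasses k h1 hNh β _ hr', add_zero, smul_mul_assoc, map_smul, smul_eq_mul]
    · rw [← ha]
    · rw [hn, t'.2.2.1]
  refine ⟨indicator (fun j => h (-j)) β, fun x hx => ?_, ?_, fun t' ht' => ?_⟩
  · induction hx using Submodule.span_induction with
    | mem x hx =>
      obtain ⟨l, g, w', hl, hlt, rfl⟩ := hx
      obtain ⟨N', w'', c', -, ⟨r', hr', e'⟩, hd', -⟩ := exists_latticeHom_prodZ k h1 h2 hl g
      rw [map_mul, e', latticeHom_prodK, mul_assoc, ← kapWord_append]
      have hle : lowerClasses k A m (listWeight k l g) ≤ lowerClasses k A m n := by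
        refine Submodule.span_mono ?_
        rintro x ⟨N'', hN'', rfl⟩
        exact ⟨N'', by omega, rfl⟩
      refine pairing_lowerClasses k h1 hNh β hn.ge (add_mem (Submodule.smul_mem _ _
        (hallClass_mem_lowerClasses k ?_)) (hle hr')) _
      omega
    | zero => rw [map_zero, map_zero]
    | add x y _ _ hx hy => rw [map_add, map_add, hx, hy, add_zero]
    | smul c x _ hx => rw [map_smul, map_smul, hx, smul_zero]
  · obtain ⟨a, ha⟩ := hstd t
    rw [ha, indicator_apply, if_pos ⟨hNh, fun i => by rw [Pi.neg_apply, sub_neg_eq_add]⟩, mul_one]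
    exact mul_ne_zero (hc _) (zpow_ne_zero _ (vParam_ne_zero k))
  · obtain ⟨a, ha⟩ := hstd t'
    rw [ha, indicator_apply, if_neg, mul_zero, mul_zero]
    rintro ⟨h3, h4⟩
    refine ht' (Subtype.ext ?_)
    have e1 : t'.1.1 = h := by
      funext i
      have h5 := hH t'.1.1 (-i)
      rw [restrictFamily_supportList t'.2.1] at h5
      have h6 := h5.nonempty_equiv (h3 (-i))
      rw [neg_neg] at h6
      rw [← isoMod_mk_out (t'.1.1 i)]
      exact isoMod_mk_eq_iff.2 h6
    refine Prod.ext e1 ?_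
    have e2 : ∀ i, wordDegree (W t') i = wordDegree (W t) i := by
      intro i
      have h5 := h4 i
      rw [Pi.neg_apply, sub_neg_eq_add, e1] at h5
      exact add_left_cancel h5
    funext i
    have h5 := e2 (-i)
    simp only [W] at h5
    rw [wordDegree_append, wordDegree_append, Pi.add_apply, Pi.add_apply, e1, wordDegree_map_neg,
      wordDegree_map_neg, neg_neg, t'.2.2.2, t.2.2.2] at h5
    exact add_left_cancel h5

/-- By induction on the filtration: the test functions show that an element of the kernel has no
component of highest weight. -/
theorem latticeHom_injective : Function.Injective (latticeHom (A := A) k h1 h2) := by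
  rw [injective_iff_map_eq_zero]
  intro x hx
  obtain ⟨n, hn⟩ := exists_mem_filtration k x
  induction n with
  | zero => rwa [filtration_zero, Submodule.mem_bot] at hn
  | succ n ih =>
    refine ih ?_
    obtain ⟨y, hy, z, hz, rfl⟩ := Submodule.mem_sup.1 (filtration_succ_le k n hn)
    obtain ⟨c, rfl⟩ := (Finsupp.mem_span_range_iff_exists_finsupp).1 hz
    have hc : c = 0 := by
      ext t
      obtain ⟨F, hF, hF', hF''⟩ := exists_test k h1 h2 t
      have h3 := congrArg (pairing k h1 F) hx
      rw [map_add, map_add, hF y hy, zero_add, map_zero, Finsupp.sum, map_sum, map_sum,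
        Finset.sum_eq_single t] at h3
      · rw [map_smul, map_smul, smul_eq_mul] at h3
        exact (mul_eq_zero.1 h3).resolve_right hF'
      · intro t' _ ht'
        rw [map_smul, map_smul, hF'' t' ht', smul_zero]
      · intro ht
        rw [Finsupp.notMem_support_iff.1 ht, zero_smul, map_zero, map_zero]
    rw [hc, Finsupp.sum_zero_index, add_zero]
    exact hy

end Injective

end BridgelandHall

theorem theorem3p2 (k : Type v) [Field k] [Finite k] (A : Type u) [Ring A] [Algebra k A]
    [Module.Finite k A] [BridgelandHall.IsHereditaryRing A] (m : ℕ) (hm : m = 0 ∨ 2 < m) :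
    ∃ Φ : BridgelandHall.LatticeAlgebra k A m ≃ₐ[ℂ] BridgelandHall.BridgelandHallAlgebra k A m,
      (∀ (M : FGModuleCat.{u} A) (R : BridgelandHall.MinProjRes M) (i : ZMod m),
        Φ (BridgelandHall.latticeZ k M i) = BridgelandHall.bridgelandE k R i) ∧
      (∀ (α : BridgelandHall.K0 A) (P Q : BridgelandHall.ProjMod A),
        α = BridgelandHall.K0.mk P.toFG - BridgelandHall.K0.mk Q.toFG → ∀ i : ZMod m,
        Φ (BridgelandHall.latticeK k α i) = BridgelandHall.bridgelandK k P Q i) := by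
  have : Finite A := Module.finite_of_finite k
  have hne : ∀ n : ℕ, 0 < n → n ≤ 2 → (n : ZMod m) ≠ 0 := by
    intro n hn hn2 h
    rw [ZMod.natCast_eq_zero_iff] at h
    rcases hm with rfl | hm
    · exact hn.ne' (Nat.eq_zero_of_zero_dvd h)
    · exact absurd (Nat.le_of_dvd hn h) (by omega)
  have h1 : (1 : ZMod m) ≠ 0 := by exact_mod_cast hne 1 one_pos one_le_two
  have h2 : (2 : ZMod m) ≠ 0 := by exact_mod_cast hne 2 two_pos le_rfl
  refine ⟨AlgEquiv.ofBijective (BridgelandHall.latticeHom k h1 h2)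
    ⟨BridgelandHall.latticeHom_injective k h1 h2, BridgelandHall.latticeHom_surjective k h1 h2⟩,
    fun M R i => ?_, fun α P Q h i => ?_⟩
  · exact (BridgelandHall.latticeHom_latticeZ k h1 h2 M i).trans
      (BridgelandHall.bridgelandE_eq_modElt k h1 h2 R i).symm
  · rw [h]
    exact (BridgelandHall.latticeHom_latticeK k h1 h2 _ i).trans
      (BridgelandHall.bridgelandK_eq k h1 h2 P Q i).symm
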